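/- Let $p',q'\ge 0$ be integers with $p'+q'\ge 1$, put $m=p'+q'+2$ and let $(M,[g])$ be a smooth conformal manifold of dimension $n=2p'+2q'+2$ and signature $(2p'+1,2q'+1)$. Let $\mathcal T\to M$ be its standard tractor bundle, with tractor metric $h$, canonical isotropic real line subbundle $\mathcal T^1$ and (normal) tractor connection $\nabla$. In the splitting given by $g\in[g]$ these are $\mathcal T=\mathbb R\oplus TM\oplus\mathbb R\ni(\sigma,\mu,\rho)$, $h=2\sigma\rho+g(\mu,\mu)$ (as a quadratic form), $\mathcal T^1=\{(0,0,\rho)\}$ and $\nabla_X(\sigma,\mu,\rho)=(X\sigma-g(X,\mu),\ \nabla_X\mu+\rho X+\sigma P^\sharp X,\ X\rho-P(X,\mu))$, with $P$ the Schouten tensor and $\nabla_X\mu$ the Levi-Civita derivative. Let $\mathbb J$ be a parallel orthogonal complex structure on $\mathcal T$, and let $\nu$ be a parallel non-vanishing section of the highest complex exterior power $\Lambda^m_{\mathbb C}\mathcal T$. Let $\kappa$ be the vector field underlying $\mathbb J$, i.e. the $TM$-component of $\mathbb J(0,0,1)$. Fix a Hermitian inner product of signature $(p'+1,q'+1)$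 on $\mathbb V=\mathbb C^m$, a real isotropic line $L_{\mathbb R}\subset\mathbb V$ and $0\neq\nu_0\in\Lambda^m_{\mathbb C}\mathbb V$, and assume that $\nu$ is normalised so that $\nu_0$ and $\nu(x)$, for all $x\in M$, have the same square norm for the induced Hermitian forms on $\Lambda^m_{\mathbb C}$. Let $L=\mathbb C L_{\mathbb R}$, let $Q\subset SU(\mathbb V)$ be the stabiliser of $L$, with Lie algebra $\mathfrak q$, and let $P^{SU}\subset Q$ be the stabiliser of $L_{\mathbb R}$ in $SU(\mathbb V)$. Let $p:\mathcal G^{SU}\to M$ be the principal $P^{SU}$-bundle whose fibre over $x$ consists of the complex linear orthogonal maps $u:\mathbb V\to\mathcal T_x$ with $u(L_{\mathbb R})=\mathcal T^1_x$ which map $\nu_0$ to $\nu(x)$. Let $\omega^{SU}$ be the Cartan connection on $\mathcal G^{SU}$ of type $(SU(\mathbb V),P^{SU})$ given by restriction of the conformal Cartan connection; explicitly, $u(\omega^{SU}(\xi)v)$ is the covariant derivative, in direction $\xi\in T_u\mathcal G^{SU}$, of the $\mathcal T$-valued function $u\mapsto u(v)$, for $v\in\mathbb V$. A local leaf space $\psi:W\to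 N$ of $\kappa$ is a smooth surjective submersion from an open subset $W\subset M$ onto a manifold $N$ with $\ker T_y\psi=\mathbb R\kappa(y)$ for all $y\in W$. Then every point of $M$ lies in the domain of a local leaf space. Moreover, for every local leaf space $\psi:W\to N$ and every $x\in W$ there is an open neighbourhood $N_0$ of $\psi(x)$ in $N$ such that for every open subset $N'\subset N_0$ there are (a) a Cartan connection $\underline\omega\in\Omega^1(N'\times Q,\mathfrak{su}(\mathbb V))$ of type $(SU(\mathbb V),Q)$ on the trivial principal bundle $N'\times Q\to N'$, and (b) a $P^{SU}$-invariant open subset $D\subset N'\times Q$ containing $N'\times\{e\}$ and a $P^{SU}$-equivariant diffeomorphism $\Phi$ from $D$ onto a $P^{SU}$-invariant open subset of $\mathcal G^{SU}$, with $p(\Phi(D))\subset W$ and $\psi\circ p\circ\Phi=\mathrm{pr}_1$, such that $\Phi^*\omega^{SU}=\underline\omega$ on $D$. -/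

import Mathlib

open Set Bundle Manifold
open scoped Manifold ContDiff Topology Bundle

noncomputable section

/-! ### Curvature of a pseudo-Riemannian metric given in coordinates

`G : ℝⁿ → (bilinear forms on ℝⁿ)` is a metric on (an open part of) `ℝⁿ`. -/

namespace CoordMetric

variable {n : ℕ}

/-- The vector `a` with `G y a = α`. -/
def sharp (G : EuclideanSpace ℝ (Fin n) → EuclideanSpace ℝ (Fin n) →L[ℝ]
      EuclideanSpace ℝ (Fin n) →L[ℝ] ℝ) (y : EuclideanSpace ℝ (Fin n))
    (α : EuclideanSpace ℝ (Fin n) →L[ℝ] ℝ) : EuclideanSpace ℝ (Fin n) :=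
  ContinuousLinearMap.inverse (G y) α

/-- The Christoffel map `Γ(a, b) = ∇_a b` (for constant vector fields `a`, `b`) of the Levi-Civita
connection:  `2 G(Γ(a, b), c) = ∂_a G(b, c) + ∂_b G(a, c) - ∂_c G(a, b)`. -/
def christoffel (G : EuclideanSpace ℝ (Fin n) → EuclideanSpace ℝ (Fin n) →L[ℝ]
      EuclideanSpace ℝ (Fin n) →L[ℝ] ℝ) (y a b : EuclideanSpace ℝ (Fin n)) :
    EuclideanSpace ℝ (Fin n) :=
  sharp G y ((1 / 2 : ℝ) • (fderiv ℝ G y a b + fderiv ℝ G y b a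
    - ((fderiv ℝ G y).flip a).flip b))

/-- The Riemann curvature `R(a, b) c = ∇_a ∇_b c - ∇_b ∇_a c` (constant vector fields). -/
def riemann (G : EuclideanSpace ℝ (Fin n) → EuclideanSpace ℝ (Fin n) →L[ℝ]
      EuclideanSpace ℝ (Fin n) →L[ℝ] ℝ) (y a b c : EuclideanSpace ℝ (Fin n)) :
    EuclideanSpace ℝ (Fin n) :=
  fderiv ℝ (fun z => christoffel G z b c) y a - fderiv ℝ (fun z => christoffel G z a c) y b
    + christoffel G y a (christoffel G y b c) - christoffel G y b (christoffel G y a c)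

/-- The Ricci curvature `Ric(b, c) = tr (a ↦ R(a, b) c)`. -/
def ricci (G : EuclideanSpace ℝ (Fin n) → EuclideanSpace ℝ (Fin n) →L[ℝ]
      EuclideanSpace ℝ (Fin n) →L[ℝ] ℝ) (y b c : EuclideanSpace ℝ (Fin n)) : ℝ :=
  ∑ i, (riemann G y (EuclideanSpace.single i 1) b c) i

/-- The scalar curvature, the `G`-trace of the Ricci curvature. -/
def scal (G : EuclideanSpace ℝ (Fin n) → EuclideanSpace ℝ (Fin n) →L[ℝ]
      EuclideanSpace ℝ (Fin n) →L[ℝ] ℝ) (y : EuclideanSpace ℝ (Fin n)) : ℝ :=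
  ∑ i, ricci G y (EuclideanSpace.single i 1) (sharp G y (EuclideanSpace.proj i))

/-- The Schouten tensor `P = (Ric - scal / (2 (n - 1)) G) / (n - 2)`. -/
def schouten (G : EuclideanSpace ℝ (Fin n) → EuclideanSpace ℝ (Fin n) →L[ℝ]
      EuclideanSpace ℝ (Fin n) →L[ℝ] ℝ) (y a b : EuclideanSpace ℝ (Fin n)) : ℝ :=
  (1 / ((n : ℝ) - 2)) * (ricci G y a b - scal G y / (2 * ((n : ℝ) - 1)) * G y a b)

/-- The Schouten tensor with one index raised: `G(P♯ a, b) = P(a, b)`. -/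
def schoutenSharp (G : EuclideanSpace ℝ (Fin n) → EuclideanSpace ℝ (Fin n) →L[ℝ]
      EuclideanSpace ℝ (Fin n) →L[ℝ] ℝ) (y a : EuclideanSpace ℝ (Fin n)) :
    EuclideanSpace ℝ (Fin n) :=
  ∑ i, schouten G y a (EuclideanSpace.single i 1) • sharp G y (EuclideanSpace.proj i)

end CoordMetric

/-! ### Metrics and standard tractors -/

/-- A smooth pseudo-Riemannian metric of signature `(r, s)` (`r` plus signs, `s` minus signs) on the
`n`-dimensional manifold `M`. -/
structure PseudoRiemannianMetric (n : ℕ) (M : Type*) [TopologicalSpace M]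
    [ChartedSpace (EuclideanSpace ℝ (Fin n)) M] [IsManifold (𝓡 n) ∞ M] (r s : ℕ) where
  inner : ∀ x : M, TangentSpace (𝓡 n) x →L[ℝ] TangentSpace (𝓡 n) x →L[ℝ] ℝ
  smooth : ContMDiff (𝓡 n) ((𝓡 n).prod 𝓘(ℝ, EuclideanSpace ℝ (Fin n) →L[ℝ]
      EuclideanSpace ℝ (Fin n) →L[ℝ] ℝ)) ∞
    (fun x => TotalSpace.mk' (EuclideanSpace ℝ (Fin n) →L[ℝ] EuclideanSpace ℝ (Fin n) →L[ℝ] ℝ)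
      (E := fun x : M => TangentSpace (𝓡 n) x →L[ℝ] TangentSpace (𝓡 n) x →L[ℝ] ℝ) x (inner x))
  symm : ∀ x v w, inner x v w = inner x w v
  signature : ∀ x, ∃ b : Module.Basis (Fin r ⊕ Fin s) ℝ (TangentSpace (𝓡 n) x),
    ∀ i j, inner x (b i) (b j) = if i = j then Sum.elim (fun _ => 1) (fun _ => -1) i else 0

/-- The standard tractor bundle of the conformal class `[g]`, in the splitting given by the metric
`g` (which also trivialises the density bundles):  `T = ℝ ⊕ TM ⊕ ℝ`, with elements
`(σ, μ, ρ)`. -/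
abbrev Tractor (n : ℕ) (M : Type*) [TopologicalSpace M]
    [ChartedSpace (EuclideanSpace ℝ (Fin n)) M] : M → Type :=
  Bundle.Trivial M ℝ ×ᵇ ((TangentSpace (𝓡 n) : M → Type) ×ᵇ Bundle.Trivial M ℝ)

/-- The model fibre of the standard tractor bundle. -/
abbrev TractorFibre (n : ℕ) : Type := ℝ × EuclideanSpace ℝ (Fin n) × ℝ

section tractors

variable {n : ℕ} {M : Type*} [TopologicalSpace M]
  [ChartedSpace (EuclideanSpace ℝ (Fin n)) M] [IsManifold (𝓡 n) ∞ M] {r s : ℕ}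

namespace PseudoRiemannianMetric

variable (g : PseudoRiemannianMetric n M r s)

/-- The coordinate expression of the metric in the preferred chart at `x₀`: the pull-back of `g`
by the inverse of this chart. Recall that `TangentSpace (𝓡 n) x₀` is identified with `ℝⁿ` by
this chart. -/
def inChart (x₀ : M) (y : EuclideanSpace ℝ (Fin n)) :
    EuclideanSpace ℝ (Fin n) →L[ℝ] EuclideanSpace ℝ (Fin n) →L[ℝ] ℝ :=
  let A : EuclideanSpace ℝ (Fin n) →L[ℝ] EuclideanSpace ℝ (Fin n) :=
    mfderiv 𝓘(ℝ, EuclideanSpace ℝ (Fin n)) (𝓡 n) (extChartAt (𝓡 n) x₀).symm y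
  let B : EuclideanSpace ℝ (Fin n) →L[ℝ] EuclideanSpace ℝ (Fin n) →L[ℝ] ℝ :=
    g.inner ((extChartAt (𝓡 n) x₀).symm y)
  B.bilinearComp A A

/-- The Christoffel map at `x`, in the preferred chart at `x`. -/
def christoffel (x : M) (a b : TangentSpace (𝓡 n) x) : TangentSpace (𝓡 n) x :=
  CoordMetric.christoffel (g.inChart x) (extChartAt (𝓡 n) x x) a b

/-- The Schouten tensor at `x`. -/
def schouten (x : M) (a b : TangentSpace (𝓡 n) x) : ℝ :=
  CoordMetric.schouten (g.inChart x) (extChartAt (𝓡 n) x x) a b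

/-- The Schouten tensor at `x` as an endomorphism of the tangent space. -/
def schoutenSharp (x : M) (a : TangentSpace (𝓡 n) x) : TangentSpace (𝓡 n) x :=
  CoordMetric.schoutenSharp (g.inChart x) (extChartAt (𝓡 n) x x) a

/-- The tractor metric `h((σ, μ, ρ), (σ', μ', ρ')) = σ ρ' + ρ σ' + g(μ, μ')`. -/
def tractorMetric (x : M) (v w : Tractor n M x) : ℝ :=
  (show ℝ from v.1) * (show ℝ from w.2.2) + (show ℝ from v.2.2) * (show ℝ from w.1)
    + g.inner x v.2.1 w.2.1

/-- The standard tractor connection as a connector: `v` is a tractor at `x`, and `(X, v')` is a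
tangent vector to the total space of the tractor bundle at `v` (`X` its projection to `T_x M`, `v'`
the derivative of the components in the preferred trivialisation at `x`). The result is
`(X σ - g(X, μ), ∇_X μ + ρ X + σ P♯ X, X ρ - P(X, μ))` where `∇` is the Levi-Civita connection. -/
def tractorConnector (x : M) (v : Tractor n M x) (X : TangentSpace (𝓡 n) x)
    (v' : TractorFibre n) : Tractor n M x :=
  let σ : ℝ := v.1
  let μ : TangentSpace (𝓡 n) x := v.2.1
  let ρ : ℝ := v.2.2
  ((v'.1 - g.inner x X μ : ℝ),
    ((show TangentSpace (𝓡 n) x from v'.2.1) + g.christoffel x X μ + ρ • X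
        + σ • g.schoutenSharp x X,
      (v'.2.2 - g.schouten x X μ : ℝ)))

/-- The covariant derivative `∇_X s` of a section `s` of the standard tractor bundle. -/
def tractorDeriv (s : ∀ x : M, Tractor n M x) (x : M) (X : TangentSpace (𝓡 n) x) :
    Tractor n M x :=
  let d : EuclideanSpace ℝ (Fin n) × TractorFibre n :=
    mfderiv (𝓡 n) ((𝓡 n).prod 𝓘(ℝ, TractorFibre n))
      (fun y => TotalSpace.mk' (TractorFibre n) y (s y)) x X
  g.tractorConnector x (s x) d.1 d.2

end PseudoRiemannianMetric

/-- The section `s` of the standard tractor bundle is smooth on `U`. -/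
def IsSmoothTractorOn (s : ∀ x : M, Tractor n M x) (U : Set M) : Prop :=
  ContMDiffOn (𝓡 n) ((𝓡 n).prod 𝓘(ℝ, TractorFibre n)) ∞
    (fun y => TotalSpace.mk' (TractorFibre n) y (s y)) U

/-- A parallel orthogonal complex structure on the standard tractor bundle. -/
structure ParallelComplexStructure (g : PseudoRiemannianMetric n M r s) where
  J : ∀ x : M, Tractor n M x →L[ℝ] Tractor n M x
  smooth : ContMDiff (𝓡 n) ((𝓡 n).prod 𝓘(ℝ, TractorFibre n →L[ℝ] TractorFibre n)) ∞
    (fun x => TotalSpace.mk' (TractorFibre n →L[ℝ] TractorFibre n)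
      (E := fun x : M => Tractor n M x →L[ℝ] Tractor n M x) x (J x))
  sq : ∀ x v, J x (J x v) = -v
  orthogonal : ∀ x v w, g.tractorMetric x (J x v) (J x w) = g.tractorMetric x v w
  parallel : ∀ (U : Set M), IsOpen U → ∀ s : ∀ x : M, Tractor n M x, IsSmoothTractorOn s U →
    ∀ x ∈ U, ∀ X, g.tractorDeriv (fun y => J y (s y)) x X = J x (g.tractorDeriv s x X)

/-- The vector field underlying `𝕁`, viewed as a section of the adjoint tractor bundle: its
projection to `Hom(T¹, (T¹)^⊥ / T¹) = TM`, where `T¹ = {(0, 0, ρ)}`. -/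
def ParallelComplexStructure.kappa {g : PseudoRiemannianMetric n M r s}
    (𝕁 : ParallelComplexStructure g) (x : M) : TangentSpace (𝓡 n) x :=
  (𝕁.J x ((0 : ℝ), ((0 : TangentSpace (𝓡 n) x), (1 : ℝ)))).2.1

end tractors

/-! ### Complex exterior powers -/

/-- The real vector space `T`, regarded as a complex vector space by means of `J`. -/
def CplxOf {T : Type*} [AddCommGroup T] [Module ℝ T] (J : Module.End ℝ T) (_hJ : J * J = -1) :
    Type _ := T

instance {T : Type*} [AddCommGroup T] [Module ℝ T] (J : Module.End ℝ T) (hJ : J * J = -1) :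
    AddCommGroup (CplxOf J hJ) := inferInstanceAs (AddCommGroup T)

instance {T : Type*} [AddCommGroup T] [Module ℝ T] (J : Module.End ℝ T) (hJ : J * J = -1) :
    Module ℂ (CplxOf J hJ) :=
  Module.compHom T (Complex.lift ⟨J, hJ⟩ : ℂ →ₐ[ℝ] Module.End ℝ T).toRingHom

/-- An element of `T`, regarded as an element of the complex vector space `CplxOf J hJ`. -/
def CplxOf.of {T : Type*} [AddCommGroup T] [Module ℝ T] (J : Module.End ℝ T) (hJ : J * J = -1)
    (v : T) : CplxOf J hJ := v

theorem CplxOf.smul_def {T : Type*} [AddCommGroup T] [Module ℝ T] (J : Module.End ℝ T)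
    (hJ : J * J = -1) (z : ℂ) (v : T) :
    (show T from z • (show CplxOf J hJ from v)) = z.re • v + z.im • J v := by
  change (Complex.lift ⟨J, hJ⟩ : ℂ →ₐ[ℝ] Module.End ℝ T) z v = _
  simp [Complex.lift_apply, Complex.liftAux_apply, Algebra.algebraMap_eq_smul_one]

/-- A real linear map that intertwines `i` and `J`, as a complex linear map. -/
def CplxOf.lift {V T : Type*} [AddCommGroup V] [Module ℂ V] [Module ℝ V] [IsScalarTower ℝ ℂ V]
    [AddCommGroup T] [Module ℝ T] (J : Module.End ℝ T) (hJ : J * J = -1) (u : V →ₗ[ℝ] T)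
    (hu : ∀ v, u (Complex.I • v) = J (u v)) : V →ₗ[ℂ] CplxOf J hJ where
  toFun v := u v
  map_add' v w := u.map_add v w
  map_smul' z v := by
    have h : z • v = z.re • v + z.im • Complex.I • v := by
      conv_lhs => rw [← Complex.re_add_im z]
      rw [add_smul, mul_smul, ← algebraMap_smul ℂ z.re v,
        ← algebraMap_smul ℂ z.im (Complex.I • v)]
      rfl
    have h2 : u (z • v) = z.re • u v + z.im • J (u v) := by
      rw [h, map_add, map_smul, map_smul, hu]
    exact h2.trans (CplxOf.smul_def J hJ z (u v)).symm

/-! ### The model: a Hermitian vector space with a null line and a volume element -/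

/-- The complex vector space `ℂ^(p+q+2)`. -/
abbrev ModelV (p q : ℕ) : Type := EuclideanSpace ℂ (Fin (p + q + 2))

/-- A Hermitian inner product of signature `(p + 1, q + 1)` on `V = ℂ^(p+q+2)` (linear in the second
argument), a real isotropic line in `V`, and a non-zero element of the highest complex exterior
power of `V`. -/
structure HermitianModel (p q : ℕ) where
  H : ModelV p q →ₗ⋆[ℂ] ModelV p q →ₗ[ℂ] ℂ
  hermitian : ∀ v w, starRingEnd ℂ (H v w) = H w v
  signature : ∃ b : Module.Basis (Fin (p + 1) ⊕ Fin (q + 1)) ℂ (ModelV p q),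
    ∀ i j, H (b i) (b j) = if i = j then Sum.elim (fun _ => 1) (fun _ => -1) i else 0
  LR : Submodule ℝ (ModelV p q)
  finrank_LR : Module.finrank ℝ LR = 1
  isotropic : ∀ v ∈ LR, H v v = 0
  vol : ⋀[ℂ]^(p + q + 2) (ModelV p q)
  vol_ne_zero : vol ≠ 0

/-- The complex endomorphisms of `V`; its units form the Lie group `GL(V)`. -/
abbrev ModelEnd (p q : ℕ) : Type := ModelV p q →L[ℂ] ModelV p q

theorem isUnit_exp_modelEnd {p q : ℕ} (A : ModelEnd p q) : IsUnit (NormedSpace.exp A) := by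
  let _ : NormedAlgebra ℚ (ModelEnd p q) := NormedAlgebra.restrictScalars ℚ ℂ (ModelEnd p q)
  exact NormedSpace.isUnit_exp A

/-- `exp A` as an element of `GL(V)`. -/
def expGL {p q : ℕ} (A : ModelEnd p q) : (ModelEnd p q)ˣ := (isUnit_exp_modelEnd A).unit

namespace HermitianModel

variable {p q : ℕ} (𝓥 : HermitianModel p q)

/-- The complex line generated by the real line `LR`. -/
def L : Submodule ℂ (ModelV p q) := Submodule.span ℂ (𝓥.LR : Set (ModelV p q))

/-- The group `SU(V)`. -/
def SU : Subgroup (ModelEnd p q)ˣ where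
  carrier := {a | (∀ v w, 𝓥.H ((a : ModelEnd p q) v) ((a : ModelEnd p q) w) = 𝓥.H v w) ∧
    LinearMap.det ((a : ModelEnd p q) : ModelV p q →ₗ[ℂ] ModelV p q) = 1}
  one_mem' := by simp
  mul_mem' := by
    rintro a b ⟨ha, ha'⟩ ⟨hb, hb'⟩
    refine ⟨fun v w => ?_, ?_⟩
    · simp [ha, hb]
    · have : (((a * b : (ModelEnd p q)ˣ) : ModelEnd p q) : ModelV p q →ₗ[ℂ] ModelV p q)
        = ((a : ModelEnd p q) : ModelV p q →ₗ[ℂ] ModelV p q)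
          * ((b : ModelEnd p q) : ModelV p q →ₗ[ℂ] ModelV p q) := rfl
      rw [this, map_mul, ha', hb', one_mul]
  inv_mem' := by
    rintro a ⟨ha, ha'⟩
    have h1 : ∀ v, (a : ModelEnd p q) (((a⁻¹ : (ModelEnd p q)ˣ) : ModelEnd p q) v) = v := fun v => by
      have := congrArg (fun f : ModelEnd p q => f v) a.mul_inv
      exact this
    refine ⟨fun v w => ?_, ?_⟩
    · rw [← ha, h1, h1]
    · have : ((a : ModelEnd p q) : ModelV p q →ₗ[ℂ] ModelV p q)
          * (((a⁻¹ : (ModelEnd p q)ˣ) : ModelEnd p q) : ModelV p q →ₗ[ℂ] ModelV p q) = 1 := by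
        ext1 v; exact h1 v
      have h2 := congrArg LinearMap.det this
      rw [map_mul, ha', one_mul, map_one] at h2
      exact h2

/-- The parabolic subgroup `Q`: the stabiliser of the complex line `L` in `SU(V)`. -/
def Q : Set (ModelEnd p q)ˣ := {a | a ∈ 𝓥.SU ∧ 𝓥.L.map
  ((a : ModelEnd p q) : ModelV p q →ₗ[ℂ] ModelV p q) = 𝓥.L}

/-- The group `P^SU`: the stabiliser of the real line `LR` in `SU(V)`. -/
def PSU : Set (ModelEnd p q)ˣ := {a | a ∈ 𝓥.SU ∧ 𝓥.LR.map
  (((a : ModelEnd p q) : ModelV p q →ₗ[ℂ] ModelV p q).restrictScalars ℝ) = 𝓥.LR}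

/-- The Lie algebra `𝔰𝔲(V)`. -/
def su : Submodule ℝ (ModelEnd p q) where
  carrier := {A | (∀ v w, 𝓥.H (A v) w + 𝓥.H v (A w) = 0) ∧
    LinearMap.trace ℂ (ModelV p q) (A : ModelV p q →ₗ[ℂ] ModelV p q) = 0}
  zero_mem' := by simp
  add_mem' := by
    rintro A B ⟨hA, hA'⟩ ⟨hB, hB'⟩
    refine ⟨fun v w => ?_, ?_⟩
    · simp only [add_apply, map_add, LinearMap.add_apply]
      linear_combination hA v w + hB v w
    · simp [hA', hB']
  smul_mem' := by
    rintro c A ⟨hA, hA'⟩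
    have hc : (c • A : ModelEnd p q) = (c : ℂ) • A := (Complex.coe_smul c A).symm
    rw [Set.mem_ofPred_eq, hc]
    refine ⟨fun v w => ?_, ?_⟩
    · simp only [smul_apply, map_smulₛₗ, LinearMap.smul_apply,
        Complex.conj_ofReal, RingHom.id_apply, smul_eq_mul]
      linear_combination (c : ℂ) * hA v w
    · simp [hA']

/-- The Lie algebra `𝔮` of `Q`: the stabiliser of `L` in `𝔰𝔲(V)`. -/
def qLie : Submodule ℝ (ModelEnd p q) where
  carrier := {A | A ∈ 𝓥.su ∧ ∀ v ∈ 𝓥.L, A v ∈ 𝓥.L}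
  zero_mem' := ⟨𝓥.su.zero_mem, by simp⟩
  add_mem' := fun ha hb => ⟨𝓥.su.add_mem ha.1 hb.1, fun v hv => 𝓥.L.add_mem (ha.2 v hv) (hb.2 v hv)⟩
  smul_mem' := fun c A hA => ⟨𝓥.su.smul_mem c hA.1, fun v hv => by
    have hc : (c • A : ModelEnd p q) = (c : ℂ) • A := (Complex.coe_smul c A).symm
    rw [hc]
    exact 𝓥.L.smul_mem _ (hA.2 v hv)⟩

end HermitianModel

/-! ### Parallel volume elements and the reduced frame bundle -/

section frames

variable {p q : ℕ} {M : Type*} [TopologicalSpace M]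
  [ChartedSpace (EuclideanSpace ℝ (Fin (2 * p + 2 * q + 2))) M]
  [IsManifold (𝓡 (2 * p + 2 * q + 2)) ∞ M]
  {g : PseudoRiemannianMetric (2 * p + 2 * q + 2) M (2 * p + 1) (2 * q + 1)}

theorem ParallelComplexStructure.mul_self (𝕁 : ParallelComplexStructure g) (x : M) :
    ((𝕁.J x : Tractor (2 * p + 2 * q + 2) M x →ₗ[ℝ] Tractor (2 * p + 2 * q + 2) M x) : Module.End ℝ (Tractor (2 * p + 2 * q + 2) M x))
      * (𝕁.J x : Tractor (2 * p + 2 * q + 2) M x →ₗ[ℝ] Tractor (2 * p + 2 * q + 2) M x) = -1 := by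
  apply LinearMap.ext
  intro v
  exact 𝕁.sq x v

/-- The fibre of the standard tractor bundle at `x`, as a complex vector space. -/
abbrev ParallelComplexStructure.Fibre (𝕁 : ParallelComplexStructure g) (x : M) : Type :=
  CplxOf (𝕁.J x : Tractor (2 * p + 2 * q + 2) M x →ₗ[ℝ] Tractor (2 * p + 2 * q + 2) M x) (𝕁.mul_self x)

/-- A tractor at `x`, regarded as an element of the complex vector space `𝕁.Fibre x`. -/
abbrev ParallelComplexStructure.toFibre (𝕁 : ParallelComplexStructure g) (x : M)
    (v : Tractor (2 * p + 2 * q + 2) M x) : 𝕁.Fibre x :=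
  CplxOf.of _ (𝕁.mul_self x) v

/-- The Hermitian extension of the tractor metric, linear in the second argument. -/
def ParallelComplexStructure.hermitianMetric (𝕁 : ParallelComplexStructure g) (x : M)
    (v w : Tractor (2 * p + 2 * q + 2) M x) : ℂ :=
  (g.tractorMetric x v w : ℂ) - Complex.I * (g.tractorMetric x v (𝕁.J x w) : ℂ)

/-- A smooth non-vanishing section `ν` of the highest complex exterior power of the standard tractor
bundle, which is parallel for the connection induced by the tractor connection: locally
`ν = s₁ ∧ ⋯ ∧ s_m` for smooth sections `s_i` of the tractor bundle and
`∇_X ν = ∑ i, s₁ ∧ ⋯ ∧ ∇_X s_i ∧ ⋯ ∧ s_m`. -/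
structure ParallelVolume (𝕁 : ParallelComplexStructure g) where
  ν : ∀ x : M, ⋀[ℂ]^(p + q + 2) (𝕁.Fibre x)
  ne_zero : ∀ x, ν x ≠ 0
  parallel : ∀ x₀ : M, ∃ U : Set M, IsOpen U ∧ x₀ ∈ U ∧
    ∃ s : Fin (p + q + 2) → ∀ x : M, Tractor (2 * p + 2 * q + 2) M x,
      (∀ i, IsSmoothTractorOn (s i) U) ∧
      (∀ x ∈ U, ν x = exteriorPower.ιMulti ℂ (p + q + 2) (fun i => 𝕁.toFibre x (s i x))) ∧
      ∀ x ∈ U, ∀ X, ∑ i, exteriorPower.ιMulti ℂ (p + q + 2)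
        (Function.update (fun j => 𝕁.toFibre x (s j x)) i
          (𝕁.toFibre x (g.tractorDeriv (s i) x X))) = 0

/-- `ν` and the volume element of the model have the same square norm for the Hermitian forms on the
top exterior powers induced by the Hermitian metrics. -/
def ParallelVolume.IsNormalized {𝕁 : ParallelComplexStructure g} (ν : ParallelVolume 𝕁)
    (𝓥 : HermitianModel p q) : Prop :=
  ∀ (x : M) (v : Fin (p + q + 2) → ModelV p q) (w : Fin (p + q + 2) → 𝕁.Fibre x),
    exteriorPower.ιMulti ℂ (p + q + 2) v = 𝓥.vol →
    exteriorPower.ιMulti ℂ (p + q + 2) w = ν.ν x →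
    (Matrix.of fun i j => 𝕁.hermitianMetric x (w i) (w j)).det
      = (Matrix.of fun i j => 𝓥.H (v i) (v j)).det

/-- The total space of the vector bundle `Hom_ℝ(V, T)` over `M`, which contains all the frame
bundles of the tractor bundle as submanifolds. -/
abbrev FrameSpace (p q : ℕ) (M : Type*) [TopologicalSpace M]
    [ChartedSpace (EuclideanSpace ℝ (Fin (2 * p + 2 * q + 2))) M]
    [IsManifold (𝓡 (2 * p + 2 * q + 2)) ∞ M] : Type _ :=
  TotalSpace (ModelV p q →L[ℝ] TractorFibre (2 * p + 2 * q + 2))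
    (fun x : M => Bundle.Trivial M (ModelV p q) x →L[ℝ] Tractor (2 * p + 2 * q + 2) M x)

/-- The model with corners of `FrameSpace p q M`. -/
abbrev frameModel (p q : ℕ) :=
  (𝓡 (2 * p + 2 * q + 2)).prod 𝓘(ℝ, ModelV p q →L[ℝ] TractorFibre (2 * p + 2 * q + 2))

/-- The linear map `V → T_x` that is the fibre component of a point of `FrameSpace p q M`. -/
def FrameSpace.map (u : FrameSpace p q M) :
    ModelV p q →L[ℝ] Tractor (2 * p + 2 * q + 2) M u.proj := u.2

/-- The right action `u ↦ u ∘ a` on frames. -/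
def FrameSpace.act (u : FrameSpace p q M) (a : (ModelEnd p q)ˣ) : FrameSpace p q M :=
  ⟨u.proj, (FrameSpace.map u).comp ((a : ModelEnd p q).restrictScalars ℝ)⟩

/-- The reduced Cartan bundle `𝒢^SU ⊆ Hom_ℝ(V, T)`: all the orthogonal maps `u : V → T_x` with
`u(LR) = T¹_x` which are complex linear and map the volume element of `V` to `ν(x)`. -/
def GSU (𝓥 : HermitianModel p q) {𝕁 : ParallelComplexStructure g} (ν : ParallelVolume 𝕁) :
    Set (FrameSpace p q M) :=
  {u | (∀ v w, g.tractorMetric u.proj (FrameSpace.map u v) (FrameSpace.map u w) = (𝓥.H v w).re) ∧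
    (FrameSpace.map u) '' (𝓥.LR : Set (ModelV p q)) =
      {t | ∃ ρ : ℝ, t = ((0 : ℝ), ((0 : TangentSpace (𝓡 (2 * p + 2 * q + 2)) u.proj), ρ))} ∧
    ∃ hu : ∀ v : ModelV p q,
        FrameSpace.map u (Complex.I • v) = 𝕁.J u.proj (FrameSpace.map u v),
      exteriorPower.map (p + q + 2)
        (CplxOf.lift (𝕁.J u.proj : Tractor (2 * p + 2 * q + 2) M u.proj →ₗ[ℝ] Tractor (2 * p + 2 * q + 2) M u.proj)
          (𝕁.mul_self u.proj) (FrameSpace.map u : ModelV p q →ₗ[ℝ] Tractor (2 * p + 2 * q + 2) M u.proj) hu) 𝓥.vol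
        = ν.ν u.proj}

variable (g) in
/-- The conformal Cartan connection: `u (ω(ξ) v) = ∇_ξ (u v)`, the derivative of the
tractor-valued function `u ↦ u v` in direction `ξ`. This is the form characterised by
`∇_X s ↔ ξ · f + ω(ξ) f`, for the function `f(u) = u⁻¹(s)` that corresponds to a section `s`, where
`ξ` lifts `X`. Its restriction to `𝒢^SU` is `ω^SU`. -/
def cartanForm (u : FrameSpace p q M) (ξ : TangentSpace (frameModel p q) u) (v : ModelV p q) :
    ModelV p q :=
  let ξ' : EuclideanSpace ℝ (Fin (2 * p + 2 * q + 2)) ×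
    (ModelV p q →L[ℝ] TractorFibre (2 * p + 2 * q + 2)) := ξ
  ContinuousLinearMap.inverse (FrameSpace.map u)
    (g.tractorConnector u.proj (FrameSpace.map u v) ξ'.1 (ξ'.2 v))

end frames

/-! ### Local leaf spaces and Cartan connections on trivial bundles -/

/-- `ψ : W → N` is a local leaf space for the foliation spanned by the vector field `κ` on the
`n`-manifold `M`: a smooth surjective submersion with `ker T_x ψ = ℝ κ(x)`. -/
structure IsLocalLeafSpace {n d : ℕ} {M : Type*} [TopologicalSpace M]
    [ChartedSpace (EuclideanSpace ℝ (Fin n)) M]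
    {N : Type*} [TopologicalSpace N] [ChartedSpace (EuclideanSpace ℝ (Fin d)) N]
    (κ : ∀ x : M, TangentSpace (𝓡 n) x) (W : Set M) (ψ : M → N) : Prop where
  isOpen : IsOpen W
  smooth : ContMDiffOn (𝓡 n) (𝓡 d) ∞ ψ W
  surjective : ψ '' W = univ
  submersion : ∀ x ∈ W, Function.Surjective (mfderiv (𝓡 n) (𝓡 d) ψ x)
  ker : ∀ x ∈ W, LinearMap.ker (mfderiv (𝓡 n) (𝓡 d) ψ x : TangentSpace (𝓡 n) x →ₗ[ℝ]
    TangentSpace (𝓡 d) (ψ x)) = Submodule.span ℝ {κ x}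

section cartan

variable {p q d : ℕ} {N : Type*} [TopologicalSpace N] [ChartedSpace (EuclideanSpace ℝ (Fin d)) N]

/-- An `𝔰𝔲(V)`-valued one-form on `N × Q`. The tangent space of `N × Q` at `(x, a)` is identified
with `T_x N × 𝔮`, where `(ξ, A)` stands for `(ξ, a A)`. Only the values with `a ∈ Q` matter. -/
abbrev FormOnProduct (𝓥 : HermitianModel p q) (N : Type*) [TopologicalSpace N]
    [ChartedSpace (EuclideanSpace ℝ (Fin d)) N] : Type _ :=
  ∀ (x : N), (ModelEnd p q)ˣ → (TangentSpace (𝓡 d) x × 𝓥.qLie) →L[ℝ] 𝓥.su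

/-- `θ` is a Cartan connection of type `(SU(V), Q)` on the trivial principal bundle `N' × Q → N'`
over the open subset `N'` of `N`. -/
structure IsCartanConnection [IsManifold (𝓡 d) ∞ N] (𝓥 : HermitianModel p q)
    (θ : FormOnProduct (d := d) 𝓥 N)
    (N' : Set N) : Prop where
  /-- `θ` is a smooth function on the tangent bundle of `N' × Q`. -/
  smooth : ContMDiffOn ((𝓡 d).tangent.prod (𝓘(ℝ, ModelEnd p q).prod 𝓘(ℝ, 𝓥.qLie)))
    𝓘(ℝ, 𝓥.su) ∞
    (fun z : TangentBundle (𝓡 d) N × ((ModelEnd p q)ˣ × 𝓥.qLie) =>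
      θ z.1.proj z.2.1 (z.1.2, z.2.2))
    {z | z.1.proj ∈ N' ∧ z.2.1 ∈ 𝓥.Q}
  bijective : ∀ x ∈ N', ∀ a ∈ 𝓥.Q, Function.Bijective (θ x a)
  /-- `θ` reproduces the generators of the fundamental vector fields. -/
  fundamental : ∀ x ∈ N', ∀ a ∈ 𝓥.Q, ∀ A : 𝓥.qLie,
    (θ x a (0, A) : ModelEnd p q) = A
  /-- `θ` is equivariant: `(r^b)^* θ = Ad(b⁻¹) ∘ θ`. The right translation by `b` maps the tangent
  vector `(ξ, a A)` at `(x, a)` to `(ξ, (a b) (b⁻¹ A b))`. -/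
  equivariant : ∀ x ∈ N', ∀ a ∈ 𝓥.Q, ∀ b ∈ 𝓥.Q, ∀ (ξ : TangentSpace (𝓡 d) x) (A A' : 𝓥.qLie),
    (A' : ModelEnd p q) = ((b⁻¹ : (ModelEnd p q)ˣ) : ModelEnd p q) * A * b →
    (θ x (a * b) (ξ, A') : ModelEnd p q)
      = ((b⁻¹ : (ModelEnd p q)ˣ) : ModelEnd p q) * θ x a (ξ, A) * b

end cartan

end

noncomputable section

local notation:max "𝔼" n:max => EuclideanSpace ℝ (Fin n)

local notation:max "𝕋" n:max => TractorFibre n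

local notation:max "𝐞" i:max => EuclideanSpace.single i 1

local notation:max "chart" n:max => extChartAt (𝓡 n)

set_option maxSynthPendingDepth 3
set_option autoImplicit false

universe u

/-! ### Smooth local inverses -/

theorem exists_smooth_local_inverse {E F : Type*} [NormedAddCommGroup E] [NormedSpace ℝ E]
    [CompleteSpace E] [NormedAddCommGroup F] [NormedSpace ℝ F] {f : E → F} {Ω : Set E}
    (hΩ : IsOpen Ω) (hf : ContDiffOn ℝ ∞ f Ω) {x₀ : E} (hx₀ : x₀ ∈ Ω) (f' : E ≃L[ℝ] F)
    (hf' : HasFDerivAt f (f' : E →L[ℝ] F) x₀) : ∃ Θ : OpenPartialHomeomorph E F, x₀ ∈ Θ.source ∧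
    Θ.source ⊆ Ω ∧ (∀ x, Θ x = f x) ∧ ContDiffOn ℝ ∞ Θ.symm Θ.target := by
  have h0 : ContDiffAt ℝ ∞ f x₀ := hf.contDiffAt (hΩ.mem_nhds hx₀)
  let Θ₀ := h0.toOpenPartialHomeomorph f hf' (by simp)
  have hcont : ContinuousOn (fderiv ℝ f) Ω := hf.continuousOn_fderiv_of_isOpen hΩ (by simp)
  have hO : IsOpen (Ω ∩ fderiv ℝ f ⁻¹' range ((↑) : (E ≃L[ℝ] F) → E →L[ℝ] F)) :=
    hcont.isOpen_inter_preimage hΩ ContinuousLinearEquiv.isOpen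
  let Θ := Θ₀.restrOpen _ hO
  have hsrc : Θ.source = Θ₀.source ∩ (Ω ∩ fderiv ℝ f ⁻¹' range ((↑) : (E ≃L[ℝ] F) → E →L[ℝ] F)) :=
    Θ₀.restrOpen_source _ hO
  refine ⟨Θ, ?_, ?_, fun x => rfl, ?_⟩
  · rw [hsrc]
    exact ⟨h0.mem_toOpenPartialHomeomorph_source hf' (by simp), hx₀, f', hf'.fderiv.symm⟩
  · rw [hsrc]
    exact fun x hx => hx.2.1
  · intro y hy
    have hx : Θ.symm y ∈ Θ.source := Θ.map_target hy
    have hx' := hx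
    rw [hsrc] at hx'
    obtain ⟨-, hxΩ, g, hg⟩ := hx'
    have hfx : ContDiffAt ℝ ∞ f (Θ.symm y) := hf.contDiffAt (hΩ.mem_nhds hxΩ)
    refine (Θ.contDiffAt_symm (f₀' := g) hy ?_ hfx).contDiffWithinAt
    have := (hfx.differentiableAt (by simp)).hasFDerivAt
    rw [← hg] at this
    exact this

/-! ### Composition operators on spaces of continuous functions -/

section composition

variable (K : Type*) [TopologicalSpace K] [CompactSpace K]

/-- The bilinear map on continuous functions induced pointwise by a bilinear map `B`. -/
def ContinuousMap.bilinearL {E F G : Type*} [NormedAddCommGroup E] [NormedSpace ℝ E]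
    [NormedAddCommGroup F] [NormedSpace ℝ F] [NormedAddCommGroup G] [NormedSpace ℝ G]
    (B : G →L[ℝ] E →L[ℝ] F) : C(K, G) →L[ℝ] C(K, E) →L[ℝ] C(K, F) :=
  LinearMap.mkContinuous₂
    (LinearMap.mk₂ ℝ (fun (A : C(K, G)) (γ : C(K, E)) =>
        (⟨fun k => B (A k) (γ k), by fun_prop⟩ : C(K, F)))
      (fun _ _ _ => by ext; simp) (fun _ _ _ => by ext; simp)
      (fun _ _ _ => by ext; simp) (fun _ _ _ => by ext; simp)) ‖B‖ fun A γ => by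
    rw [ContinuousMap.norm_le _ (by positivity)]
    intro k
    refine (B.le_opNorm₂ _ _).trans ?_
    gcongr
    exacts [A.norm_coe_le_norm k, γ.norm_coe_le_norm k]

theorem ContinuousMap.hasFDerivAt_comp_left {E F G : Type*} [NormedAddCommGroup E] [NormedSpace ℝ E]
    [NormedAddCommGroup F] [NormedSpace ℝ F] [NormedAddCommGroup G] [NormedSpace ℝ G]
    (B : G →L[ℝ] E →L[ℝ] F) (f : C(E, F)) (f' : C(E, G))
    (hf : ∀ x, HasFDerivAt f (B (f' x)) x) (hu : UniformContinuous f') (γ : C(K, E)) :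
    HasFDerivAt (fun γ : C(K, E) => f.comp γ) (ContinuousMap.bilinearL K B (f'.comp γ)) γ := by
  rw [hasFDerivAt_iff_isLittleO_nhds_zero, Asymptotics.isLittleO_iff]
  intro ε hε
  obtain ⟨δ, hδ, h⟩ := Metric.uniformContinuous_iff.1 (B.uniformContinuous.comp hu) ε hε
  filter_upwards [Metric.ball_mem_nhds (0 : C(K, E)) hδ] with h' hh'
  rw [ContinuousMap.norm_le _ (by positivity)]
  intro k
  have hk : ‖h' k‖ < δ := (h'.norm_coe_le_norm k).trans_lt (by simpa using hh')
  have key := (convex_ball (γ k) δ).norm_image_sub_le_of_norm_hasFDerivWithin_le'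
    (f := f) (f' := fun x => B (f' x)) (φ := B (f' (γ k))) (C := ε) (x := γ k) (y := γ k + h' k)
    (fun x _ => (hf x).hasFDerivWithinAt)
    (fun x hx => by
      rw [← dist_eq_norm]
      exact (h (by simpa using hx)).le)
    (Metric.mem_ball_self hδ) (by simpa [dist_eq_norm] using hk)
  simp only [add_sub_cancel_left] at key
  refine (le_of_eq ?_).trans (key.trans ?_)
  · simp [ContinuousMap.bilinearL]
  · gcongr
    exact h'.norm_coe_le_norm k

theorem ContinuousMap.contDiff_comp_left_succ {E F G : Type*} [NormedAddCommGroup E]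
    [NormedSpace ℝ E] [NormedAddCommGroup F] [NormedSpace ℝ F] [NormedAddCommGroup G]
    [NormedSpace ℝ G] (B : G →L[ℝ] E →L[ℝ] F) (f : C(E, F)) (f' : C(E, G))
    (hf : ∀ x, HasFDerivAt f (B (f' x)) x) (hu : UniformContinuous f') {n : ℕ}
    (ih : ContDiff ℝ n (fun γ : C(K, E) => f'.comp γ)) :
    ContDiff ℝ (n + 1) (fun γ : C(K, E) => f.comp γ) :=
  contDiff_succ_iff_hasFDerivAt.2 ⟨fun γ => ContinuousMap.bilinearL K B (f'.comp γ),
    (ContinuousMap.bilinearL K B).contDiff.comp ih,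
    ContinuousMap.hasFDerivAt_comp_left K B f f' hf hu⟩

theorem ContinuousMap.contDiff_comp_left_nat (n : ℕ) : ∀ {E F : Type u} [NormedAddCommGroup E]
    [NormedSpace ℝ E] [NormedAddCommGroup F] [NormedSpace ℝ F] (f : C(E, F)),
    ContDiff ℝ ∞ f → HasCompactSupport f → ContDiff ℝ n (fun γ : C(K, E) => f.comp γ) := by
  induction n with
  | zero =>
    intro E F _ _ _ _ f hf hc
    exact contDiff_zero.2 (ContinuousMap.continuous_postcomp f)
  | succ n ih =>
    intro E F _ _ _ _ f hf hc
    have hf' : ContDiff ℝ ∞ (fderiv ℝ f) := hf.fderiv_right (by simp)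
    have hc' : HasCompactSupport (fderiv ℝ f) := hc.fderiv ℝ
    exact ContinuousMap.contDiff_comp_left_succ K (ContinuousLinearMap.id ℝ (E →L[ℝ] F)) f
      ⟨fderiv ℝ f, hf'.continuous⟩ (fun x => (hf.differentiable (by simp) x).hasFDerivAt)
      (hc'.uniformContinuous_of_continuous hf'.continuous) (ih _ hf' hc')

theorem ContinuousMap.contDiff_comp_left {E F : Type u} [NormedAddCommGroup E] [NormedSpace ℝ E]
    [NormedAddCommGroup F] [NormedSpace ℝ F] (f : C(E, F)) (hf : ContDiff ℝ ∞ f)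
    (hc : HasCompactSupport f) : ContDiff ℝ ∞ (fun γ : C(K, E) => f.comp γ) :=
  contDiff_infty.2 fun n => ContinuousMap.contDiff_comp_left_nat K n f hf hc

end composition

/-! ### The flow of a smooth vector field -/

/-- The operator `γ ↦ (t ↦ ∫ r in 0..t, γ r)` on continuous curves `[-1, 1] → E`. -/
def integralL (E : Type*) [NormedAddCommGroup E] [NormedSpace ℝ E] [CompleteSpace E] :
    C(Icc (-1 : ℝ) 1, E) →L[ℝ] C(Icc (-1 : ℝ) 1, E) :=
  LinearMap.mkContinuous
    { toFun := fun γ => ⟨fun t => ∫ r in (0 : ℝ)..t, IccExtend (by norm_num) γ r, by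
        have h : Continuous (IccExtend (h := (by norm_num : (-1 : ℝ) ≤ 1)) γ) :=
          γ.continuous.Icc_extend'
        exact (intervalIntegral.continuous_primitive
          (fun a b => h.intervalIntegrable a b) 0).comp continuous_subtype_val⟩
      map_add' := fun γ₁ γ₂ => by
        have h : ∀ γ : C(Icc (-1 : ℝ) 1, E),
          Continuous (IccExtend (h := (by norm_num : (-1 : ℝ) ≤ 1)) γ) :=
            fun γ => γ.continuous.Icc_extend'
        ext t
        exact intervalIntegral.integral_add ((h γ₁).intervalIntegrable _ _)
          ((h γ₂).intervalIntegrable _ _)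
      map_smul' := fun c γ => by
        ext t
        exact intervalIntegral.integral_smul c _ } 1 fun γ => by
    rw [one_mul, ContinuousMap.norm_le _ (norm_nonneg _)]
    intro t
    have := intervalIntegral.norm_integral_le_of_norm_le_const (a := (0 : ℝ)) (b := t)
      (f := IccExtend (h := (by norm_num : (-1 : ℝ) ≤ 1)) γ) (C := ‖γ‖)
      (fun x _ => γ.norm_coe_le_norm _)
    refine this.trans ?_
    have h2 : |(t : ℝ) - 0| ≤ 1 := by
      rw [sub_zero, abs_le]
      exact ⟨t.2.1, t.2.2⟩
    exact mul_le_of_le_one_right (norm_nonneg _) h2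

/-- The reparametrised curve `r ↦ γ (t r)`. -/
def reparam {E : Type*} [TopologicalSpace E] (γ : C(Icc (-1 : ℝ) 1, E)) (t : Icc (-1 : ℝ) 1) :
    C(Icc (-1 : ℝ) 1, E) :=
  γ.comp ⟨fun r => ⟨t * r, by
    rw [mem_Icc, ← abs_le, abs_mul]
    exact mul_le_one₀ (abs_le.2 t.2) (abs_nonneg _) (abs_le.2 r.2)⟩, by fun_prop⟩

theorem integralL_reparam {E : Type*} [NormedAddCommGroup E] [NormedSpace ℝ E] [CompleteSpace E]
    (γ : C(Icc (-1 : ℝ) 1, E)) (t : Icc (-1 : ℝ) 1) :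
    (t : ℝ) • integralL E (reparam γ t) = reparam (integralL E γ) t := by
  ext r
  have hr : ∀ s ∈ uIcc (0 : ℝ) r, s ∈ Icc (-1 : ℝ) 1 := fun s hs =>
    (uIcc_subset_Icc (by norm_num : (0 : ℝ) ∈ Icc (-1 : ℝ) 1) r.2) hs
  change (t : ℝ) • ∫ s in (0 : ℝ)..r, IccExtend _ (reparam γ t) s
    = ∫ s in (0 : ℝ)..(t * r), IccExtend _ γ s
  have h1 : ∫ s in (0 : ℝ)..r, IccExtend (by norm_num : (-1 : ℝ) ≤ 1) (reparam γ t) s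
      = ∫ s in (0 : ℝ)..r, IccExtend (by norm_num : (-1 : ℝ) ≤ 1) γ (t * s) := by
    refine intervalIntegral.integral_congr fun s hs => ?_
    have hs' := hr s hs
    have hts : (t : ℝ) * s ∈ Icc (-1 : ℝ) 1 := by
      rw [mem_Icc, ← abs_le, abs_mul]
      exact mul_le_one₀ (abs_le.2 t.2) (abs_nonneg _) (abs_le.2 hs')
    simp only [IccExtend_of_mem _ _ hs', IccExtend_of_mem _ _ hts]
    rfl
  rw [h1, intervalIntegral.smul_integral_comp_mul_left, mul_zero]

theorem exists_flow_of_hasCompactSupport {E : Type*} [NormedAddCommGroup E] [NormedSpace ℝ E]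
    [CompleteSpace E] (f : C(E, E)) (hf : ContDiff ℝ ∞ f) (hc : HasCompactSupport f) (x₀ : E) : ∃
    (Θ : ℝ × E → E) (O : Set (ℝ × E)), IsOpen O ∧ (0, x₀) ∈ O ∧ ContDiffOn ℝ ∞ Θ O ∧
    (∀ x, (0, x) ∈ O → Θ (0, x) = x) ∧ ∀ z ∈ O, HasDerivAt (fun t => Θ (t, z.2)) (f (Θ z)) z.1 := by
  let N : C(Icc (-1 : ℝ) 1, E) → C(Icc (-1 : ℝ) 1, E) := fun γ => integralL E (f.comp γ)
  have hN : ContDiff ℝ ∞ N := (integralL E).contDiff.comp (ContinuousMap.contDiff_comp_left (Icc (-1 : ℝ) 1) f hf hc)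
  let cst : E →L[ℝ] C(Icc (-1 : ℝ) 1, E) := ContinuousLinearMap.const ℝ (Icc (-1 : ℝ) 1)
  let Ψ : (ℝ × E) × C(Icc (-1 : ℝ) 1, E) → (ℝ × E) × C(Icc (-1 : ℝ) 1, E) := fun z => (z.1, z.2 - cst z.1.2 - z.1.1 • N z.2)
  have hΨ : ContDiff ℝ ∞ Ψ := by
    refine contDiff_fst.prodMk ?_
    exact (contDiff_snd.sub (cst.contDiff.comp (contDiff_snd.comp contDiff_fst))).sub
      ((contDiff_fst.comp contDiff_fst).smul (hN.comp contDiff_snd))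
  let F' : ((ℝ × E) × C(Icc (-1 : ℝ) 1, E)) ≃L[ℝ] ((ℝ × E) × C(Icc (-1 : ℝ) 1, E)) :=
    ContinuousLinearEquiv.skewProd (.refl ℝ _) (.refl ℝ _)
      (-((cst.comp (ContinuousLinearMap.snd ℝ ℝ E)) +
        (ContinuousLinearMap.fst ℝ ℝ E).smulRight (N (cst x₀))))
  have hΨ' : HasFDerivAt Ψ (F' : (ℝ × E) × C(Icc (-1 : ℝ) 1, E) →L[ℝ] (ℝ × E) × C(Icc (-1 : ℝ) 1, E)) ((0, x₀), cst x₀) := by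
    have hNd : HasFDerivAt N (fderiv ℝ N (cst x₀)) (cst x₀) :=
      (hN.differentiable (by simp) _).hasFDerivAt
    have h1 : HasFDerivAt (fun z : (ℝ × E) × C(Icc (-1 : ℝ) 1, E) => N z.2) _ ((0, x₀), cst x₀) :=
      HasFDerivAt.comp (g := N) (f := Prod.snd) (((0 : ℝ), x₀), cst x₀) hNd hasFDerivAt_snd
    have h2 : HasFDerivAt (fun z : (ℝ × E) × C(Icc (-1 : ℝ) 1, E) => z.1.1) _ ((0, x₀), cst x₀) :=
      ((ContinuousLinearMap.fst ℝ ℝ E).comp (ContinuousLinearMap.fst ℝ (ℝ × E) C(Icc (-1 : ℝ) 1, E))).hasFDerivAt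
    have h3 : HasFDerivAt (fun z : (ℝ × E) × C(Icc (-1 : ℝ) 1, E) => cst z.1.2) _ ((0, x₀), cst x₀) :=
      (cst.comp ((ContinuousLinearMap.snd ℝ ℝ E).comp (ContinuousLinearMap.fst ℝ (ℝ × E) C(Icc (-1 : ℝ) 1, E)))).hasFDerivAt
    have h4 := (hasFDerivAt_fst (𝕜 := ℝ) (p := (((0 : ℝ), x₀), cst x₀))).prodMk
      ((hasFDerivAt_snd.sub h3).sub (h2.smul h1))
    refine h4.congr_fderiv ?_
    refine ContinuousLinearMap.ext fun z => Prod.ext rfl ?_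
    simp [F']
    abel
  obtain ⟨Γ, hΓ0, -, hΓ, hΓs⟩ := exists_smooth_local_inverse isOpen_univ hΨ.contDiffOn
    (mem_univ _) F' hΨ'
  have hval : Ψ ((0, x₀), cst x₀) = ((0, x₀), 0) := by simp [Ψ]
  have hcoe : ∀ z ∈ Γ.target, Ψ (Γ.symm z) = z := fun z hz => by rw [← hΓ]; exact Γ.right_inv hz
  have hmem : (((0 : ℝ), x₀), (0 : C(Icc (-1 : ℝ) 1, E))) ∈ Γ.target := by
    rw [← hval, ← hΓ]
    exact Γ.map_source hΓ0
  let G : ℝ × E → C(Icc (-1 : ℝ) 1, E) := fun w => (Γ.symm (w, 0)).2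
  let O' : Set (ℝ × E) := (fun w => (w, (0 : C(Icc (-1 : ℝ) 1, E)))) ⁻¹' Γ.target
  have hO' : IsOpen O' := Γ.open_target.preimage (by fun_prop)
  have hGs : ContDiffOn ℝ ∞ G O' := by
    refine contDiff_snd.comp_contDiffOn (hΓs.comp ?_ fun w hw => hw)
    exact (contDiff_id.prodMk contDiff_const).contDiffOn
  have hG1 : ∀ w ∈ O', Γ.symm (w, 0) = (w, G w) := fun w hw =>
    Prod.ext (congrArg Prod.fst (hcoe (w, 0) hw) :) rfl
  have hGeq : ∀ w ∈ O', G w - cst w.2 - w.1 • N (G w) = 0 := fun w hw => by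
    have h := congrArg Prod.snd (hcoe _ hw)
    rw [hG1 w hw] at h
    exact h
  have hGuniq : ∀ w γ, (w, γ) ∈ Γ.source → γ - cst w.2 - w.1 • N γ = 0 → γ = G w := by
    intro w γ hs h
    have h1 : Γ (w, γ) = (w, 0) := by rw [hΓ]; exact Prod.ext rfl h
    have h2 : Γ.symm (w, 0) = (w, γ) := by rw [← h1]; exact Γ.left_inv hs
    exact (congrArg Prod.snd h2).symm
  have hG0 : G (0, x₀) = cst x₀ := (hGuniq _ _ hΓ0 (by simp)).symm
  obtain ⟨ε, hε, hball⟩ := Metric.isOpen_iff.1 Γ.open_source _ hΓ0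
  have hnear : ∀ᶠ w in 𝓝 ((0 : ℝ), x₀), w ∈ O' ∧ G w ∈ Metric.ball (cst x₀) ε := by
    refine Filter.Eventually.and (hO'.mem_nhds hmem) ?_
    have : ContinuousAt G (0, x₀) := hGs.continuousOn.continuousAt (hO'.mem_nhds hmem)
    refine this.eventually (Metric.isOpen_ball.mem_nhds ?_)
    rw [hG0]
    exact Metric.mem_ball_self hε
  obtain ⟨δ', hδ', hδb⟩ := Metric.eventually_nhds_iff_ball.1 hnear
  let δ := min δ' ε
  have hδ : 0 < δ := lt_min hδ' hε
  have hrep : ∀ (s : ℝ) (x : E), (s, x) ∈ Metric.ball ((0 : ℝ), x₀) δ → ∀ t : (Icc (-1 : ℝ) 1),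
      reparam (G (s, x)) t = G (t * s, x) := by
    intro s x hw t
    have hw' : ((t * s, x) : ℝ × E) ∈ Metric.ball ((0 : ℝ), x₀) δ := by
      simp only [Metric.mem_ball, Prod.dist_eq, max_lt_iff, dist_zero_right, norm_mul] at hw ⊢
      refine ⟨lt_of_le_of_lt ?_ hw.1, hw.2⟩
      exact mul_le_of_le_one_left (norm_nonneg _) (abs_le.2 t.2)
    have hγ := hδb _ (Metric.ball_subset_ball (min_le_left _ _) hw)
    refine hGuniq _ _ (hball ?_) ?_
    · simp only [Metric.mem_ball, Prod.dist_eq, max_lt_iff] at hw' ⊢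
      refine ⟨⟨hw'.1.trans_le (min_le_right _ _), hw'.2.trans_le (min_le_right _ _)⟩, ?_⟩
      refine lt_of_le_of_lt ?_ (Metric.mem_ball.1 hγ.2)
      rw [ContinuousMap.dist_le dist_nonneg]
      intro r
      exact ContinuousMap.dist_apply_le_dist (f := G (s, x)) (g := cst x₀) _
    · have h1 : (t * s : ℝ) • N (reparam (G (s, x)) t) = reparam (s • N (G (s, x))) t := by
        rw [mul_comm, mul_smul]
        exact congrArg (s • ·) (integralL_reparam (f.comp (G (s, x))) t)
      change reparam (G (s, x)) t - cst x - (t * s : ℝ) • N (reparam (G (s, x)) t) = 0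
      rw [h1]
      ext r
      exact congrArg (fun γ : C(Icc (-1 : ℝ) 1, E) => γ ⟨t * r, by
        rw [mem_Icc, ← abs_le, abs_mul]
        exact mul_le_one₀ (abs_le.2 t.2) (abs_nonneg _) (abs_le.2 r.2)⟩) (hGeq (s, x) hγ.1)
  let Θ : ℝ × E → E := fun w => G w ⟨1, by norm_num, le_rfl⟩
  have hev : ContDiff ℝ ∞ (fun γ : C(Icc (-1 : ℝ) 1, E) => γ ⟨1, by norm_num, le_rfl⟩) :=
    (ContinuousMap.evalCLM (M := E) ℝ (⟨1, by norm_num, le_rfl⟩ : (Icc (-1 : ℝ) 1))).contDiff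
  refine ⟨Θ, Metric.ball 0 (δ / 2) ×ˢ Metric.ball x₀ δ, Metric.isOpen_ball.prod Metric.isOpen_ball,
    ⟨Metric.mem_ball_self (by positivity), Metric.mem_ball_self hδ⟩, ?_, ?_, ?_⟩
  · refine hev.comp_contDiffOn (hGs.mono fun w hw => (hδb w ?_).1)
    simp only [mem_prod, Metric.mem_ball, Prod.dist_eq, max_lt_iff] at hw ⊢
    exact ⟨(hw.1.trans (half_lt_self hδ)).trans_le (min_le_left _ _),
      hw.2.trans_le (min_le_left _ _)⟩
  · intro x hx
    have h := hGeq (0, x) (hδb _ (by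
      simp only [mem_prod, Metric.mem_ball, Prod.dist_eq, max_lt_iff] at hx ⊢
      exact ⟨by simpa using hδ', hx.2.trans_le (min_le_left _ _)⟩)).1
    simp only [zero_smul, sub_zero, sub_eq_zero] at h
    change G (0, x) _ = x
    rw [h]
    rfl
  · rintro ⟨σ, x⟩ ⟨hσ, hx⟩
    simp only [Metric.mem_ball, dist_zero_right, Real.norm_eq_abs] at hσ hx
    let s := δ / 2
    have hs : 0 < s := by positivity
    have hsx : (s, x) ∈ Metric.ball ((0 : ℝ), x₀) δ := by
      simp only [Metric.mem_ball, Prod.dist_eq, max_lt_iff, dist_zero_right, Real.norm_eq_abs,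
        abs_of_pos hs]
      exact ⟨by simp only [s]; linarith, hx⟩
    have ht : ∀ u : ℝ, |u| < s → u / s ∈ (Icc (-1 : ℝ) 1) := fun u hu => by
      rw [mem_Icc, ← abs_le, abs_div, abs_of_pos hs]
      exact (div_le_one hs).2 hu.le
    have hΘ : ∀ u : ℝ, ∀ hu : |u| < s, Θ (u, x) = G (s, x) ⟨u / s, ht u hu⟩ := fun u hu => by
      have h := congrArg (fun γ : C(Icc (-1 : ℝ) 1, E) => γ ⟨1, by norm_num, le_rfl⟩) (hrep s x hsx ⟨u / s, ht u hu⟩)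
      have h1 : u / s * s = u := div_mul_cancel₀ u hs.ne'
      simp only [h1] at h
      refine h.symm.trans ?_
      change G (s, x) _ = _
      refine congrArg (G (s, x)) (Subtype.ext ?_)
      exact mul_one _
    let k : ℝ → E := IccExtend (by norm_num : (-1 : ℝ) ≤ 1) (f.comp (G (s, x)))
    have hk : Continuous k := (f.comp (G (s, x))).continuous.Icc_extend'
    have hform : ∀ u : ℝ, ∀ hu : |u| < s, Θ (u, x) = x + s • ∫ r in (0 : ℝ)..(u / s), k r := by
      intro u hu
      rw [hΘ u hu]
      have h := hGeq (s, x) (hδb _ (Metric.ball_subset_ball (min_le_left _ _) hsx)).1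
      have h2 := congrArg (fun γ : C(Icc (-1 : ℝ) 1, E) => γ ⟨u / s, ht u hu⟩) h
      rw [sub_sub, sub_eq_zero] at h
      exact congrArg (fun γ : C(Icc (-1 : ℝ) 1, E) => γ ⟨u / s, ht u hu⟩) h
    have hd : HasDerivAt (fun u : ℝ => x + s • ∫ r in (0 : ℝ)..(u / s), k r)
        (s • ((1 / s) • k (σ / s))) σ := by
      have h1 : HasDerivAt (fun u => ∫ r in (0 : ℝ)..u, k r) (k (σ / s)) (σ / s) :=
        intervalIntegral.integral_hasDerivAt_right (hk.intervalIntegrable _ _)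
          hk.aestronglyMeasurable.stronglyMeasurableAtFilter hk.continuousAt
      have h2 : HasDerivAt (fun u : ℝ => u / s) (1 / s) σ := (hasDerivAt_id σ).div_const s
      exact ((h1.scomp σ h2).const_smul s).const_add x
    have hkv : k (σ / s) = f (Θ (σ, x)) := by
      rw [hΘ σ hσ]
      exact IccExtend_of_mem _ _ (ht σ hσ)
    rw [smul_smul, mul_one_div_cancel hs.ne', one_smul, hkv] at hd
    refine hd.congr_of_eventuallyEq ?_
    have : ∀ᶠ u in 𝓝 σ, |u| < s := (isOpen_lt continuous_abs continuous_const).mem_nhds hσ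
    filter_upwards [this] with u hu
    exact hform u hu

theorem exists_smooth_flow {E : Type*} [NormedAddCommGroup E] [NormedSpace ℝ E]
    [FiniteDimensional ℝ E] {f : E → E} {Ω : Set E} (hΩ : IsOpen Ω) (hf : ContDiffOn ℝ ∞ f Ω)
    {x₀ : E} (hx₀ : x₀ ∈ Ω) : ∃ (Θ : ℝ × E → E) (O : Set (ℝ × E)), IsOpen O ∧ (0, x₀) ∈ O ∧
    ContDiffOn ℝ ∞ Θ O ∧ (∀ z ∈ O, Θ z ∈ Ω) ∧ (∀ x, (0, x) ∈ O → Θ (0, x) = x) ∧ ∀ z ∈ O, HasDerivAt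
    (fun t => Θ (t, z.2)) (f (Θ z)) z.1 := by
  have : CompleteSpace E := FiniteDimensional.complete ℝ E
  obtain ⟨r, hr, hrΩ⟩ := Metric.nhds_basis_closedBall.mem_iff.1 (hΩ.mem_nhds hx₀)
  let χ : ContDiffBump x₀ := ⟨r / 2, r, by positivity, by linarith⟩
  let F : E → E := fun x => χ x • f x
  have hF : ContDiff ℝ ∞ F := by
    rw [contDiff_iff_contDiffAt]
    intro x
    by_cases hx : x ∈ Ω
    · exact χ.contDiffAt.smul (hf.contDiffAt (hΩ.mem_nhds hx))
    · have hx' : x ∉ tsupport χ := by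
        rw [χ.tsupport_eq]
        exact fun h => hx (hrΩ h)
      have : F =ᶠ[𝓝 x] fun _ => 0 := by
        filter_upwards [notMem_tsupport_iff_eventuallyEq.1 hx'] with y hy
        simp [F, hy]
      exact contDiffAt_const.congr_of_eventuallyEq this
  have hFc : HasCompactSupport F := χ.hasCompactSupport.smul_right
  obtain ⟨Θ, O, hO, h0, hΘ, hΘ0, hΘd⟩ := exists_flow_of_hasCompactSupport ⟨F, hF.continuous⟩ hF hFc x₀
  have hO2 : IsOpen (O ∩ Θ ⁻¹' Metric.ball x₀ (r / 2)) :=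
    hΘ.continuousOn.isOpen_inter_preimage hO Metric.isOpen_ball
  have hsub : Metric.ball x₀ (r / 2) ⊆ Ω := fun x hx =>
    hrΩ (Metric.ball_subset_closedBall (Metric.ball_subset_ball (by linarith) hx))
  refine ⟨Θ, _, hO2, ⟨h0, ?_⟩, hΘ.mono inter_subset_left, fun z hz => hsub hz.2,
    fun x hx => hΘ0 x hx.1, fun z hz => ?_⟩
  · rw [mem_preimage, hΘ0 x₀ h0]
    exact Metric.mem_ball_self (by positivity)
  · have h := hΘd z hz.1
    have h1 : χ (Θ z) = 1 := χ.one_of_mem_closedBall (Metric.ball_subset_closedBall hz.2)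
    simpa [F, h1] using h

/-! ### Curvature of connections in coordinates -/

section connection

variable {E T : Type*} [NormedAddCommGroup E] [NormedSpace ℝ E] [NormedAddCommGroup T]
  [NormedSpace ℝ T]

/-- The curvature `∂A + A ∧ A` of the connection `d + A` on a trivial bundle with fibre `T`. -/
def curvL (A : E → E →L[ℝ] T →L[ℝ] T) (y : E) : E →L[ℝ] E →L[ℝ] T →L[ℝ] T :=
  fderiv ℝ A y - (fderiv ℝ A y).flip
    + (ContinuousLinearMap.compL ℝ T T T).bilinearComp (A y) (A y)
    - ((ContinuousLinearMap.compL ℝ T T T).bilinearComp (A y) (A y)).flip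

theorem curvL_apply (A : E → E →L[ℝ] T →L[ℝ] T) (y a b : E) (v : T) : curvL A y a b v = fderiv ℝ A y
    a b v - fderiv ℝ A y b a v + A y a (A y b v) - A y b (A y a v) := rfl

theorem curvL_antisymm (A : E → E →L[ℝ] T →L[ℝ] T) (y a b : E) (v : T) :
    curvL A y a b v = -curvL A y b a v := by
  simp only [curvL_apply]
  abel

variable {A : E → E →L[ℝ] T →L[ℝ] T} {Ω : Set E}

theorem contDiffOn_curvL [FiniteDimensional ℝ E] (hΩ : IsOpen Ω) (hA : ContDiffOn ℝ ∞ A Ω) :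
    ContDiffOn ℝ ∞ (curvL A) Ω := by
  have hA' : ContDiffOn ℝ ∞ (fderiv ℝ A) Ω := hA.fderiv_of_isOpen hΩ (by simp)
  refine contDiffOn_clm_apply.2 fun a => contDiffOn_clm_apply.2 fun b => ?_
  have h : ∀ c d, ContDiffOn ℝ ∞ (fun y => fderiv ℝ A y c d) Ω := fun c d =>
    (hA'.clm_apply contDiffOn_const).clm_apply contDiffOn_const
  have h2 : ∀ c, ContDiffOn ℝ ∞ (fun y => A y c) Ω := fun c => hA.clm_apply contDiffOn_const
  exact (((h a b).sub (h b a)).add ((h2 a).clm_comp (h2 b))).sub ((h2 b).clm_comp (h2 a))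

theorem hasFDerivAt_curvL_apply (hΩ : IsOpen Ω) (hA : ContDiffOn ℝ ∞ A Ω) {y : E} (hy : y ∈ Ω)
    (a b x : E) (v : T) : fderiv ℝ (fun z => curvL A z a b v) y x = fderiv ℝ (fderiv ℝ A) y x a b v
    - fderiv ℝ (fderiv ℝ A) y x b a v + (fderiv ℝ A y x a (A y b v) + A y a (fderiv ℝ A y x b v)) -
    (fderiv ℝ A y x b (A y a v) + A y b (fderiv ℝ A y x a v)) := by
  have hA' : ContDiffOn ℝ ∞ (fderiv ℝ A) Ω := hA.fderiv_of_isOpen hΩ (by simp)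
  have h1 : HasFDerivAt (fderiv ℝ A) (fderiv ℝ (fderiv ℝ A) y) y :=
    ((hA'.differentiableOn (by simp)).differentiableAt (hΩ.mem_nhds hy)).hasFDerivAt
  have h0 : HasFDerivAt A (fderiv ℝ A y) y :=
    ((hA.differentiableOn (by simp)).differentiableAt (hΩ.mem_nhds hy)).hasFDerivAt
  have h2 : ∀ c w, HasFDerivAt (fun z => A z c w) _ y := fun c w =>
    (h0.clm_apply (hasFDerivAt_const c y)).clm_apply (hasFDerivAt_const w y)
  have h3 : ∀ c d w, HasFDerivAt (fun z => fderiv ℝ A z c d w) _ y := fun c d w =>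
    ((h1.clm_apply (hasFDerivAt_const c y)).clm_apply (hasFDerivAt_const d y)).clm_apply
      (hasFDerivAt_const w y)
  have h4 : ∀ c d, HasFDerivAt (fun z => A z c (A z d v)) _ y := fun c d =>
    (h0.clm_apply (hasFDerivAt_const c y)).clm_apply (h2 d v)
  have h5 := (((h3 a b v).sub (h3 b a v)).add (h4 a b)).sub (h4 b a)
  have h6 : fderiv ℝ (fun z => curvL A z a b v) y = _ := h5.fderiv
  rw [h6]
  simp
  abel

theorem curvL_bianchi (hΩ : IsOpen Ω) (hA : ContDiffOn ℝ ∞ A Ω) {y : E} (hy : y ∈ Ω) (a b c : E)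
    (v : T) :
    (fderiv ℝ (fun z => curvL A z b c v) y a + A y a (curvL A y b c v) - curvL A y b c (A y a v)) +
    (fderiv ℝ (fun z => curvL A z c a v) y b + A y b (curvL A y c a v) - curvL A y c a (A y b v)) +
    (fderiv ℝ (fun z => curvL A z a b v) y c + A y c (curvL A y a b v) - curvL A y a b (A y c v)) =
    0 := by
  have hs : ∀ x z w u, fderiv ℝ (fderiv ℝ A) y x z w u = fderiv ℝ (fderiv ℝ A) y z x w u := by
    have h : IsSymmSndFDerivAt ℝ A y :=
      (hA.contDiffAt (hΩ.mem_nhds hy)).isSymmSndFDerivAt (by simpa using ENat.LEInfty.out)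
    intro x z w u
    rw [h x z]
  simp only [hasFDerivAt_curvL_apply hΩ hA hy]
  rw [hs a b c v, hs b c a v, hs c a b v]
  simp only [curvL_apply, map_add, map_sub]
  abel

theorem curvL_skew (hΩ : IsOpen Ω) (hA : ContDiffOn ℝ ∞ A Ω) {h : E → T →L[ℝ] T →L[ℝ] ℝ}
    (hh : ContDiffOn ℝ ∞ h Ω)
    (hpar : ∀ z ∈ Ω, ∀ a u v, fderiv ℝ h z a u v = h z (A z a u) v + h z u (A z a v)) {y : E}
    (hy : y ∈ Ω) (a b : E) (u v : T) : h y (curvL A y a b u) v + h y u (curvL A y a b v) = 0 := by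
  have hh' : ContDiffOn ℝ ∞ (fderiv ℝ h) Ω := hh.fderiv_of_isOpen hΩ (by simp)
  have d1 : HasFDerivAt (fderiv ℝ h) (fderiv ℝ (fderiv ℝ h) y) y :=
    ((hh'.differentiableOn (by simp)).differentiableAt (hΩ.mem_nhds hy)).hasFDerivAt
  have d0 : HasFDerivAt h (fderiv ℝ h y) y :=
    ((hh.differentiableOn (by simp)).differentiableAt (hΩ.mem_nhds hy)).hasFDerivAt
  have dA : HasFDerivAt A (fderiv ℝ A y) y :=
    ((hA.differentiableOn (by simp)).differentiableAt (hΩ.mem_nhds hy)).hasFDerivAt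
  have hs : ∀ x z, fderiv ℝ (fderiv ℝ h) y x z u v = fderiv ℝ (fderiv ℝ h) y z x u v := by
    have hsym : IsSymmSndFDerivAt ℝ h y :=
      (hh.contDiffAt (hΩ.mem_nhds hy)).isSymmSndFDerivAt (by simpa using ENat.LEInfty.out)
    intro x z
    rw [hsym x z]
  have key : ∀ x c, fderiv ℝ (fderiv ℝ h) y x c u v
      = h y (A y x (A y c u)) v + h y (A y c u) (A y x v) + h y (fderiv ℝ A y x c u) v
        + (h y (A y x u) (A y c v) + h y u (A y x (A y c v)) + h y u (fderiv ℝ A y x c v)) := by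
    intro x c
    have hl : HasFDerivAt (fun z => fderiv ℝ h z c u v) _ y :=
      ((d1.clm_apply (hasFDerivAt_const c y)).clm_apply (hasFDerivAt_const u y)).clm_apply
        (hasFDerivAt_const v y)
    have hAc : ∀ w, HasFDerivAt (fun z => A z c w) _ y := fun w =>
      (dA.clm_apply (hasFDerivAt_const c y)).clm_apply (hasFDerivAt_const w y)
    have hr := ((d0.clm_apply (hAc u)).clm_apply (hasFDerivAt_const v y)).add
      ((d0.clm_apply (hasFDerivAt_const u y)).clm_apply (hAc v))
    have heq : (fun z => fderiv ℝ h z c u v) =ᶠ[𝓝 y]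
        fun z => h z (A z c u) v + h z u (A z c v) := by
      filter_upwards [hΩ.mem_nhds hy] with z hz
      exact hpar z hz c u v
    have := hl.unique (hr.congr_of_eventuallyEq heq)
    have := congrArg (fun f : E →L[ℝ] ℝ => f x) this
    simp [hpar y hy] at this
    linarith
  have h1 := key a b
  have h2 := key b a
  rw [hs] at h1
  simp only [curvL_apply, map_add, map_sub, add_apply, sub_apply]
  linarith

end connection

/-! ### Levi-Civita connection -/

namespace CoordMetric

variable {n : ℕ}

/-- `G` is a smooth pseudo-Riemannian metric on the open set `Ω`. -/
structure IsMetricOn (G : 𝔼 n → 𝔼 n →L[ℝ] 𝔼 n →L[ℝ] ℝ) (Ω : Set (𝔼 n)) : Prop where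
  isOpen : IsOpen Ω
  smooth : ContDiffOn ℝ ∞ G Ω
  symm : ∀ y ∈ Ω, ∀ a b, G y a b = G y b a
  inv : ∀ y ∈ Ω, (G y).IsInvertible

variable {G : 𝔼 n → 𝔼 n →L[ℝ] 𝔼 n →L[ℝ] ℝ} {Ω : Set (𝔼 n)}

/-- The Christoffel map as a bilinear map. -/
def christoffelL (G : 𝔼 n → 𝔼 n →L[ℝ] 𝔼 n →L[ℝ] ℝ) (y : 𝔼 n) : 𝔼 n →L[ℝ] 𝔼 n →L[ℝ] 𝔼 n :=
  (ContinuousLinearMap.compL ℝ (𝔼 n) (𝔼 n →L[ℝ] ℝ) (𝔼 n) (ContinuousLinearMap.inverse (G y))) ∘L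
    ((1 / 2 : ℝ) • (fderiv ℝ G y + (fderiv ℝ G y).flip
      - ((ContinuousLinearMap.flipₗᵢ ℝ (𝔼 n) (𝔼 n) ℝ).toContinuousLinearEquiv : (𝔼 n →L[ℝ] 𝔼 n →L[ℝ] ℝ) →L[ℝ] (𝔼 n →L[ℝ] 𝔼 n →L[ℝ] ℝ)) ∘L (fderiv ℝ G y).flip))

theorem christoffelL_apply (G : 𝔼 n → 𝔼 n →L[ℝ] 𝔼 n →L[ℝ] ℝ) (y a b : 𝔼 n) :
    christoffelL G y a b = christoffel G y a b := rfl

theorem IsMetricOn.apply_sharp (h : IsMetricOn G Ω) {y : 𝔼 n} (hy : y ∈ Ω) (α : 𝔼 n →L[ℝ] ℝ) :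
    G y (sharp G y α) = α := by
  obtain ⟨e, he⟩ := h.inv y hy
  rw [sharp, ← he, ContinuousLinearMap.inverse_equiv]
  exact e.apply_symm_apply α

theorem IsMetricOn.ext (h : IsMetricOn G Ω) {y : 𝔼 n} (hy : y ∈ Ω) {a b : 𝔼 n}
    (hab : ∀ c, G y a c = G y b c) : a = b := by
  obtain ⟨e, he⟩ := h.inv y hy
  apply e.injective
  ext1 c
  have := hab c
  rwa [← he] at this

theorem IsMetricOn.fderiv_symm (h : IsMetricOn G Ω) {y : 𝔼 n} (hy : y ∈ Ω) (x a b : 𝔼 n) :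
    fderiv ℝ G y x a b = fderiv ℝ G y x b a := by
  have d0 : HasFDerivAt G (fderiv ℝ G y) y :=
    ((h.smooth.differentiableOn (by simp)).differentiableAt (h.isOpen.mem_nhds hy)).hasFDerivAt
  have h1 : ∀ a b, HasFDerivAt (fun z => G z a b) _ y := fun a b =>
    (d0.clm_apply (hasFDerivAt_const a y)).clm_apply (hasFDerivAt_const b y)
  have heq : (fun z => G z a b) =ᶠ[𝓝 y] fun z => G z b a := by
    filter_upwards [h.isOpen.mem_nhds hy] with z hz
    exact h.symm z hz a b
  have := congrArg (fun f : 𝔼 n →L[ℝ] ℝ => f x) ((h1 a b).unique ((h1 b a).congr_of_eventuallyEq heq))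
  simpa using this

theorem IsMetricOn.apply_christoffel (h : IsMetricOn G Ω) {y : 𝔼 n} (hy : y ∈ Ω) (a b c : 𝔼 n) : G y
    (christoffelL G y a b) c = 1 / 2 *
    (fderiv ℝ G y a b c + fderiv ℝ G y b a c - fderiv ℝ G y c a b) := by
  rw [christoffelL_apply, christoffel, h.apply_sharp hy]
  rfl

theorem IsMetricOn.christoffel_symm (h : IsMetricOn G Ω) {y : 𝔼 n} (hy : y ∈ Ω) (a b : 𝔼 n) :
    christoffelL G y a b = christoffelL G y b a := by
  refine h.ext hy fun c => ?_
  rw [h.apply_christoffel hy, h.apply_christoffel hy, h.fderiv_symm hy c a b]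
  ring

theorem IsMetricOn.fderiv_apply (h : IsMetricOn G Ω) {y : 𝔼 n} (hy : y ∈ Ω) (x a b : 𝔼 n) :
    fderiv ℝ G y x a b = G y (christoffelL G y x a) b + G y a (christoffelL G y x b) := by
  rw [h.symm y hy a, h.apply_christoffel hy, h.apply_christoffel hy, h.fderiv_symm hy x b a,
    h.fderiv_symm hy b x a, h.fderiv_symm hy a x b]
  ring

theorem IsMetricOn.contDiffOn_inverse (h : IsMetricOn G Ω) :
    ContDiffOn ℝ ∞ (fun y => ContinuousLinearMap.inverse (G y)) Ω := by
  intro y hy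
  obtain ⟨e, he⟩ := h.inv y hy
  have : ContDiffAt ℝ ∞ ContinuousLinearMap.inverse (G y) := by
    rw [← he]
    exact contDiffAt_map_inverse e
  exact this.comp_contDiffWithinAt y (h.smooth y hy)

theorem IsMetricOn.contDiffOn_christoffelL (h : IsMetricOn G Ω) : ContDiffOn ℝ ∞ (christoffelL G) Ω := by
  have hG' : ContDiffOn ℝ ∞ (fderiv ℝ G) Ω := h.smooth.fderiv_of_isOpen h.isOpen (by simp)
  refine contDiffOn_clm_apply.2 fun a => contDiffOn_clm_apply.2 fun b => ?_
  refine h.contDiffOn_inverse.clm_apply (contDiffOn_clm_apply.2 fun c => ?_)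
  have h3 : ∀ a b c, ContDiffOn ℝ ∞ (fun z => fderiv ℝ G z a b c) Ω := fun a b c =>
    ((hG'.clm_apply contDiffOn_const).clm_apply contDiffOn_const).clm_apply contDiffOn_const
  exact contDiffOn_const.mul (((h3 a b c).add (h3 b a c)).sub (h3 c a b))

theorem IsMetricOn.riemann_eq (h : IsMetricOn G Ω) {y : 𝔼 n} (hy : y ∈ Ω) (a b c : 𝔼 n) :
    riemann G y a b c = curvL (christoffelL G) y a b c := by
  have d0 : HasFDerivAt (christoffelL G) (fderiv ℝ (christoffelL G) y) y :=
    ((h.contDiffOn_christoffelL.differentiableOn (by simp)).differentiableAt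
      (h.isOpen.mem_nhds hy)).hasFDerivAt
  have h1 : ∀ a b, fderiv ℝ (fun z => christoffel G z a b) y = _ := fun a b =>
    ((d0.clm_apply (hasFDerivAt_const a y)).clm_apply (hasFDerivAt_const b y)).fderiv
  rw [riemann, h1, h1, curvL_apply]
  simp [christoffelL_apply]

theorem IsMetricOn.curvL_christoffel_cyclic (h : IsMetricOn G Ω) {y : 𝔼 n} (hy : y ∈ Ω)
    (a b c : 𝔼 n) : curvL (christoffelL G) y a b c + curvL (christoffelL G) y b c a + curvL
    (christoffelL G) y c a b = 0 := by
  have d0 : HasFDerivAt (christoffelL G) (fderiv ℝ (christoffelL G) y) y :=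
    ((h.contDiffOn_christoffelL.differentiableOn (by simp)).differentiableAt
      (h.isOpen.mem_nhds hy)).hasFDerivAt
  have h1 : ∀ a b, HasFDerivAt (fun z => christoffelL G z a b) _ y := fun a b =>
    (d0.clm_apply (hasFDerivAt_const a y)).clm_apply (hasFDerivAt_const b y)
  have hs : ∀ x a b, fderiv ℝ (christoffelL G) y x a b = fderiv ℝ (christoffelL G) y x b a := by
    intro x a b
    have heq : (fun z => christoffelL G z a b) =ᶠ[𝓝 y] fun z => christoffelL G z b a := by
      filter_upwards [h.isOpen.mem_nhds hy] with z hz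
      exact h.christoffel_symm hz a b
    have := congrArg (fun f : 𝔼 n →L[ℝ] 𝔼 n => f x)
      ((h1 a b).unique ((h1 b a).congr_of_eventuallyEq heq))
    simpa using this
  simp only [curvL_apply]
  rw [hs a b c, hs b c a, hs c a b, h.christoffel_symm hy b c, h.christoffel_symm hy c a,
    h.christoffel_symm hy a b]
  abel

end CoordMetric

/-- The continuous bilinear map given by a bilinear map of finite-dimensional spaces. -/
def toCLM₂ {E F V : Type*} [NormedAddCommGroup E] [NormedSpace ℝ E] [FiniteDimensional ℝ E]
    [NormedAddCommGroup F] [NormedSpace ℝ F] [FiniteDimensional ℝ F]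
    [NormedAddCommGroup V] [NormedSpace ℝ V] (f : E →ₗ[ℝ] F →ₗ[ℝ] V) : E →L[ℝ] F →L[ℝ] V :=
  LinearMap.toContinuousLinearMap
    ((LinearMap.toContinuousLinearMap : (F →ₗ[ℝ] V) ≃ₗ[ℝ] (F →L[ℝ] V)) ∘ₗ f)

theorem toCLM₂_apply {E F V : Type*} [NormedAddCommGroup E] [NormedSpace ℝ E]
    [FiniteDimensional ℝ E] [NormedAddCommGroup F] [NormedSpace ℝ F] [FiniteDimensional ℝ F]
    [NormedAddCommGroup V] [NormedSpace ℝ V] (f : E →ₗ[ℝ] F →ₗ[ℝ] V) (a : E) (b : F) :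
    toCLM₂ f a b = f a b := rfl

namespace CoordMetric

variable {n : ℕ} {G : 𝔼 n → 𝔼 n →L[ℝ] 𝔼 n →L[ℝ] ℝ} {Ω : Set (𝔼 n)}

/-! ### Traces -/

/-- The coordinate expression of the trace. -/
def tr (f : 𝔼 n →ₗ[ℝ] (𝔼 n)) : ℝ := ∑ i, (f (𝐞 i)) i

theorem tr_eq_trace (f : 𝔼 n →ₗ[ℝ] (𝔼 n)) : tr f = LinearMap.trace ℝ _ f := by
  rw [LinearMap.trace_eq_matrix_trace ℝ (EuclideanSpace.basisFun (Fin n) ℝ).toBasis f]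
  simp [tr, Matrix.trace, LinearMap.toMatrix_apply]

theorem tr_comp_comm (f g : 𝔼 n →ₗ[ℝ] (𝔼 n)) : tr (f ∘ₗ g) = tr (g ∘ₗ f) := by
  rw [tr_eq_trace, tr_eq_trace]
  exact LinearMap.trace_mul_comm ℝ f g

theorem sum_single (v : 𝔼 n) : ∑ i, v i • EuclideanSpace.single i (1 : ℝ) = v := by
  have := (EuclideanSpace.basisFun (Fin n) ℝ).sum_repr v
  simpa using this

theorem sum_map_single {V : Type*} [AddCommGroup V] [Module ℝ V] (f : 𝔼 n →ₗ[ℝ] V) (v : 𝔼 n) :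
    ∑ i, v i • f (𝐞 i) = f v := by
  conv_rhs => rw [← sum_single v]
  simp

/-- The basis dual to the standard basis with respect to `G`. -/
abbrev dualVec (G : 𝔼 n → 𝔼 n →L[ℝ] 𝔼 n →L[ℝ] ℝ) (y : 𝔼 n) (i : Fin n) : (𝔼 n) :=
  sharp G y (EuclideanSpace.proj i)

theorem IsMetricOn.apply_dualVec (h : IsMetricOn G Ω) {y : 𝔼 n} (hy : y ∈ Ω) (i : Fin n) (v : 𝔼 n) :
    G y (dualVec G y i) v = v i := by
  rw [h.apply_sharp hy]
  rfl

theorem IsMetricOn.sharp_coord (h : IsMetricOn G Ω) {y : 𝔼 n} (hy : y ∈ Ω) (i : Fin n)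
    (α : 𝔼 n →L[ℝ] ℝ) : (sharp G y α) i = α (dualVec G y i) := by
  rw [← h.apply_dualVec hy i, h.symm y hy, h.apply_sharp hy]

theorem IsMetricOn.sum_dual_swap (h : IsMetricOn G Ω) {y : 𝔼 n} (hy : y ∈ Ω)
    (B : 𝔼 n →ₗ[ℝ] 𝔼 n →ₗ[ℝ] ℝ) : ∑ i, B (𝐞 i) (dualVec G y i) = ∑ i, B (dualVec G y i) (𝐞 i) := by
  have h1 : ∀ i, B (𝐞 i) (dualVec G y i)
      = ∑ k, (dualVec G y i) k * B (𝐞 i) (EuclideanSpace.single k 1) :=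
    fun i => by simpa using (sum_map_single (B (𝐞 i)) (dualVec G y i)).symm
  have h2 : ∀ i, B (dualVec G y i) (𝐞 i)
      = ∑ k, (dualVec G y i) k * B (EuclideanSpace.single k 1) (𝐞 i) :=
    fun i => by
      simpa using (sum_map_single (B.flip (𝐞 i)) (dualVec G y i)).symm
  have h3 : ∀ i k, (dualVec G y i) k = (dualVec G y k) i := fun i k => by
    rw [← h.apply_dualVec hy k, h.symm y hy, h.apply_dualVec hy i]
  simp_rw [h1, h2]
  rw [Finset.sum_comm]
  exact Finset.sum_congr rfl fun i _ => Finset.sum_congr rfl fun k _ => by rw [h3]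

theorem IsMetricOn.tr_eq_of_adjoint (h : IsMetricOn G Ω) {y : 𝔼 n} (hy : y ∈ Ω)
    (f f' : 𝔼 n →ₗ[ℝ] (𝔼 n)) (hf : ∀ a b, G y (f a) b = G y a (f' b)) : tr f = tr f' := by
  have h1 := h.sum_dual_swap hy (LinearMap.mk₂ ℝ (fun a b => G y a (f b)) (by simp) (by simp)
    (by simp) (by simp))
  simp only [LinearMap.mk₂_apply] at h1
  unfold tr
  simp_rw [← h.apply_dualVec hy]
  rw [← h1]
  refine Finset.sum_congr rfl fun i _ => ?_
  rw [← hf, h.symm y hy]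

theorem IsMetricOn.tr_eq_zero_of_skew (h : IsMetricOn G Ω) {y : 𝔼 n} (hy : y ∈ Ω)
    (f : 𝔼 n →ₗ[ℝ] (𝔼 n)) (hf : ∀ a b, G y (f a) b + G y a (f b) = 0) : tr f = 0 := by
  have h1 := h.tr_eq_of_adjoint hy f (-f) fun a b => by
    rw [LinearMap.neg_apply, map_neg]
    linarith [hf a b]
  have h2 : tr (-f) = -tr f := by simp [tr]
  linarith

/-! ### Symmetry of the Ricci and Schouten tensors -/

theorem IsMetricOn.curvL_christoffel_skew (h : IsMetricOn G Ω) {y : 𝔼 n} (hy : y ∈ Ω)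
    (a b u v : 𝔼 n) :
    G y (curvL (christoffelL G) y a b u) v + G y u (curvL (christoffelL G) y a b v) = 0 :=
  curvL_skew h.isOpen h.contDiffOn_christoffelL h.smooth
    (fun z hz a u v => h.fderiv_apply hz a u v) hy a b u v

theorem IsMetricOn.ricci_eq (h : IsMetricOn G Ω) {y : 𝔼 n} (hy : y ∈ Ω) (b c : 𝔼 n) :
    ricci G y b c = tr (((curvL (christoffelL G) y).flip b).flip c).toLinearMap := by
  simp only [ricci, tr, h.riemann_eq hy]
  rfl

theorem IsMetricOn.ricci_symm (h : IsMetricOn G Ω) {y : 𝔼 n} (hy : y ∈ Ω) (b c : 𝔼 n) :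
    ricci G y b c = ricci G y c b := by
  have h0 := h.tr_eq_zero_of_skew hy (curvL (christoffelL G) y b c).toLinearMap
    (h.curvL_christoffel_skew hy b c)
  have h1 : ricci G y b c - ricci G y c b
      = -tr (curvL (christoffelL G) y b c).toLinearMap := by
    simp only [ricci, tr, h.riemann_eq hy, ← Finset.sum_sub_distrib, ← Finset.sum_neg_distrib]
    refine Finset.sum_congr rfl fun i _ => ?_
    have h2 := congrArg (fun v : (𝔼 n) => v i)
      (h.curvL_christoffel_cyclic hy (𝐞 i) b c)
    rw [curvL_antisymm _ y c] at h2
    simp only [PiLp.add_apply, PiLp.neg_apply, PiLp.zero_apply] at h2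
    simp only [ContinuousLinearMap.coe_coe]
    linarith
  linarith

/-- The Ricci tensor as a bilinear map. -/
def ricciL (G : 𝔼 n → 𝔼 n →L[ℝ] 𝔼 n →L[ℝ] ℝ) (y : 𝔼 n) : 𝔼 n →ₗ[ℝ] 𝔼 n →ₗ[ℝ] ℝ :=
  LinearMap.mk₂ ℝ
    (fun b c => ∑ i, (curvL (christoffelL G) y (𝐞 i) b c) i)
    (fun _ _ _ => by simp [Finset.sum_add_distrib]) (fun _ _ _ => by simp [Finset.mul_sum])
    (fun _ _ _ => by simp [Finset.sum_add_distrib]) (fun _ _ _ => by simp [Finset.mul_sum])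

theorem IsMetricOn.ricciL_apply (h : IsMetricOn G Ω) {y : 𝔼 n} (hy : y ∈ Ω) (b c : 𝔼 n) :
    ricciL G y b c = ricci G y b c := by
  simp only [ricci, h.riemann_eq hy]
  rfl

/-- The Schouten tensor as a bilinear map. -/
def schoutenL (G : 𝔼 n → 𝔼 n →L[ℝ] 𝔼 n →L[ℝ] ℝ) (y : 𝔼 n) : 𝔼 n →L[ℝ] 𝔼 n →L[ℝ] ℝ :=
  (1 / ((n : ℝ) - 2)) • (toCLM₂ (ricciL G y) - (scal G y / (2 * ((n : ℝ) - 1))) • G y)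

theorem IsMetricOn.schoutenL_apply (h : IsMetricOn G Ω) {y : 𝔼 n} (hy : y ∈ Ω) (b c : 𝔼 n) :
    schoutenL G y b c = schouten G y b c := by
  simp [schoutenL, schouten, toCLM₂_apply, h.ricciL_apply hy]

theorem IsMetricOn.schouten_symm (h : IsMetricOn G Ω) {y : 𝔼 n} (hy : y ∈ Ω) (a b : 𝔼 n) :
    schouten G y a b = schouten G y b a := by
  simp only [schouten, h.ricci_symm hy a b, h.symm y hy a b]

theorem IsMetricOn.apply_schoutenSharp (h : IsMetricOn G Ω) {y : 𝔼 n} (hy : y ∈ Ω) (a b : 𝔼 n) :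
    G y (schoutenSharp G y a) b = schouten G y a b := by
  simp only [schoutenSharp, map_sum, map_smul, sum_apply, smul_apply, smul_eq_mul,
    h.apply_dualVec hy]
  have := sum_map_single (schoutenL G y a).toLinearMap b
  simp only [smul_eq_mul, ContinuousLinearMap.coe_coe, h.schoutenL_apply hy] at this
  rw [← this]
  exact Finset.sum_congr rfl fun i _ => mul_comm _ _

theorem IsMetricOn.sum_schouten (h : IsMetricOn G Ω) {y : 𝔼 n} (hy : y ∈ Ω) (hn : 3 ≤ n) :
    ∑ i, (schoutenSharp G y (𝐞 i)) i = scal G y / (2 * ((n : ℝ) - 1)) := by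
  have hn' : (3 : ℝ) ≤ n := by exact_mod_cast hn
  have h1 : ∀ i, (schoutenSharp G y (𝐞 i)) i
      = schouten G y (𝐞 i) (dualVec G y i) := fun i => by
    rw [← h.apply_dualVec hy i, h.symm y hy, h.apply_schoutenSharp hy]
  simp_rw [h1, schouten]
  rw [← Finset.mul_sum, Finset.sum_sub_distrib, ← Finset.mul_sum]
  have h2 : ∑ i, G y (𝐞 i) (dualVec G y i) = n := by
    simp_rw [h.symm y hy _ (dualVec G y _), h.apply_dualVec hy]
    simp
  rw [h2]
  change 1 / ((n : ℝ) - 2) * (scal G y - _) = _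
  have e1 : (n : ℝ) - 2 ≠ 0 := by linarith
  have e2 : (n : ℝ) - 1 ≠ 0 := by linarith
  field_simp
  ring

theorem IsMetricOn.contDiffOn_schouten (h : IsMetricOn G Ω) (a b : 𝔼 n) :
    ContDiffOn ℝ ∞ (fun y => schouten G y a b) Ω := by
  have hK := contDiffOn_curvL h.isOpen h.contDiffOn_christoffelL
  have hcoord : ∀ (i : Fin n) {f : 𝔼 n → 𝔼 n}, ContDiffOn ℝ ∞ f Ω →
      ContDiffOn ℝ ∞ (fun y => f y i) Ω := fun i f hf =>
    (EuclideanSpace.proj (𝕜 := ℝ) i).contDiff.comp_contDiffOn hf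
  have hric : ∀ {u v : 𝔼 n → 𝔼 n}, ContDiffOn ℝ ∞ u Ω → ContDiffOn ℝ ∞ v Ω →
      ContDiffOn ℝ ∞ (fun y => ricci G y (u y) (v y)) Ω := by
    intro u v hu hv
    have : ContDiffOn ℝ ∞ (fun y => ∑ i,
        (curvL (christoffelL G) y (𝐞 i) (u y) (v y)) i) Ω :=
      ContDiffOn.sum fun i _ => hcoord i (((hK.clm_apply contDiffOn_const).clm_apply hu).clm_apply hv)
    refine this.congr fun y hy => ?_
    rw [h.ricci_eq hy]
    rfl
  have hscal : ContDiffOn ℝ ∞ (fun y => scal G y) Ω :=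
    ContDiffOn.sum fun i _ => hric contDiffOn_const (h.contDiffOn_inverse.clm_apply contDiffOn_const)
  exact contDiffOn_const.mul ((hric contDiffOn_const contDiffOn_const).sub
    ((hscal.div_const _).mul ((h.smooth.clm_apply contDiffOn_const).clm_apply contDiffOn_const)))

theorem IsMetricOn.contDiffOn_schoutenSharp (h : IsMetricOn G Ω) (a : 𝔼 n) :
    ContDiffOn ℝ ∞ (fun y => schoutenSharp G y a) Ω :=
  ContDiffOn.sum fun i _ => (h.contDiffOn_schouten a _).smul
    (h.contDiffOn_inverse.clm_apply contDiffOn_const)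

end CoordMetric

namespace CoordMetric

variable {n : ℕ} {G : 𝔼 n → 𝔼 n →L[ℝ] 𝔼 n →L[ℝ] ℝ} {Ω : Set (𝔼 n)}

/-! ### The tractor connection in coordinates -/

/-- The tractor connection form in coordinates. -/
def tractorConn (G : 𝔼 n → 𝔼 n →L[ℝ] 𝔼 n →L[ℝ] ℝ) (y : 𝔼 n) : 𝔼 n →L[ℝ] 𝕋 n →L[ℝ] 𝕋 n :=
  toCLM₂ (LinearMap.mk₂ ℝ
    (fun (X : 𝔼 n) (v : 𝕋 n) => ((-(G y X v.2.1), christoffelL G y X v.2.1 + v.2.2 • X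
      + v.1 • sharp G y (schoutenL G y X), -(schoutenL G y X v.2.1)) : 𝕋 n))
    (fun X X' v => by
      simp only [sharp, map_add, add_apply, Prod.mk_add_mk, smul_add]
      refine Prod.ext (by simp; ring) (Prod.ext (by simp; abel) (by simp; ring)))
    (fun c X v => by
      simp only [sharp, map_smul, smul_apply, Prod.smul_mk]
      refine Prod.ext (by simp) (Prod.ext ?_ (by simp))
      simp only [smul_add, smul_comm c])
    (fun X v v' => by
      refine Prod.ext (by simp; ring) (Prod.ext ?_ (by simp; ring))
      simp only [Prod.snd_add, Prod.fst_add, map_add, add_smul]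
      abel)
    (fun c X v => by
      refine Prod.ext (by simp) (Prod.ext ?_ (by simp))
      simp only [Prod.smul_snd, Prod.smul_fst, map_smul, smul_add, smul_smul, smul_eq_mul]))

theorem tractorConn_apply (y X : 𝔼 n) (v : 𝕋 n) :
    tractorConn G y X v = (-(G y X v.2.1), christoffelL G y X v.2.1 + v.2.2 • X
      + v.1 • sharp G y (schoutenL G y X), -(schoutenL G y X v.2.1)) := rfl

/-- The tractor metric in coordinates. -/
def tractorForm (G : 𝔼 n → 𝔼 n →L[ℝ] 𝔼 n →L[ℝ] ℝ) (y : 𝔼 n) : 𝕋 n →L[ℝ] 𝕋 n →L[ℝ] ℝ :=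
  toCLM₂ (LinearMap.mk₂ ℝ
    (fun v w : 𝕋 n => v.1 * w.2.2 + v.2.2 * w.1 + G y v.2.1 w.2.1)
    (fun _ _ _ => by simp; ring) (fun _ _ _ => by simp; ring)
    (fun _ _ _ => by simp; ring) (fun _ _ _ => by simp; ring))

theorem tractorForm_apply (y : 𝔼 n) (v w : 𝕋 n) :
    tractorForm G y v w = v.1 * w.2.2 + v.2.2 * w.1 + G y v.2.1 w.2.1 := rfl

theorem IsMetricOn.tractorForm_symm (h : IsMetricOn G Ω) {y : 𝔼 n} (hy : y ∈ Ω)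
    (v w : 𝕋 n) : tractorForm G y v w = tractorForm G y w v := by
  rw [tractorForm_apply, tractorForm_apply, h.symm y hy]
  ring

theorem IsMetricOn.sharp_schoutenL (h : IsMetricOn G Ω) {y : 𝔼 n} (hy : y ∈ Ω) (X : 𝔼 n) :
    sharp G y (schoutenL G y X) = schoutenSharp G y X :=
  h.ext hy fun c => by
    rw [h.apply_sharp hy, h.apply_schoutenSharp hy, h.schoutenL_apply hy]

theorem contDiffOn_tractorForm (hG : ContDiffOn ℝ ∞ G Ω) : ContDiffOn ℝ ∞ (tractorForm G) Ω :=
  contDiffOn_clm_apply.2 fun v => contDiffOn_clm_apply.2 fun w =>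
    contDiffOn_const.add ((hG.clm_apply contDiffOn_const).clm_apply contDiffOn_const)

theorem IsMetricOn.contDiffOn_tractorConn (h : IsMetricOn G Ω) : ContDiffOn ℝ ∞ (tractorConn G) Ω := by
  refine contDiffOn_clm_apply.2 fun X => contDiffOn_clm_apply.2 fun v => ?_
  have h1 : ContDiffOn ℝ ∞ (fun y => christoffelL G y X v.2.1) Ω :=
    (h.contDiffOn_christoffelL.clm_apply contDiffOn_const).clm_apply contDiffOn_const
  have h2 : ContDiffOn ℝ ∞ (fun y => sharp G y (schoutenL G y X)) Ω :=
    (h.contDiffOn_schoutenSharp X).congr fun y hy => h.sharp_schoutenL hy X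
  have h3 : ContDiffOn ℝ ∞ (fun y => schoutenL G y X v.2.1) Ω :=
    (h.contDiffOn_schouten X v.2.1).congr fun y hy => h.schoutenL_apply hy X v.2.1
  have h0 : ContDiffOn ℝ ∞ (fun y => G y X v.2.1) Ω :=
    (h.smooth.clm_apply contDiffOn_const).clm_apply contDiffOn_const
  exact h0.neg.prodMk (((h1.add contDiffOn_const).add (h2.const_smul v.1)).prodMk h3.neg)

theorem IsMetricOn.hasFDerivAt (h : IsMetricOn G Ω) {y : 𝔼 n} (hy : y ∈ Ω) :
    HasFDerivAt G (fderiv ℝ G y) y :=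
  ((h.smooth.differentiableOn (by simp)).differentiableAt (h.isOpen.mem_nhds hy)).hasFDerivAt

theorem IsMetricOn.fderiv_tractorForm (h : IsMetricOn G Ω) {y : 𝔼 n} (hy : y ∈ Ω) (X : 𝔼 n)
    (v w : 𝕋 n) : fderiv ℝ (tractorForm G) y X v w = fderiv ℝ G y X v.2.1 w.2.1 := by
  have d0 := h.hasFDerivAt hy
  have d1 : HasFDerivAt (tractorForm G) (fderiv ℝ (tractorForm G) y) y :=
    (((contDiffOn_tractorForm h.smooth).differentiableOn (by simp)).differentiableAt
      (h.isOpen.mem_nhds hy)).hasFDerivAt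
  have e1 : HasFDerivAt (fun z => tractorForm G z v w) _ y :=
    (d1.clm_apply (hasFDerivAt_const v y)).clm_apply (hasFDerivAt_const w y)
  have e2 : HasFDerivAt (fun z => tractorForm G z v w) _ y :=
    ((d0.clm_apply (hasFDerivAt_const v.2.1 y)).clm_apply (hasFDerivAt_const w.2.1 y)).const_add
      (v.1 * w.2.2 + v.2.2 * w.1)
  have := congrArg (fun f : 𝔼 n →L[ℝ] ℝ => f X) (e1.unique e2)
  simpa using this

theorem IsMetricOn.tractorForm_parallel (h : IsMetricOn G Ω) {y : 𝔼 n} (hy : y ∈ Ω) (X : 𝔼 n)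
    (v w : 𝕋 n) : fderiv ℝ (tractorForm G) y X v w = tractorForm G y (tractorConn G y X v) w +
    tractorForm G y v (tractorConn G y X w) := by
  rw [h.fderiv_tractorForm hy, h.fderiv_apply hy]
  simp only [tractorForm_apply, tractorConn_apply, map_add, add_apply, map_smul, smul_apply,
    smul_eq_mul, h.apply_sharp hy]
  rw [h.symm y hy v.2.1 (sharp G y _), h.apply_sharp hy, h.symm y hy v.2.1 X]
  ring

/-- The curvature of the tractor connection. -/
abbrev tractorCurv (G : 𝔼 n → 𝔼 n →L[ℝ] 𝔼 n →L[ℝ] ℝ) (y : 𝔼 n) :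
    𝔼 n →L[ℝ] 𝔼 n →L[ℝ] 𝕋 n →L[ℝ] 𝕋 n :=
  curvL (tractorConn G) y

theorem IsMetricOn.tractorCurv_skew (h : IsMetricOn G Ω) {y : 𝔼 n} (hy : y ∈ Ω) (a b : 𝔼 n)
    (v w : 𝕋 n) :
    tractorForm G y (tractorCurv G y a b v) w + tractorForm G y v (tractorCurv G y a b w) = 0 :=
  curvL_skew h.isOpen h.contDiffOn_tractorConn (contDiffOn_tractorForm h.smooth)
    (fun _ hz X v w => h.tractorForm_parallel hz X v w) hy a b v w

theorem IsMetricOn.hasFDerivAt_tractorConn (h : IsMetricOn G Ω) {y : 𝔼 n} (hy : y ∈ Ω) :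
    HasFDerivAt (tractorConn G) (fderiv ℝ (tractorConn G) y) y :=
  ((h.contDiffOn_tractorConn.differentiableOn (by simp)).differentiableAt
    (h.isOpen.mem_nhds hy)).hasFDerivAt

theorem IsMetricOn.tractorCurv_apply_bot (h : IsMetricOn G Ω) {y : 𝔼 n} (hy : y ∈ Ω) (a b : 𝔼 n) :
    tractorCurv G y a b (0, 0, 1) = 0 := by
  have key : ∀ x c, fderiv ℝ (tractorConn G) y x c ((0, 0, 1) : 𝕋 n) = 0 := by
    intro x c
    have e1 : HasFDerivAt (fun z => tractorConn G z c ((0, 0, 1) : 𝕋 n)) _ y :=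
      ((h.hasFDerivAt_tractorConn hy).clm_apply (hasFDerivAt_const c y)).clm_apply
        (hasFDerivAt_const _ y)
    have e2 : (fun z => tractorConn G z c ((0, 0, 1) : 𝕋 n)) = fun _ => (0, c, 0) := by
      funext z
      simp [tractorConn_apply]
    rw [e2] at e1
    have := congrArg (fun f : 𝔼 n →L[ℝ] 𝕋 n => f x)
      (e1.unique (hasFDerivAt_const _ y))
    simpa using this
  have hs : schoutenL G y a b = schoutenL G y b a := by
    rw [h.schoutenL_apply hy, h.schoutenL_apply hy, h.schouten_symm hy]
  rw [tractorCurv, curvL_apply, key, key]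
  simp only [tractorConn_apply]
  simp [h.symm y hy a b, h.christoffel_symm hy a b, hs]

theorem IsMetricOn.tractorCurv_apply_fst (h : IsMetricOn G Ω) {y : 𝔼 n} (hy : y ∈ Ω) (a b : 𝔼 n)
    (v : 𝕋 n) : (tractorCurv G y a b v).1 = 0 := by
  have := h.tractorCurv_skew hy a b v (0, 0, 1)
  rw [h.tractorCurv_apply_bot hy] at this
  simpa [tractorForm_apply] using this

/-- The Weyl curvature. -/
def weyl (G : 𝔼 n → 𝔼 n →L[ℝ] 𝔼 n →L[ℝ] ℝ) (y a b c : 𝔼 n) : (𝔼 n) :=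
  (tractorCurv G y a b (0, c, 0)).2.1

/-- The Cotton tensor, with the last index raised. -/
def cotton (G : 𝔼 n → 𝔼 n →L[ℝ] 𝔼 n →L[ℝ] ℝ) (y a b : 𝔼 n) : (𝔼 n) :=
  (tractorCurv G y a b (1, 0, 0)).2.1

theorem IsMetricOn.tractorCurv_eq (h : IsMetricOn G Ω) {y : 𝔼 n} (hy : y ∈ Ω) (a b : 𝔼 n) (v : 𝕋 n)
    : tractorCurv G y a b v =
    (0, weyl G y a b v.2.1 + v.1 • cotton G y a b, -(G y (cotton G y a b) v.2.1)) := by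
  have hv : v = v.1 • ((1, 0, 0) : 𝕋 n) + (0, v.2.1, 0)
      + v.2.2 • ((0, 0, 1) : 𝕋 n) := by
    refine Prod.ext ?_ (Prod.ext ?_ ?_) <;> simp
  refine Prod.ext (h.tractorCurv_apply_fst hy a b v) (Prod.ext ?_ ?_)
  · conv_lhs => rw [hv]
    simp only [map_add, map_smul, h.tractorCurv_apply_bot hy, weyl, cotton, Prod.snd_add,
      Prod.fst_add, Prod.smul_snd, Prod.smul_fst, Prod.snd_zero, Prod.fst_zero, smul_zero, add_zero]
    exact add_comm _ _
  · have h1 := h.tractorCurv_skew hy a b (1, 0, 0) v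
    have h2 := h.tractorCurv_skew hy a b (1, 0, 0) (1, 0, 0)
    simp [tractorForm_apply, h.tractorCurv_apply_fst hy] at h1 h2
    rw [h2] at h1
    change _ = -(G y (tractorCurv G y a b (1, 0, 0)).2.1 v.2.1)
    linarith

theorem weyl_antisymm (y a b c : 𝔼 n) : weyl G y a b c = -weyl G y b a c := by
  rw [weyl, tractorCurv, curvL_antisymm]
  rfl

theorem cotton_antisymm (y a b : 𝔼 n) : cotton G y a b = -cotton G y b a := by
  rw [cotton, tractorCurv, curvL_antisymm]
  rfl

theorem IsMetricOn.weyl_skew (h : IsMetricOn G Ω) {y : 𝔼 n} (hy : y ∈ Ω) (a b c d : 𝔼 n) :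
    G y (weyl G y a b c) d + G y c (weyl G y a b d) = 0 := by
  have := h.tractorCurv_skew hy a b (0, c, 0) (0, d, 0)
  simpa [tractorForm_apply, h.tractorCurv_eq hy] using this

theorem IsMetricOn.tractorCurv_cyclic (h : IsMetricOn G Ω) {y : 𝔼 n} (hy : y ∈ Ω) (a b c : 𝔼 n) :
    tractorCurv G y a b (0, c, 0) + tractorCurv G y b c (0, a, 0) + tractorCurv G y c a (0, b, 0) =
    0 := by
  have hB := curvL_bianchi h.isOpen h.contDiffOn_tractorConn hy a b c
    ((0, 0, 1) : 𝕋 n)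
  have hz : ∀ x d e, fderiv ℝ (fun z => curvL (tractorConn G) z d e ((0, 0, 1) : 𝕋 n)) y x
      = 0 := by
    intro x d e
    have : (fun z => curvL (tractorConn G) z d e ((0, 0, 1) : 𝕋 n)) =ᶠ[𝓝 y] fun _ => 0 := by
      filter_upwards [h.isOpen.mem_nhds hy] with z hz
      exact h.tractorCurv_apply_bot hz d e
    rw [this.fderiv_eq]
    simp
  have he : ∀ x, tractorConn G y x ((0, 0, 1) : 𝕋 n) = (0, x, 0) := fun x => by
    simp [tractorConn_apply]
  have h0 : ∀ d e, curvL (tractorConn G) y d e ((0, 0, 1) : 𝕋 n) = 0 :=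
    h.tractorCurv_apply_bot hy
  simp only [hz, he, h0, map_zero, zero_add, zero_sub] at hB
  rw [← neg_eq_zero, ← hB]
  simp only [tractorCurv]
  abel

theorem IsMetricOn.weyl_cyclic (h : IsMetricOn G Ω) {y : 𝔼 n} (hy : y ∈ Ω) (a b c : 𝔼 n) :
    weyl G y a b c + weyl G y b c a + weyl G y c a b = 0 :=
  congrArg (fun v : 𝕋 n => v.2.1) (h.tractorCurv_cyclic hy a b c)

theorem IsMetricOn.cotton_cyclic (h : IsMetricOn G Ω) {y : 𝔼 n} (hy : y ∈ Ω) (a b c : 𝔼 n) :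
    G y (cotton G y a b) c + G y (cotton G y b c) a + G y (cotton G y c a) b = 0 := by
  have := congrArg (fun v : 𝕋 n => v.2.2) (h.tractorCurv_cyclic hy a b c)
  simp [h.tractorCurv_eq hy] at this
  linarith

theorem IsMetricOn.weyl_pair_symm (h : IsMetricOn G Ω) {y : 𝔼 n} (hy : y ∈ Ω) (a b c d : 𝔼 n) :
    G y (weyl G y a b c) d = G y (weyl G y c d a) b := by
  have hc : ∀ a b c d, G y (weyl G y a b c) d + G y (weyl G y b c a) d + G y (weyl G y c a b) d
      = 0 := fun a b c d => by
    simpa using congrArg (fun v : (𝔼 n) => G y v d) (h.weyl_cyclic hy a b c)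
  have hs : ∀ a b c d, G y (weyl G y a b c) d = -G y (weyl G y a b d) c := fun a b c d => by
    have := h.weyl_skew hy a b c d
    rw [h.symm y hy c] at this
    linarith
  have ha : ∀ a b c d, G y (weyl G y a b c) d = -G y (weyl G y b a c) d := fun a b c d => by
    rw [weyl_antisymm, map_neg]
    rfl
  have e1 := hc a b c d
  have e2 := hc b c d a
  have e3 := hc c d a b
  have e4 := hc d a b c
  have := hs a b c d
  have := hs b c a d
  have := hs c a b d
  have := hs c d b a
  have := hs d b c a
  have := hs d a c b
  have := hs a c d b
  have := hs a b d c
  have := hs b d a c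
  have := ha a c d b
  have := ha b d a c
  have := ha d b c a
  have := ha c a b d
  have := hs b c d a
  have := hs c d a b
  have := hs d a b c
  linarith

theorem IsMetricOn.weyl_eq (h : IsMetricOn G Ω) {y : 𝔼 n} (hy : y ∈ Ω) (a b c : 𝔼 n) : weyl G y a b
    c = curvL (christoffelL G) y a b c - schouten G y b c • a + schouten G y a c • b - G y b c •
    schoutenSharp G y a + G y a c • schoutenSharp G y b := by
  have key : ∀ x d, (fderiv ℝ (tractorConn G) y x d ((0, c, 0) : 𝕋 n)).2.1
      = fderiv ℝ (christoffelL G) y x d c := by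
    intro x d
    have e1 : HasFDerivAt (fun z => tractorConn G z d ((0, c, 0) : 𝕋 n)) _ y :=
      ((h.hasFDerivAt_tractorConn hy).clm_apply (hasFDerivAt_const d y)).clm_apply
        (hasFDerivAt_const _ y)
    have e2 : HasFDerivAt (fun z => christoffelL G z d c) _ y :=
      ((((h.contDiffOn_christoffelL.differentiableOn (by simp)).differentiableAt
        (h.isOpen.mem_nhds hy)).hasFDerivAt).clm_apply (hasFDerivAt_const d y)).clm_apply
        (hasFDerivAt_const c y)
    have e3 := e1.snd.fst
    have e4 : (fun z => (tractorConn G z d ((0, c, 0) : 𝕋 n)).2.1)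
        = fun z => christoffelL G z d c := by
      funext z
      simp [tractorConn_apply]
    rw [e4] at e3
    have := congrArg (fun f : 𝔼 n →L[ℝ] 𝔼 n => f x) (e3.unique e2)
    simpa using this
  rw [weyl, tractorCurv, curvL_apply, curvL_apply]
  simp only [Prod.snd_add, Prod.snd_sub, Prod.fst_add, Prod.fst_sub, key]
  simp only [tractorConn_apply, h.sharp_schoutenL hy, h.schoutenL_apply hy]
  simp only [zero_smul, add_zero, neg_smul]
  abel

theorem IsMetricOn.sum_weyl (h : IsMetricOn G Ω) {y : 𝔼 n} (hy : y ∈ Ω) (hn : 3 ≤ n) (b c : 𝔼 n) :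
    ∑ i, (weyl G y (𝐞 i) b c) i = 0 := by
  have hn' : (3 : ℝ) ≤ n := by exact_mod_cast hn
  have e1 : (n : ℝ) - 2 ≠ 0 := by linarith
  have e2 : (n : ℝ) - 1 ≠ 0 := by linarith
  have h1 : ∑ i, b i * schouten G y (𝐞 i) c = schouten G y b c := by
    have := sum_map_single ((schoutenL G y).flip c).toLinearMap b
    simpa [h.schoutenL_apply hy] using this
  have h2 : ∑ i, G y (𝐞 i) c * (schoutenSharp G y b) i = schouten G y b c := by
    have := sum_map_single ((G y).flip c).toLinearMap (schoutenSharp G y b)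
    rw [← h.apply_schoutenSharp hy]
    simp only [ContinuousLinearMap.coe_coe, ContinuousLinearMap.flip_apply, smul_eq_mul] at this
    rw [← this]
    exact Finset.sum_congr rfl fun i _ => mul_comm _ _
  have h3 : ∑ i, (curvL (christoffelL G) y (𝐞 i) b c) i = ricci G y b c :=
    h.ricciL_apply hy b c
  simp only [h.weyl_eq hy, PiLp.add_apply, PiLp.sub_apply, PiLp.smul_apply, smul_eq_mul,
    Finset.sum_add_distrib, Finset.sum_sub_distrib, ← Finset.mul_sum, h.sum_schouten hy hn, h2, h3]
  simp only [mul_comm _ (b _), h1]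
  simp only [EuclideanSpace.single_apply, if_true, Finset.sum_const, Finset.card_univ,
    Fintype.card_fin, nsmul_eq_mul, mul_one]
  rw [schouten]
  field_simp
  ring

end CoordMetric

namespace CoordMetric

variable {n : ℕ} {G : 𝔼 n → 𝔼 n →L[ℝ] 𝔼 n →L[ℝ] ℝ} {Ω : Set (𝔼 n)}

/-! ### The contracted second Bianchi identity -/

theorem IsMetricOn.hasFDerivAt_tractorCurv_apply (h : IsMetricOn G Ω) {y : 𝔼 n} (hy : y ∈ Ω)
    (b c : 𝔼 n) (v : 𝕋 n) :
    HasFDerivAt (fun z => tractorCurv G z b c v) (fderiv ℝ (fun z => tractorCurv G z b c v) y) y :=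
  ((((contDiffOn_curvL h.isOpen h.contDiffOn_tractorConn).clm_apply contDiffOn_const).clm_apply
    contDiffOn_const).clm_apply contDiffOn_const |>.differentiableOn (by simp) |>.differentiableAt
      (h.isOpen.mem_nhds hy)).hasFDerivAt

theorem IsMetricOn.hasFDerivAt_weyl (h : IsMetricOn G Ω) {y : 𝔼 n} (hy : y ∈ Ω) (b c d : 𝔼 n) :
    HasFDerivAt (fun z => weyl G z b c d) (fderiv ℝ (fun z => weyl G z b c d) y) y :=
  ((h.hasFDerivAt_tractorCurv_apply hy b c (0, d, 0)).snd.fst).differentiableAt.hasFDerivAt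

/-- The covariant derivative of the Weyl curvature. -/
def weylDeriv (G : 𝔼 n → 𝔼 n →L[ℝ] 𝔼 n →L[ℝ] ℝ) (y x b c d : 𝔼 n) : (𝔼 n) :=
  fderiv ℝ (fun z => weyl G z b c d) y x + christoffelL G y x (weyl G y b c d)
    - weyl G y b c (christoffelL G y x d) - weyl G y (christoffelL G y x b) c d
    - weyl G y b (christoffelL G y x c) d

theorem IsMetricOn.weylDeriv_antisymm (h : IsMetricOn G Ω) {y : 𝔼 n} (hy : y ∈ Ω)
    (x b c d : 𝔼 n) : weylDeriv G y x b c d = -weylDeriv G y x c b d := by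
  have h1 : fderiv ℝ (fun z => weyl G z b c d) y = -fderiv ℝ (fun z => weyl G z c b d) y := by
    have e : (fun z => weyl G z b c d) = fun z => -weyl G z c b d :=
      funext fun z => weyl_antisymm z b c d
    rw [e]
    exact ((h.hasFDerivAt_weyl hy c b d).neg).fderiv
  have h2 : ∀ u v w, weyl G y u v w = -weyl G y v u w := weyl_antisymm y
  rw [weylDeriv, weylDeriv, h1, h2 b c, h2 b c, h2 _ c, h2 b _]
  simp only [map_neg, neg_apply]
  abel

theorem IsMetricOn.weylDeriv_skew (h : IsMetricOn G Ω) {y : 𝔼 n} (hy : y ∈ Ω) (x b c u v : 𝔼 n) : G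
    y (weylDeriv G y x b c u) v + G y u (weylDeriv G y x b c v) = 0 := by
  have d0 := h.hasFDerivAt hy
  have e1 := ((d0.clm_apply (h.hasFDerivAt_weyl hy b c u)).clm_apply (hasFDerivAt_const v y)).add
    ((d0.clm_apply (hasFDerivAt_const u y)).clm_apply (h.hasFDerivAt_weyl hy b c v))
  have e2 : (fun z => G z (weyl G z b c u) v + G z u (weyl G z b c v)) =ᶠ[𝓝 y] fun _ => 0 := by
    filter_upwards [h.isOpen.mem_nhds hy] with z hz
    exact h.weyl_skew hz b c u v
  have e3 := congrArg (fun f : 𝔼 n →L[ℝ] ℝ => f x)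
    (e1.unique ((hasFDerivAt_const (0 : ℝ) y).congr_of_eventuallyEq e2))
  simp [h.fderiv_apply hy] at e3
  have s1 := h.weyl_skew hy b c (christoffelL G y x u) v
  have s2 := h.weyl_skew hy b c u (christoffelL G y x v)
  have s3 := h.weyl_skew hy (christoffelL G y x b) c u v
  have s4 := h.weyl_skew hy b (christoffelL G y x c) u v
  simp only [weylDeriv, map_add, map_sub, add_apply, sub_apply]
  linarith

theorem IsMetricOn.sum_weylDeriv (h : IsMetricOn G Ω) {y : 𝔼 n} (hy : y ∈ Ω) (hn : 3 ≤ n)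
    (x b c : 𝔼 n) : ∑ i, (weylDeriv G y x (𝐞 i) b c) i = 0 := by
  have e1 : HasFDerivAt (fun z => ∑ i, (weyl G z (𝐞 i) b c) i)
      (∑ i, (EuclideanSpace.proj i : 𝔼 n →L[ℝ] ℝ) ∘L
        (fderiv ℝ (fun z => weyl G z (𝐞 i) b c) y)) y := by
    refine HasFDerivAt.fun_sum fun i _ => ?_
    exact (EuclideanSpace.proj i : 𝔼 n →L[ℝ] ℝ).hasFDerivAt.comp y (h.hasFDerivAt_weyl hy _ b c)
  have e2 : (fun z => ∑ i, (weyl G z (𝐞 i) b c) i) =ᶠ[𝓝 y] fun _ => 0 := by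
    filter_upwards [h.isOpen.mem_nhds hy] with z hz
    exact h.sum_weyl hz hn b c
  have e3 := congrArg (fun f : 𝔼 n →L[ℝ] ℝ => f x)
    (e1.unique ((hasFDerivAt_const (0 : ℝ) y).congr_of_eventuallyEq e2))
  have e4 : ∑ i, (fderiv ℝ (fun z => weyl G z (𝐞 i) b c) y x) i = 0 := by
    simpa using e3
  let N : 𝔼 n →ₗ[ℝ] (𝔼 n) :=
    { toFun := fun a => weyl G y a b c
      map_add' := fun _ _ => by simp [weyl]
      map_smul' := fun _ _ => by simp [weyl] }
  have e5 := tr_comp_comm N (christoffelL G y x).toLinearMap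
  have e6 : ∑ i, (christoffelL G y x (weyl G y (𝐞 i) b c)) i
      = ∑ i, (weyl G y (christoffelL G y x (𝐞 i)) b c) i := e5.symm
  simp only [weylDeriv, PiLp.add_apply, PiLp.sub_apply, Finset.sum_add_distrib,
    Finset.sum_sub_distrib, e4, e6, h.sum_weyl hy hn]
  ring

theorem IsMetricOn.weylDeriv_cyclic (h : IsMetricOn G Ω) {y : 𝔼 n} (hy : y ∈ Ω) (a b c d : 𝔼 n) :
    weylDeriv G y a b c d + weylDeriv G y b c a d + weylDeriv G y c a b d =
    (G y (cotton G y b c) d • a - G y a d • cotton G y b c) +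
    (G y (cotton G y c a) d • b - G y b d • cotton G y c a) +
    (G y (cotton G y a b) d • c - G y c d • cotton G y a b) := by
  have hB := congrArg (fun v : 𝕋 n => v.2.1)
    (curvL_bianchi h.isOpen h.contDiffOn_tractorConn hy a b c ((0, d, 0) : 𝕋 n))
  have hd : ∀ x b c, (fderiv ℝ (fun z => curvL (tractorConn G) z b c ((0, d, 0) : 𝕋 n))
      y x).2.1 = fderiv ℝ (fun z => weyl G z b c d) y x := by
    intro x b c
    have := ((h.hasFDerivAt_tractorCurv_apply hy b c (0, d, 0)).snd.fst).fderiv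
    exact (congrArg (fun f : 𝔼 n →L[ℝ] 𝔼 n => f x) this).symm
  have hF : ∀ a b v, curvL (tractorConn G) y a b v = _ := h.tractorCurv_eq hy
  simp only [Prod.snd_add, Prod.snd_sub, Prod.fst_add, Prod.fst_sub, hd, Prod.snd_zero,
    Prod.fst_zero, hF] at hB
  simp only [tractorConn_apply, zero_smul, add_zero, neg_smul] at hB
  have w1 : ∀ u v w, weyl G y u v w = -weyl G y v u w := weyl_antisymm y
  simp only [weylDeriv]
  rw [h.christoffel_symm hy b a, h.christoffel_symm hy c a, h.christoffel_symm hy c b,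
    w1 c (christoffelL G y a b), w1 a (christoffelL G y b c), w1 b (christoffelL G y a c)]
  rw [← sub_eq_zero, ← hB]
  abel

theorem IsMetricOn.sum_cotton (h : IsMetricOn G Ω) {y : 𝔼 n} (hy : y ∈ Ω) (hn : 3 ≤ n) (b : 𝔼 n) :
    ∑ i, (cotton G y (𝐞 i) b) i = 0 := by
  have hn' : (3 : ℝ) ≤ n := by exact_mod_cast hn
  have hca : ∀ u v, cotton G y u v = -cotton G y v u := cotton_antisymm y
  set t : 𝔼 n → ℝ := fun b => ∑ i, (cotton G y (𝐞 i) b) i with ht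
  have ht' : ∀ b, ∑ i, (cotton G y b (𝐞 i)) i = -t b := fun b => by
    simp only [ht, hca b, PiLp.neg_apply, Finset.sum_neg_distrib]
  have hsm : ∀ (u v : 𝔼 n) (f : 𝔼 n →ₗ[ℝ] ℝ), ∑ i, f (𝐞 i) * v i = f v :=
    fun u v f => by
      have := sum_map_single f v
      simp only [smul_eq_mul] at this
      rw [← this]
      exact Finset.sum_congr rfl fun i _ => mul_comm _ _
  have hG : ∀ v d, ∑ i, G y (𝐞 i) d * v i = G y v d := fun v d =>
    hsm 0 v ((G y).flip d).toLinearMap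
  have hC : ∀ c d v, ∑ i, G y (cotton G y c (𝐞 i)) d * v i
      = G y (cotton G y c v) d := fun c d v => by
    let f : 𝔼 n →ₗ[ℝ] ℝ :=
      { toFun := fun a => G y (cotton G y c a) d
        map_add' := fun _ _ => by simp [cotton]
        map_smul' := fun _ _ => by simp [cotton] }
    exact hsm 0 v f
  have hC' : ∀ c d v, ∑ i, G y (cotton G y (𝐞 i) c) d * v i
      = G y (cotton G y v c) d := fun c d v => by
    simp only [hca _ c, map_neg, neg_apply, neg_mul, Finset.sum_neg_distrib, hC]
  have hone : ∀ i : Fin n, (EuclideanSpace.single i (1 : ℝ) : 𝔼 n) i = 1 := fun i => by simp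
  have key : ∀ c d, ∑ i, (weylDeriv G y (𝐞 i) b c d) i
      = ((n : ℝ) - 3) * G y (cotton G y b c) d + G y b d * t c - G y c d * t b := by
    intro c d
    have e := fun i => congrArg (fun v : (𝔼 n) => v i)
      (h.weylDeriv_cyclic hy (𝐞 i) b c d)
    have e' := Finset.sum_congr (rfl : Finset.univ = Finset.univ) fun i _ => e i
    simp only [PiLp.add_apply, PiLp.sub_apply, PiLp.smul_apply, smul_eq_mul,
      Finset.sum_add_distrib, Finset.sum_sub_distrib, ← Finset.mul_sum, hone, Finset.sum_const,
      Finset.card_univ, Fintype.card_fin, nsmul_eq_mul, mul_one, hG, hC, hC', ht'] at e'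
    have z1 : ∑ i, (weylDeriv G y b c (𝐞 i) d) i = 0 := by
      simp only [h.weylDeriv_antisymm hy b c, PiLp.neg_apply, Finset.sum_neg_distrib,
        h.sum_weylDeriv hy hn, neg_zero]
    rw [z1, h.sum_weylDeriv hy hn, hca c b, map_neg] at e'
    simp only [neg_apply] at e'
    change _ = _ + _ + (_ - G y c d * t b) at e'
    linarith
  have hz : ∀ x, ∑ j, weylDeriv G y x b (EuclideanSpace.single j 1) (dualVec G y j) = 0 := by
    intro x
    refine h.ext hy fun d => ?_
    have e : ∀ j, G y (weylDeriv G y x b (EuclideanSpace.single j 1) (dualVec G y j)) d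
        = (weylDeriv G y x (EuclideanSpace.single j 1) b d) j := fun j => by
      have := h.weylDeriv_skew hy x b (EuclideanSpace.single j 1) (dualVec G y j) d
      rw [h.apply_dualVec hy, h.weylDeriv_antisymm hy x b _ d, PiLp.neg_apply] at this
      linarith
    simp only [map_sum, sum_apply, e, h.sum_weylDeriv hy hn, map_zero, zero_apply]
  have hfin : ∑ j, ∑ i, (weylDeriv G y (𝐞 i) b (EuclideanSpace.single j 1)
      (dualVec G y j)) i = 0 := by
    rw [Finset.sum_comm]
    refine Finset.sum_eq_zero fun i _ => ?_
    have := congrArg (fun v : (𝔼 n) => v i) (hz (𝐞 i))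
    simpa using this
  simp only [key, h.symm y hy _ (dualVec G y _), h.apply_dualVec hy, Finset.sum_add_distrib,
    Finset.sum_sub_distrib, ← Finset.mul_sum, ht', hone, one_mul, Finset.sum_const,
    Finset.card_univ, Fintype.card_fin, nsmul_eq_mul] at hfin
  have hb : ∑ j, b j * t (EuclideanSpace.single j 1) = t b := by
    let f : 𝔼 n →ₗ[ℝ] ℝ :=
      { toFun := t
        map_add' := fun _ _ => by simp [ht, cotton, Finset.sum_add_distrib]
        map_smul' := fun _ _ => by simp [ht, cotton, Finset.mul_sum] }
    exact sum_map_single f b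
  rw [hb] at hfin
  have h4 : (2 * (n : ℝ) - 4) * t b = 0 := by linarith
  rcases mul_eq_zero.1 h4 with h5 | h5
  · linarith
  · exact h5

end CoordMetric

namespace CoordMetric

variable {n : ℕ} {G : 𝔼 n → 𝔼 n →L[ℝ] 𝔼 n →L[ℝ] ℝ} {Ω : Set (𝔼 n)}

theorem IsMetricOn.tractorCurv_kappa (h : IsMetricOn G Ω) {y : 𝔼 n} (hy : y ∈ Ω) (hn : 3 ≤ n)
    (J : 𝕋 n →ₗ[ℝ] 𝕋 n) (hJ : ∀ v, J (J v) = -v)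
    (hJo : ∀ v w, tractorForm G y (J v) (J w) = tractorForm G y v w)
    (hJF : ∀ a b v, tractorCurv G y a b (J v) = J (tractorCurv G y a b v)) (b : 𝔼 n)
    (v : 𝕋 n) : tractorCurv G y (J (0, 0, 1)).2.1 b v = 0 := by
  have hsk : ∀ v w, tractorForm G y (J v) w = -tractorForm G y v (J w) := fun v w => by
    rw [← hJo (J v) w, hJ, map_neg]
    rfl
  have hself : ∀ v, tractorForm G y (J v) v = 0 := fun v => by
    have := hsk v v
    rw [h.tractorForm_symm hy v] at this
    linarith
  obtain ⟨κ, hκ⟩ : ∃ κ, κ = (J (0, 0, 1)).2.1 := ⟨_, rfl⟩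
  obtain ⟨r, hr⟩ : ∃ r, r = (J (0, 0, 1)).2.2 := ⟨_, rfl⟩
  obtain ⟨l, hl⟩ : ∃ l, l = (J (1, 0, 0)).2.1 := ⟨_, rfl⟩
  let Φ : 𝔼 n →ₗ[ℝ] (𝔼 n) :=
    { toFun := fun c => (J (0, c, 0)).2.1
      map_add' := fun c d => by
        have : ((0, c + d, 0) : 𝕋 n) = (0, c, 0) + (0, d, 0) := by simp
        rw [this, map_add]
        rfl
      map_smul' := fun c d => by
        have : ((0, c • d, 0) : 𝕋 n) = c • (0, d, 0) := by simp
        rw [this, map_smul]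
        rfl }
  rw [← hκ]
  have hJe : J (0, 0, 1) = (0, κ, r) := by
    refine Prod.ext ?_ (Prod.ext hκ.symm hr.symm)
    simpa [tractorForm_apply] using hself (0, 0, 1)
  have hJf : J (1, 0, 0) = (-r, l, 0) := by
    refine Prod.ext ?_ (Prod.ext hl.symm ?_)
    · have := hsk (1, 0, 0) (0, 0, 1)
      rw [hJe] at this
      simpa [tractorForm_apply] using this
    · simpa [tractorForm_apply] using hself (1, 0, 0)
  have hJc : ∀ c, J (0, c, 0) = (-G y κ c, Φ c, -G y c l) := fun c => by
    refine Prod.ext ?_ (Prod.ext rfl ?_)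
    · have := hsk (0, c, 0) (0, 0, 1)
      rw [hJe] at this
      rw [h.symm y hy κ]
      simpa [tractorForm_apply] using this
    · have := hsk (0, c, 0) (1, 0, 0)
      rw [hJf] at this
      simpa [tractorForm_apply] using this
  have hJ3 : ∀ s c t, J (s, c, t) = s • J (1, 0, 0) + J (0, c, 0) + t • J (0, 0, 1) := by
    intro s c t
    rw [← map_smul, ← map_smul, ← map_add, ← map_add]
    simp
  have hκl : G y κ l = 1 + r ^ 2 := by
    have := hJo (0, 0, 1) (1, 0, 0)
    rw [hJe, hJf] at this
    simp [tractorForm_apply] at this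
    linarith
  have hpos : (1 + r ^ 2 : ℝ) ≠ 0 := by positivity
  have hF := h.tractorCurv_eq hy
  have hWκ : ∀ a b, weyl G y a b κ = 0 := fun a b => by
    have := congrArg (fun v : 𝕋 n => v.2.1) (hJF a b (0, 0, 1))
    rw [h.tractorCurv_apply_bot hy, hJe, hF] at this
    simpa using this
  have hCκ : ∀ a b, G y (cotton G y a b) κ = 0 := fun a b => by
    have := congrArg (fun v : 𝕋 n => v.2.2) (hJF a b (0, 0, 1))
    rw [h.tractorCurv_apply_bot hy, hJe, hF] at this
    simpa using this
  have hκW : ∀ b c, weyl G y κ b c = 0 := fun b c => h.ext hy fun d => by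
    rw [h.weyl_pair_symm hy κ b c d, hWκ]
    simp
  have hΦC : ∀ a b, Φ (cotton G y a b) = weyl G y a b l - r • cotton G y a b := fun a b => by
    have := congrArg (fun v : 𝕋 n => v.2.1) (hJF a b (1, 0, 0))
    rw [hJf, hF, hF] at this
    have hw0 : weyl G y a b 0 = 0 := by
      have : ((0, 0, 0) : 𝕋 n) = 0 := rfl
      rw [weyl, this, map_zero]
      rfl
    rw [hJ3, hJc] at this
    simp [hw0] at this
    rw [← this]
    module
  have hΦΦ : ∀ c, G y κ c = 0 → Φ (Φ c) = -c + G y c l • κ := fun c hc => by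
    have := congrArg (fun v : 𝕋 n => v.2.1) (hJ (0, c, 0))
    rw [hJc, hJ3, hJc, hJe] at this
    simp [hc] at this
    rw [← sub_eq_zero, ← sub_eq_zero.2 this]
    module
  have hCf : ∀ a b, (1 + r ^ 2) • cotton G y a b
      = -Φ (weyl G y a b l) + r • weyl G y a b l + G y (cotton G y a b) l • κ := fun a b => by
    have e1 := hΦΦ (cotton G y a b) (by rw [h.symm y hy, hCκ])
    rw [hΦC, map_sub, map_smul, hΦC] at e1
    rw [← sub_eq_zero, ← sub_eq_zero.2 e1]
    module
  have hsum : ∀ b, (1 + r ^ 2) * ∑ i, (cotton G y (𝐞 i) b) i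
      = -∑ i, (Φ (weyl G y (𝐞 i) b l)) i
        + r * ∑ i, (weyl G y (𝐞 i) b l) i + G y (cotton G y κ b) l := by
    intro b
    have e1 := Finset.sum_congr (rfl : Finset.univ = Finset.univ) fun i _ =>
      congrArg (fun v : (𝔼 n) => v i) (hCf (𝐞 i) b)
    simp only [PiLp.add_apply, PiLp.neg_apply, PiLp.smul_apply, smul_eq_mul,
      Finset.sum_add_distrib, Finset.sum_neg_distrib, ← Finset.mul_sum] at e1
    rw [e1]
    congr 1
    let f : 𝔼 n →ₗ[ℝ] ℝ :=
      { toFun := fun a => G y (cotton G y a b) l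
        map_add' := fun _ _ => by simp [cotton]
        map_smul' := fun _ _ => by simp [cotton] }
    have e2 := sum_map_single f κ
    simp only [smul_eq_mul] at e2
    exact (Finset.sum_congr rfl fun i _ => mul_comm _ _).trans e2
  have hΦsk : ∀ c d, G y (Φ c) d = -G y c (Φ d) := fun c d => by
    have := hsk (0, c, 0) (0, d, 0)
    rw [hJc, hJc] at this
    simpa [tractorForm_apply] using this
  have htr : ∑ i, (Φ (weyl G y (𝐞 i) l l)) i = 0 := by
    let B : 𝔼 n →ₗ[ℝ] (𝔼 n) :=
      { toFun := fun a => weyl G y a l l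
        map_add' := fun _ _ => by simp [weyl]
        map_smul' := fun _ _ => by simp [weyl] }
    have hB : ∀ c d, G y (B c) d = G y c (B d) := fun c d => by
      change G y (weyl G y c l l) d = G y c (weyl G y d l l)
      rw [h.weyl_pair_symm hy, weyl_antisymm, map_neg, neg_apply]
      have := h.weyl_skew hy d l c l
      rw [h.symm y hy c] at this ⊢
      linarith
    have e1 := h.tr_eq_of_adjoint hy (Φ ∘ₗ B) (-(B ∘ₗ Φ)) fun c d => by
      simp only [LinearMap.comp_apply, LinearMap.neg_apply, map_neg, hΦsk, hB]
    have e2 : tr (-(B ∘ₗ Φ)) = -tr (B ∘ₗ Φ) := by simp [tr]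
    rw [e2, tr_comp_comm B Φ] at e1
    change tr (Φ ∘ₗ B) = 0
    linarith
  have hCll : G y (cotton G y κ l) l = 0 := by
    have := hsum l
    rw [h.sum_cotton hy hn, h.sum_weyl hy hn, htr] at this
    linarith
  have hCs : ∀ b c, G y (cotton G y κ b) c = G y (cotton G y κ c) b := fun b c => by
    have := h.cotton_cyclic hy κ b c
    rw [hCκ, cotton_antisymm y c κ, map_neg, neg_apply] at this
    linarith
  have hC0 : ∀ b, cotton G y κ b = 0 := by
    have hφ : ∀ b, (1 + r ^ 2) • cotton G y κ b = G y (cotton G y κ b) l • κ := fun b => by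
      simpa [hκW] using hCf κ b
    have e1 : ∀ b, G y (cotton G y κ b) l = 0 := fun b => by
      have := congrArg (fun v : (𝔼 n) => G y v b) (hφ l)
      simp only [map_smul, smul_apply, smul_eq_mul, hCll, zero_mul] at this
      rw [hCs b l]
      exact (mul_eq_zero.1 this).resolve_left hpos
    intro b
    have := hφ b
    rw [e1, zero_smul] at this
    exact (smul_eq_zero.1 this).resolve_left hpos
  rw [hF, hC0, hκW]
  simp

end CoordMetric

/-! ### Invariance under diffeomorphisms -/

namespace CoordMetric

variable {n : ℕ}

/-- The metric `G'` on `Ω'` is the pull-back of the metric `G` on `Ω` by the smooth map `θ`. -/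
structure IsPullback (θ : 𝔼 n → 𝔼 n) (G' : 𝔼 n → 𝔼 n →L[ℝ] 𝔼 n →L[ℝ] ℝ) (Ω' : Set (𝔼 n))
    (G : 𝔼 n → 𝔼 n →L[ℝ] 𝔼 n →L[ℝ] ℝ) (Ω : Set (𝔼 n)) : Prop where
  source : IsMetricOn G' Ω'
  target : IsMetricOn G Ω
  smooth : ContDiffOn ℝ ∞ θ Ω'
  mapsTo : MapsTo θ Ω' Ω
  apply : ∀ y ∈ Ω', ∀ a b, G' y a b = G (θ y) (fderiv ℝ θ y a) (fderiv ℝ θ y b)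

variable {θ : 𝔼 n → 𝔼 n} {G' : 𝔼 n → 𝔼 n →L[ℝ] 𝔼 n →L[ℝ] ℝ} {Ω' : Set (𝔼 n)}
  {G : 𝔼 n → 𝔼 n →L[ℝ] 𝔼 n →L[ℝ] ℝ} {Ω : Set (𝔼 n)}

namespace IsPullback

variable (h : IsPullback θ G' Ω' G Ω) {y : 𝔼 n} (hy : y ∈ Ω')

include h hy

theorem injective_fderiv : Function.Injective (fderiv ℝ θ y) := by
  intro a b hab
  refine h.source.ext hy fun c => ?_
  rw [h.apply y hy, h.apply y hy, hab]

theorem surjective_fderiv : Function.Surjective (fderiv ℝ θ y) :=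
  LinearMap.injective_iff_surjective.1 (h.injective_fderiv hy : Function.Injective (fderiv ℝ θ y : 𝔼 n →ₗ[ℝ] (𝔼 n)))

theorem exists_linearEquiv : ∃ D : (𝔼 n) ≃ₗ[ℝ] (𝔼 n), ∀ a, D a = fderiv ℝ θ y a :=
  ⟨LinearEquiv.ofBijective (fderiv ℝ θ y : 𝔼 n →ₗ[ℝ] (𝔼 n)) ⟨h.injective_fderiv hy, h.surjective_fderiv hy⟩,
    fun _ => rfl⟩

theorem hasFDerivAt : HasFDerivAt θ (fderiv ℝ θ y) y :=
  ((h.smooth.differentiableOn (by simp)).differentiableAt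
    (h.source.isOpen.mem_nhds hy)).hasFDerivAt

theorem hasFDerivAt₂ : HasFDerivAt (fderiv ℝ θ) (fderiv ℝ (fderiv ℝ θ) y) y :=
  (((h.smooth.fderiv_of_isOpen h.source.isOpen (m := ∞) (by simp)).differentiableOn
    (by simp)).differentiableAt (h.source.isOpen.mem_nhds hy)).hasFDerivAt

theorem hasFDerivAt₃ : HasFDerivAt (fderiv ℝ (fderiv ℝ θ)) (fderiv ℝ (fderiv ℝ (fderiv ℝ θ)) y) y :=
  ((((h.smooth.fderiv_of_isOpen h.source.isOpen (m := ∞) (by simp)).fderiv_of_isOpen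
    h.source.isOpen (m := ∞) (by simp)).differentiableOn
    (by simp)).differentiableAt (h.source.isOpen.mem_nhds hy)).hasFDerivAt

theorem fderiv_symm (a b : 𝔼 n) : fderiv ℝ (fderiv ℝ θ) y a b = fderiv ℝ (fderiv ℝ θ) y b a := by
  have : IsSymmSndFDerivAt ℝ θ y :=
    (h.smooth.contDiffAt (h.source.isOpen.mem_nhds hy)).isSymmSndFDerivAt
      (by simpa using ENat.LEInfty.out)
  exact this a b

theorem fderiv₃_symm (a b c : 𝔼 n) :
    fderiv ℝ (fderiv ℝ (fderiv ℝ θ)) y a b c = fderiv ℝ (fderiv ℝ (fderiv ℝ θ)) y b a c := by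
  have : IsSymmSndFDerivAt ℝ (fderiv ℝ θ) y :=
    ((h.smooth.fderiv_of_isOpen h.source.isOpen (m := ∞) (by simp)).contDiffAt
      (h.source.isOpen.mem_nhds hy)).isSymmSndFDerivAt (by simpa using ENat.LEInfty.out)
  rw [this a b]

theorem fderiv_metric (x a b : 𝔼 n) : fderiv ℝ G' y x a b = fderiv ℝ G (θ y) (fderiv ℝ θ y x)
    (fderiv ℝ θ y a) (fderiv ℝ θ y b) + G (θ y) (fderiv ℝ (fderiv ℝ θ) y x a) (fderiv ℝ θ y b) + G
    (θ y) (fderiv ℝ θ y a) (fderiv ℝ (fderiv ℝ θ) y x b) := by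
  have hl : HasFDerivAt (fun z => G' z a b) _ y :=
    ((h.source.hasFDerivAt hy).clm_apply (hasFDerivAt_const a y)).clm_apply (hasFDerivAt_const b y)
  have hG : HasFDerivAt (fun z => G (θ z)) _ y :=
    (h.target.hasFDerivAt (h.mapsTo hy)).comp y (h.hasFDerivAt hy)
  have hD : ∀ c, HasFDerivAt (fun z => fderiv ℝ θ z c) _ y := fun c =>
    (h.hasFDerivAt₂ hy).clm_apply (hasFDerivAt_const c y)
  have hr := (hG.clm_apply (hD a)).clm_apply (hD b)
  have heq : (fun z => G' z a b) =ᶠ[𝓝 y] fun z => G (θ z) (fderiv ℝ θ z a) (fderiv ℝ θ z b) := by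
    filter_upwards [h.source.isOpen.mem_nhds hy] with z hz
    exact h.apply z hz a b
  have := congrArg (fun f : 𝔼 n →L[ℝ] ℝ => f x) (hl.unique (hr.congr_of_eventuallyEq heq))
  simp at this
  rw [this]
  ring

theorem fderiv_christoffel (a b : 𝔼 n) : fderiv ℝ θ y (christoffelL G' y a b) = fderiv ℝ
    (fderiv ℝ θ) y a b + christoffelL G (θ y) (fderiv ℝ θ y a) (fderiv ℝ θ y b) := by
  have hz := h.mapsTo hy
  refine h.target.ext hz fun c' => ?_
  obtain ⟨c, rfl⟩ := h.surjective_fderiv hy c'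
  rw [← h.apply y hy, h.source.apply_christoffel hy, map_add, add_apply,
    h.target.apply_christoffel hz]
  simp only [h.fderiv_metric hy]
  rw [h.fderiv_symm hy b a, h.fderiv_symm hy c a, h.fderiv_symm hy c b,
    h.target.symm _ hz _ (fderiv ℝ (fderiv ℝ θ) y a c)]
  ring

theorem fderiv_curv (a b c : 𝔼 n) : fderiv ℝ θ y (curvL (christoffelL G') y a b c) = curvL
    (christoffelL G) (θ y) (fderiv ℝ θ y a) (fderiv ℝ θ y b) (fderiv ℝ θ y c) := by
  have hz := h.mapsTo hy
  have d1 : HasFDerivAt (christoffelL G') (fderiv ℝ (christoffelL G') y) y :=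
    ((h.source.contDiffOn_christoffelL.differentiableOn (by simp)).differentiableAt
      (h.source.isOpen.mem_nhds hy)).hasFDerivAt
  have d2 : HasFDerivAt (christoffelL G) (fderiv ℝ (christoffelL G) (θ y)) (θ y) :=
    ((h.target.contDiffOn_christoffelL.differentiableOn (by simp)).differentiableAt
      (h.target.isOpen.mem_nhds hz)).hasFDerivAt
  have hD : ∀ c, HasFDerivAt (fun z => fderiv ℝ θ z c) _ y := fun c =>
    (h.hasFDerivAt₂ hy).clm_apply (hasFDerivAt_const c y)
  have key : ∀ c a b, fderiv ℝ (fderiv ℝ θ) y c (christoffelL G' y a b)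
      + fderiv ℝ θ y (fderiv ℝ (christoffelL G') y c a b)
      = fderiv ℝ (fderiv ℝ (fderiv ℝ θ)) y c a b
        + fderiv ℝ (christoffelL G) (θ y) (fderiv ℝ θ y c) (fderiv ℝ θ y a) (fderiv ℝ θ y b)
        + christoffelL G (θ y) (fderiv ℝ (fderiv ℝ θ) y c a) (fderiv ℝ θ y b)
        + christoffelL G (θ y) (fderiv ℝ θ y a) (fderiv ℝ (fderiv ℝ θ) y c b) := by
    intro c a b
    have hl := (h.hasFDerivAt₂ hy).clm_apply
      ((d1.clm_apply (hasFDerivAt_const a y)).clm_apply (hasFDerivAt_const b y))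
    have hΓ : HasFDerivAt (fun z => christoffelL G (θ z)) _ y := d2.comp y (h.hasFDerivAt hy)
    have hr := (((h.hasFDerivAt₃ hy).clm_apply (hasFDerivAt_const a y)).clm_apply
      (hasFDerivAt_const b y)).add ((hΓ.clm_apply (hD a)).clm_apply (hD b))
    have heq : (fun z => fderiv ℝ θ z (christoffelL G' z a b)) =ᶠ[𝓝 y]
        fun z => fderiv ℝ (fderiv ℝ θ) z a b
          + christoffelL G (θ z) (fderiv ℝ θ z a) (fderiv ℝ θ z b) := by
      filter_upwards [h.source.isOpen.mem_nhds hy] with z hz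
      exact h.fderiv_christoffel hz a b
    have := congrArg (fun f : 𝔼 n →L[ℝ] 𝔼 n => f c) (hl.unique (hr.congr_of_eventuallyEq heq))
    simp at this
    rw [add_comm, this]
    abel
  have k1 := key a b c
  have k2 := key b a c
  rw [← eq_sub_iff_add_eq'] at k1 k2
  simp only [curvL_apply, map_sub, map_add]
  rw [k1, k2]
  simp only [h.fderiv_christoffel hy, map_add]
  rw [h.fderiv₃_symm hy b a, h.fderiv_symm hy b a]
  abel

theorem ricci (b c : 𝔼 n) :
    CoordMetric.ricci G' y b c = CoordMetric.ricci G (θ y) (fderiv ℝ θ y b) (fderiv ℝ θ y c) := by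
  obtain ⟨D, hD⟩ := h.exists_linearEquiv hy
  rw [h.source.ricci_eq hy, h.target.ricci_eq (h.mapsTo hy)]
  have : (((curvL (christoffelL G) (θ y)).flip (fderiv ℝ θ y b)).flip
      (fderiv ℝ θ y c)).toLinearMap = (D : 𝔼 n →ₗ[ℝ] (𝔼 n)) ∘ₗ
        (((curvL (christoffelL G') y).flip b).flip c).toLinearMap ∘ₗ (D.symm : 𝔼 n →ₗ[ℝ] (𝔼 n)) := by
    apply LinearMap.ext
    intro a
    change curvL (christoffelL G) (θ y) a (fderiv ℝ θ y b) (fderiv ℝ θ y c)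
      = D (curvL (christoffelL G') y (D.symm a) b c)
    rw [hD, h.fderiv_curv hy, ← hD (D.symm a), D.apply_symm_apply]
  rw [this, tr_comp_comm]
  congr 1
  apply LinearMap.ext
  intro a
  simp

theorem sharp (α : 𝔼 n →L[ℝ] ℝ) :
    fderiv ℝ θ y (CoordMetric.sharp G' y (α ∘L fderiv ℝ θ y)) = CoordMetric.sharp G (θ y) α := by
  have hz := h.mapsTo hy
  refine h.target.ext hz fun c' => ?_
  obtain ⟨c, rfl⟩ := h.surjective_fderiv hy c'
  rw [← h.apply y hy, h.source.apply_sharp hy, h.target.apply_sharp hz]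
  rfl

theorem scal : CoordMetric.scal G' y = CoordMetric.scal G (θ y) := by
  have hz := h.mapsTo hy
  have e : ∀ {G : 𝔼 n → 𝔼 n →L[ℝ] 𝔼 n →L[ℝ] ℝ} {Ω : Set (𝔼 n)} {y : 𝔼 n} (h : IsMetricOn G Ω)
      (hy : y ∈ Ω), CoordMetric.scal G y = tr ((ContinuousLinearMap.inverse (G y)).toLinearMap ∘ₗ
        (toCLM₂ (ricciL G y)).toLinearMap) := by
    intro G Ω y h hy
    unfold CoordMetric.scal tr
    refine Finset.sum_congr rfl fun i _ => ?_
    change _ = (CoordMetric.sharp G y (toCLM₂ (ricciL G y) (𝐞 i))) i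
    rw [h.sharp_coord hy, toCLM₂_apply, h.ricciL_apply hy]
  obtain ⟨D, hD⟩ := h.exists_linearEquiv hy
  rw [e h.source hy, e h.target hz]
  have : (ContinuousLinearMap.inverse (G (θ y))).toLinearMap ∘ₗ
        (toCLM₂ (ricciL G (θ y))).toLinearMap = (D : 𝔼 n →ₗ[ℝ] (𝔼 n)) ∘ₗ
        ((ContinuousLinearMap.inverse (G' y)).toLinearMap ∘ₗ
        (toCLM₂ (ricciL G' y)).toLinearMap) ∘ₗ (D.symm : 𝔼 n →ₗ[ℝ] (𝔼 n)) := by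
    apply LinearMap.ext
    intro a
    change CoordMetric.sharp G (θ y) (toCLM₂ (ricciL G (θ y)) a)
      = D (CoordMetric.sharp G' y (toCLM₂ (ricciL G' y) (D.symm a)))
    rw [hD, ← h.sharp hy]
    congr 2
    ext1 c
    change ricciL G (θ y) a (fderiv ℝ θ y c) = ricciL G' y (D.symm a) c
    rw [h.source.ricciL_apply hy, h.target.ricciL_apply hz, h.ricci hy, ← hD (D.symm a),
      D.apply_symm_apply]
  rw [this, tr_comp_comm]
  congr 1
  apply LinearMap.ext
  intro a
  simp

theorem schouten (a b : 𝔼 n) : CoordMetric.schouten G' y a b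
    = CoordMetric.schouten G (θ y) (fderiv ℝ θ y a) (fderiv ℝ θ y b) := by
  rw [CoordMetric.schouten, CoordMetric.schouten, h.ricci hy, h.scal hy, h.apply y hy]

theorem schoutenSharp (a : 𝔼 n) : fderiv ℝ θ y (CoordMetric.schoutenSharp G' y a)
    = CoordMetric.schoutenSharp G (θ y) (fderiv ℝ θ y a) := by
  have hz := h.mapsTo hy
  refine h.target.ext hz fun c' => ?_
  obtain ⟨c, rfl⟩ := h.surjective_fderiv hy c'
  rw [← h.apply y hy, h.source.apply_schoutenSharp hy, h.target.apply_schoutenSharp hz,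
    h.schouten hy]

theorem tractorConn (X : 𝔼 n) (v : 𝕋 n) :
    (((CoordMetric.tractorConn G' y X v).1, fderiv ℝ θ y (CoordMetric.tractorConn G' y X v).2.1,
      (CoordMetric.tractorConn G' y X v).2.2) : 𝕋 n)
      = CoordMetric.tractorConn G (θ y) (fderiv ℝ θ y X) (v.1, fderiv ℝ θ y v.2.1, v.2.2)
        + (0, fderiv ℝ (fderiv ℝ θ) y X v.2.1, 0) := by
  have hz := h.mapsTo hy
  simp only [tractorConn_apply, h.source.sharp_schoutenL hy, h.target.sharp_schoutenL hz,
    h.source.schoutenL_apply hy, h.target.schoutenL_apply hz, map_add, map_smul,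
    h.fderiv_christoffel hy, h.schoutenSharp hy, h.schouten hy, h.apply y hy]
  refine Prod.ext (by simp) (Prod.ext ?_ (by simp))
  simp
  abel

end IsPullback

end CoordMetric

/-! ### The metric and the tractor connection in a chart -/

section charts

variable {n : ℕ} {M : Type*} [TopologicalSpace M]
  [ChartedSpace (𝔼 n) M] [IsManifold (𝓡 n) ∞ M] {r s : ℕ}

/-- The transition map from the preferred chart at `x` to the preferred chart at `x₀`. -/
def transition (x₀ x : M) : 𝔼 n → 𝔼 n := chart n x₀ ∘ (chart n x).symm

/-- The domain of `transition x₀ x`. -/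
def transitionDomain (x₀ x : M) : Set (𝔼 n) :=
  ((chart n x).symm.trans (chart n x₀)).source

theorem mem_transitionDomain {x₀ x : M} {y : 𝔼 n} : y ∈ transitionDomain x₀ x ↔
    y ∈ (chart n x).target ∧ (chart n x).symm y ∈ (chart n x₀).source := by
  simp only [transitionDomain, PartialEquiv.trans_source, PartialEquiv.symm_source, mem_inter_iff,
    mem_preimage]

theorem isOpen_transitionDomain (x₀ x : M) : IsOpen (transitionDomain (n := n) x₀ x) := by
  rw [transitionDomain, PartialEquiv.trans_source, PartialEquiv.symm_source]
  exact (continuousOn_extChartAt_symm (I := 𝓡 n) x).isOpen_inter_preimage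
    (isOpen_extChartAt_target x) (isOpen_extChartAt_source x₀)

theorem contDiffOn_transition (x₀ x : M) : ContDiffOn ℝ ∞ (transition (n := n) x₀ x) (transitionDomain x₀ x) := by
  have h1 := contMDiffOn_extChartAt_symm (I := 𝓡 n) (n := ∞) x
  have h2 := contMDiffOn_extChartAt (I := 𝓡 n) (n := ∞) (x := x₀)
  rw [← contMDiffOn_iff_contDiffOn]
  refine h2.comp (h1.mono fun y hy => (mem_transitionDomain.1 hy).1) fun y hy => ?_
  rw [mem_preimage, ← extChartAt_source (𝓡 n)]
  exact (mem_transitionDomain.1 hy).2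

theorem mapsTo_transition (x₀ x : M) : MapsTo (transition (n := n) x₀ x) (transitionDomain x₀ x)
    (chart n x₀).target :=
  fun _ hy => (chart n x₀).map_source (mem_transitionDomain.1 hy).2

theorem symm_transition {x₀ x : M} {y : 𝔼 n} (hy : y ∈ transitionDomain x₀ x) :
    (chart n x₀).symm (transition x₀ x y) = (chart n x).symm y :=
  (chart n x₀).left_inv (mem_transitionDomain.1 hy).2

theorem extChartAt_mem_transitionDomain {x₀ x : M} (hx : x ∈ (chart n x₀).source) :
    chart n x x ∈ transitionDomain x₀ x := by
  rw [mem_transitionDomain, extChartAt_to_inv]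
  exact ⟨mem_extChartAt_target x, hx⟩

theorem transition_extChartAt (x₀ x : M) : transition x₀ x (chart n x x) = chart n x₀ x := by
  rw [transition, Function.comp_apply, extChartAt_to_inv]

theorem transition_extChartAt' {x₀ x z : M} (hz : z ∈ (chart n x).source) :
    transition x₀ x (chart n x z) = chart n x₀ z := by
  rw [transition, Function.comp_apply, (chart n x).left_inv hz]

theorem extChartAt_mem_transitionDomain' {x₀ x z : M} (hz : z ∈ (chart n x).source)
    (hz' : z ∈ (chart n x₀).source) : chart n x z ∈ transitionDomain x₀ x := by
  rw [mem_transitionDomain, (chart n x).left_inv hz]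
  exact ⟨(chart n x).map_source hz, hz'⟩

theorem mdifferentiableAt_extChartAt_symm {x₀ : M} {y : 𝔼 n} (hy : y ∈ (chart n x₀).target) :
    MDifferentiableAt 𝓘(ℝ, 𝔼 n) (𝓡 n) (chart n x₀).symm y :=
  ((contMDiffOn_extChartAt_symm (I := 𝓡 n) (n := ∞) x₀).contMDiffAt
    ((isOpen_extChartAt_target x₀).mem_nhds hy)).mdifferentiableAt (by simp)

/-- The derivative of the inverse of the preferred chart at `x₀`, as an endomorphism of `ℝⁿ`. -/
def symmDeriv (x₀ : M) (y : 𝔼 n) : 𝔼 n →L[ℝ] 𝔼 n :=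
  mfderiv 𝓘(ℝ, 𝔼 n) (𝓡 n) (chart n x₀).symm y

/-- The derivative of the preferred chart at `x₀`, as an endomorphism of `ℝⁿ`. -/
def chartDeriv (x₀ x : M) : 𝔼 n →L[ℝ] 𝔼 n := mfderiv (𝓡 n) 𝓘(ℝ, 𝔼 n) (chart n x₀) x

theorem chartDeriv_symmDeriv {x₀ : M} {y : 𝔼 n} (hy : y ∈ (chart n x₀).target) (a : 𝔼 n) :
    chartDeriv x₀ ((chart n x₀).symm y) (symmDeriv x₀ y a) = a := by
  have h := mfderiv_extChartAt_comp_mfderivWithin_extChartAt_symm (I := 𝓡 n) hy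
  have h2 := congrArg (fun f : 𝔼 n →L[ℝ] 𝔼 n => f a) h
  simp only [ModelWithCorners.Boundaryless.range_eq_univ, mfderivWithin_univ] at h2
  exact h2

theorem symmDeriv_chartDeriv {x₀ x : M} (hx : x ∈ (chart n x₀).source) (a : 𝔼 n) :
    symmDeriv x₀ (chart n x₀ x) (chartDeriv x₀ x a) = a := by
  have h := mfderivWithin_extChartAt_symm_comp_mfderiv_extChartAt' (I := 𝓡 n) hx
  have h2 := congrArg (fun f : 𝔼 n →L[ℝ] 𝔼 n => f a) h
  simp only [ModelWithCorners.Boundaryless.range_eq_univ, mfderivWithin_univ] at h2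
  exact h2

theorem symmDeriv_transition {x₀ x : M} {y : 𝔼 n} (hy : y ∈ transitionDomain x₀ x) (a : 𝔼 n) :
    symmDeriv x y a = symmDeriv x₀ (transition x₀ x y) (fderiv ℝ (transition x₀ x) y a) := by
  have h1 : (chart n x).symm =ᶠ[𝓝 y] (chart n x₀).symm ∘ transition x₀ x := by
    filter_upwards [(isOpen_transitionDomain x₀ x).mem_nhds hy] with z hz
    exact (symm_transition hz).symm
  have h2 : HasMFDerivAt 𝓘(ℝ, 𝔼 n) 𝓘(ℝ, 𝔼 n) (transition x₀ x) y (fderiv ℝ (transition x₀ x) y) :=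
    ((((contDiffOn_transition x₀ x).differentiableOn (by simp)).differentiableAt
      ((isOpen_transitionDomain x₀ x).mem_nhds hy)).hasFDerivAt).hasMFDerivAt
  have h3 := (mdifferentiableAt_extChartAt_symm (mapsTo_transition x₀ x hy)).hasMFDerivAt
  have h4 := ((h3.comp y h2).congr_of_eventuallyEq h1).mfderiv
  exact congrArg (fun f : 𝔼 n →L[ℝ] 𝔼 n => f a) h4

theorem symmDeriv_self (x : M) (a : 𝔼 n) : symmDeriv x (chart n x x) a = a := by
  have h := mfderivWithin_range_extChartAt_symm (I := 𝓡 n) (x := x)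
  have h2 := congrArg (fun f : 𝔼 n →L[ℝ] 𝔼 n => f a) h
  simp only [ModelWithCorners.Boundaryless.range_eq_univ, mfderivWithin_univ] at h2
  exact h2

theorem chartDeriv_eq {x₀ x : M} (hx : x ∈ (chart n x₀).source) (a : 𝔼 n) :
    chartDeriv x₀ x a = fderiv ℝ (transition x₀ x) (chart n x x) a := by
  have h := symmDeriv_transition (extChartAt_mem_transitionDomain hx) a
  rw [symmDeriv_self, transition_extChartAt] at h
  have h2 := chartDeriv_symmDeriv ((chart n x₀).map_source hx)
    (fderiv ℝ (transition x₀ x) (chart n x x) a)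
  rw [← h, (chart n x₀).left_inv hx] at h2
  exact h2

theorem trivializationAt_tangent {x₀ x : M} (hx : x ∈ (chart n x₀).source)
    (a : TangentSpace (𝓡 n) x) :
    (trivializationAt (𝔼 n) (TangentSpace (𝓡 n) : M → Type) x₀ ⟨x, a⟩).2 = chartDeriv x₀ x a := by
  rw [extChartAt_source] at hx
  have h := TangentBundle.continuousLinearMapAt_trivializationAt (I := 𝓡 n) hx
  have h2 := congrArg (fun f : 𝔼 n →L[ℝ] 𝔼 n => f a) h
  refine Eq.trans ?_ h2
  change _ = (trivializationAt (𝔼 n) (TangentSpace (𝓡 n) : M → Type) x₀).continuousLinearMapAt ℝ x a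
  rw [Trivialization.continuousLinearMapAt_apply, Trivialization.linearMapAt_apply, if_pos]
  simpa using hx

namespace PseudoRiemannianMetric

variable (g : PseudoRiemannianMetric n M r s)

/-- The metric at `x` as a bilinear form on `ℝⁿ`. -/
def form (x : M) : 𝔼 n →L[ℝ] 𝔼 n →L[ℝ] ℝ := g.inner x

theorem inChart_apply (x₀ : M) (y a b : 𝔼 n) : g.inChart x₀ y a b
    = g.form ((chart n x₀).symm y) (symmDeriv x₀ y a) (symmDeriv x₀ y b) := rfl

theorem form_injective (x : M) {a b : 𝔼 n} (h : ∀ c, g.form x a c = g.form x b c) : a = b := by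
  obtain ⟨B, hB⟩ : ∃ B : Module.Basis (Fin r ⊕ Fin s) ℝ (𝔼 n), ∀ i j, g.form x (B i) (B j)
      = if i = j then Sum.elim (fun _ => 1) (fun _ => -1) i else 0 := g.signature x
  refine B.ext_elem fun i => ?_
  have key : ∀ v : (𝔼 n), g.form x v (B i) = B.repr v i * Sum.elim (fun _ => 1) (fun _ => -1) i := by
    intro v
    have hv : v = ∑ j, B.repr v j • B j := (B.sum_repr v).symm
    conv_lhs => rw [hv]
    simp only [map_sum, map_smul, ContinuousLinearMap.sum_apply, smul_apply, hB, smul_eq_mul]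
    rw [Finset.sum_eq_single i (fun j _ hj => by rw [if_neg hj, mul_zero]) (by simp), if_pos rfl]
  have h1 := h (B i)
  rw [key, key] at h1
  refine mul_right_cancel₀ ?_ h1
  cases i <;> simp

theorem contMDiffAt_form_apply {x₀ x : M} (hx : x ∈ (chart n x₀).source) (a b : 𝔼 n) : ContMDiffAt
    (𝓡 n) 𝓘(ℝ, ℝ) ∞
    (fun z => g.form z (symmDeriv x₀ (chart n x₀ z) a) (symmDeriv x₀ (chart n x₀ z) b)) x := by
  have hb : x ∈ (trivializationAt (𝔼 n) (TangentSpace (𝓡 n) : M → Type) x₀).baseSet := by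
    simpa using hx
  have hsec : ∀ c : (𝔼 n), ContMDiffAt (𝓡 n) ((𝓡 n).prod 𝓘(ℝ, 𝔼 n)) ∞
      (fun z => TotalSpace.mk' (𝔼 n) (E := (TangentSpace (𝓡 n) : M → Type)) z
        (symmDeriv x₀ (chart n x₀ z) c)) x := by
    intro c
    refine (Trivialization.contMDiffAt_section_iff (IB := 𝓡 n)
      (e := trivializationAt (𝔼 n) (TangentSpace (𝓡 n) : M → Type) x₀)
      (s := fun z => (show TangentSpace (𝓡 n) z from symmDeriv x₀ (chart n x₀ z) c)) hb).2 ?_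
    refine (contMDiffAt_const (c := c)).congr_of_eventuallyEq ?_
    filter_upwards [(isOpen_extChartAt_source (I := 𝓡 n) x₀).mem_nhds hx] with z hz
    rw [trivializationAt_tangent hz]
    have := chartDeriv_symmDeriv ((chart n x₀).map_source hz) c
    rwa [(chart n x₀).left_inv hz] at this
  have : ContMDiffAt (𝓡 n) ((𝓡 n).prod 𝓘(ℝ, ℝ)) ∞
      (fun z => TotalSpace.mk' ℝ (E := Bundle.Trivial M ℝ) z (g.inner z
      (symmDeriv x₀ (chart n x₀ z) a) (symmDeriv x₀ (chart n x₀ z) b))) x :=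
    ContMDiffAt.clm_bundle_apply₂ (F₁ := (𝔼 n)) (F₂ := (𝔼 n)) g.smooth.contMDiffAt (hsec a) (hsec b)
  rw [contMDiffAt_totalSpace] at this
  exact this.2

theorem contDiffOn_inChart (x₀ : M) : ContDiffOn ℝ ∞ (g.inChart x₀) (chart n x₀).target := by
  refine contDiffOn_clm_apply.2 fun a => contDiffOn_clm_apply.2 fun b => ?_
  rw [← contMDiffOn_iff_contDiffOn]
  have h : ContMDiffOn (𝓡 n) 𝓘(ℝ, ℝ) ∞ (fun z => g.form z
    (symmDeriv x₀ (chart n x₀ z) a) (symmDeriv x₀ (chart n x₀ z) b))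
    (chart n x₀).source := fun x hx => (g.contMDiffAt_form_apply hx a b).contMDiffWithinAt
  refine (h.comp (contMDiffOn_extChartAt_symm (I := 𝓡 n) (n := ∞) x₀)
    fun y hy => (chart n x₀).map_target hy).congr fun y hy => ?_
  rw [inChart_apply, Function.comp_apply, (chart n x₀).right_inv hy]

theorem inChart_injective (x₀ : M) {y : 𝔼 n} (hy : y ∈ (chart n x₀).target) {a b : 𝔼 n}
    (hab : g.inChart x₀ y a = g.inChart x₀ y b) : a = b := by
  have h1 : symmDeriv x₀ y a = symmDeriv x₀ y b := g.form_injective _ fun c => by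
    have h2 := symmDeriv_chartDeriv ((chart n x₀).map_target hy) c
    rw [(chart n x₀).right_inv hy] at h2
    have h3 := congrArg (fun f : 𝔼 n →L[ℝ] ℝ => f (chartDeriv x₀ ((chart n x₀).symm y) c)) hab
    simp only [inChart_apply, h2] at h3
    exact h3
  rw [← chartDeriv_symmDeriv hy a, ← chartDeriv_symmDeriv hy b, h1]

theorem isInvertible_of_injective (B : 𝔼 n →L[ℝ] 𝔼 n →L[ℝ] ℝ) (hB : Function.Injective B) :
    B.IsInvertible := by
  have hfr : Module.finrank ℝ (𝔼 n) = Module.finrank ℝ (𝔼 n →L[ℝ] ℝ) :=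
    ((InnerProductSpace.toDual ℝ (𝔼 n)).toLinearEquiv).finrank_eq
  exact ⟨(LinearEquiv.ofInjectiveOfFinrankEq (B : 𝔼 n →ₗ[ℝ] 𝔼 n →L[ℝ] ℝ) hB
    hfr).toContinuousLinearEquiv, ContinuousLinearMap.ext fun _ => rfl⟩

theorem isMetricOn_inChart (x₀ : M) : CoordMetric.IsMetricOn (g.inChart x₀) (chart n x₀).target where
  isOpen := isOpen_extChartAt_target x₀
  smooth := g.contDiffOn_inChart x₀
  symm := fun _ _ _ _ => g.symm _ _ _
  inv := fun _ hy => isInvertible_of_injective _ fun _ _ hab => g.inChart_injective x₀ hy hab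

theorem isPullback_transition (x₀ x : M) : CoordMetric.IsPullback (transition x₀ x) (g.inChart x)
    (transitionDomain x₀ x) (g.inChart x₀) (chart n x₀).target where
  source :=
    have h := g.isMetricOn_inChart x
    have hs : transitionDomain x₀ x ⊆ (chart n x).target :=
      fun _ hy => (mem_transitionDomain.1 hy).1
    ⟨isOpen_transitionDomain x₀ x, h.smooth.mono hs, fun y hy => h.symm y (hs hy),
      fun y hy => h.inv y (hs hy)⟩
  target := g.isMetricOn_inChart x₀
  smooth := contDiffOn_transition x₀ x
  mapsTo := mapsTo_transition x₀ x
  apply := fun y hy a b => by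
    rw [inChart_apply, inChart_apply, symm_transition hy, symmDeriv_transition hy,
      symmDeriv_transition hy]

end PseudoRiemannianMetric

end charts

section tractorCharts

variable {n : ℕ} {M : Type*} [TopologicalSpace M]
  [ChartedSpace (𝔼 n) M] [IsManifold (𝓡 n) ∞ M] {r s : ℕ}

/-- The endomorphism `(σ, μ, ρ) ↦ (σ, D μ, ρ)`. -/
def diagL : (𝔼 n →L[ℝ] 𝔼 n) → 𝕋 n →L[ℝ] 𝕋 n := fun D =>
  (ContinuousLinearMap.id ℝ ℝ).prodMap (D.prodMap (ContinuousLinearMap.id ℝ ℝ))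

theorem diagL_apply (D : 𝔼 n →L[ℝ] 𝔼 n) (v : 𝕋 n) : diagL D v = (v.1, D v.2.1, v.2.2) := rfl

theorem chartDeriv_transition {x₀ x z : M} (hz : z ∈ (chart n x).source)
    (hz' : z ∈ (chart n x₀).source) (a : 𝔼 n) :
    chartDeriv x₀ z a = fderiv ℝ (transition x₀ x) (chart n x z) (chartDeriv x z a) := by
  have h := symmDeriv_transition (extChartAt_mem_transitionDomain' hz hz') (chartDeriv x z a)
  rw [symmDeriv_chartDeriv hz, transition_extChartAt' hz] at h
  have h2 := chartDeriv_symmDeriv ((chart n x₀).map_source hz')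
    (fderiv ℝ (transition x₀ x) (chart n x z) (chartDeriv x z a))
  rw [← h, (chart n x₀).left_inv hz'] at h2
  exact h2

theorem chartDeriv_self (x : M) (a : 𝔼 n) : chartDeriv x x a = a := by
  have h := symmDeriv_chartDeriv (mem_extChartAt_source (I := 𝓡 n) x) a
  rwa [symmDeriv_self] at h

theorem trivializationAt_tractor {x₀ x : M} (hx : x ∈ (chart n x₀).source) (v : Tractor n M x) :
    (trivializationAt 𝕋 n (Tractor n M) x₀ ⟨x, v⟩).2 = diagL (chartDeriv x₀ x) v := by
  refine Prod.ext rfl (Prod.ext ?_ rfl)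
  exact trivializationAt_tangent hx v.2.1

theorem baseSet_tractor (x₀ : M) :
    (trivializationAt 𝕋 n (Tractor n M) x₀).baseSet = (chart n x₀).source := by
  have : (trivializationAt 𝕋 n (Tractor n M) x₀).baseSet
    = univ ∩ ((chartAt (𝔼 n) x₀).source ∩ univ) := rfl
  rw [this, extChartAt_source]
  simp

theorem continuousLinearMapAt_tractor {x₀ x : M} (hx : x ∈ (chart n x₀).source) (v : Tractor n M x)
    : (trivializationAt 𝕋 n (Tractor n M) x₀).continuousLinearMapAt ℝ x v = diagL (chartDeriv x₀ x)
    v := by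
  rw [← trivializationAt_tractor hx, Trivialization.continuousLinearMapAt_apply,
    Trivialization.linearMapAt_apply, if_pos]
  rwa [baseSet_tractor]

theorem symmL_tractor {x₀ x : M} (hx : x ∈ (chart n x₀).source) (v : 𝕋 n) :
    ((trivializationAt 𝕋 n (Tractor n M) x₀).symmL ℝ x v : 𝕋 n) = diagL
    (symmDeriv x₀ (chart n x₀ x)) v := by
  have hb : x ∈ (trivializationAt 𝕋 n (Tractor n M) x₀).baseSet := by
    rwa [baseSet_tractor]
  have h : (trivializationAt 𝕋 n (Tractor n M) x₀).symmL ℝ x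
      ((trivializationAt 𝕋 n (Tractor n M) x₀).continuousLinearMapAt ℝ x
        (diagL (symmDeriv x₀ (chart n x₀ x)) v : 𝕋 n))
      = (diagL (symmDeriv x₀ (chart n x₀ x)) v : 𝕋 n) :=
    Trivialization.symmL_continuousLinearMapAt _ hb _
  refine Eq.trans ?_ h
  congr 1
  refine Eq.trans ?_ (continuousLinearMapAt_tractor hx _).symm
  have h1 := chartDeriv_symmDeriv ((chart n x₀).map_source hx) v.2.1
  rw [(chart n x₀).left_inv hx] at h1
  exact Prod.ext rfl (Prod.ext h1.symm rfl)

theorem symmL_trivial {V : Type*} [NormedAddCommGroup V] [NormedSpace ℝ V] (x₀ x : M) (v : V) :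
    ((trivializationAt V (Bundle.Trivial M V) x₀).symmL ℝ x v : V) = v :=
  congrArg (fun f : V →L[ℝ] V => f v) (Bundle.Trivial.symmL_trivialization ℝ M V x)

theorem trivializationAt_frame {V : Type*} [NormedAddCommGroup V] [NormedSpace ℝ V] {x₀ x : M}
    (hx : x ∈ (chart n x₀).source) (u : Bundle.Trivial M V x →L[ℝ] Tractor n M x) (v : V) :
    (trivializationAt (V →L[ℝ] 𝕋 n)
      (fun x : M => Bundle.Trivial M V x →L[ℝ] Tractor n M x) x₀ ⟨x, u⟩).2 v
      = diagL (chartDeriv x₀ x) (u v) := by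
  rw [hom_trivializationAt_apply, ← continuousLinearMapAt_tractor hx]
  change (trivializationAt 𝕋 n (Tractor n M) x₀).continuousLinearMapAt ℝ x
    (u ((trivializationAt V (Bundle.Trivial M V) x₀).symmL ℝ x v)) = _
  rw [symmL_trivial]

theorem trivializationAt_end {x₀ x : M} (hx : x ∈ (chart n x₀).source)
    (u : Tractor n M x →L[ℝ] Tractor n M x) (v : 𝕋 n) :
    (trivializationAt (𝕋 n →L[ℝ] 𝕋 n) (fun x : M => Tractor n M x →L[ℝ] Tractor n M x) x₀ ⟨x, u⟩).2
    v = diagL (chartDeriv x₀ x) (u (diagL (symmDeriv x₀ (chart n x₀ x)) v : 𝕋 n)) := by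
  rw [hom_trivializationAt_apply, ← continuousLinearMapAt_tractor hx]
  change (trivializationAt 𝕋 n (Tractor n M) x₀).continuousLinearMapAt ℝ x
    (u ((trivializationAt 𝕋 n (Tractor n M) x₀).symmL ℝ x v)) = _
  congr 2
  exact symmL_tractor hx v

/-- The connector of the tractor connection as a map between fixed vector spaces. -/
def PseudoRiemannianMetric.connector (g : PseudoRiemannianMetric n M r s) (x : M)
    (v : 𝕋 n) (X : 𝔼 n) (v' : 𝕋 n) : 𝕋 n :=
  g.tractorConnector x v X v'

theorem PseudoRiemannianMetric.connector_eq (g : PseudoRiemannianMetric n M r s) (x : M) (v : 𝕋 n)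
    (X : 𝔼 n) (v' : 𝕋 n) : g.connector x v X v' = v' + CoordMetric.tractorConn (g.inChart x)
    (chart n x x) X v := by
  have h := g.isMetricOn_inChart x
  have hx := mem_extChartAt_target (I := 𝓡 n) x
  have hg : ∀ a b : (𝔼 n), g.inChart x (chart n x x) a b = g.form x a b := fun a b => by
    rw [g.inChart_apply, symmDeriv_self, symmDeriv_self, extChartAt_to_inv]
  rw [CoordMetric.tractorConn_apply, h.sharp_schoutenL hx, h.schoutenL_apply hx, hg]
  refine Prod.ext (sub_eq_add_neg _ _) (Prod.ext ?_ (sub_eq_add_neg _ _))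
  exact (add_assoc _ _ _).trans ((add_assoc _ _ _).trans (congrArg _ (add_assoc _ _ _).symm))

section naturality

variable {EX : Type*} [NormedAddCommGroup EX] [NormedSpace ℝ EX] {HX : Type*} [TopologicalSpace HX]
  {I : ModelWithCorners ℝ EX HX} {X : Type*} [TopologicalSpace X] [ChartedSpace HX X]

theorem hasFDerivAt_diagL {E : Type*} [NormedAddCommGroup E] [NormedSpace ℝ E]
    {D : E → 𝔼 n →L[ℝ] 𝔼 n} {w : E → 𝕋 n} {y : E} {D' : E →L[ℝ] 𝔼 n →L[ℝ] 𝔼 n} {w' : E →L[ℝ] 𝕋 n}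
    (hD : HasFDerivAt D D' y) (hw : HasFDerivAt w w' y) : ∃ L : E →L[ℝ] 𝕋 n, HasFDerivAt
    (fun z => diagL (D z) (w z)) L y ∧ ∀ a, L a = diagL (D y) (w' a) + (0, D' a (w y).2.1, 0) := by
  refine ⟨_, hw.fst.prodMk ((hD.clm_apply hw.snd.fst).prodMk hw.snd.snd), fun a => ?_⟩
  refine Prod.ext ?_ (Prod.ext ?_ ?_) <;> simp [diagL_apply]

theorem PseudoRiemannianMetric.connector_natural (g : PseudoRiemannianMetric n M r s)
    {z : X} {p : X → M} {w : X → 𝕋 n} {x₀ : M}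
    (hx₀ : p z ∈ (chart n x₀).source)
    (hc : ContinuousAt p z) {f' : EX →L[ℝ] 𝔼 n × 𝕋 n}
    (hf : HasMFDerivAt I 𝓘(ℝ, 𝔼 n × 𝕋 n) (fun z' => (chart n (p z) (p z'),
      diagL (chartDeriv (p z) (p z')) (w z'))) z f')
    {P : EX →L[ℝ] 𝔼 n} (hP : HasMFDerivAt I 𝓘(ℝ, 𝔼 n) (fun z' => chart n x₀ (p z')) z P)
    {W : EX →L[ℝ] 𝕋 n} (hW : HasMFDerivAt I 𝓘(ℝ, 𝕋 n)
      (fun z' => diagL (chartDeriv x₀ (p z')) (w z')) z W) (ζ : EX) :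
    diagL (chartDeriv x₀ (p z)) (g.connector (p z) (w z) (f' ζ).1 (f' ζ).2)
      = W ζ + CoordMetric.tractorConn (g.inChart x₀) (chart n x₀ (p z)) (P ζ)
          (diagL (chartDeriv x₀ (p z)) (w z)) := by
  have hpb := g.isPullback_transition x₀ (p z)
  have hmem := extChartAt_mem_transitionDomain hx₀
  have hev : ∀ᶠ z' in 𝓝 z, p z' ∈ (chart n (p z)).source
      ∧ p z' ∈ (chart n x₀).source :=
    (hc.eventually ((isOpen_extChartAt_source _).mem_nhds (mem_extChartAt_source _))).and
      (hc.eventually ((isOpen_extChartAt_source _).mem_nhds hx₀))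
  have hP1 : HasMFDerivAt I 𝓘(ℝ, 𝔼 n) (fun z' => chart n x₀ (p z')) z
      (fderiv ℝ (transition x₀ (p z)) (chart n (p z) (p z)) ∘L
        (ContinuousLinearMap.fst ℝ (𝔼 n) 𝕋 n) ∘L f') := by
    have h1 : HasFDerivAt (fun q : (𝔼 n) × 𝕋 n => transition x₀ (p z) q.1)
      (fderiv ℝ (transition x₀ (p z)) (chart n (p z) (p z)) ∘L
        (ContinuousLinearMap.fst ℝ (𝔼 n) 𝕋 n))
      (chart n (p z) (p z), diagL (chartDeriv (p z) (p z)) (w z)) :=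
      HasFDerivAt.comp (g := transition x₀ (p z)) _ (hpb.hasFDerivAt hmem) hasFDerivAt_fst
    refine (h1.hasMFDerivAt.comp z hf).congr_of_eventuallyEq ?_
    filter_upwards [hev] with z' hz'
    exact (transition_extChartAt' hz'.1).symm
  obtain ⟨L, hL, hL'⟩ := hasFDerivAt_diagL (E := (𝔼 n) × 𝕋 n)
    (D := fun q => fderiv ℝ (transition x₀ (p z)) q.1) (w := Prod.snd)
    (y := (chart n (p z) (p z), diagL (chartDeriv (p z) (p z)) (w z)))
    (HasFDerivAt.comp (g := fderiv ℝ (transition x₀ (p z))) _ (hpb.hasFDerivAt₂ hmem)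
      hasFDerivAt_fst) hasFDerivAt_snd
  have hW1 : HasMFDerivAt I 𝓘(ℝ, 𝕋 n)
      (fun z' => diagL (chartDeriv x₀ (p z')) (w z')) z (L ∘L f') := by
    refine (hL.hasMFDerivAt.comp z hf).congr_of_eventuallyEq ?_
    filter_upwards [hev] with z' hz'
    refine Prod.ext rfl (Prod.ext ?_ rfl)
    exact chartDeriv_transition hz'.1 hz'.2 _
  have eP : P ζ = fderiv ℝ (transition x₀ (p z)) (chart n (p z) (p z))
      (f' ζ).1 := congrArg (fun F : EX →L[ℝ] 𝔼 n => F ζ) (hasMFDerivAt_unique hP hP1)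
  have eW : W ζ = L (f' ζ) :=
    congrArg (fun F : EX →L[ℝ] 𝕋 n => F ζ) (hasMFDerivAt_unique hW hW1)
  have ec : ∀ v : 𝕋 n, diagL (chartDeriv x₀ (p z)) v = diagL (fderiv ℝ
      (transition x₀ (p z)) (chart n (p z) (p z))) v := fun v =>
    Prod.ext rfl (Prod.ext (chartDeriv_eq hx₀ _) rfl)
  have es : diagL (chartDeriv (p z) (p z)) (w z) = w z :=
    Prod.ext rfl (Prod.ext (chartDeriv_self _ _) rfl)
  have e := hpb.tractorConn hmem (f' ζ).1 (w z)
  rw [transition_extChartAt] at e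
  rw [g.connector_eq, ec, eW, eP, hL', map_add, ec]
  simp only [es]
  rw [add_assoc, add_comm (0, _) (CoordMetric.tractorConn _ _ _ _)]
  exact congrArg _ e

theorem HasMFDerivAt.tractor_components {z : X} {f : X → TotalSpace 𝕋 n (Tractor n M)}
    {f' : EX →L[ℝ] 𝔼 n × 𝕋 n} (hf : HasMFDerivAt I ((𝓡 n).prod 𝓘(ℝ, 𝕋 n)) f z f') : HasMFDerivAt I
    𝓘(ℝ, 𝔼 n × 𝕋 n)
    (fun z' => (chart n (f z).proj (f z').proj, diagL (chartDeriv (f z).proj (f z').proj) (f z').2))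
    z f' := by
  have h1 : HasMFDerivAt I 𝓘(ℝ, 𝔼 n × 𝕋 n)
      (extChartAt ((𝓡 n).prod 𝓘(ℝ, 𝕋 n)) (f z) ∘ f) z f' :=
    ⟨(continuousAt_extChartAt (f z)).comp hf.1, hf.2⟩
  refine h1.congr_of_eventuallyEq ?_
  have hc : ContinuousAt (fun z' => (f z').proj) z :=
    (FiberBundle.continuous_proj 𝕋 n (Tractor n M)).continuousAt.comp hf.1
  filter_upwards [hc.eventually ((isOpen_extChartAt_source (I := 𝓡 n) _).mem_nhds
    (mem_extChartAt_source _))] with z' hz'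
  rw [Function.comp_apply, FiberBundle.extChartAt]
  refine Prod.ext ?_ (trivializationAt_tractor hz' (f z').2).symm
  change _ = chart n (f z).proj
    (trivializationAt 𝕋 n (Tractor n M) (f z).proj (f z')).1
  rw [Trivialization.coe_fst']
  rwa [baseSet_tractor]

theorem HasMFDerivAt.frame_components {V : Type*} [NormedAddCommGroup V] [NormedSpace ℝ V] {z : X}
    {f : X → TotalSpace (V →L[ℝ] 𝕋 n)
      (fun x : M => Bundle.Trivial M V x →L[ℝ] Tractor n M x)}
    {f' : EX →L[ℝ] 𝔼 n × (V →L[ℝ] 𝕋 n)}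
    (hf : HasMFDerivAt I ((𝓡 n).prod 𝓘(ℝ, V →L[ℝ] 𝕋 n)) f z f') (v : V) :
    HasMFDerivAt I 𝓘(ℝ, 𝔼 n × 𝕋 n) (fun z' => (chart n (f z).proj (f z').proj,
      diagL (chartDeriv (f z).proj (f z').proj) ((f z').2 v))) z
      (((ContinuousLinearMap.id ℝ (𝔼 n)).prodMap (ContinuousLinearMap.apply ℝ _ v)) ∘L f') := by
  have h1 : HasMFDerivAt I 𝓘(ℝ, 𝔼 n × (V →L[ℝ] 𝕋 n))
      (extChartAt ((𝓡 n).prod 𝓘(ℝ, V →L[ℝ] 𝕋 n)) (f z) ∘ f) z f' :=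
    ⟨(continuousAt_extChartAt (f z)).comp hf.1, hf.2⟩
  have h2 := (((ContinuousLinearMap.id ℝ (𝔼 n)).prodMap (ContinuousLinearMap.apply ℝ
    𝕋 n v)).hasMFDerivAt (x := (extChartAt ((𝓡 n).prod 𝓘(ℝ, V →L[ℝ] 𝕋 n)) (f z) ∘ f) z)).comp z h1
  refine h2.congr_of_eventuallyEq ?_
  have hc : ContinuousAt (fun z' => (f z').proj) z :=
    (FiberBundle.continuous_proj (V →L[ℝ] 𝕋 n)
      (fun x : M => Bundle.Trivial M V x →L[ℝ] Tractor n M x)).continuousAt.comp hf.1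
  filter_upwards [hc.eventually ((isOpen_extChartAt_source (I := 𝓡 n) _).mem_nhds
    (mem_extChartAt_source _))] with z' hz'
  refine Prod.ext ?_ (trivializationAt_frame hz' (f z').2 v).symm
  change _ = (extChartAt ((𝓡 n).prod 𝓘(ℝ, V →L[ℝ] 𝕋 n)) (f z) (f z')).1
  rw [FiberBundle.extChartAt]
  change _ = chart n (f z).proj (trivializationAt (V →L[ℝ] 𝕋 n)
    (fun x : M => Bundle.Trivial M V x →L[ℝ] Tractor n M x) (f z).proj (f z')).1
  rfl

end naturality

end tractorCharts

/-! ### Hermitian forms -/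

namespace HermitianForm

variable {W : Type*} [AddCommGroup W] [Module ℂ W]

theorem linearIndependent_of_dual {ι : Type*} [DecidableEq ι] (φ : ι → W →ₗ[ℂ] ℂ)
    {d : ι → W} {ε : ι → ℂ} (hε : ∀ i, ε i ≠ 0) (hd : ∀ i j, φ i (d j) = if i = j then ε i else 0) :
    LinearIndependent ℂ d := by
  rw [linearIndependent_iff']
  intro s c hc i hi
  have := congrArg (φ i) hc
  simp only [map_sum, map_smul, hd, smul_eq_mul, map_zero] at this
  rw [Finset.sum_eq_single i (fun j _ hj => by rw [if_neg hj.symm, mul_zero])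
    (fun h => absurd hi h), if_pos rfl] at this
  exact (mul_eq_zero.1 this).resolve_right (hε i)

theorem exists_orthonormal_basis [FiniteDimensional ℂ W] (h : W →ₗ⋆[ℂ] W →ₗ[ℂ] ℂ)
    (hh : ∀ v w, starRingEnd ℂ (h v w) = h w v) (hnd : ∀ v, (∀ w, h v w = 0) → v = 0) : ∃
    (d : Module.Basis (Fin (Module.finrank ℂ W)) ℂ W) (ε : Fin (Module.finrank ℂ W) → ℝ),
    (∀ i, ε i = 1 ∨ ε i = -1) ∧ ∀ i j, h (d i) (d j) = if i = j then (ε i : ℂ) else 0 := by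
  let b := Module.finBasis ℂ W
  let A : Matrix (Fin (Module.finrank ℂ W)) (Fin (Module.finrank ℂ W)) ℂ :=
    Matrix.of fun i j => h (b i) (b j)
  have hA : A.IsHermitian := by
    ext i j
    simp [A, Matrix.conjTranspose_apply, ← hh (b i) (b j)]
  let U : Matrix (Fin (Module.finrank ℂ W)) (Fin (Module.finrank ℂ W)) ℂ := hA.eigenvectorUnitary
  have hU : star U * A * U = Matrix.diagonal (RCLike.ofReal ∘ hA.eigenvalues) := by
    have h1 := hA.spectral_theorem
    rw [Unitary.conjStarAlgAut_apply] at h1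
    have h2 : star U * U = 1 := Unitary.coe_star_mul_self hA.eigenvectorUnitary
    conv_lhs => rw [h1]
    change star U * (U * _ * star U) * U = _
    rw [mul_assoc, mul_assoc, h2, mul_one, ← mul_assoc, h2, one_mul]
  let d₀ : Fin (Module.finrank ℂ W) → W := fun k => ∑ i, U i k • b i
  have hd₀ : ∀ k l, h (d₀ k) (d₀ l) = if k = l then (hA.eigenvalues k : ℂ) else 0 := by
    intro k l
    have h1 := congrFun (congrFun hU k) l
    rw [Matrix.diagonal_apply] at h1
    refine Eq.trans ?_ h1
    simp only [d₀, map_sum, map_smul, map_smulₛₗ, LinearMap.sum_apply, LinearMap.smul_apply,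
      smul_eq_mul, Matrix.mul_apply, Finset.sum_mul, Matrix.star_apply, A, Matrix.of_apply,
      Finset.mul_sum]
    refine Finset.sum_congr rfl fun j _ => Finset.sum_congr rfl fun i _ => ?_
    simp only [RCLike.star_def]
    ring
  have hU' : U * star U = 1 := Unitary.coe_mul_star_self hA.eigenvectorUnitary
  have hb : ∀ j, b j = ∑ k, (star U) k j • d₀ k := by
    intro j
    simp only [d₀, Finset.smul_sum, smul_smul]
    rw [Finset.sum_comm]
    have h1 : ∀ i, ∑ k, ((star U) k j * U i k) = if i = j then 1 else 0 := fun i => by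
      have := congrFun (congrFun hU' i) j
      rw [Matrix.mul_apply, Matrix.one_apply] at this
      rw [← this]
      exact Finset.sum_congr rfl fun k _ => mul_comm _ _
    simp only [← Finset.sum_smul, h1]
    simp
  have hne : ∀ k, hA.eigenvalues k ≠ 0 := by
    intro k hk
    have h0 : d₀ k = 0 := hnd _ fun w => by
      rw [← b.sum_repr w]
      simp only [map_sum, map_smul, hb, hd₀, hk]
      simp
    have h2 : ∀ i, U i k = 0 := fun i => by
      have := congrArg (fun w => b.repr w i) h0
      simpa [d₀, Finsupp.single_apply] using this
    have h3 : star U * U = 1 := Unitary.coe_star_mul_self hA.eigenvectorUnitary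
    have h4 := congrFun (congrFun h3 k) k
    rw [Matrix.mul_apply] at h4
    simp [h2] at h4
  let ε : Fin (Module.finrank ℂ W) → ℝ := fun k => SignType.sign (hA.eigenvalues k)
  let d₁ : Fin (Module.finrank ℂ W) → W := fun k => (((√|hA.eigenvalues k|)⁻¹ : ℝ) : ℂ) • d₀ k
  have hε : ∀ k, ε k = 1 ∨ ε k = -1 := fun k => by
    rcases lt_or_gt_of_ne (hne k) with h | h
    · right
      simp [ε, sign_neg h]
    · left
      simp [ε, sign_pos h]
  have hd₁ : ∀ k l, h (d₁ k) (d₁ l) = if k = l then (ε k : ℂ) else 0 := by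
    intro k l
    simp only [d₁, map_smul, map_smulₛₗ, LinearMap.smul_apply, smul_eq_mul, hd₀, Complex.conj_ofReal]
    split_ifs with hkl
    · subst hkl
      rw [← Complex.ofReal_mul, ← Complex.ofReal_mul]
      congr 1
      have hs : √|hA.eigenvalues k| ^ 2 = |hA.eigenvalues k| := Real.sq_sqrt (abs_nonneg _)
      have hs0 : √|hA.eigenvalues k| ≠ 0 := Real.sqrt_ne_zero'.2 (abs_pos.2 (hne k))
      field_simp
      rw [hs]
      exact (sign_mul_abs _).symm.trans (mul_comm _ _)
    · simp
  have hli := linearIndependent_of_dual (fun i => h (d₁ i)) (ε := fun k => (ε k : ℂ))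
    (fun i => by rcases hε i with h | h <;> simp [h]) hd₁
  refine ⟨.mk hli (hli.span_eq_top_of_card_eq_finrank' (by simp)).ge, ε, hε, fun i j => ?_⟩
  simp [hd₁]

theorem finrank_le_of_pos {A R B : Type*} [AddCommGroup A] [Module ℝ A] [AddCommGroup R] [Module ℝ R]
    [AddCommGroup B] [Module ℝ B] [FiniteDimensional ℝ B] (Q : R → ℝ)
    (f : A →ₗ[ℝ] R) (hf : ∀ a, a ≠ 0 → 0 < Q (f a)) (g : R →ₗ[ℝ] B) (hg : ∀ x, g x = 0 → Q x ≤ 0) :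
    Module.finrank ℝ A ≤ Module.finrank ℝ B := by
  refine LinearMap.finrank_le_finrank_of_injective (f := g ∘ₗ f) ?_
  rw [← LinearMap.ker_eq_bot, LinearMap.ker_eq_bot']
  intro a ha
  by_contra h
  exact absurd (hf a h) (not_lt.2 (hg _ ha))

/-- The Gram matrix of a basis that consists of a hyperbolic pair and an orthonormal basis of the
orthogonal complement. -/
def nullGram (p q : ℕ) : Fin 2 ⊕ (Fin p ⊕ Fin q) → Fin 2 ⊕ (Fin p ⊕ Fin q) → ℂ
  | .inl i, .inl j => if i = j then 0 else 1
  | .inr i, .inr j => if i = j then Sum.elim (fun _ => 1) (fun _ => -1) i else 0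
  | _, _ => 0

theorem exists_hyperbolic_partner (h : W →ₗ⋆[ℂ] W →ₗ[ℂ] ℂ)
    (hh : ∀ v w, starRingEnd ℂ (h v w) = h w v) (hnd : ∀ v, (∀ w, h v w = 0) → v = 0)
    {e : W} (he : e ≠ 0) (hee : h e e = 0) : ∃ w, h e w = 1 ∧ h w e = 1 ∧ h w w = 0 := by
  obtain ⟨w₀, hw₀⟩ : ∃ w, h e w ≠ 0 := by
    by_contra! hc
    exact he (hnd e hc)
  obtain ⟨w₁, hw₁⟩ : ∃ w, h e w = 1 := ⟨(h e w₀)⁻¹ • w₀, by simp [hw₀]⟩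
  have hw₁' : h w₁ e = 1 := by rw [← hh, hw₁, map_one]
  refine ⟨w₁ - (h w₁ w₁ / 2) • e, ?_, ?_, ?_⟩
  · simp [hee, hw₁]
  · simp [hee, hw₁']
  · have hr : starRingEnd ℂ (h w₁ w₁) = h w₁ w₁ := hh _ _
    simp only [map_sub, map_smul, map_smulₛₗ, LinearMap.sub_apply, LinearMap.smul_apply, smul_eq_mul,
      hee, hw₁, hw₁', map_div₀, hr, map_ofNat]
    ring

theorem two_mul_card_add_two_le {ι B : Type*} [Fintype ι] [DecidableEq ι] [AddCommGroup B]
    [Module ℝ B] [FiniteDimensional ℝ B] (h : W →ₗ⋆[ℂ] W →ₗ[ℂ] ℂ) {e w : W} (hee : h e e = 0)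
    (hew : h e w = 1) (hwe : h w e = 1) (hww : h w w = 0) {s : ℝ} (hs : s * s = 1) {d : ι → W}
    (hd : ∀ i j, h (d i) (d j) = if i = j then (s : ℂ) else 0) (hed : ∀ i, h e (d i) = 0)
    (hwd : ∀ i, h w (d i) = 0) (hde : ∀ i, h (d i) e = 0) (hdw : ∀ i, h (d i) w = 0) (g : W →ₗ[ℝ] B)
    (hg : ∀ x, g x = 0 → s * (h x x).re ≤ 0) : 2 * Fintype.card ι + 2 ≤ Module.finrank ℝ B := by
  let f : ℂ × (ι → ℂ) →ₗ[ℝ] W :=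
    { toFun := fun a => a.1 • (e + (s : ℂ) • w) + ∑ i, a.2 i • d i
      map_add' := fun a b => by
        simp only [Prod.fst_add, Prod.snd_add, Pi.add_apply, add_smul, Finset.sum_add_distrib]
        abel
      map_smul' := fun c a => by
        simp only [Prod.smul_fst, Prod.smul_snd, Pi.smul_apply, RingHom.id_apply, smul_add,
          Finset.smul_sum, smul_assoc] }
  have key : ∀ a, s * (h (f a) (f a)).re = 2 * Complex.normSq a.1 + ∑ i, Complex.normSq (a.2 i) := by
    intro a
    have h1 : h (f a) (f a)
        = (s * (2 * Complex.normSq a.1 + ∑ i, Complex.normSq (a.2 i) : ℝ) : ℝ) := by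
      simp only [f, LinearMap.coe_mk, AddHom.coe_mk, map_add, map_smul, map_smulₛₗ, map_sum,
        LinearMap.add_apply, LinearMap.smul_apply, LinearMap.sum_apply, smul_eq_mul, hee, hew,
        hwe, hww, hed, hwd, hde, hdw, hd, Complex.conj_ofReal]
      simp only [mul_ite, mul_zero, Finset.sum_ite_eq, Finset.sum_ite_eq', Finset.mem_univ, if_true,
        Finset.sum_const_zero, add_zero, zero_add]
      push_cast
      simp only [Complex.normSq_eq_conj_mul_self, mul_add, Finset.mul_sum]
      congr 1
      · ring
      · exact Finset.sum_congr rfl fun i _ => by ring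
    rw [h1, Complex.ofReal_re, ← mul_assoc, hs, one_mul]
  have hle := finrank_le_of_pos (fun x => s * (h x x).re) f (fun a ha => ?_) g hg
  · have : Module.finrank ℝ (ℂ × (ι → ℂ)) = 2 * Fintype.card ι + 2 := by
      rw [Module.finrank_prod, Module.finrank_pi_fintype]
      simp
      ring
    omega
  · change 0 < s * (h (f a) (f a)).re
    rw [key]
    have h1 : 0 ≤ ∑ i, Complex.normSq (a.2 i) := Finset.sum_nonneg fun i _ => Complex.normSq_nonneg _
    have h0 := Complex.normSq_nonneg a.1
    by_contra hc
    refine ha (Prod.ext (Complex.normSq_eq_zero.1 (by linarith)) (funext fun i => ?_))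
    have h2 : ∑ i, Complex.normSq (a.2 i) = 0 := by linarith
    exact Complex.normSq_eq_zero.1
      ((Finset.sum_eq_zero_iff_of_nonneg fun i _ => Complex.normSq_nonneg _).1 h2 i (Finset.mem_univ i))

theorem exists_adapted_basis [FiniteDimensional ℂ W] {B₁ B₂ : Type*} [AddCommGroup B₁] [Module ℝ B₁]
    [FiniteDimensional ℝ B₁] [AddCommGroup B₂] [Module ℝ B₂] [FiniteDimensional ℝ B₂]
    (h : W →ₗ⋆[ℂ] W →ₗ[ℂ] ℂ) (hh : ∀ v w, starRingEnd ℂ (h v w) = h w v)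
    (hnd : ∀ v, (∀ w, h v w = 0) → v = 0) {p q : ℕ} (hdim : Module.finrank ℂ W = p + q + 2)
    (g₁ : W →ₗ[ℝ] B₁) (hg₁ : ∀ x, g₁ x = 0 → (h x x).re ≤ 0) (hB₁ : Module.finrank ℝ B₁ = 2 * p + 2)
    (g₂ : W →ₗ[ℝ] B₂) (hg₂ : ∀ x, g₂ x = 0 → 0 ≤ (h x x).re) (hB₂ : Module.finrank ℝ B₂ = 2 * q + 2)
    {e : W} (he : e ≠ 0) (hee : h e e = 0) : ∃ c : Module.Basis (Fin 2 ⊕ (Fin p ⊕ Fin q)) ℂ W, c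
    (.inl 0) = e ∧ ∀ i j, h (c i) (c j) = nullGram p q i j := by
  obtain ⟨w, hew, hwe, hww⟩ := exists_hyperbolic_partner h hh hnd he hee
  let C : Submodule ℂ W := LinearMap.ker (h e) ⊓ LinearMap.ker (h w)
  have hC : ∀ x : C, h e x = 0 ∧ h w x = 0 := fun x => ⟨x.2.1, x.2.2⟩
  have hC' : ∀ x : C, h x e = 0 ∧ h x w = 0 := fun x =>
    ⟨by rw [← hh, (hC x).1, map_zero], by rw [← hh, (hC x).2, map_zero]⟩
  have hdec : ∀ y, y - h w y • e - h e y • w ∈ C := fun y =>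
    ⟨by simp [LinearMap.mem_ker, hee, hew], by simp [LinearMap.mem_ker, hww, hwe]⟩
  obtain ⟨d, ε, hε, hd⟩ := exists_orthonormal_basis (W := C)
    ((h.domRestrict₁₂ C C) : C →ₗ⋆[ℂ] C →ₗ[ℂ] ℂ) (fun v w => hh _ _) (fun x hx => by
      refine Subtype.ext (hnd _ fun y => ?_)
      have h1 : h x (y - h w y • e - h e y • w) = 0 := hx ⟨_, hdec y⟩
      simpa [hC' x] using h1)
  have hd' : ∀ i j, h (d i) (d j) = if i = j then (ε i : ℂ) else 0 := hd
  let N := Module.finrank ℂ C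
  have hε0 : ∀ i, (ε i : ℂ) ≠ 0 := fun i => by rcases hε i with h | h <;> simp [h]
  let F : Fin 2 ⊕ Fin N → W := Sum.elim ![e, w] fun i => d i
  have hli : LinearIndependent ℂ F := by
    refine linearIndependent_of_dual (Sum.elim ![h w, h e] fun i => h (d i))
      (ε := Sum.elim (fun _ => 1) fun i => ε i) ?_ ?_
    · rintro (i | i) <;> simp [hε0]
    · rintro (i | i) (j | j)
      · fin_cases i <;> fin_cases j <;> simp [F, hee, hew, hwe, hww]
      · fin_cases i <;> simp [F, hC]
      · fin_cases j <;> simp [F, hC']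
      · simp [F, hd']
  have hsp : ⊤ ≤ Submodule.span ℂ (range F) := by
    intro y _
    have h1 : y = h w y • e + h e y • w + ∑ i, d.repr ⟨_, hdec y⟩ i • (d i : W) := by
      have := congrArg (Subtype.val) (d.sum_repr ⟨_, hdec y⟩)
      simp only [Submodule.coe_sum, Submodule.coe_smul] at this
      rw [this]
      abel
    rw [h1]
    have hm : ∀ i, F i ∈ Submodule.span ℂ (range F) := fun i => Submodule.subset_span ⟨i, rfl⟩
    exact add_mem (add_mem (Submodule.smul_mem _ _ (hm (.inl 0))) (Submodule.smul_mem _ _ (hm (.inl 1))))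
      (Submodule.sum_mem _ fun i _ => Submodule.smul_mem _ _ (hm (.inr i)))
  let b := Module.Basis.mk hli hsp
  have hN : N = p + q := by
    have := Module.finrank_eq_card_basis b
    simp at this
    omega
  have hgr : ∀ (s : ℝ) (i j : {i // ε i = s}), h (d i) (d j) = if i = j then (s : ℂ) else 0 := by
    intro s i j
    rw [hd', i.2]
    simp [Subtype.ext_iff]
  have hpos := two_mul_card_add_two_le h hee hew hwe hww (one_mul 1)
    (d := fun i : {i // ε i = 1} => (d i : W)) (hgr 1) (fun i => (hC _).1) (fun i => (hC _).2)
    (fun i => (hC' _).1) (fun i => (hC' _).2) g₁ (by simpa using hg₁)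
  have hneg := two_mul_card_add_two_le h hee hew hwe hww (by norm_num : (-1 : ℝ) * (-1) = 1)
    (d := fun i : {i // ε i = -1} => (d i : W)) (hgr (-1)) (fun i => (hC _).1) (fun i => (hC _).2)
    (fun i => (hC' _).1) (fun i => (hC' _).2) g₂ (by simpa using hg₂)
  rw [hB₁] at hpos
  rw [hB₂] at hneg
  have hiff : ∀ i, ¬ε i = 1 ↔ ε i = -1 := fun i => by
    rcases hε i with h | h <;> rw [h] <;> norm_num
  have hcard : Fintype.card {i // ε i = 1} + Fintype.card {i // ε i = -1} = p + q := by
    rw [← hN, ← Fintype.card_congr (Equiv.subtypeEquivRight hiff), ← Fintype.card_sum,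
      Fintype.card_congr (Equiv.sumCompl fun i => ε i = 1)]
    simp [N]
  let σ₁ : Fin p ≃ {i // ε i = 1} := (Fintype.equivFinOfCardEq (by omega)).symm
  let σ₂ : Fin q ≃ {i // ε i = -1} := (Fintype.equivFinOfCardEq (by omega)).symm
  let σ : Fin p ⊕ Fin q ≃ Fin N := (σ₁.sumCongr (σ₂.trans (Equiv.subtypeEquivRight hiff).symm)).trans
    (Equiv.sumCompl fun i => ε i = 1)
  have hσ : ∀ i, (ε (σ i) : ℂ) = Sum.elim (fun _ => 1) (fun _ => -1) i := by
    rintro (i | i)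
    · have : ε (σ (.inl i)) = 1 := (σ₁ i).2
      rw [this]
      simp
    · have : ε (σ (.inr i)) = -1 := (σ₂ i).2
      rw [this]
      simp
  refine ⟨b.reindex ((Equiv.refl _).sumCongr σ).symm, ?_, ?_⟩
  · simp [b, F]
  · rintro (i | i) (j | j)
    · fin_cases i <;> fin_cases j <;> simp [b, F, hee, hew, hwe, hww, nullGram]
    · fin_cases i <;> simp [b, F, hC, nullGram]
    · fin_cases j <;> simp [b, F, hC', nullGram]
    · simp [b, F, hd', hσ, nullGram]

end HermitianForm

/-! ### Top exterior powers -/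

section exterior

variable {m : ℕ} {V W : Type*} [AddCommGroup V] [Module ℂ V] [AddCommGroup W] [Module ℂ W]

theorem ιMulti_eq_det_smul (b : Module.Basis (Fin m) ℂ V) (v : Fin m → V) :
    exteriorPower.ιMulti ℂ m v = b.det v • exteriorPower.ιMulti ℂ m b := by
  let A : V [⋀^Fin m]→ₗ[ℂ] ⋀[ℂ]^m V :=
    (LinearMap.toSpanSingleton ℂ _ (exteriorPower.ιMulti ℂ m b)).compAlternatingMap b.det
  have h : exteriorPower.ιMulti ℂ m = A := by
    refine Module.Basis.ext_alternating b fun σ hσ => ?_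
    let τ : Equiv.Perm (Fin m) := Equiv.ofBijective σ (Finite.injective_iff_bijective.1 hσ)
    have e : (fun i => b (σ i)) = fun i => b (τ i) := rfl
    have h1 : exteriorPower.ιMulti ℂ m (fun i => b (τ i)) = Equiv.Perm.sign τ • exteriorPower.ιMulti ℂ m b :=
      AlternatingMap.map_perm _ b τ
    have h2 : A (fun i => b (τ i)) = Equiv.Perm.sign τ • A b := AlternatingMap.map_perm _ b τ
    rw [e, h1, h2]
    simp [A, b.det_self]
  exact DFunLike.congr_fun h v

theorem ιMulti_basis_ne_zero (b : Module.Basis (Fin m) ℂ V) : exteriorPower.ιMulti ℂ m b ≠ 0 := by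
  intro h
  have := congrArg (exteriorPower.alternatingMapLinearEquiv b.det) h
  rw [exteriorPower.alternatingMapLinearEquiv_apply_ιMulti, map_zero, b.det_self] at this
  exact one_ne_zero this

theorem exists_eq_smul_ιMulti (b : Module.Basis (Fin m) ℂ V) (η : ⋀[ℂ]^m V) :
    ∃ c : ℂ, η = c • exteriorPower.ιMulti ℂ m b := by
  have h : η ∈ Submodule.span ℂ (range (exteriorPower.ιMulti ℂ m (M := V))) := by
    rw [exteriorPower.ιMulti_span]
    trivial
  induction h using Submodule.span_induction with
  | mem x hx =>
    obtain ⟨v, rfl⟩ := hx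
    exact ⟨_, ιMulti_eq_det_smul b v⟩
  | zero => exact ⟨0, by simp⟩
  | add x y _ _ hx hy =>
    obtain ⟨c, rfl⟩ := hx
    obtain ⟨d, rfl⟩ := hy
    exact ⟨c + d, by rw [add_smul]⟩
  | smul a x _ hx =>
    obtain ⟨c, rfl⟩ := hx
    exact ⟨a * c, by rw [mul_smul]⟩

theorem exists_basis_ιMulti_eq (hm : m ≠ 0) (b : Module.Basis (Fin m) ℂ V) {η : ⋀[ℂ]^m V}
    (hη : η ≠ 0) : ∃ b' : Module.Basis (Fin m) ℂ V, exteriorPower.ιMulti ℂ m b' = η := by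
  obtain ⟨c, hc⟩ := exists_eq_smul_ιMulti b η
  have hc0 : c ≠ 0 := by
    rintro rfl
    exact hη (by rw [hc, zero_smul])
  have : NeZero m := ⟨hm⟩
  let w : Fin m → ℂˣ := Function.update 1 0 (Units.mk0 c hc0)
  refine ⟨b.unitsSMul w, ?_⟩
  rw [ιMulti_eq_det_smul b, Module.Basis.det_unitsSMul_self, hc]
  congr 1
  simp only [w]
  rw [Finset.prod_eq_single 0 (fun i _ hi => by simp [hi]) (by simp)]
  simp

theorem ιMulti_comp_eq (b : Module.Basis (Fin m) ℂ V) (u : V →ₗ[ℂ] W) (f : Fin m → V) :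
    exteriorPower.ιMulti ℂ m (fun i => u (f i)) = b.det f • exteriorPower.ιMulti ℂ m
    (fun i => u (b i)) := by
  have h1 := exteriorPower.map_apply_ιMulti u f
  have h2 := exteriorPower.map_apply_ιMulti u b
  rw [ιMulti_eq_det_smul b f, map_smul, h2] at h1
  exact h1.symm

theorem ιMulti_comp_ne_zero (b : Module.Basis (Fin m) ℂ V) (u : V ≃ₗ[ℂ] W) :
    exteriorPower.ιMulti ℂ m (fun i => u (b i)) ≠ 0 := by
  have e : (fun i => u (b i)) = ⇑(b.map u) := by
    funext i
    simp
  rw [e]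
  exact ιMulti_basis_ne_zero _

end exterior

/-! ### Adapted frames at a point -/

namespace CplxOf

variable {T : Type*} [AddCommGroup T] [Module ℝ T] {J : Module.End ℝ T} {hJ : J * J = -1}

/-- The identity, as a real linear equivalence. -/
def realEquiv (J : Module.End ℝ T) (hJ : J * J = -1) : T ≃ₗ[ℝ] CplxOf J hJ where
  toFun v := v
  invFun v := v
  map_add' _ _ := rfl
  map_smul' c v := by
    change (c • v : T) = (show T from (c : ℂ) • (show CplxOf J hJ from v))
    rw [CplxOf.smul_def]
    simp
  left_inv _ := rfl
  right_inv _ := rfl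

theorem realEquiv_J (v : T) : realEquiv J hJ (J v) = Complex.I • realEquiv J hJ v := by
  have := CplxOf.smul_def J hJ Complex.I v
  simp at this
  exact this.symm

theorem form_skew {B : T →ₗ[ℝ] T →ₗ[ℝ] ℝ} (hB : ∀ v w, B (J v) (J w) = B v w) (hJ : J * J = -1)
    (v w : T) : B (J v) w = -B v (J w) := by
  have h := hB (J v) w
  have h2 : J (J v) = -v := congrArg (fun f : Module.End ℝ T => f v) hJ
  rw [h2, map_neg, LinearMap.neg_apply] at h
  linarith

/-- The values of the Hermitian form that extends a `J`-invariant real bilinear form. -/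
def hermValue (J : Module.End ℝ T) (B : T →ₗ[ℝ] T →ₗ[ℝ] ℝ) (v w : T) : ℂ :=
  (B v w : ℂ) - Complex.I * (B v (J w) : ℂ)

theorem hermValue_smul_left {B : T →ₗ[ℝ] T →ₗ[ℝ] ℝ} (hB : ∀ v w, B (J v) (J w) = B v w)
    (hJ : J * J = -1) (z : ℂ) (v w : T) :
    hermValue J B (z.re • v + z.im • J v) w = starRingEnd ℂ z * hermValue J B v w := by
  simp only [hermValue, map_add, map_smul, LinearMap.add_apply, LinearMap.smul_apply,
    smul_eq_mul, form_skew hB hJ]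
  have h2 : J (J w) = -w := congrArg (fun f : Module.End ℝ T => f w) hJ
  rw [h2, map_neg]
  apply Complex.ext <;> simp <;> ring

theorem hermValue_smul_right (B : T →ₗ[ℝ] T →ₗ[ℝ] ℝ) (hJ : J * J = -1) (z : ℂ) (v w : T) :
    hermValue J B v (z.re • w + z.im • J w) = z * hermValue J B v w := by
  have h2 : J (J w) = -w := congrArg (fun f : Module.End ℝ T => f w) hJ
  simp only [hermValue, map_add, map_smul, smul_eq_mul, h2, map_neg]
  apply Complex.ext <;> simp <;> ring

/-- The Hermitian form that extends a `J`-invariant real bilinear form. -/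
def hermForm (B : T →ₗ[ℝ] T →ₗ[ℝ] ℝ) (hB : ∀ v w, B (J v) (J w) = B v w) :
    CplxOf J hJ →ₗ⋆[ℂ] CplxOf J hJ →ₗ[ℂ] ℂ :=
  LinearMap.mk₂'ₛₗ _ _ (fun v w => hermValue J B v w)
    (fun v v' w => by
      refine (?_ : ∀ v v' w : T, hermValue J B (v + v') w = hermValue J B v w + hermValue J B v' w)
        v v' w
      intro v v' w
      simp only [hermValue, map_add, LinearMap.add_apply]
      push_cast
      ring)
    (fun z v w => (congrArg (fun t : T => hermValue J B t w) (CplxOf.smul_def J hJ z v)).trans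
      (hermValue_smul_left hB hJ z v w))
    (fun v w w' => by
      refine (?_ : ∀ v w w' : T, hermValue J B v (w + w') = hermValue J B v w + hermValue J B v w')
        v w w'
      intro v w w'
      simp only [hermValue, map_add]
      push_cast
      ring)
    (fun z v w => (congrArg (fun t : T => hermValue J B v t) (CplxOf.smul_def J hJ z w)).trans
      (hermValue_smul_right B hJ z v w))

theorem hermForm_apply (B : T →ₗ[ℝ] T →ₗ[ℝ] ℝ) (hB : ∀ v w, B (J v) (J w) = B v w) (v w : T) :
    hermForm (hJ := hJ) B hB (realEquiv J hJ v) (realEquiv J hJ w)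
      = (B v w : ℂ) - Complex.I * (B v (J w) : ℂ) := rfl

end CplxOf

namespace HermitianForm

theorem gram_det_ne_zero {m : ℕ} {W : Type*} [AddCommGroup W] [Module ℂ W] (h : W →ₗ⋆[ℂ] W →ₗ[ℂ] ℂ)
    (hh : ∀ v w, starRingEnd ℂ (h v w) = h w v) (hnd : ∀ v, (∀ w, h v w = 0) → v = 0)
    (b : Module.Basis (Fin m) ℂ W) : (Matrix.of fun i j => h (b i) (b j)).det ≠ 0 := by
  intro h0
  obtain ⟨x, hx, hx0⟩ := Matrix.exists_mulVec_eq_zero_iff.2 h0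
  have h1 : ∀ i, h (b i) (∑ j, x j • b j) = 0 := fun i => by
    have := congrFun hx0 i
    simp only [Matrix.mulVec, dotProduct, Matrix.of_apply, Pi.zero_apply] at this
    rw [map_sum, ← this]
    exact Finset.sum_congr rfl fun j _ => by rw [map_smul, smul_eq_mul, mul_comm]
  have h2 : (∑ j, x j • b j) = 0 := by
    refine hnd _ fun w => ?_
    have h3 : h (∑ j, x j • b j) = 0 := b.ext fun i => by
      rw [← hh, h1, map_zero]
      rfl
    rw [h3]
    rfl
  exact hx (funext fun i => (Fintype.linearIndependent_iff.1 b.linearIndependent) x h2 i)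

theorem form_eq_of_basis {ι W W' : Type*} [AddCommGroup W] [Module ℂ W]
    [AddCommGroup W'] [Module ℂ W'] (h : W →ₗ⋆[ℂ] W →ₗ[ℂ] ℂ) (h' : W' →ₗ⋆[ℂ] W' →ₗ[ℂ] ℂ)
    (u : W →ₗ[ℂ] W') (b : Module.Basis ι ℂ W) (hb : ∀ i j, h' (u (b i)) (u (b j)) = h (b i) (b j))
    (v w : W) : h' (u v) (u w) = h v w := by
  have e : ((h'.comp u).compl₂ u : W →ₗ⋆[ℂ] W →ₗ[ℂ] ℂ) = h :=
    b.ext fun i => b.ext fun j => hb i j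
  exact congrArg (fun f : W →ₗ⋆[ℂ] W →ₗ[ℂ] ℂ => f v w) e

theorem nullGram_unitsSMul {p q : ℕ} {W : Type*} [AddCommGroup W] [Module ℂ W]
    (h : W →ₗ⋆[ℂ] W →ₗ[ℂ] ℂ) (c : Module.Basis (Fin 2 ⊕ (Fin p ⊕ Fin q)) ℂ W)
    (hc : ∀ i j, h (c i) (c j) = nullGram p q i j) (k : Fin p ⊕ Fin q) (z : ℂˣ)
    (hz : starRingEnd ℂ (z : ℂ) * z = 1) (i j : Fin 2 ⊕ (Fin p ⊕ Fin q)) : h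
    (c.unitsSMul (Function.update 1 (.inr k) z) i) (c.unitsSMul (Function.update 1 (.inr k) z) j) =
    nullGram p q i j := by
  rw [Module.Basis.unitsSMul_apply, Module.Basis.unitsSMul_apply, Units.smul_def, Units.smul_def,
    map_smul, map_smulₛₗ, LinearMap.smul_apply, smul_eq_mul, smul_eq_mul, hc,
    mul_left_comm]
  by_cases hi : i = .inr k <;> by_cases hj : j = .inr k
  · subst hi hj
    rw [Function.update_self, ← mul_assoc, hz, one_mul]
  · subst hi
    have : nullGram p q (.inr k) j = 0 := by
      rcases j with j | j
      · rfl
      · simp only [nullGram]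
        rw [if_neg (fun h => hj (by rw [h]))]
    rw [this, mul_zero, mul_zero]
  · subst hj
    have : nullGram p q i (.inr k) = 0 := by
      rcases i with i | i
      · rfl
      · simp only [nullGram]
        rw [if_neg (fun h => hi (by rw [h]))]
    rw [this, mul_zero, mul_zero]
  · simp [hi, hj]

end HermitianForm

namespace HermitianModel

variable {p q : ℕ} (𝓥 : HermitianModel p q)

theorem exists_spanning : ∃ v₀ : ModelV p q, v₀ ≠ 0 ∧ 𝓥.LR = Submodule.span ℝ {v₀} := by
  obtain ⟨v, hv, h⟩ := finrank_eq_one_iff'.1 𝓥.finrank_LR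
  refine ⟨v, fun h => hv (Subtype.ext h), le_antisymm (fun w hw => ?_) ?_⟩
  · obtain ⟨c, hc⟩ := h ⟨w, hw⟩
    exact Submodule.mem_span_singleton.2 ⟨c, congrArg Subtype.val hc⟩
  · rw [Submodule.span_singleton_le_iff_mem]
    exact v.2

theorem nondegenerate (v : ModelV p q) (hv : ∀ w, 𝓥.H v w = 0) : v = 0 := by
  obtain ⟨b, hb⟩ := 𝓥.signature
  refine b.ext_elem fun i => ?_
  have h := congrArg (starRingEnd ℂ) (hv (b i))
  rw [𝓥.hermitian, ← b.sum_repr v, map_sum] at h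
  simp only [map_smul, hb, smul_eq_mul, mul_ite, mul_zero, Finset.sum_ite_eq, Finset.mem_univ,
    if_true, map_zero] at h
  rcases i with i | i <;> simpa using h

theorem apply_self {b : Module.Basis (Fin (p + 1) ⊕ Fin (q + 1)) ℂ (ModelV p q)}
    (hb : ∀ i j, 𝓥.H (b i) (b j) = if i = j then Sum.elim (fun _ => 1) (fun _ => -1) i else 0)
    (v : ModelV p q) : (𝓥.H v v).re = ∑ i, Complex.normSq (b.repr v (.inl i)) - ∑ i, Complex.normSq
    (b.repr v (.inr i)) := by
  have h : 𝓥.H v v = ∑ i, starRingEnd ℂ (b.repr v i) * (b.repr v i *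
      Sum.elim (fun _ => 1) (fun _ => -1) i) := by
    conv_lhs => rw [← b.sum_repr v]
    simp only [map_sum, map_smulₛₗ, LinearMap.sum_apply, LinearMap.smul_apply, map_smul, hb,
      smul_eq_mul, mul_ite, mul_zero, Finset.sum_ite_eq, Finset.mem_univ, if_true, RingHom.id_apply,
      Finset.sum_ite_eq']
    exact Finset.sum_congr rfl fun i _ => mul_left_comm _ _ _
  rw [h, Fintype.sum_sum_type]
  simp [Complex.normSq_apply, Finset.sum_neg_distrib]
  ring

theorem exists_adapted_basis {v₀ : ModelV p q} (hv₀ : v₀ ≠ 0) (h0 : 𝓥.H v₀ v₀ = 0) : ∃ c :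
    Module.Basis (Fin 2 ⊕ (Fin p ⊕ Fin q)) ℂ (ModelV p q), c (.inl 0) = v₀ ∧ ∀ i j, 𝓥.H (c i) (c j)
    = HermitianForm.nullGram p q i j := by
  obtain ⟨b, hb⟩ := 𝓥.signature
  let R : (Fin (p + 1) ⊕ Fin (q + 1) → ℂ) →ₗ[ℝ] (Fin (p + 1) ⊕ Fin (q + 1) → ℂ) := LinearMap.id
  let f : ModelV p q →ₗ[ℝ] (Fin (p + 1) ⊕ Fin (q + 1) → ℂ) :=
    (b.equivFun : ModelV p q →ₗ[ℂ] _).restrictScalars ℝ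
  have hf : ∀ v i, f v i = b.repr v i := fun _ _ => rfl
  refine HermitianForm.exists_adapted_basis 𝓥.H 𝓥.hermitian 𝓥.nondegenerate (by simp)
    ((LinearMap.funLeft ℝ ℂ Sum.inl).comp f) ?_ ?_ ((LinearMap.funLeft ℝ ℂ Sum.inr).comp f) ?_ ?_
    hv₀ h0
  · intro x hx
    have h1 : ∀ i, b.repr x (.inl i) = 0 := fun i => congrFun hx i
    rw [𝓥.apply_self hb]
    simp only [h1, map_zero, Finset.sum_const_zero, zero_sub, neg_nonpos]
    exact Finset.sum_nonneg fun i _ => Complex.normSq_nonneg _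
  · simp [Module.finrank_pi_fintype]
    ring
  · intro x hx
    have h1 : ∀ i, b.repr x (.inr i) = 0 := fun i => congrFun hx i
    rw [𝓥.apply_self hb]
    simp only [h1, map_zero, Finset.sum_const_zero, sub_zero]
    exact Finset.sum_nonneg fun i _ => Complex.normSq_nonneg _
  · simp [Module.finrank_pi_fintype]
    ring

theorem exists_vol_basis : ∃ b : Module.Basis (Fin (p + q + 2)) ℂ (ModelV p q),
    exteriorPower.ιMulti ℂ (p + q + 2) b = 𝓥.vol :=
  exists_basis_ιMulti_eq (by omega) (EuclideanSpace.basisFun _ ℂ).toBasis 𝓥.vol_ne_zero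

theorem exists_isometry (hpq : 1 ≤ p + q) {W : Type*} [AddCommGroup W] [Module ℂ W]
    (h : W →ₗ⋆[ℂ] W →ₗ[ℂ] ℂ) (c : Module.Basis (Fin 2 ⊕ (Fin p ⊕ Fin q)) ℂ W)
    (hc : ∀ i j, h (c i) (c j) = HermitianForm.nullGram p q i j)
    (η : ⋀[ℂ]^(p + q + 2) W) 
    (hnorm : ∀ (v : Fin (p + q + 2) → ModelV p q) (w : Fin (p + q + 2) → W),
      exteriorPower.ιMulti ℂ (p + q + 2) v = 𝓥.vol → exteriorPower.ιMulti ℂ (p + q + 2) w = η →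
      (Matrix.of fun i j => h (w i) (w j)).det = (Matrix.of fun i j => 𝓥.H (v i) (v j)).det)
    {v₀ : ModelV p q} (hv₀ : v₀ ≠ 0) (h0 : 𝓥.H v₀ v₀ = 0) :
    ∃ u : ModelV p q ≃ₗ[ℂ] W, (∀ v w, h (u v) (u w) = 𝓥.H v w) ∧ u v₀ = c (.inl 0) ∧
      exteriorPower.map (p + q + 2) (u : ModelV p q →ₗ[ℂ] W) 𝓥.vol = η := by
  obtain ⟨b, hb0, hb⟩ := 𝓥.exists_adapted_basis hv₀ h0
  obtain ⟨b₁, hb₁⟩ := 𝓥.exists_vol_basis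
  let u₁ : ModelV p q ≃ₗ[ℂ] W := b.equiv c (Equiv.refl _)
  have hu₁ : ∀ v w, h (u₁ v) (u₁ w) = 𝓥.H v w :=
    HermitianForm.form_eq_of_basis 𝓥.H h u₁ b fun i j => by simp [u₁, hc, hb]
  obtain ⟨z, hz⟩ := exists_eq_smul_ιMulti (b₁.map u₁) η
  let a : Fin (p + q + 2) → ℂ := Function.update 1 0 z
  have ha : ∏ i, a i = z := by
    rw [Finset.prod_eq_single 0 (fun i _ hi => by simp [a, hi]) (by simp)]
    simp [a]
  have h1 := hnorm b₁ (fun i => a i • u₁ (b₁ i)) hb₁ (by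
    have h2 := (exteriorPower.ιMulti ℂ (p + q + 2) (M := W)).map_smul_univ a (fun i => u₁ (b₁ i))
    rw [ha] at h2
    rw [h2, hz]
    rfl)
  have h2 : (Matrix.of fun i j => h (a i • u₁ (b₁ i)) (a j • u₁ (b₁ j))).det
      = starRingEnd ℂ z * (z * (Matrix.of fun i j => 𝓥.H (b₁ i) (b₁ j)).det) := by
    rw [← ha, ← Matrix.det_mul_row, map_prod, ← Matrix.det_mul_column]
    congr 1
    ext i j
    simp [hu₁, mul_left_comm]
  have hG := HermitianForm.gram_det_ne_zero 𝓥.H 𝓥.hermitian 𝓥.nondegenerate b₁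
  have hzz : starRingEnd ℂ z * z = 1 := by
    rw [h2, ← mul_assoc] at h1
    exact mul_right_cancel₀ hG (h1.trans (one_mul _).symm)
  have hz0 : z ≠ 0 := by
    rintro rfl
    simp at hzz
  obtain ⟨k⟩ : Nonempty (Fin p ⊕ Fin q) := by
    rcases Nat.eq_zero_or_pos p with hp | hp
    · exact ⟨.inr ⟨0, by omega⟩⟩
    · exact ⟨.inl ⟨0, hp⟩⟩
  let b' := b.unitsSMul (Function.update 1 (.inr k) (Units.mk0 z hz0))
  have hb' : ∀ i j, 𝓥.H (b' i) (b' j) = HermitianForm.nullGram p q i j :=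
    HermitianForm.nullGram_unitsSMul 𝓥.H b hb k (Units.mk0 z hz0) hzz
  let S : ModelV p q ≃ₗ[ℂ] ModelV p q := b.equiv b' (Equiv.refl _)
  have hS : LinearMap.det (S : ModelV p q →ₗ[ℂ] ModelV p q) = z := by
    have h3 := b.det_comp (S : ModelV p q →ₗ[ℂ] ModelV p q) b
    have h4 : (S : ModelV p q →ₗ[ℂ] ModelV p q) ∘ b = b' := by
      funext i
      simp [S]
    rw [h4, b.det_self, mul_one, Module.Basis.det_unitsSMul_self] at h3
    rw [← h3, Finset.prod_eq_single (.inr k) (fun i _ hi => by simp [hi]) (by simp)]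
    simp
  refine ⟨S.trans u₁, fun v w => ?_, ?_, ?_⟩
  · have h3 := HermitianForm.form_eq_of_basis 𝓥.H 𝓥.H S b
      (fun i j => by simp [S, hb, hb']) v w
    exact (hu₁ _ _).trans h3
  · rw [← hb0]
    have h3 : b' (.inl 0) = b (.inl 0) := by
      simp only [b']
      rw [Module.Basis.unitsSMul_apply, Function.update_of_ne (by simp), Pi.one_apply, one_smul]
    rw [LinearEquiv.trans_apply, Module.Basis.equiv_apply, Equiv.refl_apply, h3,
      Module.Basis.equiv_apply, Equiv.refl_apply]
  · have h3 := exteriorPower.map_apply_ιMulti (S.trans u₁ : ModelV p q →ₗ[ℂ] W) b₁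
    rw [hb₁] at h3
    have h4 := ιMulti_comp_eq b₁ (u₁ : ModelV p q →ₗ[ℂ] W) (fun i => S (b₁ i))
    have h5 := b₁.det_comp (S : ModelV p q →ₗ[ℂ] ModelV p q) b₁
    rw [b₁.det_self, mul_one, hS] at h5
    have h6 : b₁.det (fun i => S (b₁ i)) = z := h5
    rw [h6] at h4
    refine h3.trans (h4.trans ?_)
    rw [hz]
    rfl

end HermitianModel

namespace CplxOf

variable {T : Type*} [AddCommGroup T] [Module ℝ T] {J : Module.End ℝ T} {hJ : J * J = -1}

theorem finrank_eq : 2 * Module.finrank ℂ (CplxOf J hJ) = Module.finrank ℝ T := by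
  rw [← finrank_real_of_complex]
  exact (realEquiv J hJ).finrank_eq.symm

theorem exists_adapted_basis {n p q : ℕ} {r s : ℕ} (hr : r = 2 * p + 1) (hs : s = 2 * q + 1)
    (β : 𝔼 n →L[ℝ] 𝔼 n →L[ℝ] ℝ) (hsymm : ∀ a b, β a b = β b a)
    (hsig : ∃ b : Module.Basis (Fin r ⊕ Fin s) ℝ (𝔼 n),
      ∀ i j, β (b i) (b j) = if i = j then Sum.elim (fun _ => 1) (fun _ => -1) i else 0)
    (J : Module.End ℝ 𝕋 n) (hJ : J * J = -1)
    (B : 𝕋 n →ₗ[ℝ] 𝕋 n →ₗ[ℝ] ℝ)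
    (hBβ : ∀ v w, B v w = v.1 * w.2.2 + v.2.2 * w.1 + β v.2.1 w.2.1)
    (hB : ∀ v w, B (J v) (J w) = B v w) :
    ∃ c : Module.Basis (Fin 2 ⊕ (Fin p ⊕ Fin q)) ℂ (CplxOf J hJ),
      c (.inl 0) = realEquiv J hJ (0, 0, 1) ∧
      ∀ i j, hermForm B hB (c i) (c j) = HermitianForm.nullGram p q i j := by
  obtain ⟨b, hb⟩ := hsig
  have hβ : ∀ v : (𝔼 n), β v v = ∑ i, b.repr v (.inl i) ^ 2 - ∑ i, b.repr v (.inr i) ^ 2 := by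
    intro v
    have h1 : β v v = ∑ i, b.repr v i * (b.repr v i * Sum.elim (fun _ => 1) (fun _ => -1) i) := by
      conv_lhs => rw [← b.sum_repr v]
      simp only [map_sum, map_smul, ContinuousLinearMap.sum_apply, smul_apply, hb,
        smul_eq_mul, mul_ite, mul_zero, Finset.sum_ite_eq, Finset.mem_univ, if_true,
        Finset.sum_ite_eq']
    rw [h1, Fintype.sum_sum_type]
    simp [Finset.sum_neg_distrib, sq]
    ring
  have hnondeg : ∀ v : (𝔼 n), (∀ w, β v w = 0) → v = 0 := by
    intro v hv
    refine b.ext_elem fun i => ?_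
    have h := hv (b i)
    rw [← b.sum_repr v, map_sum] at h
    simp only [map_smul, ContinuousLinearMap.sum_apply, smul_apply, hb, smul_eq_mul, mul_ite,
      mul_zero, Finset.sum_ite_eq', Finset.mem_univ, if_true] at h
    rcases i with i | i <;> simpa using h
  have hn : n = r + s := by
    have := Module.finrank_eq_card_basis b
    simpa using this
  have hBs : ∀ v w, B v w = B w v := fun v w => by rw [hBβ, hBβ, hsymm]; ring
  have hdimT : Module.finrank ℝ 𝕋 n = n + 2 := by
    simp [TractorFibre, Module.finrank_prod]
    ring
  have : FiniteDimensional ℝ (CplxOf J hJ) := Module.Finite.equiv (realEquiv J hJ)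
  have : FiniteDimensional ℂ (CplxOf J hJ) := FiniteDimensional.right ℝ ℂ _
  have hself : ∀ v : 𝕋 n, (hermForm (hJ := hJ) B hB (realEquiv J hJ v)
      (realEquiv J hJ v)).re = B v v := fun v => by
    rw [hermForm_apply]
    simp
  have hBv : ∀ v : 𝕋 n, B v v = 2 * (v.1 * v.2.2) + (∑ i, b.repr v.2.1 (.inl i) ^ 2
      - ∑ i, b.repr v.2.1 (.inr i) ^ 2) := fun v => by
    rw [hBβ, hβ]
    ring
  let f : 𝕋 n →ₗ[ℝ] (Fin r ⊕ Fin s → ℝ) :=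
    (b.equivFun : 𝔼 n →ₗ[ℝ] _) ∘ₗ LinearMap.fst ℝ (𝔼 n) ℝ ∘ₗ LinearMap.snd ℝ ℝ ((𝔼 n) × ℝ)
  let σ : 𝕋 n →ₗ[ℝ] ℝ := LinearMap.fst ℝ ℝ ((𝔼 n) × ℝ)
  let ρ : 𝕋 n →ₗ[ℝ] ℝ := LinearMap.snd ℝ (𝔼 n) ℝ ∘ₗ LinearMap.snd ℝ ℝ ((𝔼 n) × ℝ)
  refine HermitianForm.exists_adapted_basis (hermForm B hB) ?_ ?_ ?_
    ((((LinearMap.funLeft ℝ ℝ Sum.inl).comp f).prod (σ + ρ)) ∘ₗ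
      ((realEquiv J hJ).symm : CplxOf J hJ →ₗ[ℝ] 𝕋 n)) ?_ ?_
    ((((LinearMap.funLeft ℝ ℝ Sum.inr).comp f).prod (σ - ρ)) ∘ₗ
      ((realEquiv J hJ).symm : CplxOf J hJ →ₗ[ℝ] 𝕋 n)) ?_ ?_ ?_ ?_
  · intro v w
    obtain ⟨v, rfl⟩ := (realEquiv J hJ).surjective v
    obtain ⟨w, rfl⟩ := (realEquiv J hJ).surjective w
    have h1 := form_skew hB hJ w v
    rw [hBs] at h1
    rw [hermForm_apply, hermForm_apply, h1, hBs w v]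
    apply Complex.ext <;> simp
  · intro v hv
    obtain ⟨v, rfl⟩ := (realEquiv J hJ).surjective v
    have h1 : ∀ w, B v w = 0 := fun w => by
      have := congrArg Complex.re (hv (realEquiv J hJ w))
      rw [hermForm_apply] at this
      simpa using this
    have h2 : v = 0 := by
      refine Prod.ext ?_ (Prod.ext (hnondeg _ fun w => ?_) ?_)
      · simpa [hBβ] using h1 (0, 0, 1)
      · simpa [hBβ] using h1 (0, w, 0)
      · simpa [hBβ] using h1 (1, 0, 0)
    rw [h2, map_zero]
  · have := finrank_eq (J := J) (hJ := hJ)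
    omega
  · intro v hv
    obtain ⟨v, rfl⟩ := (realEquiv J hJ).surjective v
    have h1 : ∀ i, b.repr v.2.1 (.inl i) = 0 := fun i => congrFun (congrArg Prod.fst hv) i
    have h2 : v.1 + v.2.2 = 0 := congrArg Prod.snd hv
    rw [hself, hBv, eq_neg_of_add_eq_zero_left h2]
    simp only [h1]
    have := Finset.sum_nonneg fun (i : Fin s) (_ : i ∈ Finset.univ) => sq_nonneg (b.repr v.2.1 (.inr i))
    norm_num
    nlinarith [sq_nonneg v.2.2]
  · simp [hr]
  · intro v hv
    obtain ⟨v, rfl⟩ := (realEquiv J hJ).surjective v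
    have h1 : ∀ i, b.repr v.2.1 (.inr i) = 0 := fun i => congrFun (congrArg Prod.fst hv) i
    have h2 : v.1 - v.2.2 = 0 := congrArg Prod.snd hv
    rw [hself, hBv, sub_eq_zero.1 h2]
    simp only [h1]
    have := Finset.sum_nonneg fun (i : Fin r) (_ : i ∈ Finset.univ) => sq_nonneg (b.repr v.2.1 (.inl i))
    norm_num
    nlinarith [sq_nonneg v.2.2]
  · simp [hs]
  · intro h
    have h2 := (realEquiv J hJ).injective (h.trans (map_zero _).symm)
    exact one_ne_zero (congrArg (fun t : 𝕋 n => t.2.2) h2)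
  · have h1 : B (0, 0, 1) (0, 0, 1) = 0 := by simp [hBβ]
    have h2 := form_skew hB hJ (0, 0, 1) (0, 0, 1)
    rw [hBs] at h2
    have h3 : B (0, 0, 1) (J (0, 0, 1)) = 0 := by linarith
    rw [hermForm_apply, h1, h3]
    simp

end CplxOf

theorem CplxOf.exists_frame {p q n r s : ℕ} (hpq : 1 ≤ p + q) (hr : r = 2 * p + 1) (hs : s = 2 * q + 1)
    (β : 𝔼 n →L[ℝ] 𝔼 n →L[ℝ] ℝ)
    (hsymm : ∀ a b, β a b = β b a)
    (hsig : ∃ b : Module.Basis (Fin r ⊕ Fin s) ℝ (𝔼 n),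
      ∀ i j, β (b i) (b j) = if i = j then Sum.elim (fun _ => 1) (fun _ => -1) i else 0)
    (J : Module.End ℝ 𝕋 n) (hJ : J * J = -1) (B : 𝕋 n → 𝕋 n → ℝ)
    (hBβ : ∀ v w, B v w = v.1 * w.2.2 + v.2.2 * w.1 + β v.2.1 w.2.1)
    (hB : ∀ v w, B (J v) (J w) = B v w) {𝓥 : HermitianModel p q}
    (η : ⋀[ℂ]^(p + q + 2) (CplxOf J hJ))
    (hη : ∀ (v : Fin (p + q + 2) → ModelV p q) (w : Fin (p + q + 2) → CplxOf J hJ),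
      exteriorPower.ιMulti ℂ (p + q + 2) v = 𝓥.vol → exteriorPower.ιMulti ℂ (p + q + 2) w = η →
      (Matrix.of fun i j => ((B (w i) (w j) : ℂ) - Complex.I * (B (w i) (J (w j)) : ℂ))).det
        = (Matrix.of fun i j => 𝓥.H (v i) (v j)).det)
    {v₀ : ModelV p q} (hv₀ : v₀ ≠ 0) (h0 : 𝓥.H v₀ v₀ = 0) :
    ∃ u : ModelV p q →L[ℝ] 𝕋 n,
      (∀ v w, B (u v) (u w) = (𝓥.H v w).re) ∧ u v₀ = (0, 0, 1) ∧
      ∃ hu : ∀ v : ModelV p q, u (Complex.I • v) = J (u v),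
        exteriorPower.map (p + q + 2) (CplxOf.lift J hJ (u : ModelV p q →ₗ[ℝ] 𝕋 n) hu)
          𝓥.vol = η := by
  let B' : 𝕋 n →ₗ[ℝ] 𝕋 n →ₗ[ℝ] ℝ := LinearMap.mk₂ ℝ
    (fun v w => v.1 * w.2.2 + v.2.2 * w.1 + β v.2.1 w.2.1)
    (fun _ _ _ => by simp; ring) (fun _ _ _ => by simp; ring)
    (fun _ _ _ => by simp; ring) (fun _ _ _ => by simp; ring)
  obtain rfl : B = fun v w => B' v w := funext fun v => funext fun w => hBβ v w
  clear_value B'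
  obtain ⟨c, hc0, hc⟩ := CplxOf.exists_adapted_basis (p := p) (q := q) hr hs β hsymm hsig J hJ B' hBβ hB
  obtain ⟨u, hu1, hu2, hu3⟩ := 𝓥.exists_isometry hpq (CplxOf.hermForm B' hB) c hc η hη hv₀ h0
  let u' : ModelV p q →ₗ[ℝ] 𝕋 n := ((CplxOf.realEquiv J hJ).symm : _ →ₗ[ℝ] 𝕋 n)
    ∘ₗ (u : ModelV p q →ₗ[ℂ] CplxOf J hJ).restrictScalars ℝ
  have hre : ∀ v, CplxOf.realEquiv J hJ (u' v) = u v := fun v => rfl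
  refine ⟨LinearMap.toContinuousLinearMap u', fun v w => ?_, ?_, fun v => ?_, ?_⟩
  · have h1 := congrArg Complex.re (hu1 v w)
    rw [← hre, ← hre, CplxOf.hermForm_apply] at h1
    simp at h1
    exact h1
  · exact hu2.trans hc0
  · have h1 : u' (Complex.I • v) = J (u' v) := by
      refine (CplxOf.realEquiv J hJ).injective ?_
      rw [hre, map_smul, CplxOf.realEquiv_J, hre]
    exact h1
  · exact hu3

theorem ParallelVolume.exists_frame {p q : ℕ} (hpq : 1 ≤ p + q) {M : Type*} [TopologicalSpace M]
    [ChartedSpace (𝔼 (2 * p + 2 * q + 2)) M]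
    [IsManifold (𝓡 (2 * p + 2 * q + 2)) ∞ M]
    {g : PseudoRiemannianMetric (2 * p + 2 * q + 2) M (2 * p + 1) (2 * q + 1)}
    {𝕁 : ParallelComplexStructure g} (ν : ParallelVolume 𝕁) {𝓥 : HermitianModel p q}
    (hν : ν.IsNormalized 𝓥) (x : M) {v₀ : ModelV p q} (hv₀ : v₀ ≠ 0) (h0 : 𝓥.H v₀ v₀ = 0) :
    ∃ u : ModelV p q →L[ℝ] Tractor (2 * p + 2 * q + 2) M x,
      (∀ v w, g.tractorMetric x (u v) (u w) = (𝓥.H v w).re) ∧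
      u v₀ = ((0 : ℝ), ((0 : TangentSpace (𝓡 (2 * p + 2 * q + 2)) x), (1 : ℝ))) ∧
      ∃ hu : ∀ v : ModelV p q, u (Complex.I • v) = 𝕁.J x (u v),
        exteriorPower.map (p + q + 2)
          (CplxOf.lift (𝕁.J x : Tractor (2 * p + 2 * q + 2) M x →ₗ[ℝ] Tractor (2 * p + 2 * q + 2) M x)
            (𝕁.mul_self x) (u : ModelV p q →ₗ[ℝ] Tractor (2 * p + 2 * q + 2) M x) hu) 𝓥.vol
          = ν.ν x := by
  exact CplxOf.exists_frame hpq rfl rfl (g.form x) (g.symm x) (g.signature x) _ (𝕁.mul_self x)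
    (g.tractorMetric x) (fun _ _ => rfl) (𝕁.orthogonal x) (ν.ν x) (hν x) hv₀ h0

/-! ### Unitary connections on trivial bundles -/

theorem HermitianModel.re_nondegenerate {p q : ℕ} (𝓥 : HermitianModel p q) (v : ModelV p q)
    (hv : ∀ w, (𝓥.H v w).re = 0) : v = 0 := by
  refine 𝓥.nondegenerate v fun w => Complex.ext (hv w) ?_
  have h := hv (Complex.I • w)
  simpa using h

/-- The data of the standard tractor bundle with a parallel complex structure and a parallel
complex volume form, in a trivialisation over an open set: a connection `d + A`, a metric `h`, a
complex structure `J`, sections `s i` that represent the volume form, the canonical null section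
`e`, and the soldering `ι` of `T¹^⊥ / T¹` with left inverse `pr`. -/
structure TractorChart {p q : ℕ} (𝓥 : HermitianModel p q) (E T : Type*) [NormedAddCommGroup E]
    [NormedSpace ℝ E] [NormedAddCommGroup T] [NormedSpace ℝ T] where
  Ω : Set E
  A : E → E →L[ℝ] T →L[ℝ] T
  h : E → T →L[ℝ] T →L[ℝ] ℝ
  J : E → T →L[ℝ] T
  b : Module.Basis (Fin (p + q + 2)) ℂ (ModelV p q)
  s : Fin (p + q + 2) → E → T
  e : T
  ι : E →L[ℝ] T
  pr : T →L[ℝ] E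
  isOpen : IsOpen Ω
  finrank_eq : Module.finrank ℝ (ModelV p q) = Module.finrank ℝ T
  smooth_A : ContDiffOn ℝ ∞ A Ω
  smooth_h : ContDiffOn ℝ ∞ h Ω
  smooth_J : ContDiffOn ℝ ∞ J Ω
  smooth_s : ∀ i, ContDiffOn ℝ ∞ (s i) Ω
  h_symm : ∀ y ∈ Ω, ∀ v w, h y v w = h y w v
  h_nondegenerate : ∀ y ∈ Ω, ∀ v, (∀ w, h y v w = 0) → v = 0
  h_parallel : ∀ y ∈ Ω, ∀ X v w, fderiv ℝ h y X v w = h y (A y X v) w + h y v (A y X w)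
  J_sq : ∀ y ∈ Ω, ∀ v, J y (J y v) = -v
  J_orthogonal : ∀ y ∈ Ω, ∀ v w, h y (J y v) (J y w) = h y v w
  J_parallel : ∀ y ∈ Ω, ∀ X v, fderiv ℝ J y X v + A y X (J y v) = J y (A y X v)
  s_parallel : ∀ y ∈ Ω, ∀ X, ∀ τ : ModelV p q →L[ℝ] T, Function.Injective τ →
    (∀ v, τ (Complex.I • v) = J y (τ v)) → ∀ f f' : Fin (p + q + 2) → ModelV p q,
    (∀ i, τ (f i) = s i y) → (∀ i, τ (f' i) = fderiv ℝ (s i) y X + A y X (s i y)) →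
    ∑ i, b.det (Function.update f i (f' i)) = 0
  A_e : ∀ y ∈ Ω, ∀ X, A y X e = ι X
  pr_e : pr e = 0
  pr_ι : ∀ X, pr (ι X) = X
  h_e_e : ∀ y ∈ Ω, h y e e = 0
  eq_of_perp : ∀ y ∈ Ω, ∀ t, h y e t = 0 → ∃ c : ℝ, t = ι (pr t) + c • e
  curv_kappa : ∀ y ∈ Ω, ∀ X v, curvL A y (pr (J y e)) X v = 0

theorem Module.Basis.hasFDerivAt_det {m : ℕ} {V E : Type*} [NormedAddCommGroup V] [NormedSpace ℂ V]
    [FiniteDimensional ℂ V] [NormedAddCommGroup E] [NormedSpace ℝ E] (b : Module.Basis (Fin m) ℂ V)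
    {f : E → Fin m → V} {f' : Fin m → E →L[ℝ] V} {y : E}
    (hf : ∀ i, HasFDerivAt (fun z => f z i) (f' i) y) : ∃ L : E →L[ℝ] ℂ, HasFDerivAt
    (fun z => b.det (f z)) L y ∧ ∀ X, L X = ∑ i, b.det (Function.update (f y) i (f' i X)) := by
  let D : ContinuousMultilinearMap ℝ (fun _ : Fin m => V) ℂ :=
    { (b.det.toMultilinearMap.restrictScalars ℝ) with
      cont := by
        change Continuous fun v => b.det v
        have h1 : ∀ i, Continuous fun x : V => b.repr x i := fun i =>
          LinearMap.continuous_of_finiteDimensional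
            ((LinearMap.proj i : (Fin m → ℂ) →ₗ[ℂ] ℂ) ∘ₗ (b.equivFun : V →ₗ[ℂ] _))
        simp only [Module.Basis.det_apply]
        refine Continuous.matrix_det (continuous_matrix fun i j => ?_)
        exact (h1 i).comp (continuous_apply j) }
  have hD : ∀ v, D v = b.det v := fun v => rfl
  refine ⟨_, HasFDerivAt.multilinear_comp D hf, fun X => ?_⟩
  simp only [← hD]
  simp [ContinuousMultilinearMap.toContinuousLinearMap_apply]

theorem Module.Basis.det_eq_of_deriv {m : ℕ} {V : Type*} [NormedAddCommGroup V] [NormedSpace ℂ V]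
    [FiniteDimensional ℂ V] (b : Module.Basis (Fin m) ℂ V) {S : Set ℝ} (hS : IsOpen S)
    (hS' : IsPreconnected S) {f f' : ℝ → Fin m → V}
    (hf : ∀ t ∈ S, ∀ i, HasDerivAt (fun t => f t i) (f' t i) t)
    (h0 : ∀ t ∈ S, ∑ i, b.det (Function.update (f t) i (f' t i)) = 0) {t t' : ℝ} (ht : t ∈ S)
    (ht' : t' ∈ S) : b.det (f t) = b.det (f t') := by
  have key : ∀ t ∈ S, HasDerivAt (fun t => b.det (f t)) 0 t := by
    intro t ht
    obtain ⟨L, hL, hL'⟩ := b.hasFDerivAt_det fun i => (hf t ht i).hasFDerivAt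
    refine hL.hasDerivAt.congr_deriv ?_
    rw [hL', ← h0 t ht]
    simp
  exact hS.is_const_of_deriv_eq_zero hS' (fun t ht => (key t ht).differentiableAt.differentiableWithinAt)
    (fun t ht => (key t ht).deriv) ht ht'

namespace TractorChart

variable {p q : ℕ} {𝓥 : HermitianModel p q} {E T : Type*} [NormedAddCommGroup E]
    [NormedSpace ℝ E] [NormedAddCommGroup T] [NormedSpace ℝ T] (C : TractorChart 𝓥 E T)

/-- The special unitary frames at `y`. -/
structure IsFrame (y : E) (τ : ModelV p q →L[ℝ] T) : Prop where
  isometry : ∀ v w, C.h y (τ v) (τ w) = (𝓥.H v w).re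
  complex : ∀ v, τ (Complex.I • v) = C.J y (τ v)
  unimodular : ∃ f, (∀ i, τ (f i) = C.s i y) ∧ C.b.det f = 1

variable {C}

theorem injective_of_isometry {y : E} {τ : ModelV p q →L[ℝ] T}
    (h : ∀ v w, C.h y (τ v) (τ w) = (𝓥.H v w).re) : Function.Injective τ := by
  rw [injective_iff_map_eq_zero]
  intro v hv
  refine 𝓥.re_nondegenerate v fun w => ?_
  rw [← h, hv, map_zero, zero_apply]

variable [FiniteDimensional ℝ T] 

theorem isInvertible_of_injective (C : TractorChart 𝓥 E T) {τ : ModelV p q →L[ℝ] T} (hτ : Function.Injective τ) :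
    τ.IsInvertible :=
  ⟨(LinearMap.linearEquivOfInjective (τ : ModelV p q →ₗ[ℝ] T) hτ
    C.finrank_eq).toContinuousLinearEquiv, by ext v; rfl⟩

theorem isInvertible_of_isometry {y : E} {τ : ModelV p q →L[ℝ] T}
    (h : ∀ v w, C.h y (τ v) (τ w) = (𝓥.H v w).re) : τ.IsInvertible :=
  C.isInvertible_of_injective (injective_of_isometry h)

theorem IsFrame.isInvertible {y : E} {τ : ModelV p q →L[ℝ] T} (h : C.IsFrame y τ) : τ.IsInvertible := isInvertible_of_isometry h.isometry

theorem hasDerivAt_inverse_apply {V : Type*} [NormedAddCommGroup V] [NormedSpace ℝ V]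
    [FiniteDimensional ℝ V] {τ : ℝ → V →L[ℝ] T} {τ' : V →L[ℝ] T} {w : ℝ → T} {w' : T} {t : ℝ}
    (hτ : HasDerivAt τ τ' t) (hw : HasDerivAt w w' t) (hi : (τ t).IsInvertible) : HasDerivAt
    (fun t => (τ t).inverse (w t)) ((τ t).inverse (w' - τ' ((τ t).inverse (w t)))) t := by
  have : CompleteSpace V := FiniteDimensional.complete ℝ V
  obtain ⟨d, hd⟩ : ∃ d, HasDerivAt (fun t => (τ t).inverse (w t)) d t := by
    have h1 : DifferentiableAt ℝ (fun t => (τ t).inverse) t :=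
      ((ContinuousLinearMap.IsInvertible.contDiffAt_map_inverse (n := 1) hi).differentiableAt
        (by simp)).comp t hτ.differentiableAt
    exact ⟨_, (h1.hasDerivAt.clm_apply hw)⟩
  have h2 := hτ.clm_apply hd
  have h3 : (fun t => τ t ((τ t).inverse (w t))) =ᶠ[𝓝 t] w := by
    have : ∀ᶠ t' in 𝓝 t, (τ t').IsInvertible :=
      hτ.continuousAt.eventually (ContinuousLinearEquiv.isOpen.mem_nhds hi)
    filter_upwards [this] with t' h'
    exact h'.self_apply_inverse _
  have h4 := (h2.congr_of_eventuallyEq h3.symm).unique hw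
  have h5 : d = (τ t).inverse (w' - τ' ((τ t).inverse (w t))) := by
    rw [← h4, add_sub_cancel_left, hi.inverse_apply_self]
  exact h5 ▸ hd

theorem IsFrame.transport {S : Set ℝ} (hS : IsOpen S) (hS' : IsPreconnected S) {γ γ' : ℝ → E}
    {τ : ℝ → ModelV p q →L[ℝ] T} (hγ : ∀ t ∈ S, HasDerivAt γ (γ' t) t) (hΩ : ∀ t ∈ S, γ t ∈ C.Ω)
    (hτ : ∀ t ∈ S, HasDerivAt τ (-(C.A (γ t) (γ' t)).comp (τ t)) t) {t₀ t : ℝ} (ht₀ : t₀ ∈ S)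
    (h0 : C.IsFrame (γ t₀) (τ t₀)) (ht : t ∈ S) : C.IsFrame (γ t) (τ t) := by
  have hder : ∀ {F : Type _} [NormedAddCommGroup F] [NormedSpace ℝ F] {f : E → F},
      ContDiffOn ℝ ∞ f C.Ω → ∀ t ∈ S, HasDerivAt (fun t => f (γ t)) (fderiv ℝ f (γ t) (γ' t)) t :=
    fun hf t ht => (((hf.differentiableOn (by simp)).differentiableAt
      (C.isOpen.mem_nhds (hΩ t ht))).hasFDerivAt).comp_hasDerivAt t (hγ t ht)
  have hτv : ∀ v, ∀ t ∈ S, HasDerivAt (fun t => τ t v) (-C.A (γ t) (γ' t) (τ t v)) t :=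
    fun v t ht => by
      simpa using (hτ t ht).clm_apply (hasDerivAt_const t v)
  have h1 : ∀ v w, ∀ t ∈ S, C.h (γ t) (τ t v) (τ t w) = (𝓥.H v w).re := by
    intro v w t ht
    rw [← h0.isometry]
    have hd : ∀ t ∈ S, HasDerivAt (fun t => C.h (γ t) (τ t v) (τ t w)) 0 t := fun t ht => by
      have := ((hder C.smooth_h t ht).clm_apply (hτv v t ht)).clm_apply (hτv w t ht)
      refine this.congr_deriv ?_
      simp [C.h_parallel _ (hΩ t ht)]
    exact hS.is_const_of_deriv_eq_zero hS'
      (fun t ht => (hd t ht).differentiableAt.differentiableWithinAt)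
      (fun t ht => (hd t ht).deriv) ht ht₀
  have hinv : ∀ t ∈ S, (τ t).IsInvertible := fun t ht =>
    isInvertible_of_isometry (C := C) (y := γ t) fun v w => h1 v w t ht
  have h2 : ∀ v, ∀ t ∈ S, τ t (Complex.I • v) = C.J (γ t) (τ t v) := by
    intro v t ht
    rw [← sub_eq_zero]
    refine C.h_nondegenerate _ (hΩ t ht) _ fun w => ?_
    obtain ⟨w, rfl⟩ := (hinv t ht).surjective w
    rw [map_sub, sub_apply, sub_eq_zero, h1 _ _ t ht, ← h0.isometry, h0.complex]
    symm
    have hd : ∀ t ∈ S, HasDerivAt (fun t => C.h (γ t) (C.J (γ t) (τ t v)) (τ t w)) 0 t :=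
      fun t ht => by
        have := ((hder C.smooth_h t ht).clm_apply ((hder C.smooth_J t ht).clm_apply
          (hτv v t ht))).clm_apply (hτv w t ht)
        refine this.congr_deriv ?_
        have h3 := C.J_parallel _ (hΩ t ht) (γ' t) (τ t v)
        simp only [C.h_parallel _ (hΩ t ht), add_apply, map_neg, ← h3, map_add, neg_apply]
        ring
    exact hS.is_const_of_deriv_eq_zero hS'
      (fun t ht => (hd t ht).differentiableAt.differentiableWithinAt)
      (fun t ht => (hd t ht).deriv) ht ht₀
  refine ⟨fun v w => h1 v w t ht, fun v => h2 v t ht,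
    fun i => (τ t).inverse (C.s i (γ t)), fun i => (hinv t ht).self_apply_inverse _, ?_⟩
  obtain ⟨f, hf, hf1⟩ := h0.unimodular
  have hff : f = fun i => (τ t₀).inverse (C.s i (γ t₀)) := funext fun i => by
    rw [← hf, (hinv t₀ ht₀).inverse_apply_self]
  rw [← hf1, hff]
  have hd : ∀ t ∈ S, ∀ i, HasDerivAt (fun t => (τ t).inverse (C.s i (γ t))) _ t := fun t ht i =>
    hasDerivAt_inverse_apply (hτ t ht) (hder (C.smooth_s i) t ht) (hinv t ht)
  refine C.b.det_eq_of_deriv hS hS' hd (fun t ht => ?_) ht ht₀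
  refine C.s_parallel _ (hΩ t ht) (γ' t) (τ t) (hinv t ht).injective (fun v => h2 v t ht) _ _
    (fun i => (hinv t ht).self_apply_inverse _) fun i => ?_
  rw [(hinv t ht).self_apply_inverse]
  simp [(hinv t ht).self_apply_inverse]

end TractorChart

theorem LinearMap.det_one_add_of_isNilpotent {K V : Type*} [Field K] [AddCommGroup V] [Module K V]
    [FiniteDimensional K V] {N : Module.End K V} (hN : IsNilpotent N) : LinearMap.det (1 + N) = 1 := by
  have h1 := LinearMap.eval_charpoly N (-1)
  rw [hN.charpoly_eq_X_pow_finrank, Polynomial.eval_pow, Polynomial.eval_X] at h1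
  have h2 : algebraMap K (Module.End K V) (-1) - N = (-1 : K) • (1 + N) := by
    rw [Algebra.algebraMap_eq_smul_one, neg_smul, neg_smul, one_smul, one_smul]
    abel
  rw [h2, LinearMap.det_smul] at h1
  exact mul_left_cancel₀ (pow_ne_zero _ (neg_ne_zero.2 one_ne_zero)) (h1.symm.trans (mul_one _).symm)

theorem HasDerivAt.fst_comp {F G : Type*} [NormedAddCommGroup F] [NormedSpace ℝ F]
    [NormedAddCommGroup G] [NormedSpace ℝ G] {f : ℝ → F × G} {f' : F × G} {t : ℝ}
    (h : HasDerivAt f f' t) : HasDerivAt (fun t => (f t).1) f'.1 t :=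
  (ContinuousLinearMap.fst ℝ F G).hasFDerivAt.comp_hasDerivAt t h

theorem HasDerivAt.snd_comp {F G : Type*} [NormedAddCommGroup F] [NormedSpace ℝ F]
    [NormedAddCommGroup G] [NormedSpace ℝ G] {f : ℝ → F × G} {f' : F × G} {t : ℝ}
    (h : HasDerivAt f f' t) : HasDerivAt (fun t => (f t).2) f'.2 t :=
  (ContinuousLinearMap.snd ℝ F G).hasFDerivAt.comp_hasDerivAt t h

namespace HermitianModel

variable {p q : ℕ} (𝓥 : HermitianModel p q)

/-- The Hermitian form as a real bilinear map. -/
def hermL : ModelV p q →L[ℝ] ModelV p q →L[ℝ] ℂ :=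
  LinearMap.toContinuousLinearMap (LinearMap.toContinuousLinearMap.toLinearMap ∘ₗ
    LinearMap.mk₂ ℝ (fun v w => 𝓥.H v w) (fun _ _ _ => by simp)
      (fun c v w => by
        have hc : (c • v : ModelV p q) = (c : ℂ) • v := (Complex.coe_smul c v).symm
        rw [hc, map_smulₛₗ]
        simp)
      (fun _ _ _ => by simp)
      (fun c v w => by
        have hc : (c • w : ModelV p q) = (c : ℂ) • w := (Complex.coe_smul c w).symm
        rw [hc, map_smul]
        simp))

theorem hermL_apply (v w : ModelV p q) : 𝓥.hermL v w = 𝓥.H v w := rfl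

theorem eq_zero_of_re {v : ModelV p q} (h : (𝓥.H v v).re = 0) : 𝓥.H v v = 0 := by
  have h1 := congrArg Complex.im (𝓥.hermitian v v)
  rw [Complex.conj_im] at h1
  exact Complex.ext h (by simp; linarith)

/-- The component of `v` that is orthogonal to the hyperbolic pair `v₀`, `w₀`, when
`H(w₀, v) = 1`. -/
def orthComp (v₀ w₀ v : ModelV p q) : ModelV p q := v - v₀ - 𝓥.H v₀ v • w₀

/-- The nilpotent part of the Siegel transformation which maps `v₀` to `v` and fixes `w₀`. -/
def siegelN (v₀ w₀ v : ModelV p q) : ModelV p q →ₗ[ℂ] ModelV p q :=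
  (𝓥.H w₀).smulRight (v - v₀) - (𝓥.H (𝓥.orthComp v₀ w₀ v)).smulRight w₀

theorem siegelN_apply (v₀ w₀ v x : ModelV p q) : 𝓥.siegelN v₀ w₀ v x
    = 𝓥.H w₀ x • (v - v₀) - 𝓥.H (𝓥.orthComp v₀ w₀ v) x • w₀ := rfl

theorem contDiff_siegel (v₀ w₀ z : ModelV p q) : ContDiff ℝ ∞ fun v => z + 𝓥.siegelN v₀ w₀ v z := by
  have h1 : ContDiff ℝ ∞ fun v : ModelV p q => v - v₀ := contDiff_id.sub contDiff_const
  have h2 : ContDiff ℝ ∞ fun v => 𝓥.hermL v₀ v := (𝓥.hermL v₀).contDiff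
  have h3 : ContDiff ℝ ∞ fun v => 𝓥.hermL v₀ v • w₀ := h2.smul contDiff_const
  have h4 : ContDiff ℝ ∞ fun v => 𝓥.hermL (v - v₀ - 𝓥.hermL v₀ v • w₀) z :=
    (𝓥.hermL.contDiff.comp (h1.sub h3)).clm_apply contDiff_const
  exact contDiff_const.add ((contDiff_const.smul h1).sub (h4.smul contDiff_const))

section siegel

variable {𝓥} {v₀ w₀ v : ModelV p q}

theorem siegelN_eq_orthComp (x : ModelV p q) : 𝓥.siegelN v₀ w₀ v x
    = 𝓥.H w₀ x • (𝓥.orthComp v₀ w₀ v + 𝓥.H v₀ v • w₀) - 𝓥.H (𝓥.orthComp v₀ w₀ v) x • w₀ := by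
  rw [siegelN_apply, orthComp]
  congr 2
  abel

theorem herm_orthComp_left (h00 : 𝓥.H v₀ v₀ = 0) (h01 : 𝓥.H v₀ w₀ = 1) :
    𝓥.H v₀ (𝓥.orthComp v₀ w₀ v) = 0 := by
  simp [orthComp, h00, h01]

theorem herm_orthComp_right (h10 : 𝓥.H w₀ v₀ = 1) (h11 : 𝓥.H w₀ w₀ = 0) (hw : 𝓥.H w₀ v = 1) :
    𝓥.H w₀ (𝓥.orthComp v₀ w₀ v) = 0 := by
  simp [orthComp, h10, h11, hw]

theorem siegelN_isometry (h00 : 𝓥.H v₀ v₀ = 0) (h01 : 𝓥.H v₀ w₀ = 1) (h10 : 𝓥.H w₀ v₀ = 1)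
    (h11 : 𝓥.H w₀ w₀ = 0) (hv : 𝓥.H v v = 0) (hw : 𝓥.H w₀ v = 1) (x y : ModelV p q) : 𝓥.H
    (x + 𝓥.siegelN v₀ w₀ v x) (y + 𝓥.siegelN v₀ w₀ v y) = 𝓥.H x y := by
  have e1 := herm_orthComp_left (v := v) h00 h01
  have e2 := herm_orthComp_right h10 h11 hw
  have hdec : v = v₀ + 𝓥.orthComp v₀ w₀ v + 𝓥.H v₀ v • w₀ := by
    rw [orthComp]
    abel
  rw [siegelN_eq_orthComp, siegelN_eq_orthComp]
  have hcz : 𝓥.H v₀ v = 𝓥.H v₀ v := rfl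
  generalize 𝓥.H v₀ v = z at *
  generalize 𝓥.orthComp v₀ w₀ v = k at *
  have e1' : 𝓥.H k v₀ = 0 := by rw [← 𝓥.hermitian, e1, map_zero]
  have e2' : 𝓥.H k w₀ = 0 := by rw [← 𝓥.hermitian, e2, map_zero]
  have hx : starRingEnd ℂ (𝓥.H w₀ x) = 𝓥.H x w₀ := 𝓥.hermitian _ _
  have hx' : starRingEnd ℂ (𝓥.H k x) = 𝓥.H x k := 𝓥.hermitian _ _
  have hz : 𝓥.H k k + z + starRingEnd ℂ z = 0 := by
    rw [hdec] at hv
    simp only [map_add, LinearMap.add_apply, map_smulₛₗ, LinearMap.smul_apply, smul_eq_mul,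
      RingHom.id_apply, h00, h01, h10, h11, e1, e2, e1', e2'] at hv
    linear_combination hv
  simp only [map_add, map_sub, LinearMap.add_apply, LinearMap.sub_apply, map_smulₛₗ,
    LinearMap.smul_apply, smul_eq_mul, RingHom.id_apply, h11, e2, e2', hx, hx']
  linear_combination 𝓥.H x w₀ * 𝓥.H w₀ y * hz

theorem siegelN_isNilpotent (h10 : 𝓥.H w₀ v₀ = 1) (h11 : 𝓥.H w₀ w₀ = 0) (hw : 𝓥.H w₀ v = 1) :
    IsNilpotent (𝓥.siegelN v₀ w₀ v : Module.End ℂ (ModelV p q)) := by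
  have e2 := herm_orthComp_right h10 h11 hw
  have e2' : 𝓥.H (𝓥.orthComp v₀ w₀ v) w₀ = 0 := by rw [← 𝓥.hermitian, e2, map_zero]
  refine ⟨3, LinearMap.ext fun x => ?_⟩
  change 𝓥.siegelN v₀ w₀ v (𝓥.siegelN v₀ w₀ v (𝓥.siegelN v₀ w₀ v x)) = 0
  simp only [siegelN_eq_orthComp, map_add, map_sub, map_smul, smul_eq_mul, h11, e2, e2']
  simp

theorem siegelN_self (h00 : 𝓥.H v₀ v₀ = 0) (h01 : 𝓥.H v₀ w₀ = 1) (h10 : 𝓥.H w₀ v₀ = 1) :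
    v₀ + 𝓥.siegelN v₀ w₀ v v₀ = v := by
  have e1 := herm_orthComp_left (v := v) h00 h01
  have e1' : 𝓥.H (𝓥.orthComp v₀ w₀ v) v₀ = 0 := by rw [← 𝓥.hermitian, e1, map_zero]
  rw [siegelN_apply, h10, e1']
  simp

end siegel

end HermitianModel

namespace TractorChart

variable {p q : ℕ} {𝓥 : HermitianModel p q} {E T : Type*} [NormedAddCommGroup E]
    [NormedSpace ℝ E] [NormedAddCommGroup T] [NormedSpace ℝ T] {C : TractorChart 𝓥 E T}

theorem IsFrame.comp {y : E} {τ : ModelV p q →L[ℝ] T} (h : C.IsFrame y τ)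
    {a : ModelEnd p q} (ha : ∀ v w, 𝓥.H (a v) (a w) = 𝓥.H v w)
    (hdet : LinearMap.det (a : ModelV p q →ₗ[ℂ] ModelV p q) = 1) :
    C.IsFrame y (τ.comp (a.restrictScalars ℝ)) := by
  refine ⟨fun v w => ?_, fun v => ?_, ?_⟩
  · simp [h.isometry, ha]
  · simp [h.complex]
  · obtain ⟨f, hf, hf1⟩ := h.unimodular
    have hu : IsUnit (a : ModelV p q →ₗ[ℂ] ModelV p q) :=
      (LinearMap.isUnit_iff_isUnit_det _).2 (by rw [hdet]; exact isUnit_one)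
    have hs := ((Module.End.isUnit_iff _).1 hu).surjective
    choose g hg using fun i => hs (f i)
    refine ⟨g, fun i => ?_, ?_⟩
    · rw [← hf, ← hg]
      rfl
    · have h1 := C.b.det_comp (a : ModelV p q →ₗ[ℂ] ModelV p q) g
      rw [hdet, one_mul] at h1
      rw [← h1, ← hf1]
      congr 1
      exact funext hg

variable [FiniteDimensional ℝ E] [FiniteDimensional ℝ T]

theorem exists_frame_field {y₀ : E} (hy₀ : y₀ ∈ C.Ω) {u₀ : ModelV p q →L[ℝ] T}
    (hu₀ : C.IsFrame y₀ u₀) : ∃ (O : Set E) (τ : E → ModelV p q →L[ℝ] T), IsOpen O ∧ y₀ ∈ O ∧ O ⊆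
    C.Ω ∧ ContDiffOn ℝ ∞ τ O ∧ τ y₀ = u₀ ∧ ∀ y ∈ O, C.IsFrame y (τ y) := by
  let Z : E × E × (ModelV p q →L[ℝ] T) → E × E × (ModelV p q →L[ℝ] T) := fun z =>
    (z.2.1, 0, -(C.A z.1 z.2.1).comp z.2.2)
  have hZ : ContDiffOn ℝ ∞ Z (C.Ω ×ˢ univ) := by
    have h1 : ContDiffOn ℝ ∞ (fun z : E × E × (ModelV p q →L[ℝ] T) => C.A z.1) (C.Ω ×ˢ univ) :=
      C.smooth_A.comp contDiffOn_fst fun z hz => hz.1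
    exact (contDiff_fst.comp contDiff_snd).contDiffOn.prodMk (contDiffOn_const.prodMk
      ((h1.clm_apply (contDiff_fst.comp contDiff_snd).contDiffOn).clm_comp
        (contDiff_snd.comp contDiff_snd).contDiffOn).neg)
  obtain ⟨Θ, O, hO, hmem, hsm, hΩ, hinit, hder⟩ := exists_smooth_flow (C.isOpen.prod isOpen_univ) hZ
    (x₀ := (y₀, 0, u₀)) ⟨hy₀, trivial⟩
  obtain ⟨ε, hε, hεO⟩ := Metric.isOpen_iff.1 hO _ hmem
  have hin : ∀ X : E, ‖X‖ < ε → ∀ t ∈ Metric.ball (0 : ℝ) ε, (t, y₀, X, u₀) ∈ O := by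
    intro X hX t ht
    refine hεO ?_
    rw [← ball_prod_same, ← ball_prod_same, ← ball_prod_same]
    exact ⟨ht, Metric.mem_ball_self hε, by simpa using hX, Metric.mem_ball_self hε⟩
  have hball : IsPreconnected (Metric.ball (0 : ℝ) ε) := (convex_ball _ _).isPreconnected
  have h0 : (0 : ℝ) ∈ Metric.ball (0 : ℝ) ε := Metric.mem_ball_self hε
  have hX : ∀ X : E, ‖X‖ < ε → ∀ t ∈ Metric.ball (0 : ℝ) ε, (Θ (t, y₀, X, u₀)).2.1 = X := by
    intro X hX t ht
    have hd : ∀ t ∈ Metric.ball (0 : ℝ) ε, HasDerivAt (fun t => (Θ (t, y₀, X, u₀)).2.1) 0 t :=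
      fun t ht => (hder _ (hin X hX t ht)).snd_comp.fst_comp
    have h1 := Metric.isOpen_ball.is_const_of_deriv_eq_zero hball
      (fun t ht => (hd t ht).differentiableAt.differentiableWithinAt)
      (fun t ht => (hd t ht).deriv) ht h0
    rw [h1, hinit _ (hin X hX 0 h0)]
  have hY : ∀ X : E, ‖X‖ < ε → ∀ t ∈ Metric.ball (0 : ℝ) ε,
      (Θ (t, y₀, X, u₀)).1 = y₀ + t • X := by
    intro X hX' t ht
    have hd : ∀ t ∈ Metric.ball (0 : ℝ) ε,
        HasDerivAt (fun t => (Θ (t, y₀, X, u₀)).1 - t • X) 0 t := fun t ht => by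
      have h1 : HasDerivAt (fun t => (Θ (t, y₀, X, u₀)).1) X t :=
        (hder _ (hin X hX' t ht)).fst_comp.congr_deriv (hX X hX' t ht)
      refine (h1.sub ((hasDerivAt_id t).smul_const X)).congr_deriv ?_
      simp
    have h1 := Metric.isOpen_ball.is_const_of_deriv_eq_zero hball
      (fun t ht => (hd t ht).differentiableAt.differentiableWithinAt)
      (fun t ht => (hd t ht).deriv) ht h0
    rw [hinit _ (hin X hX' 0 h0), zero_smul, sub_zero] at h1
    exact sub_eq_iff_eq_add.1 h1
  have hF : ∀ X : E, ‖X‖ < ε → ∀ t ∈ Metric.ball (0 : ℝ) ε,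
      C.IsFrame (y₀ + t • X) (Θ (t, y₀, X, u₀)).2.2 := by
    intro X hX' t ht
    refine IsFrame.transport Metric.isOpen_ball hball (γ := fun t => y₀ + t • X) (γ' := fun _ => X)
      (τ := fun t => (Θ (t, y₀, X, u₀)).2.2) (fun t _ => ?_) (fun t ht => ?_) (fun t ht => ?_) h0 ?_ ht
    · simpa using ((hasDerivAt_id t).smul_const X).const_add y₀
    · rw [← hY X hX' t ht]
      exact (hΩ _ (hin X hX' t ht)).1
    · refine (hder _ (hin X hX' t ht)).snd_comp.snd_comp.congr_deriv ?_
      simp only [Z, hX X hX' t ht, hY X hX' t ht]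
    · rw [hinit _ (hin X hX' 0 h0), zero_smul, add_zero]
      exact hu₀
  have hε2 : ε / 2 ∈ Metric.ball (0 : ℝ) ε := by
    rw [mem_ball_zero_iff, Real.norm_of_nonneg (by positivity)]
    linarith
  have hnorm : ∀ y ∈ Metric.ball y₀ (ε / 2 * ε), ‖(ε / 2)⁻¹ • (y - y₀)‖ < ε := by
    intro y hy
    rw [norm_smul, Real.norm_of_nonneg (by positivity), inv_mul_lt_iff₀ (by positivity)]
    rwa [mem_ball_iff_norm] at hy
  have hpt : ∀ y : E, y₀ + (ε / 2) • (ε / 2)⁻¹ • (y - y₀) = y := fun y => by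
    rw [smul_smul, mul_inv_cancel₀ (by positivity), one_smul, add_sub_cancel]
  refine ⟨Metric.ball y₀ (ε / 2 * ε), fun y => (Θ (ε / 2, y₀, (ε / 2)⁻¹ • (y - y₀), u₀)).2.2,
    Metric.isOpen_ball, Metric.mem_ball_self (by positivity), fun y hy => ?_, ?_, ?_, fun y hy => ?_⟩
  · have := (hΩ _ (hin _ (hnorm y hy) _ hε2)).1
    rwa [hY _ (hnorm y hy) _ hε2, hpt] at this
  · refine (contDiff_snd.comp contDiff_snd).comp_contDiffOn (hsm.comp ?_ fun y hy => hin _ (hnorm y hy) _ hε2)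
    exact contDiffOn_const.prodMk (contDiffOn_const.prodMk
      ((contDiffOn_const.smul (contDiffOn_id.sub contDiffOn_const)).prodMk contDiffOn_const))
  · have h00 : ‖(0 : E)‖ < ε := by simpa using hε
    have hd : ∀ t ∈ Metric.ball (0 : ℝ) ε, HasDerivAt (fun t => (Θ (t, y₀, 0, u₀)).2.2) 0 t :=
      fun t ht => by
        refine (hder _ (hin 0 h00 t ht)).snd_comp.snd_comp.congr_deriv ?_
        simp [Z, hX 0 h00 t ht]
    have h1 := Metric.isOpen_ball.is_const_of_deriv_eq_zero hball
      (fun t ht => (hd t ht).differentiableAt.differentiableWithinAt)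
      (fun t ht => (hd t ht).deriv) hε2 h0
    simp only [sub_self, smul_zero]
    rw [h1, hinit _ (hin 0 h00 0 h0)]
  · have := hF _ (hnorm y hy) _ hε2
    rwa [hpt] at this

theorem exists_adapted_frame_field {y₀ : E} (hy₀ : y₀ ∈ C.Ω) {u₀ : ModelV p q →L[ℝ] T}
    (hu₀ : C.IsFrame y₀ u₀) {v₀ w₀ : ModelV p q} (h00 : 𝓥.H v₀ v₀ = 0) (h01 : 𝓥.H v₀ w₀ = 1)
    (h10 : 𝓥.H w₀ v₀ = 1) (h11 : 𝓥.H w₀ w₀ = 0) (hv₀ : u₀ v₀ = C.e) : ∃ (O : Set E)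
    (τ : E → ModelV p q →L[ℝ] T), IsOpen O ∧ y₀ ∈ O ∧ O ⊆ C.Ω ∧ ContDiffOn ℝ ∞ τ O ∧ τ y₀ = u₀ ∧
    (∀ y ∈ O, C.IsFrame y (τ y)) ∧ ∀ y ∈ O, ∃ c : ℂ, τ y (c • v₀) = C.e := by
  obtain ⟨O, τ, hO, hyO, hOΩ, hτ, hτ0, hfr⟩ := exists_frame_field hy₀ hu₀
  let v : E → ModelV p q := fun y => (τ y).inverse C.e
  have hv : ContDiffOn ℝ ∞ v O := by
    intro y hy
    exact (((ContinuousLinearMap.IsInvertible.contDiffAt_map_inverse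
      (hfr y hy).isInvertible).comp_contDiffWithinAt y (hτ y hy)).clm_apply contDiffWithinAt_const)
  have hve : ∀ y ∈ O, τ y (v y) = C.e := fun y hy => (hfr y hy).isInvertible.self_apply_inverse _
  let a : E → ℂ := fun y => 𝓥.hermL w₀ (v y)
  have ha : ContDiffOn ℝ ∞ a O := (𝓥.hermL w₀).contDiff.comp_contDiffOn hv
  let O' : Set E := O ∩ a ⁻¹' {0}ᶜ
  have hO' : IsOpen O' := ha.continuousOn.isOpen_inter_preimage hO isOpen_compl_singleton
  have hvy₀ : v y₀ = v₀ := by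
    simp only [v, hτ0]
    rw [← hv₀, hu₀.isInvertible.inverse_apply_self]
  let x : E → ModelV p q := fun y => (a y)⁻¹ • v y
  have hx : ContDiffOn ℝ ∞ x O' := ((ha.mono inter_subset_left).inv fun y hy => hy.2).smul
    (hv.mono inter_subset_left)
  have hxx : ∀ y ∈ O', 𝓥.H (x y) (x y) = 0 := by
    intro y hy
    have h1 : 𝓥.H (v y) (v y) = 0 := by
      refine 𝓥.eq_zero_of_re ?_
      rw [← (hfr y hy.1).isometry, hve y hy.1, C.h_e_e y (hOΩ hy.1)]
    simp [x, h1]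
  have hwx : ∀ y ∈ O', 𝓥.H w₀ (x y) = 1 := by
    intro y hy
    simp only [x, map_smul, smul_eq_mul]
    exact inv_mul_cancel₀ hy.2
  let U : E → ModelEnd p q := fun y => LinearMap.toContinuousLinearMap
    (LinearMap.id + 𝓥.siegelN v₀ w₀ (x y))
  have hU : ∀ y z, U y z = z + (𝓥.hermL w₀ z • (x y - v₀)
    - 𝓥.hermL (x y - v₀ - 𝓥.hermL v₀ (x y) • w₀) z • w₀) := fun y z => rfl
  have hUN : ∀ y z, U y z = z + 𝓥.siegelN v₀ w₀ (x y) z := fun y z => rfl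
  have hsm : ∀ z, ContDiffOn ℝ ∞ (fun y => U y z) O' := by
    intro z
    exact (𝓥.contDiff_siegel v₀ w₀ z).comp_contDiffOn hx
  have hx0 : x y₀ = v₀ := by
    simp only [x, a, hvy₀, 𝓥.hermL_apply, h10]
    simp
  have hUv : ∀ y, U y v₀ = x y := fun y => HermitianModel.siegelN_self h00 h01 h10
  refine ⟨O', fun y => (τ y).comp ((U y).restrictScalars ℝ), hO', ⟨hyO, ?_⟩,
    inter_subset_left.trans hOΩ, ?_, ?_, fun y hy => ?_, fun y hy => ⟨a y, ?_⟩⟩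
  · simp [a, hvy₀, 𝓥.hermL_apply, h10]
  · exact contDiffOn_clm_apply.2 fun z => (hτ.mono inter_subset_left).clm_apply (hsm z)
  · refine ContinuousLinearMap.ext fun z => ?_
    change τ y₀ (U y₀ z) = u₀ z
    rw [hτ0, hU, hx0]
    simp [𝓥.hermL_apply, h00]
  · refine (hfr y hy.1).comp (fun z w => ?_) ?_
    · rw [hUN, hUN]
      exact HermitianModel.siegelN_isometry h00 h01 h10 h11 (hxx y hy) (hwx y hy) z w
    · exact LinearMap.det_one_add_of_isNilpotent
        (HermitianModel.siegelN_isNilpotent h10 h11 (hwx y hy))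
  · change τ y (U y (a y • v₀)) = C.e
    rw [map_smul, hUv, smul_smul, mul_inv_cancel₀ hy.2, one_smul, hve y hy.1]

end TractorChart

theorem exists_flow_box {E E' P : Type*} [NormedAddCommGroup E] [NormedSpace ℝ E]
    [FiniteDimensional ℝ E] [NormedAddCommGroup E'] [NormedSpace ℝ E'] [NormedAddCommGroup P]
    [NormedSpace ℝ P] [FiniteDimensional ℝ P] {Ω : Set E} (hΩ : IsOpen Ω) {κ : E → E}
    (hκ : ContDiffOn ℝ ∞ κ Ω) {Z : E × P → P} (hZ : ContDiffOn ℝ ∞ Z (Ω ×ˢ univ)) {σ : E → P}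
    (hσ : ContDiffOn ℝ ∞ σ Ω) {y₀ : E} (hy₀ : y₀ ∈ Ω) (Λ : (ℝ × E') ≃L[ℝ] E) (hΛ : Λ (1, 0) = κ y₀)
    : ∃ (ε : ℝ) (Θ : OpenPartialHomeomorph (ℝ × E') E) (η : ℝ × E' → P), 0 < ε ∧ Θ.source =
    Metric.ball 0 ε ×ˢ Metric.ball 0 ε ∧ Θ.target ⊆ Ω ∧ Θ (0, 0) = y₀ ∧ ContDiffOn ℝ ∞ Θ Θ.source ∧
    ContDiffOn ℝ ∞ Θ.symm Θ.target ∧ ContDiffOn ℝ ∞ η Θ.source ∧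
    (∀ z ∈ Θ.source, HasDerivAt (fun t => Θ (t, z.2)) (κ (Θ z)) z.1) ∧
    (∀ z ∈ Θ.source, HasDerivAt (fun t => η (t, z.2)) (Z (Θ z, η z)) z.1) ∧ ∀ z ∈ Θ.source, η
    (0, z.2) = σ (Θ (0, z.2)) := by
  have : CompleteSpace E := FiniteDimensional.complete ℝ E
  have : FiniteDimensional ℝ (ℝ × E') := Module.Finite.equiv Λ.symm.toLinearEquiv
  have : CompleteSpace (ℝ × E') := FiniteDimensional.complete ℝ _
  have hF : ContDiffOn ℝ ∞ (fun z : E × P => (κ z.1, Z z)) (Ω ×ˢ univ) :=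
    (hκ.comp contDiffOn_fst fun z hz => hz.1).prodMk hZ
  obtain ⟨Fl, O, hO, hmem, hsm, hFΩ, hinit, hder⟩ :=
    exists_smooth_flow (hΩ.prod isOpen_univ) hF (x₀ := (y₀, σ y₀)) ⟨hy₀, trivial⟩
  let m : ℝ × E' → E := fun z => y₀ + Λ (0, z.2)
  have hm : ContDiff ℝ ∞ m := contDiff_const.add (Λ.contDiff.comp (contDiff_const.prodMk contDiff_snd))
  have hO₁ : IsOpen (m ⁻¹' Ω) := hΩ.preimage hm.continuous
  let i : ℝ × E' → ℝ × E × P := fun z => (z.1, m z, σ (m z))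
  have hi : ContDiffOn ℝ ∞ i (m ⁻¹' Ω) := contDiffOn_fst.prodMk (hm.contDiffOn.prodMk
    (hσ.comp hm.contDiffOn fun z hz => hz))
  let O₂ : Set (ℝ × E') := m ⁻¹' Ω ∩ i ⁻¹' O
  have hO₂ : IsOpen O₂ := hi.continuousOn.isOpen_inter_preimage hO₁ hO
  have hm0 : m 0 = y₀ := by
    have : ((0 : ℝ), (0 : ℝ × E').2) = 0 := rfl
    simp only [m, this, map_zero, add_zero]
  have h0 : (0 : ℝ × E') ∈ O₂ := ⟨by rw [mem_preimage, hm0]; exact hy₀, by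
    rw [mem_preimage]
    simp only [i, hm0]
    exact hmem⟩
  obtain ⟨ε, hε, hεO⟩ := Metric.isOpen_iff.1 hO₂ _ h0
  have hball : Metric.ball (0 : ℝ × E') ε = Metric.ball 0 ε ×ˢ Metric.ball 0 ε :=
    (ball_prod_same _ _ _).symm
  let Ξ : ℝ × E' → E := fun z => (Fl (i z)).1
  let η : ℝ × E' → P := fun z => (Fl (i z)).2
  have hFli : ContDiffOn ℝ ∞ (fun z => Fl (i z)) (Metric.ball (0 : ℝ × E') ε) :=
    hsm.comp (hi.mono fun z hz => (hεO hz).1) fun z hz => (hεO hz).2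
  have hΞ : ContDiffOn ℝ ∞ Ξ (Metric.ball (0 : ℝ × E') ε) := contDiff_fst.comp_contDiffOn hFli
  have hη : ContDiffOn ℝ ∞ η (Metric.ball (0 : ℝ × E') ε) := contDiff_snd.comp_contDiffOn hFli
  have hdi : ∀ z ∈ Metric.ball (0 : ℝ × E') ε,
      HasDerivAt (fun t => Fl (i (t, z.2))) (κ (Ξ z), Z (Ξ z, η z)) z.1 := fun z hz =>
    hder (i z) (hεO hz).2
  have hz0 : ∀ z ∈ Metric.ball (0 : ℝ × E') ε, Fl (i (0, z.2)) = (m z, σ (m z)) := by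
    intro z hz
    refine hinit _ (hεO ?_ : (0, z.2) ∈ O₂).2
    rw [hball] at hz ⊢
    exact ⟨Metric.mem_ball_self hε, hz.2⟩
  have hΞ0 : Ξ 0 = y₀ := by
    have := congrArg Prod.fst (hz0 0 (Metric.mem_ball_self hε))
    rw [hm0] at this
    exact this
  have hderiv : HasFDerivAt Ξ (Λ : ℝ × E' →L[ℝ] E) 0 := by
    have h1 : HasFDerivAt Ξ (fderiv ℝ Ξ 0) 0 := ((hΞ.differentiableOn (by simp)).differentiableAt
      (Metric.ball_mem_nhds _ hε)).hasFDerivAt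
    have h2 : fderiv ℝ Ξ 0 (1, 0) = Λ (1, 0) := by
      have h3 : HasDerivAt (fun t : ℝ => ((t, 0) : ℝ × E')) (1, 0) 0 :=
        (hasDerivAt_id (0 : ℝ)).prodMk (hasDerivAt_const _ _)
      have h4 := (HasFDerivAt.comp_hasDerivAt (0 : ℝ) (f := fun t : ℝ => ((t, 0) : ℝ × E')) h1 h3)
      have h5 := (hdi 0 (Metric.mem_ball_self hε)).fst_comp
      rw [hΛ, ← hΞ0]
      exact h4.unique h5
    have h3 : ∀ s, fderiv ℝ Ξ 0 (0, s) = Λ (0, s) := by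
      intro s
      have h4 : HasFDerivAt (fun s : E' => ((0, s) : ℝ × E')) (ContinuousLinearMap.inr ℝ ℝ E') 0 :=
        (ContinuousLinearMap.inr ℝ ℝ E').hasFDerivAt
      have h5 := HasFDerivAt.comp (0 : E') (f := fun s : E' => ((0, s) : ℝ × E')) h1 h4
      have h6 : HasFDerivAt (fun s : E' => y₀ + Λ (0, s))
          ((Λ : ℝ × E' →L[ℝ] E) ∘L ContinuousLinearMap.inr ℝ ℝ E') 0 :=
        ((Λ : ℝ × E' →L[ℝ] E) ∘L ContinuousLinearMap.inr ℝ ℝ E').hasFDerivAt.const_add y₀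
      have h7 : (Ξ ∘ fun s : E' => ((0, s) : ℝ × E')) =ᶠ[𝓝 0] fun s => y₀ + Λ (0, s) := by
        filter_upwards [Metric.ball_mem_nhds (0 : E') hε] with s hs
        exact congrArg Prod.fst (hz0 (0, s) (by rw [hball]; exact ⟨Metric.mem_ball_self hε, hs⟩))
      exact congrArg (fun f : E' →L[ℝ] E => f s) ((h5.congr_of_eventuallyEq h7.symm).unique h6)
    have h4 : fderiv ℝ Ξ 0 = Λ := by
      refine ContinuousLinearMap.ext fun z => ?_
      have h5 : z = z.1 • (1, 0) + (0, z.2) := by simp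
      rw [h5, map_add, map_smul, h2, h3]
      exact ((Λ : ℝ × E' →L[ℝ] E).map_add _ _).symm ▸
        congrArg (· + Λ (0, z.2)) ((Λ : ℝ × E' →L[ℝ] E).map_smul _ _).symm
    rwa [h4] at h1
  obtain ⟨Θ, hΘ0, hΘB, hΘ, hΘs⟩ := exists_smooth_local_inverse Metric.isOpen_ball hΞ
    (Metric.mem_ball_self hε) Λ hderiv
  obtain ⟨δ, hδ, hδΘ⟩ := Metric.isOpen_iff.1 Θ.open_source _ hΘ0
  have hsrc : (Θ.restrOpen (Metric.ball 0 δ) Metric.isOpen_ball).source = Metric.ball 0 δ := by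
    rw [Θ.restrOpen_source]
    exact inter_eq_right.2 hδΘ
  have hsub : Metric.ball (0 : ℝ × E') δ ⊆ Metric.ball 0 ε := hδΘ.trans hΘB
  have hco : ∀ z, Θ.restrOpen (Metric.ball 0 δ) Metric.isOpen_ball z = Ξ z := hΘ
  refine ⟨δ, Θ.restrOpen (Metric.ball 0 δ) Metric.isOpen_ball, η, hδ, ?_, ?_, ?_, ?_, ?_, ?_, ?_, ?_, ?_⟩
  · rw [hsrc, ← ball_prod_same]
    rfl
  · intro y hy
    obtain ⟨z, hz, rfl⟩ := (Θ.restrOpen (Metric.ball 0 δ) Metric.isOpen_ball).surjOn hy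
    rw [hsrc] at hz
    rw [hco]
    exact (hFΩ _ (hεO (hsub hz)).2).1
  · exact (hco _).trans hΞ0
  · rw [hsrc]
    exact (hΞ.mono hsub).congr fun z _ => hco z
  · exact hΘs.mono fun y hy => hy.1
  · rw [hsrc]
    exact hη.mono hsub
  · intro z hz
    rw [hsrc] at hz
    simp only [hco]
    exact (hdi z (hsub hz)).fst_comp
  · intro z hz
    rw [hsrc] at hz
    simp only [hco]
    exact (hdi z (hsub hz)).snd_comp
  · intro z hz
    rw [hsrc] at hz
    rw [hco]
    have := hz0 z (hsub hz)
    have h1 : Ξ (0, z.2) = m z := congrArg Prod.fst this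
    rw [h1]
    exact congrArg Prod.snd this

namespace TractorChart

variable {p q : ℕ} {𝓥 : HermitianModel p q} {E T : Type*} [NormedAddCommGroup E]
    [NormedSpace ℝ E] [NormedAddCommGroup T] [NormedSpace ℝ T] (C : TractorChart 𝓥 E T)

/-- The vector field underlying the complex structure. -/
def kappa (y : E) : E := C.pr (C.J y C.e)

theorem contDiffOn_kappa : ContDiffOn ℝ ∞ C.kappa C.Ω :=
  C.pr.contDiff.comp_contDiffOn (C.smooth_J.clm_apply contDiffOn_const)

variable {C}

theorem J_skew {y : E} (hy : y ∈ C.Ω) (v w : T) : C.h y (C.J y v) w = -C.h y v (C.J y w) := by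
  have h1 := C.J_orthogonal y hy (C.J y v) w
  rw [C.J_sq y hy, map_neg, neg_apply] at h1
  linarith

theorem J_e {y : E} (hy : y ∈ C.Ω) : ∃ c : ℝ, C.J y C.e = C.ι (C.kappa y) + c • C.e := by
  refine C.eq_of_perp y hy _ ?_
  have h1 := J_skew hy C.e C.e
  rw [C.h_symm y hy] at h1
  linarith

theorem kappa_ne_zero {y : E} (hy : y ∈ C.Ω) (he : C.e ≠ 0) : C.kappa y ≠ 0 := by
  intro h
  obtain ⟨c, hc⟩ := J_e hy
  rw [h, map_zero, zero_add] at hc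
  have h1 := C.J_sq y hy C.e
  rw [hc, map_smul, hc, smul_smul, ← neg_one_smul ℝ C.e] at h1
  have h2 := smul_left_injective ℝ he h1
  nlinarith [mul_self_nonneg c]

end TractorChart

namespace TractorChart

variable {p q : ℕ} {𝓥 : HermitianModel p q} {E T : Type*} [NormedAddCommGroup E] [NormedSpace ℝ E]
    [NormedAddCommGroup T] [NormedSpace ℝ T] {C : TractorChart 𝓥 E T} [FiniteDimensional ℝ T]

theorem IsFrame.inverse_complex {y : E} {τ : ModelV p q →L[ℝ] T} (h : C.IsFrame y τ) (t : T) :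
    τ.inverse (C.J y t) = Complex.I • τ.inverse t := by
  refine h.isInvertible.injective ?_
  rw [h.isInvertible.self_apply_inverse, h.complex, h.isInvertible.self_apply_inverse]

theorem IsFrame.inverse_ι_kappa {y : E} (hy : y ∈ C.Ω) {τ : ModelV p q →L[ℝ] T}
    (h : C.IsFrame y τ) : ∃ a : ℂ, a.im = 1 ∧ τ.inverse (C.ι (C.kappa y)) = a • τ.inverse C.e := by
  obtain ⟨c, hc⟩ := J_e hy
  refine ⟨Complex.I - c, by simp, ?_⟩
  have h1 := h.inverse_complex C.e
  rw [hc, map_add, map_smul] at h1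
  have h2 : ((c : ℂ) • τ.inverse C.e : ModelV p q) = c • τ.inverse C.e := Complex.coe_smul c _
  rw [sub_smul, h2, ← h1, add_sub_cancel_right]

variable [FiniteDimensional ℝ E] {E' : Type*} [NormedAddCommGroup E'] [NormedSpace ℝ E']

theorem exists_parallel_frame_field {y₀ : E} (hy₀ : y₀ ∈ C.Ω) {u₀ : ModelV p q →L[ℝ] T}
    (hu₀ : C.IsFrame y₀ u₀) {v₀ w₀ : ModelV p q} (h00 : 𝓥.H v₀ v₀ = 0) (h01 : 𝓥.H v₀ w₀ = 1)
    (h10 : 𝓥.H w₀ v₀ = 1) (h11 : 𝓥.H w₀ w₀ = 0) (hv₀ : u₀ v₀ = C.e) (Λ : (ℝ × E') ≃L[ℝ] E)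
    (hΛ : Λ (1, 0) = C.kappa y₀) : ∃ (O : Set E) (τ : E → ModelV p q →L[ℝ] T) (c : E → ℂ), IsOpen O
    ∧ y₀ ∈ O ∧ O ⊆ C.Ω ∧ ContDiffOn ℝ ∞ τ O ∧ ContDiffOn ℝ ∞ c O ∧ c y₀ = 1 ∧
    (∀ y ∈ O, C.IsFrame y (τ y)) ∧ (∀ y ∈ O, τ y (c y • v₀) = C.e) ∧ ∀ y ∈ O, ∀ v, fderiv ℝ τ y
    (C.kappa y) v + C.A y (C.kappa y) (τ y v) = 0 := by
  obtain ⟨O₁, τ₁, hO₁, hy₁, hO₁Ω, hτ₁, hτ₁0, hfr₁, he₁⟩ :=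
    exists_adapted_frame_field hy₀ hu₀ h00 h01 h10 h11 hv₀
  have hκ : ContDiffOn ℝ ∞ C.kappa O₁ := C.contDiffOn_kappa.mono hO₁Ω
  have hZ : ContDiffOn ℝ ∞ (fun z : E × (ModelV p q →L[ℝ] T) =>
      -(C.A z.1 (C.kappa z.1)).comp z.2) (O₁ ×ˢ univ) := by
    have h1 : ContDiffOn ℝ ∞ (fun z : E × (ModelV p q →L[ℝ] T) => C.A z.1) (O₁ ×ˢ univ) :=
      (C.smooth_A.mono hO₁Ω).comp contDiffOn_fst fun z hz => hz.1
    have h2 : ContDiffOn ℝ ∞ (fun z : E × (ModelV p q →L[ℝ] T) => C.kappa z.1) (O₁ ×ˢ univ) :=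
      hκ.comp contDiffOn_fst fun z hz => hz.1
    exact ((h1.clm_apply h2).clm_comp contDiffOn_snd).neg
  obtain ⟨ε, Θ, η, hε, hsrc, htgt, hΘ0, hΘ, hΘs, hη, hdΘ, hdη, hη0⟩ :=
    exists_flow_box hO₁ hκ hZ hτ₁ hy₁ Λ hΛ
  have hmem0 : (0 : ℝ × E') ∈ Θ.source := by
    rw [hsrc]
    exact ⟨Metric.mem_ball_self hε, Metric.mem_ball_self hε⟩
  have hline : ∀ z ∈ Θ.source, ∀ t ∈ Metric.ball (0 : ℝ) ε, (t, z.2) ∈ Θ.source := by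
    intro z hz t ht
    rw [hsrc] at hz ⊢
    exact ⟨ht, hz.2⟩
  have hΘΩ : ∀ z ∈ Θ.source, Θ z ∈ C.Ω := fun z hz => hO₁Ω (htgt (Θ.map_source hz))
  have hfr : ∀ z ∈ Θ.source, C.IsFrame (Θ z) (η z) := by
    intro z hz
    have hz1 : z.1 ∈ Metric.ball (0 : ℝ) ε := by
      rw [hsrc] at hz
      exact hz.1
    have h0 := Metric.mem_ball_self (x := (0 : ℝ)) hε
    refine IsFrame.transport (S := Metric.ball (0 : ℝ) ε) Metric.isOpen_ball
      (convex_ball _ _).isPreconnected (γ := fun t => Θ (t, z.2))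
      (γ' := fun t => C.kappa (Θ (t, z.2))) (τ := fun t => η (t, z.2))
      (fun t ht => hdΘ _ (hline z hz t ht)) (fun t ht => hΘΩ _ (hline z hz t ht))
      (fun t ht => hdη _ (hline z hz t ht)) h0 ?_ hz1
    rw [hη0 z hz]
    exact hfr₁ _ (htgt (Θ.map_source (hline z hz 0 h0)))
  let v : ℝ × E' → ModelV p q := fun z => (η z).inverse C.e
  have hv : ContDiffOn ℝ ∞ v Θ.source := fun z hz =>
    ((ContinuousLinearMap.IsInvertible.contDiffAt_map_inverse
      (hfr z hz).isInvertible).comp_contDiffWithinAt z (hη z hz)).clm_apply contDiffWithinAt_const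
  let a : ℝ × E' → ℂ := fun z => 𝓥.hermL w₀ (v z)
  have ha : ContDiffOn ℝ ∞ a Θ.source := (𝓥.hermL w₀).contDiff.comp_contDiffOn hv
  have hη00 : η 0 = u₀ := by
    have h1 := hη0 0 hmem0
    have h2 : Θ ((0 : ℝ), (0 : ℝ × E').2) = y₀ := hΘ0
    rw [h2, hτ₁0] at h1
    exact h1
  have ha0 : a 0 = 1 := by
    simp only [a, v, hη00]
    rw [← hv₀, hu₀.isInvertible.inverse_apply_self]
    exact h10
  have hO₂ : IsOpen (Θ.source ∩ a ⁻¹' {0}ᶜ) :=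
    ha.continuousOn.isOpen_inter_preimage Θ.open_source isOpen_compl_singleton
  obtain ⟨δ, hδ, hδO⟩ := Metric.isOpen_iff.1 hO₂ 0 ⟨hmem0, by simp [ha0]⟩
  have hB : Metric.ball (0 : ℝ × E') δ = Metric.ball 0 δ ×ˢ Metric.ball 0 δ :=
    (ball_prod_same _ _ _).symm
  have hBs : Metric.ball (0 : ℝ × E') δ ⊆ Θ.source := fun z hz => (hδO hz).1
  have hva : ∀ z ∈ Metric.ball (0 : ℝ × E') δ, v z = a z • v₀ := by
    intro z hz
    let x : ℝ → ModelV p q := fun t => (a (t, z.2))⁻¹ • v (t, z.2)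
    have hl : ∀ t ∈ Metric.ball (0 : ℝ) δ, (t, z.2) ∈ Metric.ball (0 : ℝ × E') δ := by
      intro t ht
      rw [hB] at hz ⊢
      exact ⟨ht, hz.2⟩
    have hd : ∀ t ∈ Metric.ball (0 : ℝ) δ, HasDerivAt x 0 t := by
      intro t ht
      have hs := hBs (hl t ht)
      have hne : a (t, z.2) ≠ 0 := (hδO (hl t ht)).2
      obtain ⟨k, -, hk⟩ := (hfr _ hs).inverse_ι_kappa (hΘΩ _ hs)
      have h1 : HasDerivAt (fun t => v (t, z.2)) (k • v (t, z.2)) t := by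
        have h2 := hasDerivAt_inverse_apply (hdη _ hs) (hasDerivAt_const t C.e)
          (hfr _ hs).isInvertible
        refine h2.congr_deriv ?_
        have h3 : (0 : T) - (-(C.A (Θ (t, z.2)) (C.kappa (Θ (t, z.2)))).comp (η (t, z.2)))
            ((η (t, z.2)).inverse C.e) = C.ι (C.kappa (Θ (t, z.2))) := by
          rw [neg_apply, ContinuousLinearMap.comp_apply,
            (hfr _ hs).isInvertible.self_apply_inverse, zero_sub, neg_neg, C.A_e _ (hΘΩ _ hs)]
        rw [h3, hk]
      have h2 : HasDerivAt (fun t => a (t, z.2)) (k * a (t, z.2)) t := by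
        have h3 := (𝓥.hermL w₀).hasFDerivAt.comp_hasDerivAt t h1
        refine h3.congr_deriv ?_
        simp only [a, 𝓥.hermL_apply, map_smul, smul_eq_mul]
      have h3 : DifferentiableAt ℝ x t := (h2.differentiableAt.inv hne).smul h1.differentiableAt
      have h4 := h2.smul h3.hasDerivAt
      have h5 : (fun t => a (t, z.2) • x t) =ᶠ[𝓝 t] fun t => v (t, z.2) := by
        filter_upwards [Metric.isOpen_ball.mem_nhds ht] with t' ht'
        have hne' : a (t', z.2) ≠ 0 := (hδO (hl t' ht')).2
        simp only [x]
        rw [smul_smul, mul_inv_cancel₀ hne', one_smul]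
      have h6 := (h4.congr_of_eventuallyEq h5.symm).unique h1
      have h7 : v (t, z.2) = a (t, z.2) • x t := (h5.self_of_nhds).symm
      rw [h7, ← smul_smul] at h6
      have h8 : a (t, z.2) • deriv x t = 0 := add_eq_right.1 h6
      have h9 : deriv x t = 0 := (smul_eq_zero.1 h8).resolve_left hne
      rw [← h9]
      exact h3.hasDerivAt
    have h0 := Metric.mem_ball_self (x := (0 : ℝ)) hδ
    have hz1 : z.1 ∈ Metric.ball (0 : ℝ) δ := by
      rw [hB] at hz
      exact hz.1
    have h1 : x z.1 = x 0 := Metric.isOpen_ball.is_const_of_deriv_eq_zero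
      (convex_ball _ _).isPreconnected
      (fun t ht => (hd t ht).differentiableAt.differentiableWithinAt)
      (fun t ht => (hd t ht).deriv) hz1 h0
    have h2 : x 0 = v₀ := by
      have hs := hBs (hl 0 h0)
      obtain ⟨c, hc⟩ := he₁ _ (htgt (Θ.map_source hs))
      have h3 : v (0, z.2) = c • v₀ := by
        simp only [v]
        rw [hη0 z (hBs hz), ← hc, (hfr₁ _ (htgt (Θ.map_source hs))).isInvertible.inverse_apply_self]
      have h4 : a (0, z.2) = c := by
        simp only [a, h3, 𝓥.hermL_apply, map_smul, h10, smul_eq_mul, mul_one]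
      have h5 : a (0, z.2) ≠ 0 := (hδO (hl 0 h0)).2
      simp only [x]
      rw [h3, h4, smul_smul, inv_mul_cancel₀ (h4 ▸ h5), one_smul]
    rw [h2] at h1
    rw [← h1]
    simp only [x]
    rw [smul_smul, mul_inv_cancel₀ (hδO hz).2, one_smul]
  have hO : IsOpen (Θ '' Metric.ball 0 δ) := Θ.isOpen_image_of_subset_source Metric.isOpen_ball hBs
  have hOt : Θ '' Metric.ball 0 δ ⊆ Θ.target := by
    rintro _ ⟨z, hz, rfl⟩
    exact Θ.map_source (hBs hz)
  have hinv : ∀ z ∈ Metric.ball (0 : ℝ × E') δ, Θ.symm (Θ z) = z := fun z hz =>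
    Θ.left_inv (hBs hz)
  have hmaps : MapsTo Θ.symm (Θ '' Metric.ball 0 δ) Θ.source := by
    rintro _ ⟨z, hz, rfl⟩
    rw [hinv z hz]
    exact hBs hz
  have hτ : ContDiffOn ℝ ∞ (fun y => η (Θ.symm y)) (Θ '' Metric.ball 0 δ) :=
    hη.comp (hΘs.mono hOt) hmaps
  refine ⟨Θ '' Metric.ball 0 δ, fun y => η (Θ.symm y), fun y => a (Θ.symm y), hO,
    ⟨0, Metric.mem_ball_self hδ, hΘ0⟩, hOt.trans (htgt.trans hO₁Ω), hτ,
    ha.comp (hΘs.mono hOt) hmaps, ?_, ?_, ?_, ?_⟩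
  · have h1 : Θ.symm y₀ = 0 := by
      rw [← hΘ0]
      exact Θ.left_inv hmem0
    simp only [h1, ha0]
  · rintro _ ⟨z, hz, rfl⟩
    simp only [hinv z hz]
    exact hfr z (hBs hz)
  · rintro _ ⟨z, hz, rfl⟩
    simp only [hinv z hz]
    rw [← hva z hz]
    exact (hfr z (hBs hz)).isInvertible.self_apply_inverse _
  · rintro _ ⟨z, hz, rfl⟩ w
    have h1 : HasFDerivAt (fun y => η (Θ.symm y)) (fderiv ℝ (fun y => η (Θ.symm y)) (Θ z)) (Θ z) :=
      ((hτ.differentiableOn (by simp)).differentiableAt (hO.mem_nhds ⟨z, hz, rfl⟩)).hasFDerivAt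
    have h2 := HasFDerivAt.comp_hasDerivAt z.1 (f := fun t => Θ (t, z.2)) h1 (hdΘ z (hBs hz))
    have h3 : ((fun y => η (Θ.symm y)) ∘ fun t => Θ (t, z.2)) =ᶠ[𝓝 z.1] fun t => η (t, z.2) := by
      have h4 : ∀ᶠ t in 𝓝 z.1, (t, z.2) ∈ Metric.ball (0 : ℝ × E') δ :=
        (continuousAt_id.prodMk continuousAt_const).eventually (Metric.isOpen_ball.mem_nhds hz)
      filter_upwards [h4] with t ht
      simp only [Function.comp_apply, hinv _ ht]
    have h4 := (h2.congr_of_eventuallyEq h3.symm).unique (hdη z (hBs hz))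
    rw [h4]
    simp [hinv z hz]

end TractorChart

theorem Module.Basis.sum_det_update_eq_trace {m : ℕ} {V : Type*} [AddCommGroup V] [Module ℂ V]
    (b : Module.Basis (Fin m) ℂ V) (B : V →ₗ[ℂ] V) :
    ∑ i, b.det (Function.update b i (B (b i))) = LinearMap.trace ℂ V B := by
  have h1 : ∀ i w, b.det (Function.update b i w) = b.repr w i := by
    intro i w
    have h2 : (b.det.toMultilinearMap.toLinearMap b i : V →ₗ[ℂ] ℂ) = b.coord i := by
      refine b.ext fun j => ?_
      rw [b.coord_apply, b.repr_self, MultilinearMap.toLinearMap_apply]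
      by_cases hij : i = j
      · subst hij
        rw [Function.update_eq_self, Finsupp.single_eq_same]
        exact b.det_self
      · rw [Finsupp.single_eq_of_ne hij]
        exact b.det.map_update_self _ hij
    exact congrArg (fun f : V →ₗ[ℂ] ℂ => f w) h2
  rw [LinearMap.trace_eq_matrix_trace ℂ b, Matrix.trace]
  refine Finset.sum_congr rfl fun i _ => ?_
  rw [h1, Matrix.diag_apply, LinearMap.toMatrix_apply]

namespace HermitianModel

variable {p q : ℕ} (𝓥 : HermitianModel p q)

/-- The inclusion of `𝔰𝔲(V)` into the real endomorphisms of `V`. -/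
def suIncl : 𝓥.su →ₗ[ℝ] (ModelV p q →L[ℝ] ModelV p q) where
  toFun B := (B : ModelEnd p q).restrictScalars ℝ
  map_add' _ _ := rfl
  map_smul' _ _ := rfl

theorem exists_suRetraction : ∃ R : (ModelV p q →L[ℝ] ModelV p q) →ₗ[ℝ] 𝓥.su,
    R ∘ₗ 𝓥.suIncl = LinearMap.id := by
  refine LinearMap.exists_leftInverse_of_injective _ ?_
  rw [LinearMap.ker_eq_bot]
  intro B B' h
  refine Subtype.ext (ContinuousLinearMap.ext fun v => ?_)
  exact congrArg (fun f : ModelV p q →L[ℝ] ModelV p q => f v) h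

/-- A retraction from the real endomorphisms of `V` onto `𝔰𝔲(V)`. -/
def suRetraction : (ModelV p q →L[ℝ] ModelV p q) →L[ℝ] 𝓥.su :=
  LinearMap.toContinuousLinearMap 𝓥.exists_suRetraction.choose

theorem suRetraction_apply {B : ModelV p q →L[ℝ] ModelV p q} (hc : ∀ v, B (Complex.I • v) =
    Complex.I • B v) (hs : ∀ v w, (𝓥.H (B v) w + 𝓥.H v (B w)).re = 0)
    (ht : ∀ B' : ModelV p q →ₗ[ℂ] ModelV p q, (∀ v, B' v = B v) →
      LinearMap.trace ℂ (ModelV p q) B' = 0) (v : ModelV p q) :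
    (𝓥.suRetraction B : ModelEnd p q) v = B v := by
  have hlin : ∀ (z : ℂ) v, B (z • v) = z • B v := by
    intro z v
    have h : ∀ w : ModelV p q, z • w = z.re • w + z.im • Complex.I • w := fun w => by
      conv_lhs => rw [← Complex.re_add_im z]
      rw [add_smul, mul_smul]
      rfl
    rw [h, map_add, map_smul, map_smul, hc, h]
  let B' : ModelV p q →ₗ[ℂ] ModelV p q :=
    { toFun := B, map_add' := B.map_add, map_smul' := hlin }
  have hsu : LinearMap.toContinuousLinearMap B' ∈ 𝓥.su := by
    refine ⟨fun v w => ?_, ht B' fun v => rfl⟩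
    change 𝓥.H (B v) w + 𝓥.H v (B w) = 0
    refine Complex.ext (hs v w) ?_
    have h1 := hs v (Complex.I • w)
    rw [hc, map_smul, map_smul, smul_eq_mul, smul_eq_mul, ← mul_add] at h1
    simp at h1
    simp only [Complex.add_im, Complex.zero_im]
    linarith
  have h1 := congrArg (fun f : 𝓥.su →ₗ[ℝ] 𝓥.su => f ⟨_, hsu⟩) 𝓥.exists_suRetraction.choose_spec
  have h2 : 𝓥.suIncl ⟨_, hsu⟩ = B := rfl
  have h3 : 𝓥.suRetraction B = ⟨_, hsu⟩ := by
    rw [← h2]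
    exact h1
  rw [h3]
  rfl

theorem suRetraction_suIncl (B : 𝓥.su) : 𝓥.suRetraction (𝓥.suIncl B) = B :=
  congrArg (fun f : 𝓥.su →ₗ[ℝ] 𝓥.su => f B) 𝓥.exists_suRetraction.choose_spec

end HermitianModel

/-- A smooth family of special unitary frames in which the canonical null section is a multiple of
`v₀`, and which is parallel in the direction of `κ`. -/
structure AdaptedFrame {p q : ℕ} {𝓥 : HermitianModel p q} {E T : Type*} [NormedAddCommGroup E]
    [NormedSpace ℝ E] [NormedAddCommGroup T] [NormedSpace ℝ T] (C : TractorChart 𝓥 E T)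
    (v₀ : ModelV p q) where
  O : Set E
  τ : E → ModelV p q →L[ℝ] T
  c : E → ℂ
  isOpen : IsOpen O
  subset : O ⊆ C.Ω
  smooth_τ : ContDiffOn ℝ ∞ τ O
  smooth_c : ContDiffOn ℝ ∞ c O
  isFrame : ∀ y ∈ O, C.IsFrame y (τ y)
  apply_c : ∀ y ∈ O, τ y (c y • v₀) = C.e
  parallel : ∀ y ∈ O, ∀ v, fderiv ℝ τ y (C.kappa y) v + C.A y (C.kappa y) (τ y v) = 0

namespace AdaptedFrame

variable {p q : ℕ} {𝓥 : HermitianModel p q} {E T : Type*} [NormedAddCommGroup E]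
    [NormedSpace ℝ E] [NormedAddCommGroup T] [NormedSpace ℝ T] {C : TractorChart 𝓥 E T}
    {v₀ : ModelV p q} (F : AdaptedFrame C v₀)

/-- The connection form in the frame. -/
def beta (y : E) : E →L[ℝ] ModelV p q →L[ℝ] ModelV p q :=
  (ContinuousLinearMap.compL ℝ (ModelV p q) T (ModelV p q) (F.τ y).inverse) ∘L
    (fderiv ℝ F.τ y + (ContinuousLinearMap.compL ℝ (ModelV p q) T T).flip (F.τ y) ∘L C.A y)

theorem beta_apply (y X : E) (v : ModelV p q) : F.beta y X v
    = (F.τ y).inverse (fderiv ℝ F.τ y X v + C.A y X (F.τ y v)) := rfl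

variable {F} [FiniteDimensional ℝ T]

theorem isInvertible {y : E} (hy : y ∈ F.O) : (F.τ y).IsInvertible := (F.isFrame y hy).isInvertible

theorem τ_beta {y : E} (hy : y ∈ F.O) (X : E) (v : ModelV p q) :
    F.τ y (F.beta y X v) = fderiv ℝ F.τ y X v + C.A y X (F.τ y v) := by
  rw [F.beta_apply, (isInvertible hy).self_apply_inverse]

theorem beta_kappa {y : E} (hy : y ∈ F.O) (v : ModelV p q) : F.beta y (C.kappa y) v = 0 := by
  rw [F.beta_apply, F.parallel y hy, map_zero]

variable (F) in
theorem contDiffOn_inverse : ContDiffOn ℝ ∞ (fun y => (F.τ y).inverse) F.O := fun y hy =>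
  (ContinuousLinearMap.IsInvertible.contDiffAt_map_inverse
    (isInvertible hy)).comp_contDiffWithinAt y (F.smooth_τ y hy)

variable (F) in
theorem contDiffOn_beta : ContDiffOn ℝ ∞ F.beta F.O := by
  refine ContDiffOn.clm_comp ?_ (ContDiffOn.add ?_ (ContDiffOn.clm_comp ?_ ?_))
  · exact (ContinuousLinearMap.compL ℝ (ModelV p q) T (ModelV p q)).contDiff.comp_contDiffOn
      F.contDiffOn_inverse
  · exact F.smooth_τ.fderiv_of_isOpen F.isOpen (by simp)
  · exact (ContinuousLinearMap.compL ℝ (ModelV p q) T T).flip.contDiff.comp_contDiffOn F.smooth_τ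
  · exact C.smooth_A.mono F.subset

theorem hasFDerivAt_τ {y : E} (hy : y ∈ F.O) : HasFDerivAt F.τ (fderiv ℝ F.τ y) y :=
  ((F.smooth_τ.differentiableOn (by simp)).differentiableAt (F.isOpen.mem_nhds hy)).hasFDerivAt

theorem hasFDerivAt_of_smooth {G : Type*} [NormedAddCommGroup G] [NormedSpace ℝ G] {f : E → G}
    (hf : ContDiffOn ℝ ∞ f C.Ω) {y : E} (hy : y ∈ F.O) : HasFDerivAt f (fderiv ℝ f y) y :=
  ((hf.differentiableOn (by simp)).differentiableAt (C.isOpen.mem_nhds (F.subset hy))).hasFDerivAt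

theorem beta_complex {y : E} (hy : y ∈ F.O) (X : E) (v : ModelV p q) :
    F.beta y X (Complex.I • v) = Complex.I • F.beta y X v := by
  refine (isInvertible hy).injective ?_
  rw [(F.isFrame y hy).complex, τ_beta hy, τ_beta hy, (F.isFrame y hy).complex]
  have h1 : HasFDerivAt (fun z => F.τ z (Complex.I • v)) _ y :=
    (hasFDerivAt_τ hy).clm_apply (hasFDerivAt_const _ _)
  have h2 : HasFDerivAt (fun z => C.J z (F.τ z v)) _ y :=
    (hasFDerivAt_of_smooth C.smooth_J hy).clm_apply ((hasFDerivAt_τ hy).clm_apply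
      (hasFDerivAt_const v y))
  have h3 : (fun z => F.τ z (Complex.I • v)) =ᶠ[𝓝 y] fun z => C.J z (F.τ z v) := by
    filter_upwards [F.isOpen.mem_nhds hy] with z hz
    exact (F.isFrame z hz).complex v
  have h4 := congrArg (fun f : E →L[ℝ] T => f X) ((h1.congr_of_eventuallyEq h3.symm).unique h2)
  simp at h4
  rw [h4, map_add, ← C.J_parallel y (F.subset hy)]
  abel

theorem beta_skew {y : E} (hy : y ∈ F.O) (X : E) (v w : ModelV p q) :
    (𝓥.H (F.beta y X v) w + 𝓥.H v (F.beta y X w)).re = 0 := by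
  rw [Complex.add_re, ← (F.isFrame y hy).isometry, ← (F.isFrame y hy).isometry, τ_beta hy,
    τ_beta hy]
  have hv : ∀ v, HasFDerivAt (fun z => F.τ z v) _ y := fun v =>
    (hasFDerivAt_τ hy).clm_apply (hasFDerivAt_const v y)
  have h1 := ((hasFDerivAt_of_smooth C.smooth_h hy).clm_apply (hv v)).clm_apply (hv w)
  have h3 : (fun z => C.h z (F.τ z v) (F.τ z w)) =ᶠ[𝓝 y] fun z => (𝓥.H v w).re := by
    filter_upwards [F.isOpen.mem_nhds hy] with z hz
    exact (F.isFrame z hz).isometry v w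
  have h4 := congrArg (fun f : E →L[ℝ] ℝ => f X)
    ((h1.congr_of_eventuallyEq h3.symm).unique (hasFDerivAt_const _ _))
  simp [C.h_parallel y (F.subset hy)] at h4
  rw [map_add, map_add, add_apply]
  linear_combination h4

theorem beta_trace {y : E} (hy : y ∈ F.O) (X : E) {B : ModelV p q →ₗ[ℂ] ModelV p q}
    (hB : ∀ v, B v = F.beta y X v) : LinearMap.trace ℂ (ModelV p q) B = 0 := by
  let f : E → Fin (p + q + 2) → ModelV p q := fun z i => (F.τ z).inverse (C.s i z)
  have hf : ∀ i, ContDiffOn ℝ ∞ (fun z => f z i) F.O := fun i =>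
    F.contDiffOn_inverse.clm_apply ((C.smooth_s i).mono F.subset)
  have hτf : ∀ z ∈ F.O, ∀ i, F.τ z (f z i) = C.s i z := fun z hz i =>
    (isInvertible hz).self_apply_inverse _
  have hdet : ∀ z ∈ F.O, C.b.det (f z) = 1 := by
    intro z hz
    obtain ⟨k, hk, hk1⟩ := (F.isFrame z hz).unimodular
    have : f z = k := funext fun i => by
      simp only [f]
      rw [← hk, (isInvertible hz).inverse_apply_self]
    rw [this, hk1]
  have hdf : ∀ i, HasFDerivAt (fun z => f z i) (fderiv ℝ (fun z => f z i) y) y := fun i =>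
    (((hf i).differentiableOn (by simp)).differentiableAt (F.isOpen.mem_nhds hy)).hasFDerivAt
  have hs1 : ∀ i, F.τ y (B (f y i) + fderiv ℝ (fun z => f z i) y X)
      = fderiv ℝ (C.s i) y X + C.A y X (C.s i y) := by
    intro i
    have h1 := (hasFDerivAt_τ hy).clm_apply (hdf i)
    have h2 : (fun z => F.τ z (f z i)) =ᶠ[𝓝 y] C.s i := by
      filter_upwards [F.isOpen.mem_nhds hy] with z hz
      exact hτf z hz i
    have h3 := congrArg (fun g : E →L[ℝ] T => g X)
      ((h1.congr_of_eventuallyEq h2.symm).unique (hasFDerivAt_of_smooth (C.smooth_s i) hy))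
    simp at h3
    rw [← h3, map_add, hB, τ_beta hy, hτf y hy]
    abel
  have hp := C.s_parallel y (F.subset hy) X (F.τ y) (isInvertible hy).injective
    (F.isFrame y hy).complex (f y) _ (hτf y hy) hs1
  simp only [AlternatingMap.map_update_add, Finset.sum_add_distrib] at hp
  have hz : ∑ i, C.b.det (Function.update (f y) i (fderiv ℝ (fun z => f z i) y X)) = 0 := by
    obtain ⟨L, hL, hL'⟩ := C.b.hasFDerivAt_det hdf
    rw [← hL']
    have h1 : (fun z => C.b.det (f z)) =ᶠ[𝓝 y] fun _ => 1 := by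
      filter_upwards [F.isOpen.mem_nhds hy] with z hz
      exact hdet z hz
    have h2 := (hL.congr_of_eventuallyEq h1.symm).unique (hasFDerivAt_const (1 : ℂ) y)
    rw [h2]
    rfl
  rw [hz, add_zero] at hp
  have hu : IsUnit (C.b.det (f y)) := by
    rw [hdet y hy]
    exact isUnit_one
  obtain ⟨hli, hsp⟩ := (C.b.is_basis_iff_det).2 hu
  let b' := Module.Basis.mk hli hsp.ge
  have hb' : ∀ g, C.b.det g = b'.det g := by
    intro g
    have h1 := congrArg (fun A : ModelV p q [⋀^Fin (p + q + 2)]→ₗ[ℂ] ℂ => A g)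
      (AlternatingMap.eq_smul_basis_det b' C.b.det)
    have h2 : (b' : Fin (p + q + 2) → ModelV p q) = f y := Module.Basis.coe_mk _ _
    simp only [h2, hdet y hy, one_smul] at h1
    exact h1
  have h2 : (b' : Fin (p + q + 2) → ModelV p q) = f y := Module.Basis.coe_mk _ _
  rw [← b'.sum_det_update_eq_trace, ← hp]
  simp only [hb', h2]

end AdaptedFrame

namespace AdaptedFrame

variable {p q : ℕ} {𝓥 : HermitianModel p q} {E T : Type*} [NormedAddCommGroup E]
    [NormedSpace ℝ E] [NormedAddCommGroup T] [NormedSpace ℝ T] {C : TractorChart 𝓥 E T}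
    {v₀ : ModelV p q} {F : AdaptedFrame C v₀} [FiniteDimensional ℝ T]

theorem hasFDerivAt_beta {y : E} (hy : y ∈ F.O) : HasFDerivAt F.beta (fderiv ℝ F.beta y) y :=
  ((F.contDiffOn_beta.differentiableOn (by simp)).differentiableAt
    (F.isOpen.mem_nhds hy)).hasFDerivAt

theorem curv_beta {y : E} (hy : y ∈ F.O) (X Y : E) (v : ModelV p q) :
    F.τ y (fderiv ℝ F.beta y Y X v - fderiv ℝ F.beta y X Y v + F.beta y Y (F.beta y X v)
      - F.beta y X (F.beta y Y v)) = curvL C.A y Y X (F.τ y v) := by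
  have hτ' : HasFDerivAt (fderiv ℝ F.τ) (fderiv ℝ (fderiv ℝ F.τ) y) y :=
    (((F.smooth_τ.fderiv_of_isOpen F.isOpen (m := ∞) (by simp)).differentiableOn
      (by simp)).differentiableAt (F.isOpen.mem_nhds hy)).hasFDerivAt
  have key : ∀ X Y, fderiv ℝ F.τ y Y (F.beta y X v) + F.τ y (fderiv ℝ F.beta y Y X v)
      = fderiv ℝ (fderiv ℝ F.τ) y Y X v + (fderiv ℝ C.A y Y X (F.τ y v)
        + C.A y X (fderiv ℝ F.τ y Y v)) := by
    intro X Y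
    have hv : HasFDerivAt (fun z => F.τ z v) _ y :=
      (hasFDerivAt_τ hy).clm_apply (hasFDerivAt_const v y)
    have h1 := (hasFDerivAt_τ hy).clm_apply (((hasFDerivAt_beta hy).clm_apply
      (hasFDerivAt_const X y)).clm_apply (hasFDerivAt_const v y))
    have h2 := ((hτ'.clm_apply (hasFDerivAt_const X y)).clm_apply (hasFDerivAt_const v y)).add
      (((hasFDerivAt_of_smooth C.smooth_A hy).clm_apply (hasFDerivAt_const X y)).clm_apply hv)
    have h3 : (fun z => F.τ z (F.beta z X v)) =ᶠ[𝓝 y]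
        fun z => fderiv ℝ F.τ z X v + C.A z X (F.τ z v) := by
      filter_upwards [F.isOpen.mem_nhds hy] with z hz
      exact τ_beta hz X v
    have h4 := congrArg (fun f : E →L[ℝ] T => f Y) ((h1.congr_of_eventuallyEq h3.symm).unique h2)
    simp at h4
    rw [add_comm, h4]
    abel
  have hsymm : fderiv ℝ (fderiv ℝ F.τ) y Y X = fderiv ℝ (fderiv ℝ F.τ) y X Y :=
    ((F.smooth_τ.contDiffAt (F.isOpen.mem_nhds hy)).isSymmSndFDerivAt
      (by simpa using ENat.LEInfty.out)).eq Y X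
  have h1 := key X Y
  have h2 := key Y X
  rw [hsymm] at h1
  have e : ∀ X w, fderiv ℝ F.τ y X w = F.τ y (F.beta y X w) - C.A y X (F.τ y w) := fun X w => by
    rw [τ_beta hy, add_sub_cancel_right]
  rw [e Y, e Y] at h1
  rw [e X, e X] at h2
  rw [map_sub] at h1 h2
  rw [curvL_apply, map_sub, map_add, map_sub]
  have h3 := congrArg₂ (· - ·) h1 h2
  rw [← sub_eq_zero] at h3 ⊢
  rw [← h3]
  abel

theorem fderiv_beta_kappa (hTE : ∀ y ∈ C.Ω, ∀ X v, curvL C.A y (C.kappa y) X v = 0) {y : E}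
    (hy : y ∈ F.O) (X : E) : fderiv ℝ F.beta y (C.kappa y) X = fderiv ℝ F.beta y X (C.kappa y) := by
  refine ContinuousLinearMap.ext fun v => (isInvertible hy).injective ?_
  have h := curv_beta hy X (C.kappa y) v
  rw [hTE y (F.subset hy), beta_kappa hy, beta_kappa hy, map_zero, add_zero, sub_zero, map_sub] at h
  exact sub_eq_zero.1 h

theorem beta_smul {y : E} (hy : y ∈ F.O) (X : E) (z : ℂ) (v : ModelV p q) :
    F.beta y X (z • v) = z • F.beta y X v := by
  have h : ∀ w : ModelV p q, z • w = z.re • w + z.im • Complex.I • w := fun w => by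
    conv_lhs => rw [← Complex.re_add_im z]
    rw [add_smul, mul_smul]
    rfl
  rw [h, map_add, map_smul, map_smul, beta_complex hy, h]

theorem hasFDerivAt_c {y : E} (hy : y ∈ F.O) : HasFDerivAt F.c (fderiv ℝ F.c y) y :=
  ((F.smooth_c.differentiableOn (by simp)).differentiableAt (F.isOpen.mem_nhds hy)).hasFDerivAt

theorem τ_beta_c {y : E} (hy : y ∈ F.O) (X : E) :
    F.τ y (F.c y • F.beta y X v₀ + fderiv ℝ F.c y X • v₀) = C.ι X := by
  have h1 := (hasFDerivAt_τ hy).clm_apply ((hasFDerivAt_c hy).smul (hasFDerivAt_const v₀ y))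
  have h3 : (fun z => F.τ z (F.c z • v₀)) =ᶠ[𝓝 y] fun _ => C.e := by
    filter_upwards [F.isOpen.mem_nhds hy] with z hz
    exact F.apply_c z hz
  have h4 := congrArg (fun f : E →L[ℝ] T => f X)
    ((h1.congr_of_eventuallyEq h3.symm).unique (hasFDerivAt_const _ _))
  simp at h4
  have h5 := τ_beta hy X (F.c y • v₀)
  rw [beta_smul hy, F.apply_c y hy, C.A_e y (F.subset hy)] at h5
  rw [map_add, h5, add_right_comm, add_comm (fderiv ℝ F.τ y X _), h4, zero_add]

theorem fderiv_c_kappa (hv₀ : v₀ ≠ 0) {y : E} (hy : y ∈ F.O) :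
    ∃ a : ℂ, a.im = 1 ∧ fderiv ℝ F.c y (C.kappa y) = a * F.c y := by
  obtain ⟨a, ha, ha'⟩ := (F.isFrame y hy).inverse_ι_kappa (F.subset hy)
  refine ⟨a, ha, ?_⟩
  rw [← τ_beta_c hy, (isInvertible hy).inverse_apply_self, beta_kappa hy, smul_zero, zero_add,
    ← F.apply_c y hy, (isInvertible hy).inverse_apply_self, smul_smul] at ha'
  exact smul_left_injective ℂ hv₀ ha'

/-- The angular coordinate. -/
def angle (F : AdaptedFrame C v₀) (y : E) : ℝ := (F.c y).im / (F.c y).re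

theorem contDiffOn_angle : ContDiffOn ℝ ∞ F.angle (F.O ∩ {y | (F.c y).re ≠ 0}) := by
  have h := F.smooth_c.mono (inter_subset_left (t := {y | (F.c y).re ≠ 0}))
  exact (Complex.imCLM.contDiff.comp_contDiffOn h).div (Complex.reCLM.contDiff.comp_contDiffOn h)
    fun y hy => hy.2

theorem fderiv_angle_kappa (hv₀ : v₀ ≠ 0) {y : E} (hy : y ∈ F.O)
    (hr : (F.c y).re ≠ 0) : fderiv ℝ F.angle y (C.kappa y) ≠ 0 := by
  obtain ⟨a, ha, ha'⟩ := fderiv_c_kappa hv₀ hy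
  have h1 : HasFDerivAt (fun z => (F.c z).im) (Complex.imCLM ∘L fderiv ℝ F.c y) y :=
    Complex.imCLM.hasFDerivAt.comp y (hasFDerivAt_c hy)
  have h2 : HasFDerivAt (fun z => (F.c z).re) (Complex.reCLM ∘L fderiv ℝ F.c y) y :=
    Complex.reCLM.hasFDerivAt.comp y (hasFDerivAt_c hy)
  have h3 : HasFDerivAt (fun z => F.angle z * (F.c z).re) _ y :=
    ((((contDiffOn_angle (F := F)).contDiffAt ((F.smooth_c.continuousOn.isOpen_inter_preimage F.isOpen
      (isOpen_ne.preimage Complex.continuous_re)).mem_nhds ⟨hy, hr⟩)).differentiableAt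
        (by simp)).hasFDerivAt).mul h2
  have h4 : (fun z => F.angle z * (F.c z).re) =ᶠ[𝓝 y] fun z => (F.c z).im := by
    filter_upwards [(F.smooth_c.continuousOn.isOpen_inter_preimage F.isOpen
      (isOpen_ne.preimage Complex.continuous_re)).mem_nhds ⟨hy, hr⟩] with z hz
    exact div_mul_cancel₀ _ hz.2
  have h5 := congrArg (fun f : E →L[ℝ] ℝ => f (C.kappa y))
    ((h3.congr_of_eventuallyEq h4.symm).unique h1)
  simp [ha', ha, angle] at h5
  intro h0
  rw [h0, mul_zero, add_zero] at h5
  field_simp at h5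
  have h6 : 0 < (F.c y).re ^ 2 := by positivity
  nlinarith [sq_nonneg (F.c y).im]

end AdaptedFrame

/-- Coordinates given by a local leaf space `ψ` of `κ` and the angular coordinate along the
leaves. -/
structure LeafChart {p q : ℕ} {𝓥 : HermitianModel p q} {E T E' : Type*} [NormedAddCommGroup E]
    [NormedSpace ℝ E] [NormedAddCommGroup T] [NormedSpace ℝ T] [NormedAddCommGroup E']
    [NormedSpace ℝ E'] {C : TractorChart 𝓥 E T} {v₀ : ModelV p q} (F : AdaptedFrame C v₀)
    (ψ : E → E') where
  Θ : OpenPartialHomeomorph E (E' × ℝ)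
  base : E'
  δ : ℝ
  δ_pos : 0 < δ
  source_subset : Θ.source ⊆ F.O
  target_eq : Θ.target = Metric.ball base δ ×ˢ Metric.ball 0 δ
  apply : ∀ y, Θ y = (ψ y, F.angle y)
  re_ne : ∀ y ∈ Θ.source, (F.c y).re ≠ 0
  smooth_ψ : ContDiffOn ℝ ∞ ψ Θ.source
  smooth_symm : ContDiffOn ℝ ∞ Θ.symm Θ.target
  ker : ∀ y ∈ Θ.source, ∀ X, fderiv ℝ ψ y X = 0 → ∃ t : ℝ, X = t • C.kappa y
  map_kappa : ∀ y ∈ Θ.source, fderiv ℝ ψ y (C.kappa y) = 0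

theorem exists_leafChart {p q : ℕ} {𝓥 : HermitianModel p q} {E T E' : Type*} [NormedAddCommGroup E]
    [NormedSpace ℝ E] [FiniteDimensional ℝ E] [NormedAddCommGroup T] [NormedSpace ℝ T]
    [FiniteDimensional ℝ T] [NormedAddCommGroup E'] [NormedSpace ℝ E'] [FiniteDimensional ℝ E']
    {C : TractorChart 𝓥 E T} {v₀ : ModelV p q} (hv₀ : v₀ ≠ 0) (F : AdaptedFrame C v₀) {y₀ : E}
    (hy₀ : y₀ ∈ F.O) (hc : F.c y₀ = 1) {ψ : E → E'} {U : Set E} (hU : IsOpen U) (hyU : y₀ ∈ U)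
    (hψ : ContDiffOn ℝ ∞ ψ U) (hdim : Module.finrank ℝ E = Module.finrank ℝ E' + 1)
    (hker : ∀ y ∈ U, ∀ X, fderiv ℝ ψ y X = 0 → ∃ t : ℝ, X = t • C.kappa y)
    (hκ : ∀ y ∈ U, fderiv ℝ ψ y (C.kappa y) = 0) :
    ∃ K : LeafChart F ψ, y₀ ∈ K.Θ.source ∧ K.Θ.source ⊆ U ∧ K.base = ψ y₀ := by
  have : CompleteSpace E := FiniteDimensional.complete ℝ E
  let O : Set E := U ∩ (F.O ∩ {y | (F.c y).re ≠ 0})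
  have hO : IsOpen O := hU.inter (F.smooth_c.continuousOn.isOpen_inter_preimage F.isOpen
    (isOpen_ne.preimage Complex.continuous_re))
  have hyO : y₀ ∈ O := ⟨hyU, hy₀, by simp [hc]⟩
  have hsm : ContDiffOn ℝ ∞ (fun y => (ψ y, F.angle y)) O :=
    (hψ.mono inter_subset_left).prodMk (AdaptedFrame.contDiffOn_angle.mono inter_subset_right)
  have h1 : HasFDerivAt ψ (fderiv ℝ ψ y₀) y₀ :=
    ((hψ.differentiableOn (by simp)).differentiableAt (hU.mem_nhds hyU)).hasFDerivAt
  have h2 : HasFDerivAt F.angle (fderiv ℝ F.angle y₀) y₀ :=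
    (((AdaptedFrame.contDiffOn_angle.mono (inter_subset_right (s := U))).differentiableOn
      (by simp)).differentiableAt (hO.mem_nhds hyO)).hasFDerivAt
  have hinj : Function.Injective ((fderiv ℝ ψ y₀).prod (fderiv ℝ F.angle y₀) : E →ₗ[ℝ] E' × ℝ) := by
    rw [← LinearMap.ker_eq_bot, LinearMap.ker_eq_bot']
    intro X hX
    obtain ⟨t, rfl⟩ := hker y₀ hyU X (congrArg Prod.fst hX)
    have h3 : fderiv ℝ F.angle y₀ (t • C.kappa y₀) = 0 := congrArg Prod.snd hX
    rw [map_smul, smul_eq_mul] at h3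
    have h4 := (mul_eq_zero.1 h3).resolve_right
      (AdaptedFrame.fderiv_angle_kappa hv₀ hy₀ (by simp [hc]))
    rw [h4, zero_smul]
  let Λ : E ≃L[ℝ] E' × ℝ := (LinearMap.linearEquivOfInjective _ hinj
    (by simp [hdim])).toContinuousLinearEquiv
  obtain ⟨Θ, hyΘ, hΘO, hΘ, hΘs⟩ := exists_smooth_local_inverse hO hsm hyO Λ (h1.prodMk h2)
  have hΘy : Θ y₀ = (ψ y₀, 0) := by
    rw [hΘ, AdaptedFrame.angle, hc]
    simp
  obtain ⟨δ, hδ, hδΘ⟩ := Metric.isOpen_iff.1 Θ.open_target _ (Θ.map_source hyΘ)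
  let Θ' := (Θ.symm.restrOpen (Metric.ball (Θ y₀) δ) Metric.isOpen_ball).symm
  have htgt : Θ'.target = Metric.ball (Θ y₀) δ := by
    change (Θ.symm.restrOpen (Metric.ball (Θ y₀) δ) Metric.isOpen_ball).source = _
    rw [Θ.symm.restrOpen_source]
    exact inter_eq_right.2 hδΘ
  have hsrc : Θ'.source ⊆ Θ.source := by
    intro y hy
    have h3 : y ∈ (Θ.symm.restrOpen (Metric.ball (Θ y₀) δ) Metric.isOpen_ball).target := hy
    obtain ⟨z, hz, rfl⟩ := (Θ.symm.restrOpen (Metric.ball (Θ y₀) δ) Metric.isOpen_ball).surjOn h3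
    rw [Θ.symm.restrOpen_source] at hz
    exact Θ.map_target hz.1
  have hy' : y₀ ∈ Θ'.source := by
    have h3 : Θ y₀ ∈ Θ'.target := by
      rw [htgt]
      exact Metric.mem_ball_self hδ
    have h4 := Θ'.map_target h3
    have h5 : Θ'.symm (Θ y₀) = y₀ := Θ.left_inv hyΘ
    rwa [h5] at h4
  refine ⟨{ Θ := Θ', base := ψ y₀, δ := δ, δ_pos := hδ, source_subset := fun y hy => (hΘO (hsrc hy)).2.1
            target_eq := by rw [htgt, hΘy, ball_prod_same]
            apply := hΘ, re_ne := fun y hy => (hΘO (hsrc hy)).2.2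
            smooth_ψ := hψ.mono fun y hy => (hΘO (hsrc hy)).1
            smooth_symm := hΘs.mono (by rw [htgt]; exact hδΘ)
            ker := fun y hy => hker y (hΘO (hsrc hy)).1
            map_kappa := fun y hy => hκ y (hΘO (hsrc hy)).1 }, hy', fun y hy => (hΘO (hsrc hy)).1, rfl⟩

namespace LeafChart

variable {p q : ℕ} {𝓥 : HermitianModel p q} {E T E' : Type*} [NormedAddCommGroup E]
    [NormedSpace ℝ E] [NormedAddCommGroup T] [NormedSpace ℝ T] [NormedAddCommGroup E']
    [NormedSpace ℝ E'] {C : TractorChart 𝓥 E T} {v₀ : ModelV p q} {F : AdaptedFrame C v₀}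
    {ψ : E → E'} (K : LeafChart F ψ)

theorem mem_target {z : E' × ℝ} : z ∈ K.Θ.target ↔
    z.1 ∈ Metric.ball K.base K.δ ∧ z.2 ∈ Metric.ball (0 : ℝ) K.δ := by
  rw [K.target_eq, mem_prod]

theorem ψ_symm {z : E' × ℝ} (hz : z ∈ K.Θ.target) : ψ (K.Θ.symm z) = z.1 := by
  have := K.Θ.right_inv hz
  rw [K.apply] at this
  exact congrArg Prod.fst this

theorem angle_symm {z : E' × ℝ} (hz : z ∈ K.Θ.target) : F.angle (K.Θ.symm z) = z.2 := by
  have := K.Θ.right_inv hz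
  rw [K.apply] at this
  exact congrArg Prod.snd this

theorem hasFDerivAt_symm {z : E' × ℝ} (hz : z ∈ K.Θ.target) :
    HasFDerivAt K.Θ.symm (fderiv ℝ K.Θ.symm z) z :=
  ((K.smooth_symm.differentiableOn (by simp)).differentiableAt
    (K.Θ.open_target.mem_nhds hz)).hasFDerivAt

theorem hasFDerivAt_ψ {y : E} (hy : y ∈ K.Θ.source) : HasFDerivAt ψ (fderiv ℝ ψ y) y :=
  ((K.smooth_ψ.differentiableOn (by simp)).differentiableAt
    (K.Θ.open_source.mem_nhds hy)).hasFDerivAt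

theorem fderiv_ψ_symm {z : E' × ℝ} (hz : z ∈ K.Θ.target) (ζ : E' × ℝ) :
    fderiv ℝ ψ (K.Θ.symm z) (fderiv ℝ K.Θ.symm z ζ) = ζ.1 := by
  have h1 := (K.hasFDerivAt_ψ (K.Θ.map_target hz)).comp z (K.hasFDerivAt_symm hz)
  have h2 : (ψ ∘ K.Θ.symm) =ᶠ[𝓝 z] Prod.fst := by
    filter_upwards [K.Θ.open_target.mem_nhds hz] with w hw
    exact K.ψ_symm hw
  exact congrArg (fun f : E' × ℝ →L[ℝ] E' => f ζ)
    ((h1.congr_of_eventuallyEq h2.symm).unique hasFDerivAt_fst)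

variable [FiniteDimensional ℝ T]

theorem beta_symm_vertical {z : E' × ℝ} (hz : z ∈ K.Θ.target) (s : ℝ) :
    F.beta (K.Θ.symm z) (fderiv ℝ K.Θ.symm z (0, s)) = 0 := by
  obtain ⟨t, ht⟩ := K.ker _ (K.Θ.map_target hz) _ (K.fderiv_ψ_symm hz (0, s))
  rw [ht, map_smul]
  refine ContinuousLinearMap.ext fun v => ?_
  rw [smul_apply, AdaptedFrame.beta_kappa (K.source_subset (K.Θ.map_target hz)), smul_zero]
  rfl

theorem beta_symm_eq {y : E'} {t : ℝ} (hz : (y, t) ∈ K.Θ.target) (ξ : E') : F.beta (K.Θ.symm (y, t))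
    (fderiv ℝ K.Θ.symm (y, t) (ξ, 0)) = F.beta (K.Θ.symm (y, 0)) (fderiv ℝ K.Θ.symm (y, 0) (ξ, 0)) := by
  have hy : y ∈ Metric.ball K.base K.δ := (K.mem_target.1 hz).1
  have h0 : (0 : ℝ) ∈ Metric.ball (0 : ℝ) K.δ := Metric.mem_ball_self K.δ_pos
  have hmem : ∀ t ∈ Metric.ball (0 : ℝ) K.δ, (y, t) ∈ K.Θ.target := fun t ht =>
    K.mem_target.2 ⟨hy, ht⟩
  have hG : ∀ z ∈ K.Θ.target, ∀ ζ : E' × ℝ,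
      HasFDerivAt (fun z => F.beta (K.Θ.symm z) (fderiv ℝ K.Θ.symm z ζ)) _ z := fun z hz ζ =>
    ((AdaptedFrame.hasFDerivAt_beta (K.source_subset (K.Θ.map_target hz))).comp z
      (K.hasFDerivAt_symm hz)).clm_apply
      ((((K.smooth_symm.fderiv_of_isOpen K.Θ.open_target (m := ∞) (by simp)).differentiableOn
        (by simp)).differentiableAt (K.Θ.open_target.mem_nhds hz)).hasFDerivAt.clm_apply
        (hasFDerivAt_const ζ z))
  have hd : ∀ t ∈ Metric.ball (0 : ℝ) K.δ, HasDerivAt (fun t => F.beta (K.Θ.symm (y, t))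
      (fderiv ℝ K.Θ.symm (y, t) (ξ, 0))) 0 t := by
    intro t ht
    have hz := hmem t ht
    have hl : HasDerivAt (fun t : ℝ => ((y, t) : E' × ℝ)) (0, 1) t :=
      (hasDerivAt_const t y).prodMk (hasDerivAt_id t)
    refine ((hG _ hz (ξ, 0)).comp_hasDerivAt t hl).congr_deriv ?_
    have h2 : (fun z => F.beta (K.Θ.symm z) (fderiv ℝ K.Θ.symm z ((0 : E'), (1 : ℝ))))
        =ᶠ[𝓝 (y, t)] fun _ => 0 := by
      filter_upwards [K.Θ.open_target.mem_nhds hz] with w hw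
      exact K.beta_symm_vertical hw 1
    have h3 := congrArg (fun f : E' × ℝ →L[ℝ] _ => f (ξ, 0))
      (((hG _ hz (0, 1)).congr_of_eventuallyEq h2.symm).unique (hasFDerivAt_const _ _))
    obtain ⟨k, hk⟩ := K.ker _ (K.Θ.map_target hz) _ (K.fderiv_ψ_symm hz (0, 1))
    have hsymm := ((K.smooth_symm.contDiffAt (K.Θ.open_target.mem_nhds hz)).isSymmSndFDerivAt
      (by simpa using ENat.LEInfty.out)).eq ((0 : E'), (1 : ℝ)) (ξ, 0)
    simp [hk] at h3
    simp [hk]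
    rw [AdaptedFrame.fderiv_beta_kappa C.curv_kappa (K.source_subset (K.Θ.map_target hz)), hsymm]
    exact h3
  exact Metric.isOpen_ball.is_const_of_deriv_eq_zero (convex_ball _ _).isPreconnected
    (fun t ht => (hd t ht).differentiableAt.differentiableWithinAt)
    (fun t ht => (hd t ht).deriv) (K.mem_target.1 hz).2 h0

/-- The connection form on the leaf space. -/
def alpha (y : E') : E' →L[ℝ] 𝓥.su :=
  𝓥.suRetraction ∘L (F.beta (K.Θ.symm (y, 0)) ∘L (fderiv ℝ K.Θ.symm (y, 0) ∘L
    ContinuousLinearMap.inl ℝ E' ℝ))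

theorem contDiffOn_alpha : ContDiffOn ℝ ∞ K.alpha (Metric.ball K.base K.δ) := by
  have hm : MapsTo (fun y : E' => (y, (0 : ℝ))) (Metric.ball K.base K.δ) K.Θ.target := fun y hy =>
    K.mem_target.2 ⟨hy, Metric.mem_ball_self K.δ_pos⟩
  have hi : ContDiffOn ℝ ∞ (fun y : E' => (y, (0 : ℝ))) (Metric.ball K.base K.δ) :=
    contDiffOn_id.prodMk contDiffOn_const
  refine contDiffOn_const.clm_comp (ContDiffOn.clm_comp ?_ (ContDiffOn.clm_comp ?_ contDiffOn_const))
  · exact F.contDiffOn_beta.comp (K.smooth_symm.comp hi hm) fun y hy =>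
      K.source_subset (K.Θ.map_target (hm hy))
  · exact (K.smooth_symm.fderiv_of_isOpen K.Θ.open_target (m := ∞) (by simp)).comp hi hm

theorem alpha_apply {x : E} (hx : x ∈ K.Θ.source) (X : E) (v : ModelV p q) :
    (K.alpha (ψ x) (fderiv ℝ ψ x X) : ModelEnd p q) v = F.beta x X v := by
  have ht : K.Θ x ∈ K.Θ.target := K.Θ.map_source hx
  rw [K.apply] at ht
  have hsx : K.Θ.symm (ψ x, F.angle x) = x := by
    rw [← K.apply]
    exact K.Θ.left_inv hx
  have h0 : (ψ x, (0 : ℝ)) ∈ K.Θ.target := 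
    K.mem_target.2 ⟨(K.mem_target.1 ht).1, Metric.mem_ball_self K.δ_pos⟩
  have hO := K.source_subset (K.Θ.map_target h0)
  have h1 : K.alpha (ψ x) (fderiv ℝ ψ x X) = 𝓥.suRetraction (F.beta (K.Θ.symm (ψ x, 0))
    (fderiv ℝ K.Θ.symm (ψ x, 0) (fderiv ℝ ψ x X, 0))) := rfl
  rw [h1, HermitianModel.suRetraction_apply _ (AdaptedFrame.beta_complex hO _)
    (AdaptedFrame.beta_skew hO _) (fun B hB => AdaptedFrame.beta_trace hO _ hB), ← K.beta_symm_eq ht]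
  have h2 : fderiv ℝ ψ x (X - fderiv ℝ K.Θ.symm (ψ x, F.angle x) (fderiv ℝ ψ x X, 0)) = 0 := by
    have := K.fderiv_ψ_symm ht (fderiv ℝ ψ x X, 0)
    rw [hsx] at this
    rw [map_sub, this, sub_self]
  obtain ⟨t, ht'⟩ := K.ker x hx _ h2
  have h3 : F.beta x X = F.beta x (fderiv ℝ K.Θ.symm (ψ x, F.angle x) (fderiv ℝ ψ x X, 0)) := by
    rw [← sub_eq_zero, ← map_sub, ht', map_smul]
    refine ContinuousLinearMap.ext fun v => ?_
    rw [smul_apply, AdaptedFrame.beta_kappa (K.source_subset hx), smul_zero]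
    rfl
  rw [hsx, h3]

end LeafChart

theorem ContDiffOn.hasFDerivAt_of_isOpen {E F : Type*} [NormedAddCommGroup E] [NormedSpace ℝ E]
    [NormedAddCommGroup F] [NormedSpace ℝ F] {Ω : Set E} {f : E → F} (hf : ContDiffOn ℝ ∞ f Ω)
    (hΩ : IsOpen Ω) {y : E} (hy : y ∈ Ω) : HasFDerivAt f (fderiv ℝ f y) y :=
  ((hf.differentiableOn (by simp)).differentiableAt (hΩ.mem_nhds hy)).hasFDerivAt

theorem curvL_apply_comm {E T : Type*} [NormedAddCommGroup E] [NormedSpace ℝ E]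
    [NormedAddCommGroup T] [NormedSpace ℝ T] {Ω : Set E} (hΩ : IsOpen Ω) {A : E → E →L[ℝ] T →L[ℝ] T}
    (hA : ContDiffOn ℝ ∞ A Ω) {J : E → T →L[ℝ] T} (hJ : ContDiffOn ℝ ∞ J Ω)
    (hJA : ∀ y ∈ Ω, ∀ X v, fderiv ℝ J y X v + A y X (J y v) = J y (A y X v)) {y : E} (hy : y ∈ Ω)
    (X Y : E) (v : T) : curvL A y X Y (J y v) = J y (curvL A y X Y v) := by
  have hdJ := hJ.hasFDerivAt_of_isOpen hΩ hy
  have hdA := hA.hasFDerivAt_of_isOpen hΩ hy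
  have hJ' := (hJ.fderiv_of_isOpen hΩ (m := ∞) (by simp)).hasFDerivAt_of_isOpen hΩ hy
  have key : ∀ X Y, fderiv ℝ (fderiv ℝ J) y Y X v + (fderiv ℝ A y Y X (J y v)
      + A y X (fderiv ℝ J y Y v)) = fderiv ℝ J y Y (A y X v) + J y (fderiv ℝ A y Y X v) := by
    intro X Y
    have h1 := ((hJ'.clm_apply (hasFDerivAt_const X y)).clm_apply (hasFDerivAt_const v y)).add
      ((hdA.clm_apply (hasFDerivAt_const X y)).clm_apply
        (hdJ.clm_apply (hasFDerivAt_const v y)))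
    have h2 := hdJ.clm_apply ((hdA.clm_apply (hasFDerivAt_const X y)).clm_apply
      (hasFDerivAt_const v y))
    have h3 : (fun z => fderiv ℝ J z X v + A z X (J z v)) =ᶠ[𝓝 y] fun z => J z (A z X v) := by
      filter_upwards [hΩ.mem_nhds hy] with z hz
      exact hJA z hz X v
    have h4 := congrArg (fun f : E →L[ℝ] T => f Y) ((h1.congr_of_eventuallyEq h3.symm).unique h2)
    simp at h4
    rw [add_comm (fderiv ℝ A y Y X _), h4]
    abel
  have hsymm : fderiv ℝ (fderiv ℝ J) y Y X = fderiv ℝ (fderiv ℝ J) y X Y :=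
    ((hJ.contDiffAt (hΩ.mem_nhds hy)).isSymmSndFDerivAt (by simpa using ENat.LEInfty.out)).eq Y X
  have h1 := key X Y
  have h2 := key Y X
  have e : ∀ X w, fderiv ℝ J y X w = J y (A y X w) - A y X (J y w) := fun X w => by
    rw [← hJA y hy, add_sub_cancel_right]
  rw [hsymm, e Y, e Y, map_sub] at h1
  rw [e X, e X, map_sub] at h2
  rw [curvL_apply, curvL_apply, map_sub, map_add, map_sub]
  have h3 := congrArg₂ (· - ·) h2 h1
  rw [← sub_eq_zero] at h3 ⊢
  rw [← h3]
  abel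

theorem TractorChart.IsFrame.map_smul {p q : ℕ} {𝓥 : HermitianModel p q} {E T : Type*}
    [NormedAddCommGroup E] [NormedSpace ℝ E] [NormedAddCommGroup T] [NormedSpace ℝ T]
    {C : TractorChart 𝓥 E T} {y : E} {τ : ModelV p q →L[ℝ] T} (h : C.IsFrame y τ) (z : ℂ)
    (v : ModelV p q) : τ (z • v) = z.re • τ v + z.im • C.J y (τ v) := by
  have h1 : z • v = z.re • v + z.im • Complex.I • v := by
    conv_lhs => rw [← Complex.re_add_im z]
    rw [add_smul, mul_smul]
    rfl
  rw [h1, map_add, _root_.map_smul, _root_.map_smul, h.complex]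

namespace LeafChart

variable {p q : ℕ} {𝓥 : HermitianModel p q} {E T E' : Type*} [NormedAddCommGroup E]
    [NormedSpace ℝ E] [NormedAddCommGroup T] [NormedSpace ℝ T] [FiniteDimensional ℝ T]
    [NormedAddCommGroup E'] [NormedSpace ℝ E'] {C : TractorChart 𝓥 E T} {v₀ : ModelV p q}
    {F : AdaptedFrame C v₀} {ψ : E → E'} (K : LeafChart F ψ)

theorem alpha_injective {x : E} (hx : x ∈ K.Θ.source) {X : E} {z : ℂ}
    (h : (K.alpha (ψ x) (fderiv ℝ ψ x X) : ModelEnd p q) v₀ = z • v₀) : fderiv ℝ ψ x X = 0 := by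
  have hO := K.source_subset hx
  have hc : F.c x ≠ 0 := fun h0 => K.re_ne x hx (by rw [h0, Complex.zero_re])
  rw [K.alpha_apply hx] at h
  have h1 := AdaptedFrame.τ_beta_c hO X
  have h2 : F.c x • F.beta x X v₀ + fderiv ℝ F.c x X • v₀
      = ((F.c x * z + fderiv ℝ F.c x X) / F.c x) • F.c x • v₀ := by
    rw [h, smul_smul, ← add_smul, smul_smul, div_mul_cancel₀ _ hc]
  rw [h2, (F.isFrame x hO).map_smul, F.apply_c x hO] at h1
  have h3 := congrArg C.pr h1
  rw [C.pr_ι, map_add, _root_.map_smul, _root_.map_smul, C.pr_e, smul_zero, zero_add] at h3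
  rw [← h3, _root_.map_smul]
  exact (congrArg _ (K.map_kappa x hx)).trans (smul_zero _)

theorem alpha_surjective {x : E} (hx : x ∈ K.Θ.source) {B : ModelEnd p q} (hB : B ∈ 𝓥.su) :
    ∃ (X : E) (z : ℂ), (K.alpha (ψ x) (fderiv ℝ ψ x X) : ModelEnd p q) v₀ = B v₀ + z • v₀ := by
  have hO := K.source_subset hx
  have hc : F.c x ≠ 0 := fun h0 => K.re_ne x hx (by rw [h0, Complex.zero_re])
  have h1 : C.h x C.e (F.τ x (F.c x • B v₀)) = 0 := by
    have h2 := hB.1 v₀ v₀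
    rw [← F.apply_c x hO, (F.isFrame x hO).isometry, map_smul, map_smulₛₗ, LinearMap.smul_apply,
      smul_eq_mul, smul_eq_mul, ← mul_assoc, Complex.mul_conj, Complex.re_ofReal_mul]
    have h3 := congrArg Complex.re h2
    rw [Complex.add_re, ← 𝓥.hermitian, Complex.conj_re, Complex.zero_re] at h3
    have h4 : (𝓥.H v₀ (B v₀)).re = 0 := by linarith
    rw [h4, mul_zero]
  obtain ⟨r, hr⟩ := C.eq_of_perp x (F.subset hO) _ h1
  refine ⟨C.pr (F.τ x (F.c x • B v₀)), -r - fderiv ℝ F.c x (C.pr (F.τ x (F.c x • B v₀))) / F.c x, ?_⟩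
  rw [K.alpha_apply hx]
  have h2 := AdaptedFrame.τ_beta_c hO (C.pr (F.τ x (F.c x • B v₀)))
  have h3 : C.ι (C.pr (F.τ x (F.c x • B v₀))) = F.τ x (F.c x • B v₀ - r • F.c x • v₀) := by
    rw [map_sub, _root_.map_smul (F.τ x) r, F.apply_c x hO]
    exact eq_sub_of_add_eq hr.symm
  rw [h3] at h2
  have h4 := (F.isFrame x hO).isInvertible.injective h2
  refine smul_right_injective _ hc ?_
  change F.c x • _ = F.c x • _
  rw [eq_sub_of_add_eq h4, smul_add, smul_smul (F.c x), mul_sub, mul_div_cancel₀ _ hc, sub_smul,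
    mul_neg, neg_smul, mul_comm, mul_smul]
  have h5 : ((r : ℂ) • F.c x • v₀ : ModelV p q) = r • F.c x • v₀ := Complex.coe_smul r _
  rw [h5]
  abel

end LeafChart

section sectionsInCharts

variable {n : ℕ} {M : Type*} [TopologicalSpace M]
  [ChartedSpace (𝔼 n) M] [IsManifold (𝓡 n) ∞ M] {r s : ℕ}

/-- The image of `U` in the chart at `x₀`. -/
def chartImage (x₀ : M) (U : Set M) : Set (𝔼 n) :=
  (chart n x₀).target ∩ (chart n x₀).symm ⁻¹' U

theorem isOpen_chartImage (x₀ : M) {U : Set M} (hU : IsOpen U) : IsOpen (chartImage (n := n) x₀ U) :=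
  (continuousOn_extChartAt_symm (I := 𝓡 n) x₀).isOpen_inter_preimage (isOpen_extChartAt_target x₀) hU

theorem extChartAt_mem_chartImage {x₀ x : M} {U : Set M} (hx : x ∈ (chart n x₀).source) (hU : x ∈ U)
    : chart n x₀ x ∈ chartImage x₀ U :=
  ⟨(chart n x₀).map_source hx, by
    rwa [mem_preimage, (chart n x₀).left_inv hx]⟩

theorem contDiffOn_comp_extChartAt_symm {F : Type*} [NormedAddCommGroup F] [NormedSpace ℝ F]
    {f : M → F} {U : Set M} (x₀ : M) (hf : ContMDiffOn (𝓡 n) 𝓘(ℝ, F) ∞ f (U ∩ (chart n x₀).source))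
    : ContDiffOn ℝ ∞ (f ∘ (chart n x₀).symm) (chartImage (n := n) x₀ U) := by
  rw [← contMDiffOn_iff_contDiffOn]
  exact hf.comp ((contMDiffOn_extChartAt_symm (I := 𝓡 n) (n := ∞) x₀).mono inter_subset_left)
    fun y hy => ⟨hy.2, (chart n x₀).map_target hy.1⟩

theorem diagL_chartDeriv_symmDeriv {x₀ : M} {y : 𝔼 n} (hy : y ∈ (chart n x₀).target) (v : 𝕋 n) :
    diagL (chartDeriv x₀ ((chart n x₀).symm y)) (diagL (symmDeriv x₀ y) v) = v :=
  Prod.ext rfl (Prod.ext (chartDeriv_symmDeriv hy _) rfl)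

theorem diagL_symmDeriv_chartDeriv {x₀ x : M} (hx : x ∈ (chart n x₀).source) (v : 𝕋 n) : diagL
    (symmDeriv x₀ (chart n x₀ x)) (diagL (chartDeriv x₀ x) v) = v :=
  Prod.ext rfl (Prod.ext (symmDeriv_chartDeriv hx _) rfl)

theorem isSmoothTractorOn_iff {x₀ : M} {U : Set M} (hU : IsOpen U) (hU' : U ⊆ (chart n x₀).source)
    (σ : ∀ x : M, Tractor n M x) : IsSmoothTractorOn σ U ↔ ContMDiffOn (𝓡 n) 𝓘(ℝ, 𝕋 n) ∞
    (fun x => diagL (chartDeriv x₀ x) (σ x)) U := by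
  have h := (trivializationAt 𝕋 n (Tractor n M) x₀).contMDiffOn_section_iff
    (IB := 𝓡 n) (n := ∞) (s := σ) hU (by rwa [baseSet_tractor])
  refine h.trans ⟨fun h => h.congr fun x hx => ?_, fun h => h.congr fun x hx => ?_⟩
  · exact (trivializationAt_tractor (hU' hx) _).symm
  · exact trivializationAt_tractor (hU' hx) _

/-- The section with components `v` in the chart at `x₀`. -/
def constTractor (x₀ : M) (v : 𝕋 n) (x : M) : Tractor n M x :=
  (diagL (symmDeriv x₀ (chart n x₀ x)) v : 𝕋 n)

/-- The components of a section in the chart at `x₀`. -/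
def tractorInChart (x₀ : M) (σ : ∀ x : M, Tractor n M x) (y : 𝔼 n) : 𝕋 n :=
  diagL (chartDeriv x₀ ((chart n x₀).symm y)) (σ ((chart n x₀).symm y))

theorem tractorInChart_extChartAt {x₀ x : M} (hx : x ∈ (chart n x₀).source)
    (σ : ∀ x : M, Tractor n M x) :
    tractorInChart x₀ σ (chart n x₀ x) = diagL (chartDeriv x₀ x) (σ x) := by
  rw [tractorInChart, (chart n x₀).left_inv hx]

theorem tractorInChart_constTractor {x₀ : M} {y : 𝔼 n} (hy : y ∈ (chart n x₀).target)
    (v : 𝕋 n) : tractorInChart x₀ (constTractor x₀ v) y = v := by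
  refine Eq.trans ?_ (diagL_chartDeriv_symmDeriv hy v)
  rw [tractorInChart, constTractor, (chart n x₀).right_inv hy]

theorem isSmoothTractorOn_constTractor (x₀ : M) (v : 𝕋 n) :
    IsSmoothTractorOn (constTractor x₀ v) (chart n x₀).source := by
  rw [isSmoothTractorOn_iff (isOpen_extChartAt_source x₀) Subset.rfl]
  refine contMDiffOn_const (c := v) |>.congr fun x hx => ?_
  have h := diagL_chartDeriv_symmDeriv ((chart n x₀).map_source hx) v
  rwa [(chart n x₀).left_inv hx] at h

theorem IsSmoothTractorOn.contDiffOn {σ : ∀ x : M, Tractor n M x} {U : Set M}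
    (hσ : IsSmoothTractorOn σ U) (hU : IsOpen U) (x₀ : M) :
    ContDiffOn ℝ ∞ (tractorInChart x₀ σ) (chartImage x₀ U) :=
  contDiffOn_comp_extChartAt_symm x₀ ((isSmoothTractorOn_iff
    (hU.inter (isOpen_extChartAt_source x₀)) inter_subset_right σ).1 (hσ.mono inter_subset_left))

theorem hasMFDerivAt_chartDeriv {x₀ x : M} (hx : x ∈ (chart n x₀).source) :
    HasMFDerivAt (𝓡 n) 𝓘(ℝ, 𝔼 n) (chart n x₀) x (chartDeriv x₀ x) :=
  ((contMDiffAt_extChartAt' (n := ∞) (by rwa [extChartAt_source] at hx)).mdifferentiableAt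
    (by simp)).hasMFDerivAt

theorem PseudoRiemannianMetric.tractorDeriv_inChart (g : PseudoRiemannianMetric n M r s)
    {σ : ∀ x : M, Tractor n M x} {U : Set M} (hσ : IsSmoothTractorOn σ U) (hU : IsOpen U) {x₀ x : M}
    (hxU : x ∈ U) (hx : x ∈ (chart n x₀).source) (X : 𝔼 n) : diagL (chartDeriv x₀ x)
    (g.tractorDeriv σ x X) = fderiv ℝ (tractorInChart x₀ σ) (chart n x₀ x) (chartDeriv x₀ x X) +
    CoordMetric.tractorConn (g.inChart x₀) (chart n x₀ x) (chartDeriv x₀ x X)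
    (diagL (chartDeriv x₀ x) (σ x)) := by
  have h1 := ((hσ.contMDiffAt (hU.mem_nhds hxU)).mdifferentiableAt (by simp)).hasMFDerivAt
  have h2 := HasMFDerivAt.tractor_components h1
  have h3 : HasMFDerivAt (𝓡 n) 𝓘(ℝ, 𝕋 n)
      (fun z => diagL (chartDeriv x₀ z) (σ z)) x
      (fderiv ℝ (tractorInChart x₀ σ) (chart n x₀ x) ∘L chartDeriv x₀ x) := by
    have h4 := ((hσ.contDiffOn hU x₀).hasFDerivAt_of_isOpen (isOpen_chartImage x₀ hU)
      (extChartAt_mem_chartImage hx hxU)).hasMFDerivAt.comp x (hasMFDerivAt_chartDeriv hx)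
    refine h4.congr_of_eventuallyEq ?_
    filter_upwards [(isOpen_extChartAt_source (I := 𝓡 n) x₀).mem_nhds hx] with z hz
    exact (tractorInChart_extChartAt hz σ).symm
  exact g.connector_natural (p := id) (w := fun z => (σ z : 𝕋 n)) hx continuousAt_id h2
    (hasMFDerivAt_chartDeriv hx) h3 X

end sectionsInCharts

namespace CplxOf

variable {p q : ℕ} {T : Type*} [AddCommGroup T] [Module ℝ T] [FiniteDimensional ℝ T]
  {J : Module.End ℝ T}
  (hJ : J * J = -1) {u : ModelV p q →ₗ[ℝ] T} (hu : ∀ v, u (Complex.I • v) = J (u v))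

theorem ιMulti_lift_ne_zero (hinj : Function.Injective u)
    (hdim : Module.finrank ℝ (ModelV p q) = Module.finrank ℝ T)
    (b : Module.Basis (Fin (p + q + 2)) ℂ (ModelV p q)) :
    exteriorPower.ιMulti ℂ (p + q + 2) (fun i => lift J hJ u hu (b i)) ≠ 0 := by
  have : FiniteDimensional ℝ (CplxOf J hJ) := (realEquiv J hJ).finiteDimensional
  have : FiniteDimensional ℂ (CplxOf J hJ) := FiniteDimensional.right ℝ ℂ _
  have h : Module.finrank ℂ (ModelV p q) = Module.finrank ℂ (CplxOf J hJ) := by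
    have h1 := finrank_eq (J := J) (hJ := hJ)
    have h2 := finrank_real_of_complex (ModelV p q)
    omega
  exact ιMulti_comp_ne_zero b (LinearMap.linearEquivOfInjective (lift J hJ u hu) hinj h)

theorem sum_ιMulti_update_lift (b : Module.Basis (Fin (p + q + 2)) ℂ (ModelV p q))
    (f f' : Fin (p + q + 2) → ModelV p q) : ∑ i, exteriorPower.ιMulti ℂ (p + q + 2)
    (Function.update (fun j => lift J hJ u hu (f j)) i (lift J hJ u hu (f' i))) =
    (∑ i, b.det (Function.update f i (f' i))) • exteriorPower.ιMulti ℂ (p + q + 2)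
    (fun i => lift J hJ u hu (b i)) := by
  rw [Finset.sum_smul]
  refine Finset.sum_congr rfl fun i _ => ?_
  rw [← ιMulti_comp_eq]
  congr 1
  funext j
  by_cases h : j = i
  · subst h
    simp
  · simp [h]

theorem map_lift_eq_iff (hinj : Function.Injective u)
    (hdim : Module.finrank ℝ (ModelV p q) = Module.finrank ℝ T)
    (b : Module.Basis (Fin (p + q + 2)) ℂ (ModelV p q)) (f : Fin (p + q + 2) → ModelV p q) :
    exteriorPower.map (p + q + 2) (lift J hJ u hu) (exteriorPower.ιMulti ℂ (p + q + 2) b) =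
    exteriorPower.ιMulti ℂ (p + q + 2) (fun i => lift J hJ u hu (f i)) ↔ b.det f = 1 := by
  rw [exteriorPower.map_apply_ιMulti, ιMulti_comp_eq b (lift J hJ u hu) f]
  have h := ιMulti_lift_ne_zero hJ hu hinj hdim b
  constructor
  · intro h1
    refine smul_left_injective ℂ h ?_
    change _ • _ = _ • _
    rw [one_smul]
    exact h1.symm
  · intro h1
    rw [h1, one_smul]
    rfl

end CplxOf

section endomorphismsInCharts

variable {n : ℕ} {M : Type*} [TopologicalSpace M]
  [ChartedSpace (𝔼 n) M] [IsManifold (𝓡 n) ∞ M] {r s : ℕ}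
  {g : PseudoRiemannianMetric n M r s} (𝕁 : ParallelComplexStructure g)

/-- The parallel complex structure at `x` as an endomorphism of the model fibre. -/
def ParallelComplexStructure.endo (x : M) : 𝕋 n →L[ℝ] 𝕋 n := 𝕁.J x

/-- The parallel complex structure in the chart at `x₀`. -/
def ParallelComplexStructure.inChart (x₀ : M) (y : 𝔼 n) : 𝕋 n →L[ℝ] 𝕋 n :=
  diagL (chartDeriv x₀ ((chart n x₀).symm y)) ∘L
    (𝕁.endo ((chart n x₀).symm y) ∘L diagL (symmDeriv x₀ y))

theorem ParallelComplexStructure.inChart_extChartAt {x₀ x : M} (hx : x ∈ (chart n x₀).source)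
    (v : 𝕋 n) : 𝕁.inChart x₀ (chart n x₀ x) (diagL (chartDeriv x₀ x) v) = diagL (chartDeriv x₀ x)
    (𝕁.endo x v) := by
  change diagL (chartDeriv x₀ ((chart n x₀).symm _)) (𝕁.endo
    ((chart n x₀).symm _) (diagL (symmDeriv x₀ _) (diagL (chartDeriv x₀ x) v))) = _
  rw [diagL_symmDeriv_chartDeriv hx, (chart n x₀).left_inv hx]

theorem ParallelComplexStructure.inChart_apply (x₀ : M) (y : 𝔼 n) (v : 𝕋 n) : 𝕁.inChart x₀ y v =
    diagL (chartDeriv x₀ ((chart n x₀).symm y))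
    (𝕁.endo ((chart n x₀).symm y) (diagL (symmDeriv x₀ y) v)) := rfl

theorem ParallelComplexStructure.contDiffOn_inChart (x₀ : M) :
    ContDiffOn ℝ ∞ (𝕁.inChart x₀) (chart n x₀).target := by
  have hb : (chart n x₀).source ⊆ (trivializationAt (𝕋 n →L[ℝ] 𝕋 n)
      (fun x : M => Tractor n M x →L[ℝ] Tractor n M x) x₀).baseSet := by
    have : (trivializationAt (𝕋 n →L[ℝ] 𝕋 n)
      (fun x : M => Tractor n M x →L[ℝ] Tractor n M x) x₀).baseSet
        = (trivializationAt 𝕋 n (Tractor n M) x₀).baseSet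
          ∩ (trivializationAt 𝕋 n (Tractor n M) x₀).baseSet := rfl
    rw [this, baseSet_tractor, inter_self]
  have h := ((trivializationAt (𝕋 n →L[ℝ] 𝕋 n)
    (fun x : M => Tractor n M x →L[ℝ] Tractor n M x) x₀).contMDiffOn_section_iff (IB := 𝓡 n)
      (n := ∞) (s := 𝕁.J) (isOpen_extChartAt_source x₀) hb).1 𝕁.smooth.contMDiffOn
  have h1 := contDiffOn_comp_extChartAt_symm (U := univ) x₀ (h.mono inter_subset_right)
  rw [chartImage, preimage_univ, inter_univ] at h1
  refine h1.congr fun y hy => ContinuousLinearMap.ext fun v => ?_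
  have h2 := trivializationAt_end ((chart n x₀).map_target hy)
    (𝕁.J ((chart n x₀).symm y)) v
  rw [(chart n x₀).right_inv hy] at h2
  exact h2.symm

theorem ParallelComplexStructure.inChart_parallel (x₀ : M) {y : 𝔼 n} (hy : y ∈ (chart n x₀).target)
    (Y : 𝔼 n) (v : 𝕋 n) : fderiv ℝ (𝕁.inChart x₀) y Y v + CoordMetric.tractorConn (g.inChart x₀) y Y
    (𝕁.inChart x₀ y v) = 𝕁.inChart x₀ y (CoordMetric.tractorConn (g.inChart x₀) y Y v) := by
  obtain ⟨x, hx, rfl⟩ : ∃ x ∈ (chart n x₀).source, chart n x₀ x = y :=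
    ⟨_, (chart n x₀).map_target hy, (chart n x₀).right_inv hy⟩
  have hopen := isOpen_extChartAt_source (I := 𝓡 n) x₀
  have hopen' := isOpen_extChartAt_target (I := 𝓡 n) x₀
  let σ' : ∀ x : M, Tractor n M x := fun z => 𝕁.J z (constTractor x₀ v z)
  have hσ := isSmoothTractorOn_constTractor x₀ v
  have hσ'v : ∀ z ∈ (chart n x₀).source,
      diagL (chartDeriv x₀ z) (σ' z) = 𝕁.inChart x₀ (chart n x₀ z) v := fun z hz => by
    rw [𝕁.inChart_apply, (chart n x₀).left_inv hz]
    rfl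
  have hσ' : IsSmoothTractorOn σ' (chart n x₀).source := by
    rw [isSmoothTractorOn_iff hopen Subset.rfl]
    refine ContMDiffOn.congr ?_ hσ'v
    exact ((𝕁.contDiffOn_inChart x₀).clm_apply (contDiffOn_const (c := v))).contMDiffOn.comp
      (contMDiffOn_extChartAt.mono (by rw [extChartAt_source]))
      fun z hz => (chart n x₀).map_source hz
  have hfd : fderiv ℝ (tractorInChart x₀ σ') (chart n x₀ x) Y
      = fderiv ℝ (𝕁.inChart x₀) (chart n x₀ x) Y v := by
    have h1 := ((𝕁.contDiffOn_inChart x₀).hasFDerivAt_of_isOpen hopen' hy).clm_apply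
      (hasFDerivAt_const v _)
    have h2 : tractorInChart x₀ σ' =ᶠ[𝓝 (chart n x₀ x)] fun y => 𝕁.inChart x₀ y v := by
      filter_upwards [hopen'.mem_nhds hy] with y hy
      have := hσ'v _ ((chart n x₀).map_target hy)
      rw [(chart n x₀).right_inv hy] at this
      exact this
    rw [(h1.congr_of_eventuallyEq h2).fderiv]
    simp
  have hfd0 : fderiv ℝ (tractorInChart x₀ (constTractor x₀ v)) (chart n x₀ x) Y = 0 := by
    have h2 : tractorInChart x₀ (constTractor x₀ v) =ᶠ[𝓝 (chart n x₀ x)] fun _ => v := by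
      filter_upwards [hopen'.mem_nhds hy] with y hy
      exact tractorInChart_constTractor hy v
    rw [((hasFDerivAt_const v _).congr_of_eventuallyEq h2).fderiv]
    rfl
  have hXY : chartDeriv x₀ x (symmDeriv x₀ (chart n x₀ x) Y) = Y := by
    have := chartDeriv_symmDeriv hy Y
    rwa [(chart n x₀).left_inv hx] at this
  have hpar := 𝕁.parallel _ hopen (constTractor x₀ v) hσ x hx
    (symmDeriv x₀ (chart n x₀ x) Y)
  have h1 := g.tractorDeriv_inChart hσ' hopen hx hx (symmDeriv x₀ (chart n x₀ x) Y)
  have h2 := g.tractorDeriv_inChart hσ hopen hx hx (symmDeriv x₀ (chart n x₀ x) Y)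
  have h3 : diagL (chartDeriv x₀ x) (constTractor x₀ v x) = v := by
    rw [← tractorInChart_extChartAt hx, tractorInChart_constTractor hy]
  rw [hXY, hfd, hσ'v x hx] at h1
  rw [hXY, hfd0, zero_add, h3] at h2
  rw [← h1, ← h2]
  exact (congrArg (diagL (chartDeriv x₀ x)) hpar).trans (𝕁.inChart_extChartAt hx _).symm

theorem ParallelComplexStructure.inChart_sq (x₀ : M) {y : 𝔼 n} (hy : y ∈ (chart n x₀).target)
    (v : 𝕋 n) : 𝕁.inChart x₀ y (𝕁.inChart x₀ y v) = -v := by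
  have hx := (chart n x₀).map_target hy
  have h := 𝕁.inChart_extChartAt hx (𝕁.endo ((chart n x₀).symm y) (diagL (symmDeriv x₀ y) v))
  rw [(chart n x₀).right_inv hy, ← 𝕁.inChart_apply] at h
  have h2 : 𝕁.endo ((chart n x₀).symm y) (𝕁.endo ((chart n x₀).symm y)
    (diagL (symmDeriv x₀ y) v)) = -diagL (symmDeriv x₀ y) v := 𝕁.sq _ _
  rw [h, h2, map_neg, diagL_chartDeriv_symmDeriv hy]

theorem PseudoRiemannianMetric.tractorForm_inChart (g : PseudoRiemannianMetric n M r s) {x₀ x : M}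
    (hx : x ∈ (chart n x₀).source) (v w : 𝕋 n) : CoordMetric.tractorForm (g.inChart x₀)
    (chart n x₀ x) (diagL (chartDeriv x₀ x) v) (diagL (chartDeriv x₀ x) w) = g.tractorMetric x v w := by
  rw [CoordMetric.tractorForm_apply, g.inChart_apply, (chart n x₀).left_inv hx]
  simp only [diagL_apply]
  rw [symmDeriv_chartDeriv hx, symmDeriv_chartDeriv hx]
  rfl

theorem ParallelComplexStructure.inChart_orthogonal (x₀ : M) {y : 𝔼 n}
    (hy : y ∈ (chart n x₀).target) (v w : 𝕋 n) : CoordMetric.tractorForm (g.inChart x₀) y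
    (𝕁.inChart x₀ y v) (𝕁.inChart x₀ y w) = CoordMetric.tractorForm (g.inChart x₀) y v w := by
  obtain ⟨x, hx, rfl⟩ : ∃ x ∈ (chart n x₀).source, chart n x₀ x = y :=
    ⟨_, (chart n x₀).map_target hy, (chart n x₀).right_inv hy⟩
  have h := diagL_chartDeriv_symmDeriv hy
  rw [(chart n x₀).left_inv hx] at h
  rw [← h v, ← h w, 𝕁.inChart_extChartAt hx, 𝕁.inChart_extChartAt hx, g.tractorForm_inChart hx,
    g.tractorForm_inChart hx]
  exact 𝕁.orthogonal x _ _

end endomorphismsInCharts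

theorem CoordMetric.IsMetricOn.tractorForm_nondegenerate {n : ℕ} {G : 𝔼 n → 𝔼 n →L[ℝ] 𝔼 n →L[ℝ] ℝ}
    {Ω : Set (𝔼 n)} (h : CoordMetric.IsMetricOn G Ω) {y : 𝔼 n} (hy : y ∈ Ω) (v : 𝕋 n)
    (hv : ∀ w, CoordMetric.tractorForm G y v w = 0) : v = 0 := by
  have h1 := hv (0, 0, 1)
  have h2 := hv (1, 0, 0)
  have h3 : G y v.2.1 = 0 := ContinuousLinearMap.ext fun a => by
    have := hv (0, a, 0)
    simpa [CoordMetric.tractorForm_apply] using this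
  rw [CoordMetric.tractorForm_apply] at h1 h2
  simp at h1 h2
  refine Prod.ext h1 (Prod.ext ((h.inv y hy).injective ?_) h2)
  rw [h3]
  exact (map_zero _).symm

theorem CplxOf.sum_det_eq_zero {p q : ℕ} {T : Type*} [AddCommGroup T] [Module ℝ T]
    [FiniteDimensional ℝ T] {J : Module.End ℝ T} (hJ : J * J = -1) {u : ModelV p q →ₗ[ℝ] T}
    (hu : ∀ v, u (Complex.I • v) = J (u v)) (hinj : Function.Injective u)
    (hdim : Module.finrank ℝ (ModelV p q) = Module.finrank ℝ T)
    (b : Module.Basis (Fin (p + q + 2)) ℂ (ModelV p q)) {f f' : Fin (p + q + 2) → ModelV p q}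
    {t t' : Fin (p + q + 2) → T} (hf : ∀ i, u (f i) = t i) (hf' : ∀ i, u (f' i) = t' i)
    (h : ∑ i, exteriorPower.ιMulti ℂ (p + q + 2)
      (Function.update (fun j => CplxOf.of J hJ (t j)) i (CplxOf.of J hJ (t' i))) = 0) :
    ∑ i, b.det (Function.update f i (f' i)) = 0 := by
  refine (smul_eq_zero.1 ?_).resolve_right (CplxOf.ιMulti_lift_ne_zero hJ hu hinj hdim b)
  rw [← CplxOf.sum_ιMulti_update_lift hJ hu b, ← h]
  refine Finset.sum_congr rfl fun i _ => ?_
  congr 1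
  exact congrArg₂ (fun a c => Function.update a i c) (funext fun j => hf j) (hf' i)

theorem finrank_modelV_eq_finrank_tractorFibre (p q : ℕ) : Module.finrank ℝ (ModelV p q)
    = Module.finrank ℝ (𝕋 (2 * p + 2 * q + 2)) := by
  rw [finrank_real_of_complex]
  simp
  ring

/-- The middle component of a tractor. -/
def tractorPr {n : ℕ} : 𝕋 n →L[ℝ] 𝔼 n :=
  ContinuousLinearMap.fst ℝ (𝔼 n) ℝ ∘L ContinuousLinearMap.snd ℝ ℝ ((𝔼 n) × ℝ)

theorem tractorPr_apply {n : ℕ} (t : 𝕋 n) : tractorPr t = t.2.1 := rfl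

section generalDimension

variable {n : ℕ} {M : Type*} [TopologicalSpace M] [ChartedSpace (𝔼 n) M] [IsManifold (𝓡 n) ∞ M]
  {r s : ℕ} {g : PseudoRiemannianMetric n M r s} (𝕁 : ParallelComplexStructure g)

theorem ParallelComplexStructure.tractorCurv_kappa_inChart (hn : 3 ≤ n) {x₀ : M} {y : 𝔼 n}
    (hy : y ∈ (chart n x₀).target) (X : 𝔼 n) (v : 𝕋 n) :
    curvL (CoordMetric.tractorConn (g.inChart x₀)) y (𝕁.inChart x₀ y (0, 0, 1)).2.1 X v = 0 := by
  have hF : ∀ a c w, CoordMetric.tractorCurv (g.inChart x₀) y a c (𝕁.inChart x₀ y w)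
      = 𝕁.inChart x₀ y (CoordMetric.tractorCurv (g.inChart x₀) y a c w) :=
    fun a c w => curvL_apply_comm (isOpen_extChartAt_target x₀)
        (g.isMetricOn_inChart x₀).contDiffOn_tractorConn
        (𝕁.contDiffOn_inChart x₀) (fun _ hz => 𝕁.inChart_parallel x₀ hz) hy a c w
  have hsq := 𝕁.inChart_sq x₀ hy
  have ho := 𝕁.inChart_orthogonal x₀ hy
  obtain ⟨J, hJ⟩ : ∃ J : 𝕋 n →ₗ[ℝ] 𝕋 n, ∀ v, 𝕁.inChart x₀ y v = J v :=
    ⟨𝕁.inChart x₀ y, fun _ => rfl⟩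
  simp only [hJ] at hF hsq ho ⊢
  exact (g.isMetricOn_inChart x₀).tractorCurv_kappa hy hn J hsq ho hF X v

/-- The standard tractor bundle with its parallel data in the chart at `x₀`. -/
def ParallelComplexStructure.tractorChart {p q : ℕ} (hn : 3 ≤ n)
    (hdim : Module.finrank ℝ (ModelV p q) = Module.finrank ℝ 𝕋 n)
    (𝓥 : HermitianModel p q) (b : Module.Basis (Fin (p + q + 2)) ℂ (ModelV p q)) (x₀ : M)
    {U : Set M} (hU : IsOpen U) {σ : Fin (p + q + 2) → ∀ x : M, Tractor n M x}
    (hσ : ∀ i, IsSmoothTractorOn (σ i) U)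
    (hpar : ∀ x ∈ U, ∀ X, ∀ u : ModelV p q →ₗ[ℝ] 𝕋 n, Function.Injective u →
      (∀ v, u (Complex.I • v) = 𝕁.endo x (u v)) → ∀ f f' : Fin (p + q + 2) → ModelV p q,
      (∀ i, u (f i) = σ i x) → (∀ i, u (f' i) = g.tractorDeriv (σ i) x X) →
      ∑ i, b.det (Function.update f i (f' i)) = 0) :
    TractorChart 𝓥 (𝔼 n) 𝕋 n where
  Ω := chartImage x₀ U
  A := CoordMetric.tractorConn (g.inChart x₀)
  h := CoordMetric.tractorForm (g.inChart x₀)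
  J := 𝕁.inChart x₀
  b := b
  s := fun i => tractorInChart x₀ (σ i)
  e := (0, 0, 1)
  ι := ContinuousLinearMap.inr ℝ ℝ _ ∘L ContinuousLinearMap.inl ℝ _ ℝ
  pr := tractorPr
  isOpen := isOpen_chartImage x₀ hU
  finrank_eq := hdim
  smooth_A := (g.isMetricOn_inChart x₀).contDiffOn_tractorConn.mono inter_subset_left
  smooth_h := (CoordMetric.contDiffOn_tractorForm (g.isMetricOn_inChart x₀).smooth).mono
    inter_subset_left
  smooth_J := (𝕁.contDiffOn_inChart x₀).mono inter_subset_left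
  smooth_s := fun i => (hσ i).contDiffOn hU x₀
  h_symm := fun y hy => (g.isMetricOn_inChart x₀).tractorForm_symm hy.1
  h_nondegenerate := fun y hy => (g.isMetricOn_inChart x₀).tractorForm_nondegenerate hy.1
  h_parallel := fun y hy => (g.isMetricOn_inChart x₀).tractorForm_parallel hy.1
  J_sq := fun y hy => 𝕁.inChart_sq x₀ hy.1
  J_orthogonal := fun y hy => 𝕁.inChart_orthogonal x₀ hy.1
  J_parallel := fun y hy => 𝕁.inChart_parallel x₀ hy.1
  s_parallel := by
    intro y hy Y τ hinj hτ f f' hf hf'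
    have hx := (chart n x₀).map_target hy.1
    have hr := (chart n x₀).right_inv hy.1
    have hDD : ∀ v, diagL (symmDeriv x₀ y)
        (diagL (chartDeriv x₀ ((chart n x₀).symm y)) v) = v := fun v => by
      have := diagL_symmDeriv_chartDeriv hx v
      rwa [hr] at this
    have hDD' := diagL_chartDeriv_symmDeriv hy.1
    refine hpar _ hy.2 (symmDeriv x₀ y Y) (diagL (symmDeriv x₀ y) ∘L τ : _ →L[ℝ] _)
      (fun v w hvw => hinj ?_) (fun v => ?_) f f' (fun i => ?_) (fun i => ?_)
    · have := congrArg (diagL (chartDeriv x₀ ((chart n x₀).symm y))) hvw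
      exact (hDD' _).symm.trans (this.trans (hDD' _))
    · refine (congrArg (diagL (symmDeriv x₀ y)) (hτ v)).trans ?_
      exact hDD _
    · exact (congrArg (diagL (symmDeriv x₀ y)) (hf i)).trans (hDD _)
    · refine (congrArg (diagL (symmDeriv x₀ y)) (hf' i)).trans ?_
      have h1 := g.tractorDeriv_inChart (hσ i) hU hy.2 hx (symmDeriv x₀ y Y)
      rw [hr, chartDeriv_symmDeriv hy.1] at h1
      exact (congrArg (diagL (symmDeriv x₀ y)) h1.symm).trans (hDD _)
  A_e := by
    intro y hy X
    rw [CoordMetric.tractorConn_apply]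
    simp
  pr_e := rfl
  pr_ι := fun _ => rfl
  h_e_e := by
    intro y hy
    rw [CoordMetric.tractorForm_apply]
    simp
  eq_of_perp := by
    intro y hy t ht
    rw [CoordMetric.tractorForm_apply] at ht
    simp at ht
    refine ⟨t.2.2, Prod.ext ?_ (Prod.ext ?_ ?_)⟩ <;> simp [ht, tractorPr_apply]
  curv_kappa := by
    intro y hy X v
    rw [tractorPr_apply]
    refine Eq.trans ?_ (𝕁.tractorCurv_kappa_inChart hn hy.1 X v)
    congr 1

theorem ParallelComplexStructure.exists_tractorChart {p q : ℕ} (hn : 3 ≤ n)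
    (hdim : Module.finrank ℝ (ModelV p q) = Module.finrank ℝ 𝕋 n)
    (𝓥 : HermitianModel p q) (b : Module.Basis (Fin (p + q + 2)) ℂ (ModelV p q)) (x₀ : M)
    {U : Set M} (hU : IsOpen U) {σ : Fin (p + q + 2) → ∀ x : M, Tractor n M x}
    (hσ : ∀ i, IsSmoothTractorOn (σ i) U)
    (hpar : ∀ x ∈ U, ∀ X, ∀ u : ModelV p q →ₗ[ℝ] 𝕋 n, Function.Injective u →
      (∀ v, u (Complex.I • v) = 𝕁.endo x (u v)) → ∀ f f' : Fin (p + q + 2) → ModelV p q,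
      (∀ i, u (f i) = σ i x) → (∀ i, u (f' i) = g.tractorDeriv (σ i) x X) →
      ∑ i, b.det (Function.update f i (f' i)) = 0) :
    ∃ C : TractorChart 𝓥 (𝔼 n) 𝕋 n, C.Ω = chartImage x₀ U ∧
      C.A = CoordMetric.tractorConn (g.inChart x₀) ∧ C.h = CoordMetric.tractorForm (g.inChart x₀) ∧
      C.J = 𝕁.inChart x₀ ∧ C.e = (0, 0, 1) ∧ C.pr = tractorPr ∧ C.b = b ∧
      ∀ i, C.s i = tractorInChart x₀ (σ i) :=
  ⟨𝕁.tractorChart hn hdim 𝓥 b x₀ hU hσ hpar, rfl, rfl, rfl, rfl, rfl, rfl, rfl,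
    fun _ => rfl⟩

end generalDimension

section volumeInCharts

variable {p q : ℕ} {M : Type*} [TopologicalSpace M]
  [ChartedSpace (𝔼 (2 * p + 2 * q + 2)) M]
  [IsManifold (𝓡 (2 * p + 2 * q + 2)) ∞ M]
  {g : PseudoRiemannianMetric (2 * p + 2 * q + 2) M (2 * p + 1) (2 * q + 1)}
  {𝕁 : ParallelComplexStructure g}

/-- The frames of the reduced frame bundle, except for the condition on the null line. -/
def ParallelVolume.IsReducedFrame (ν : ParallelVolume 𝕁) (𝓥 : HermitianModel p q) (x : M)
    (u : ModelV p q →L[ℝ] Tractor (2 * p + 2 * q + 2) M x) : Prop :=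
  (∀ v w, g.tractorMetric x (u v) (u w) = (𝓥.H v w).re) ∧
    ∃ hu : ∀ v : ModelV p q, u (Complex.I • v) = 𝕁.J x (u v),
      exteriorPower.map (p + q + 2)
        (CplxOf.lift (𝕁.J x : Tractor (2 * p + 2 * q + 2) M x →ₗ[ℝ] Tractor (2 * p + 2 * q + 2) M x)
          (𝕁.mul_self x) (u : ModelV p q →ₗ[ℝ] Tractor (2 * p + 2 * q + 2) M x) hu) 𝓥.vol
        = ν.ν x

/-- A frame as a map between fixed vector spaces. -/
def frameMap {x : M} (u : ModelV p q →L[ℝ] Tractor (2 * p + 2 * q + 2) M x) :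
    ModelV p q →L[ℝ] 𝕋 (2 * p + 2 * q + 2) := u

theorem CplxOf.exists_map_lift_eq_iff {p q : ℕ} {T : Type*} [AddCommGroup T] [Module ℝ T]
    [FiniteDimensional ℝ T] {J : Module.End ℝ T} (hJ : J * J = -1) {u : ModelV p q →ₗ[ℝ] T}
    (hu : ∀ v, u (Complex.I • v) = J (u v)) (hinj : Function.Injective u)
    (hdim : Module.finrank ℝ (ModelV p q) = Module.finrank ℝ T)
    (b : Module.Basis (Fin (p + q + 2)) ℂ (ModelV p q)) (t : Fin (p + q + 2) → T)
    {η : ⋀[ℂ]^(p + q + 2) (ModelV p q)} (hη : exteriorPower.ιMulti ℂ (p + q + 2) b = η)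
    {ζ : ⋀[ℂ]^(p + q + 2) (CplxOf J hJ)}
    (hζ : ζ = exteriorPower.ιMulti ℂ (p + q + 2) (fun i => CplxOf.of J hJ (t i))) :
    exteriorPower.map (p + q + 2) (lift J hJ u hu) η = ζ ↔ ∃ f, (∀ i, u (f i) = t i) ∧ b.det f = 1 := by
  subst hη hζ
  have hsurj : Function.Surjective u := (LinearMap.linearEquivOfInjective u hinj hdim).surjective
  choose f hf using fun i => hsurj (t i)
  have h := CplxOf.map_lift_eq_iff hJ hu hinj hdim b f
  have e : (fun i => lift J hJ u hu (f i)) = fun i => CplxOf.of J hJ (t i) := funext hf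
  rw [e] at h
  rw [h]
  refine ⟨fun h => ⟨f, hf, h⟩, fun ⟨f', hf', h⟩ => ?_⟩
  rwa [show f = f' from funext fun i => hinj ((hf i).trans (hf' i).symm)]

set_option maxHeartbeats 1600000 in
theorem ParallelVolume.isReducedFrame_iff (ν : ParallelVolume 𝕁) (𝓥 : HermitianModel p q) {x : M}
    {b : Module.Basis (Fin (p + q + 2)) ℂ (ModelV p q)}
    (hb : exteriorPower.ιMulti ℂ (p + q + 2) b = 𝓥.vol)
    {σ : Fin (p + q + 2) → Tractor (2 * p + 2 * q + 2) M x}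
    (hσ : ν.ν x = exteriorPower.ιMulti ℂ (p + q + 2) (fun i => 𝕁.toFibre x (σ i)))
    {u : ModelV p q →L[ℝ] Tractor (2 * p + 2 * q + 2) M x}
    (hinj : (∀ v w, g.tractorMetric x (u v) (u w) = (𝓥.H v w).re) →
      Function.Injective (frameMap u : ModelV p q →ₗ[ℝ] 𝕋 (2 * p + 2 * q + 2))) :
    ν.IsReducedFrame 𝓥 x u ↔ (∀ v w, g.tractorMetric x (u v) (u w) = (𝓥.H v w).re) ∧
      (∀ v, frameMap u (Complex.I • v) = 𝕁.endo x (frameMap u v)) ∧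
      ∃ f, (∀ i, frameMap u (f i) = σ i) ∧ b.det f = 1 :=
  and_congr_right fun hm =>
    have key := fun hu => CplxOf.exists_map_lift_eq_iff
      (T := 𝕋 (2 * p + 2 * q + 2)) (J := (𝕁.endo x :
        𝕋 (2 * p + 2 * q + 2) →ₗ[ℝ] 𝕋 (2 * p + 2 * q + 2)))
      (𝕁.mul_self x) hu (hinj hm)
      (finrank_modelV_eq_finrank_tractorFibre p q) b σ hb hσ
    ⟨fun ⟨hu, h⟩ => ⟨hu, (key hu).1 h⟩, fun ⟨hu, h⟩ => ⟨hu, (key hu).2 h⟩⟩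

theorem ParallelVolume.exists_tractorChart (hpq : 1 ≤ p + q) (ν : ParallelVolume 𝕁)
    (𝓥 : HermitianModel p q) (x₀ : M) : ∃
    (C : TractorChart 𝓥 (𝔼 (2 * p + 2 * q + 2)) (𝕋 (2 * p + 2 * q + 2))) (U : Set M), IsOpen U ∧ x₀
    ∈ U ∧ C.Ω = chartImage x₀ U ∧ C.A = CoordMetric.tractorConn (g.inChart x₀) ∧ C.h =
    CoordMetric.tractorForm (g.inChart x₀) ∧ C.J = 𝕁.inChart x₀ ∧ C.e = (0, 0, 1) ∧ C.pr = tractorPr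
    ∧ ∀ x ∈ U, x ∈ (extChartAt (𝓡 (2 * p + 2 * q + 2)) x₀).source → ∀ u : ModelV p q →L[ℝ] Tractor
    (2 * p + 2 * q + 2) M x, ν.IsReducedFrame 𝓥 x u ↔ C.IsFrame
    (extChartAt (𝓡 (2 * p + 2 * q + 2)) x₀ x) (diagL (chartDeriv x₀ x) ∘L frameMap u) := by
  obtain ⟨b, hb⟩ := 𝓥.exists_vol_basis
  obtain ⟨U, hU, hx₀U, σ, hσ, hνσ, hpar⟩ := ν.parallel x₀
  have hdim := finrank_modelV_eq_finrank_tractorFibre p q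
  have hpar' : ∀ x ∈ U, ∀ X, ∀ u : ModelV p q →ₗ[ℝ] 𝕋 (2 * p + 2 * q + 2),
      Function.Injective u → (∀ v, u (Complex.I • v) = 𝕁.endo x (u v)) →
      ∀ f f' : Fin (p + q + 2) → ModelV p q,
      (∀ i, u (f i) = σ i x) → (∀ i, u (f' i) = g.tractorDeriv (σ i) x X) →
      ∑ i, b.det (Function.update f i (f' i)) = 0 := fun x hx X u hinj hu f f' hf hf' =>
    CplxOf.sum_det_eq_zero (T := 𝕋 (2 * p + 2 * q + 2))
      (J := (𝕁.endo x : 𝕋 (2 * p + 2 * q + 2) →ₗ[ℝ] 𝕋 (2 * p + 2 * q + 2)))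
      (𝕁.mul_self x) hu hinj hdim b hf hf' (hpar x hx X)
  obtain ⟨C, h1, h2, h3, h4, h5, h6, h7, h8⟩ := 𝕁.exists_tractorChart (by omega)
    hdim 𝓥 b x₀ hU hσ hpar'
  refine ⟨C, U, hU, hx₀U, h1, h2, h3, h4, h5, h6, fun x hxU hx u => ?_⟩
  have hDD := diagL_symmDeriv_chartDeriv hx
  have hD : Function.Injective (diagL (chartDeriv x₀ x)) := Function.LeftInverse.injective hDD
  have e1 : (∀ v w, C.h (extChartAt (𝓡 (2 * p + 2 * q + 2)) x₀ x)
      ((diagL (chartDeriv x₀ x) ∘L frameMap u) v) ((diagL (chartDeriv x₀ x) ∘L frameMap u) w)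
        = (𝓥.H v w).re) ↔ ∀ v w, g.tractorMetric x (u v) (u w) = (𝓥.H v w).re := by
    rw [h3]
    refine forall₂_congr fun v w => ?_
    have h := g.tractorForm_inChart hx (frameMap u v) (frameMap u w)
    exact ⟨fun h' => h.symm.trans h', fun h' => h.trans h'⟩
  have e2 : (∀ v, (diagL (chartDeriv x₀ x) ∘L frameMap u) (Complex.I • v)
      = C.J (extChartAt (𝓡 (2 * p + 2 * q + 2)) x₀ x) ((diagL (chartDeriv x₀ x) ∘L frameMap u) v))
      ↔ ∀ v, frameMap u (Complex.I • v) = 𝕁.endo x (frameMap u v) := by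
    rw [h4]
    exact forall_congr' fun v => by
      rw [ContinuousLinearMap.comp_apply, ContinuousLinearMap.comp_apply,
        𝕁.inChart_extChartAt hx, hD.eq_iff]
  have hinj : (∀ v w, g.tractorMetric x (u v) (u w) = (𝓥.H v w).re) →
      Function.Injective (frameMap u : ModelV p q →ₗ[ℝ] 𝕋 (2 * p + 2 * q + 2)) :=
    fun h => Function.Injective.of_comp (f := diagL (chartDeriv x₀ x))
      (TractorChart.injective_of_isometry (e1.2 h))
  have e3 : (∃ f, (∀ i, (diagL (chartDeriv x₀ x) ∘L frameMap u) (f i)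
      = C.s i (extChartAt (𝓡 (2 * p + 2 * q + 2)) x₀ x)) ∧ C.b.det f = 1)
      ↔ ∃ f, (∀ i, frameMap u (f i) = σ i x) ∧ b.det f = 1 := by
    rw [h7]
    refine exists_congr fun f => and_congr_left fun _ => forall_congr' fun i => ?_
    rw [h8, tractorInChart_extChartAt hx]
    exact hD.eq_iff
  refine (ν.isReducedFrame_iff 𝓥 hb (hνσ x hxU) hinj).trans ?_
  exact ⟨fun ⟨h1, h2, h3⟩ => ⟨e1.2 h1, e2.2 h2, e3.2 h3⟩,
    fun ⟨h1, h2, h3⟩ => ⟨e1.1 h1, e2.1 h2, e3.1 h3⟩⟩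

end volumeInCharts

local instance {p q : ℕ} : CompleteSpace (ModelEnd p q) := inferInstance

local instance {p q : ℕ} : HasSummableGeomSeries (ModelEnd p q) := inferInstance

local instance {p q : ℕ} : ContinuousSMul ℝ (ModelEnd p q) := inferInstance

local instance {p q : ℕ} : ChartedSpace (ModelEnd p q) (ModelEnd p q)ˣ := inferInstance

section units

variable {p q : ℕ}

theorem ModelEnd.mul_inv_apply (a : (ModelEnd p q)ˣ) (v : ModelV p q) : a.1 ((a⁻¹).1 v) = v :=
  congrArg (fun f : ModelEnd p q => f v) a.mul_inv

theorem ModelEnd.inv_mul_apply (a : (ModelEnd p q)ˣ) (v : ModelV p q) : (a⁻¹).1 (a.1 v) = v :=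
  congrArg (fun f : ModelEnd p q => f v) a.inv_mul

theorem ModelEnd.units_injective (a : (ModelEnd p q)ˣ) : Function.Injective (a : ModelEnd p q) :=
  Function.LeftInverse.injective (inv_mul_apply a)

end units

namespace HermitianModel

variable {p q : ℕ} (𝓥 : HermitianModel p q) {v₀ : ModelV p q}

theorem mem_L_iff (h : 𝓥.LR = Submodule.span ℝ {v₀}) {v : ModelV p q} :
    v ∈ 𝓥.L ↔ ∃ z : ℂ, z • v₀ = v := by
  rw [L, h, Submodule.span_span_of_tower, Submodule.mem_span_singleton]

theorem apply_mem_Q (h : 𝓥.LR = Submodule.span ℝ {v₀}) (h0 : v₀ ≠ 0) {a : (ModelEnd p q)ˣ}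
    (ha : a ∈ 𝓥.Q) : ∃ z : ℂ, z ≠ 0 ∧ a.1 v₀ = z • v₀ := by
  have h1 : a.1 v₀ ∈ 𝓥.L := by
    rw [← ha.2]
    exact ⟨v₀, (𝓥.mem_L_iff h).2 ⟨1, one_smul _ _⟩, rfl⟩
  obtain ⟨z, hz⟩ := (𝓥.mem_L_iff h).1 h1
  refine ⟨z, ?_, hz.symm⟩
  rintro rfl
  rw [zero_smul] at hz
  exact h0 (ModelEnd.units_injective a (hz.symm.trans (map_zero _).symm))

theorem mem_Q_of_apply (h : 𝓥.LR = Submodule.span ℝ {v₀}) {a : (ModelEnd p q)ˣ} (ha : a ∈ 𝓥.SU)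
    {z : ℂ} (hz : z ≠ 0) (haz : a.1 v₀ = z • v₀) : a ∈ 𝓥.Q := by
  refine ⟨ha, le_antisymm ?_ fun w hw => ?_⟩
  · rintro _ ⟨w, hw, rfl⟩
    obtain ⟨k, rfl⟩ := (𝓥.mem_L_iff h).1 hw
    refine (𝓥.mem_L_iff h).2 ⟨k * z, ?_⟩
    change _ = a.1 (k • v₀)
    rw [map_smul, haz, mul_smul]
  · obtain ⟨k, rfl⟩ := (𝓥.mem_L_iff h).1 hw
    refine ⟨(k / z) • v₀, (𝓥.mem_L_iff h).2 ⟨_, rfl⟩, ?_⟩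
    change (a : ModelEnd p q) ((k / z) • v₀) = _
    rw [map_smul, haz, smul_smul, div_mul_cancel₀ _ hz]

theorem apply_mem_PSU (h : 𝓥.LR = Submodule.span ℝ {v₀}) (h0 : v₀ ≠ 0) {a : (ModelEnd p q)ˣ}
    (ha : a ∈ 𝓥.PSU) : ∃ r : ℝ, r ≠ 0 ∧ a.1 v₀ = (r : ℂ) • v₀ := by
  have h1 : a.1 v₀ ∈ 𝓥.LR := by
    rw [← ha.2]
    exact ⟨v₀, by rw [h]; exact Submodule.mem_span_singleton_self v₀, rfl⟩
  rw [h] at h1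
  obtain ⟨r, hr⟩ := Submodule.mem_span_singleton.1 h1
  refine ⟨r, ?_, hr.symm.trans (Complex.coe_smul r v₀).symm⟩
  rintro rfl
  rw [zero_smul] at hr
  exact h0 (ModelEnd.units_injective a (hr.symm.trans (map_zero _).symm))

theorem PSU_subset_Q : 𝓥.PSU ⊆ 𝓥.Q := by
  obtain ⟨v₀, h0, h⟩ := 𝓥.exists_spanning
  intro a ha
  obtain ⟨r, hr, har⟩ := 𝓥.apply_mem_PSU h h0 ha
  exact 𝓥.mem_Q_of_apply h ha.1 (Complex.ofReal_ne_zero.2 hr) har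

theorem mul_mem_Q {a b : (ModelEnd p q)ˣ} (ha : a ∈ 𝓥.Q) (hb : b ∈ 𝓥.Q) : a * b ∈ 𝓥.Q := by
  obtain ⟨v₀, h0, h⟩ := 𝓥.exists_spanning
  obtain ⟨z, hz, haz⟩ := 𝓥.apply_mem_Q h h0 ha
  obtain ⟨k, hk, hbk⟩ := 𝓥.apply_mem_Q h h0 hb
  refine 𝓥.mem_Q_of_apply h (𝓥.SU.mul_mem ha.1 hb.1) (mul_ne_zero hk hz) ?_
  change (a : ModelEnd p q) (b.1 v₀) = _
  rw [hbk, map_smul, haz, smul_smul]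

theorem mem_qLie_of_apply (h : 𝓥.LR = Submodule.span ℝ {v₀}) {A : ModelEnd p q} (hA : A ∈ 𝓥.su)
    {z : ℂ} (hz : A v₀ = z • v₀) : A ∈ 𝓥.qLie := by
  refine ⟨hA, fun v hv => ?_⟩
  obtain ⟨k, rfl⟩ := (𝓥.mem_L_iff h).1 hv
  rw [map_smul, hz]
  exact (𝓥.mem_L_iff h).2 ⟨k * z, mul_smul _ _ _⟩

theorem apply_mem_qLie (h : 𝓥.LR = Submodule.span ℝ {v₀}) {A : ModelEnd p q} (hA : A ∈ 𝓥.qLie) :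
    ∃ z : ℂ, A v₀ = z • v₀ := by
  obtain ⟨z, hz⟩ := (𝓥.mem_L_iff h).1 (hA.2 v₀ ((𝓥.mem_L_iff h).2 ⟨1, one_smul _ _⟩))
  exact ⟨z, hz.symm⟩

theorem conj_mem_su {a : (ModelEnd p q)ˣ} (ha : a ∈ 𝓥.SU) {B : ModelEnd p q} (hB : B ∈ 𝓥.su) :
    (a⁻¹).1 * B * a ∈ 𝓥.su := by
  refine ⟨fun v w => ?_, ?_⟩
  · change 𝓥.H ((a⁻¹).1 (B (a.1 v))) w
      + 𝓥.H v ((a⁻¹).1 (B (a.1 w))) = 0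
    rw [← ha.1, ← ha.1 v, ModelEnd.mul_inv_apply, ModelEnd.mul_inv_apply]
    exact hB.1 _ _
  · have e : (((a⁻¹).1 * B * a : ModelEnd p q) :
        ModelV p q →ₗ[ℂ] ModelV p q) = ((a⁻¹).1 :
        ModelV p q →ₗ[ℂ] ModelV p q) * ((B : ModelV p q →ₗ[ℂ] ModelV p q) *
          ((a : ModelEnd p q) : ModelV p q →ₗ[ℂ] ModelV p q)) := rfl
    have e2 : ((a : ModelEnd p q) : ModelV p q →ₗ[ℂ] ModelV p q) *
        ((a⁻¹).1 : ModelV p q →ₗ[ℂ] ModelV p q) = 1 :=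
      LinearMap.ext fun v => ModelEnd.mul_inv_apply a v
    rw [e, LinearMap.trace_mul_comm, mul_assoc, e2, mul_one]
    exact hB.2

theorem conj_mem_su' {a : (ModelEnd p q)ˣ} (ha : a ∈ 𝓥.SU) {B : ModelEnd p q} (hB : B ∈ 𝓥.su) :
    a.1 * B * (a⁻¹).1 ∈ 𝓥.su := by
  have := 𝓥.conj_mem_su (𝓥.SU.inv_mem ha) hB
  rwa [inv_inv] at this

/-- Conjugation by `a`, as a map to the endomorphisms of `𝔰𝔲(V)`; only used for `a ∈ SU(V)`. -/
def conj (a : (ModelEnd p q)ˣ) : 𝓥.su →L[ℝ] 𝓥.su :=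
  𝓥.suRetraction ∘L LinearMap.toContinuousLinearMap
    { toFun := fun B => ((a⁻¹).1
          * B.1 * a).restrictScalars ℝ
      map_add' := fun B B' => by
        ext v
        simp [mul_add, add_mul]
      map_smul' := fun c B => by
        ext v
        simp }

theorem conj_apply {a : (ModelEnd p q)ˣ} (ha : a ∈ 𝓥.SU) (B : 𝓥.su) : (𝓥.conj a B : ModelEnd p q) =
    (a⁻¹).1 * B.1 * a :=
  congrArg (fun B : 𝓥.su => B.1)
    (𝓥.suRetraction_suIncl ⟨_, 𝓥.conj_mem_su ha B.2⟩)

/-- The inclusion of `𝔮` into `𝔰𝔲(V)`. -/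
def qIncl : 𝓥.qLie →L[ℝ] 𝓥.su :=
  LinearMap.toContinuousLinearMap (Submodule.inclusion fun _ hA => hA.1)

theorem qIncl_apply (A : 𝓥.qLie) : (𝓥.qIncl A : ModelEnd p q) = A := rfl

/-- The Cartan connection determined by an `𝔰𝔲(V)`-valued one-form `α`. -/
def cartanOf {E' : Type*} [NormedAddCommGroup E'] [NormedSpace ℝ E'] (α : E' →L[ℝ] 𝓥.su)
    (a : (ModelEnd p q)ˣ) : (E' × 𝓥.qLie) →L[ℝ] 𝓥.su :=
  (𝓥.conj a ∘L α) ∘L ContinuousLinearMap.fst ℝ E' 𝓥.qLie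
    + 𝓥.qIncl ∘L ContinuousLinearMap.snd ℝ E' 𝓥.qLie

section cartanOf

variable {E' : Type*} [NormedAddCommGroup E'] [NormedSpace ℝ E'] {α : E' →L[ℝ] 𝓥.su}

theorem cartanOf_apply {a : (ModelEnd p q)ˣ} (ha : a ∈ 𝓥.SU) (ξ : E') (A : 𝓥.qLie) :
    (𝓥.cartanOf α a (ξ, A) : ModelEnd p q) = (a⁻¹).1 * (α ξ : ModelEnd p q) * a + A :=
  congrArg (· + A.1) (𝓥.conj_apply ha (α ξ))

theorem cartanOf_zero (a : (ModelEnd p q)ˣ) (A : 𝓥.qLie) :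
    (𝓥.cartanOf α a (0, A) : ModelEnd p q) = A := by
  have : 𝓥.cartanOf α a (0, A) = 𝓥.conj a (α 0) + 𝓥.qIncl A := rfl
  rw [this, map_zero, map_zero, zero_add, qIncl_apply]

theorem cartanOf_mul {a b : (ModelEnd p q)ˣ} (ha : a ∈ 𝓥.SU) (hb : b ∈ 𝓥.SU) (ξ : E')
    {A A' : 𝓥.qLie} (h : (A' : ModelEnd p q) = (b⁻¹).1 * A * b) :
    (𝓥.cartanOf α (a * b) (ξ, A') : ModelEnd p q) = (b⁻¹).1 * 𝓥.cartanOf α a (ξ, A) * b := by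
  rw [𝓥.cartanOf_apply (𝓥.SU.mul_mem ha hb), 𝓥.cartanOf_apply ha, h, mul_inv_rev]
  simp only [Units.val_mul, mul_add, add_mul, mul_assoc]

theorem cartanOf_bijective (h : 𝓥.LR = Submodule.span ℝ {v₀}) (h0 : v₀ ≠ 0) {a : (ModelEnd p q)ˣ}
    (ha : a ∈ 𝓥.Q) (hinj : ∀ ξ (z : ℂ), (α ξ : ModelEnd p q) v₀ = z • v₀ → ξ = 0)
    (hsurj : ∀ B ∈ 𝓥.su, ∃ ξ, ∃ z : ℂ, (α ξ : ModelEnd p q) v₀ = B v₀ + z • v₀) : Function.Bijective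
    (𝓥.cartanOf α a) := by
  obtain ⟨k, hk, hak⟩ := 𝓥.apply_mem_Q h h0 ha
  have hinv : (a⁻¹).1 v₀ = k⁻¹ • v₀ := by
    have h1 := ModelEnd.inv_mul_apply a v₀
    rw [hak, map_smul] at h1
    rw [← h1, smul_smul, inv_mul_cancel₀ hk, one_smul, h1]
  constructor
  · rw [injective_iff_map_eq_zero]
    rintro ⟨ξ, A⟩ hz
    obtain ⟨z, hAz⟩ := 𝓥.apply_mem_qLie h A.2
    have h1 := congrArg (fun B : 𝓥.su => B.1) hz
    simp only [𝓥.cartanOf_apply ha.1] at h1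
    have h2 := congrArg (fun B : ModelEnd p q => a.1 (B v₀)) h1
    change (a : ModelEnd p q) ((a⁻¹).1
      ((α ξ : ModelEnd p q) (a.1 v₀)) + A.1 v₀)
        = a.1 0 at h2
    rw [map_add, ModelEnd.mul_inv_apply, hAz, hak, map_smul, map_smul, hak, map_zero] at h2
    have h3 : (α ξ : ModelEnd p q) v₀ = (-z) • v₀ := by
      refine smul_right_injective _ hk ?_
      change k • _ = k • _
      rw [eq_neg_of_add_eq_zero_left h2, smul_smul, smul_smul, ← neg_smul]
      congr 1
      ring
    obtain rfl := hinj ξ _ h3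
    have h4 := 𝓥.cartanOf_zero (α := α) a A
    rw [hz] at h4
    exact Prod.ext rfl (Subtype.ext h4.symm)
  · intro B
    obtain ⟨ξ, z, hξ⟩ := hsurj _ (𝓥.conj_mem_su' ha.1 B.2)
    have hA : B.1 - (a⁻¹).1
        * (α ξ : ModelEnd p q) * a ∈ 𝓥.qLie := by
      refine 𝓥.mem_qLie_of_apply h (𝓥.su.sub_mem B.2 (𝓥.conj_mem_su ha.1 (α ξ).2)) (z := -z) ?_
      change (B : ModelEnd p q) v₀ - (a⁻¹).1
        ((α ξ : ModelEnd p q) (a.1 v₀)) = _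
      have h1 : (a.1 * (B : ModelEnd p q)
          * (a⁻¹).1) v₀
          = a.1 (B.1 ((a⁻¹).1 v₀)) :=
        rfl
      rw [hak, map_smul, map_smul, hξ, h1, hinv, map_smul, map_add, ModelEnd.inv_mul_apply,
        map_smul, hinv, smul_add, smul_smul, mul_inv_cancel₀ hk, one_smul, smul_smul, smul_smul,
        neg_smul]
      rw [show k * z * k⁻¹ = z by field_simp]
      abel
    refine ⟨(ξ, ⟨_, hA⟩), Subtype.ext ?_⟩
    rw [𝓥.cartanOf_apply ha.1]
    exact add_sub_cancel _ _

end cartanOf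

end HermitianModel

section complexPart

variable {p q : ℕ}

/-- The complex linear part of a real linear endomorphism. -/
def complexPart : (ModelV p q →L[ℝ] ModelV p q) →L[ℝ] ModelEnd p q :=
  LinearMap.toContinuousLinearMap
    { toFun := fun B => LinearMap.toContinuousLinearMap
        { toFun := fun v => (1 / 2 : ℂ) • (B v - Complex.I • B (Complex.I • v))
          map_add' := fun v w => by
            simp only [smul_add, map_add]
            abel_nf
            simp only [smul_add, smul_sub]
            abel
          map_smul' := fun z v => by
            have h : ∀ w : ModelV p q, z • w = z.re • w + z.im • Complex.I • w := fun w => by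
              conv_lhs => rw [← Complex.re_add_im z]
              rw [add_smul, mul_smul]
              rfl
            have h2 : ∀ w : ModelV p q, Complex.I • Complex.I • w = -w := fun w => by
              rw [smul_smul, Complex.I_mul_I, neg_one_smul]
            rw [RingHom.id_apply, smul_comm z]
            congr 1
            rw [smul_comm Complex.I z v, h v, h (Complex.I • v), h (_ - _)]
            simp only [map_add, map_smul, h2, smul_add, smul_sub, smul_neg, map_neg,
              smul_comm Complex.I (_ : ℝ)]
            abel }
      map_add' := fun B B' => by
        ext1 v
        change (1 / 2 : ℂ) • ((B + B') v - Complex.I • (B + B') (Complex.I • v))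
          = (1 / 2 : ℂ) • (B v - Complex.I • B (Complex.I • v))
            + (1 / 2 : ℂ) • (B' v - Complex.I • B' (Complex.I • v))
        rw [add_apply, add_apply, ← smul_add, smul_add]
        congr 1
        abel
      map_smul' := fun c B => by
        ext1 v
        change (1 / 2 : ℂ) • ((c • B) v - Complex.I • (c • B) (Complex.I • v))
          = c • (1 / 2 : ℂ) • (B v - Complex.I • B (Complex.I • v))
        rw [smul_apply, smul_apply, smul_comm Complex.I c, ← smul_sub, smul_comm c] }

theorem complexPart_apply (B : ModelV p q →L[ℝ] ModelV p q) (v : ModelV p q) :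
    complexPart B v = (1 / 2 : ℂ) • (B v - Complex.I • B (Complex.I • v)) := rfl

theorem complexPart_of_complex {B : ModelV p q →L[ℝ] ModelV p q} {a : ModelEnd p q}
    (h : ∀ v, B v = a v) : complexPart B = a := by
  ext1 v
  rw [complexPart_apply, h, h, map_smul, smul_smul, Complex.I_mul_I, neg_one_smul, sub_neg_eq_add,
    ← two_smul ℂ (a v), smul_smul]
  norm_num

end complexPart

theorem TractorChart.IsFrame.exists_unit {p q : ℕ} {𝓥 : HermitianModel p q} {E T : Type*}
    [NormedAddCommGroup E] [NormedSpace ℝ E] [NormedAddCommGroup T] [NormedSpace ℝ T]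
    [FiniteDimensional ℝ T] {C : TractorChart 𝓥 E T} {y : E} {τ τ' : ModelV p q →L[ℝ] T}
    (h : C.IsFrame y τ) (h' : C.IsFrame y τ') :
    ∃ a : (ModelEnd p q)ˣ, a ∈ 𝓥.SU ∧ ∀ v, τ (a.1 v) = τ' v := by
  have hi := h.isInvertible
  have hc : ∀ v, (τ.inverse ∘L τ') (Complex.I • v) = Complex.I • (τ.inverse ∘L τ') v := fun v => by
    change τ.inverse (τ' (Complex.I • v)) = Complex.I • τ.inverse (τ' v)
    rw [h'.complex, h.inverse_complex]
  let B : ModelEnd p q := complexPart (τ.inverse ∘L τ')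
  have hB : ∀ v, B v = τ.inverse (τ' v) := fun v => by
    have : B v = (1 / 2 : ℂ) • ((τ.inverse ∘L τ') v - Complex.I • (τ.inverse ∘L τ') (Complex.I • v)) :=
      rfl
    rw [this, hc, smul_smul, Complex.I_mul_I, neg_one_smul, sub_neg_eq_add,
      ← two_smul ℂ ((τ.inverse ∘L τ') v), smul_smul]
    norm_num
  have hτB : ∀ v, τ (B v) = τ' v := fun v => by rw [hB, hi.self_apply_inverse]
  obtain ⟨f, hf, hf1⟩ := h.unimodular
  obtain ⟨f', hf', hf1'⟩ := h'.unimodular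
  have hBf : (fun i => (B : ModelV p q →ₗ[ℂ] ModelV p q) (f' i)) = f := funext fun i =>
    hi.injective ((hτB _).trans ((hf' i).trans (hf i).symm))
  have hdet : LinearMap.det (B : ModelV p q →ₗ[ℂ] ModelV p q) = 1 := by
    have h1 := C.b.det_comp (B : ModelV p q →ₗ[ℂ] ModelV p q) f'
    rw [hf1', mul_one] at h1
    rw [← h1, ← hf1]
    exact congrArg C.b.det hBf
  have hu : IsUnit B := by
    rw [ContinuousLinearMap.isUnit_iff_isUnit_toLinearMap, LinearMap.isUnit_iff_isUnit_det, hdet]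
    exact isUnit_one
  refine ⟨hu.unit, ⟨fun v w => ?_, hdet⟩, hτB⟩
  have hre : ∀ v w, (𝓥.H (B v) (B w)).re = (𝓥.H v w).re := fun v w => by
    rw [← h.isometry, hτB, hτB, h'.isometry]
  refine Complex.ext (hre v w) ?_
  have h1 := hre v (Complex.I • w)
  rw [show B (Complex.I • w) = Complex.I • B w from B.map_smul _ _, LinearMap.map_smul,
    LinearMap.map_smul] at h1
  simpa using h1

namespace HermitianModel

variable {p q : ℕ} (𝓥 : HermitianModel p q)

/-- The angular coordinate of `a ∈ Q`. -/
def ratio (v₀ w₀ : ModelV p q) (a : (ModelEnd p q)ˣ) : ℝ :=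
  (𝓥.H w₀ (a.1 v₀)).im / (𝓥.H w₀ (a.1 v₀)).re

variable {v₀ w₀ : ModelV p q}

theorem H_apply (h : 𝓥.H w₀ v₀ = 1) {a : (ModelEnd p q)ˣ} {z : ℂ}
    (ha : a.1 v₀ = z • v₀) : 𝓥.H w₀ (a.1 v₀) = z := by
  rw [ha, map_smul, h, smul_eq_mul, mul_one]

theorem H_mul_apply (h : 𝓥.H w₀ v₀ = 1) {a b : (ModelEnd p q)ˣ} {z k : ℂ} (ha : a.1 v₀ = z • v₀)
    (hb : b.1 v₀ = k • v₀) : 𝓥.H w₀ ((a * b).1 v₀) = k * z := by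
  change 𝓥.H w₀ (a.1 (b.1 v₀)) = _
  rw [hb, map_smul, map_smul, 𝓥.H_apply h ha, smul_eq_mul]

theorem ratio_mul (h : 𝓥.H w₀ v₀ = 1) {a b : (ModelEnd p q)ˣ} {z : ℂ} {r : ℝ} (hr : r ≠ 0)
    (ha : a.1 v₀ = z • v₀) (hb : b.1 v₀ = (r : ℂ) • v₀) : 𝓥.ratio v₀ w₀ (a * b) = 𝓥.ratio v₀ w₀ a := by
  rw [ratio, ratio, 𝓥.H_mul_apply h ha hb, 𝓥.H_apply h ha, Complex.re_ofReal_mul,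
    Complex.im_ofReal_mul, mul_div_mul_left _ _ hr]

end HermitianModel

/-- The parameters of the frame `u` at `x`. -/
def AdaptedFrame.param {p q : ℕ} {𝓥 : HermitianModel p q} {E T : Type*} [NormedAddCommGroup E]
    [NormedSpace ℝ E] [NormedAddCommGroup T] [NormedSpace ℝ T] {C : TractorChart 𝓥 E T}
    {v₀ : ModelV p q} (F : AdaptedFrame C v₀) (x : E) (u : ModelV p q →L[ℝ] T) : ModelEnd p q :=
  complexPart ((F.τ x).inverse ∘L u)

namespace LeafChart

variable {p q : ℕ} {𝓥 : HermitianModel p q} {E T E' : Type*} [NormedAddCommGroup E]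
    [NormedSpace ℝ E] [NormedAddCommGroup T] [NormedSpace ℝ T] [NormedAddCommGroup E']
    [NormedSpace ℝ E'] {C : TractorChart 𝓥 E T} {v₀ : ModelV p q} {F : AdaptedFrame C v₀}
    {ψ : E → E'} (K : LeafChart F ψ)

/-- The pairs `(y, a)` that parametrise frames over the domain of the leaf chart. -/
def dom (w₀ : ModelV p q) : Set (E' × (ModelEnd p q)ˣ) :=
  {z | z.1 ∈ Metric.ball K.base K.δ ∧ (𝓥.H w₀ ((z.2 : ModelEnd p q) v₀)).re ≠ 0 ∧
    𝓥.ratio v₀ w₀ z.2 ∈ Metric.ball (0 : ℝ) K.δ}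

/-- The base point of the frame with parameters `z`. -/
def point (w₀ : ModelV p q) (z : E' × (ModelEnd p q)ˣ) : E :=
  K.Θ.symm (z.1, 𝓥.ratio v₀ w₀ z.2)

/-- The frame with parameters `z`. -/
def frame (w₀ : ModelV p q) (z : E' × (ModelEnd p q)ˣ) : ModelV p q →L[ℝ] T :=
  F.τ (K.point w₀ z) ∘L (z.2 : ModelEnd p q).restrictScalars ℝ

variable {K} {w₀ : ModelV p q} {z : E' × (ModelEnd p q)ˣ}

theorem mem_target_of_dom (hz : z ∈ K.dom w₀) : (z.1, 𝓥.ratio v₀ w₀ z.2) ∈ K.Θ.target :=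
  K.mem_target.2 ⟨hz.1, hz.2.2⟩

theorem point_mem (hz : z ∈ K.dom w₀) : K.point w₀ z ∈ K.Θ.source :=
  K.Θ.map_target (mem_target_of_dom hz)

theorem ψ_point (hz : z ∈ K.dom w₀) : ψ (K.point w₀ z) = z.1 := K.ψ_symm (mem_target_of_dom hz)

theorem isFrame_frame (hz : z ∈ K.dom w₀) (ha : z.2 ∈ 𝓥.SU) :
    C.IsFrame (K.point w₀ z) (K.frame w₀ z) :=
  (F.isFrame _ (K.source_subset (point_mem hz))).comp ha.1 ha.2

theorem frame_apply (hz : z ∈ K.dom w₀) (h : 𝓥.H w₀ v₀ = 1) {k : ℂ}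
    (ha : (z.2 : ModelEnd p q) v₀ = k • v₀) : ∃ r : ℝ, r ≠ 0 ∧ K.frame w₀ z v₀ = r • C.e := by
  have h1 := point_mem hz
  have hre := K.re_ne _ h1
  have h2 : F.angle (K.point w₀ z) = 𝓥.ratio v₀ w₀ z.2 := K.angle_symm (mem_target_of_dom hz)
  have hk : k.re ≠ 0 := by
    rw [← 𝓥.H_apply h ha]
    exact hz.2.1
  refine ⟨k.re / (F.c (K.point w₀ z)).re, div_ne_zero hk hre, ?_⟩
  rw [HermitianModel.ratio, 𝓥.H_apply h ha, AdaptedFrame.angle, div_eq_div_iff hre hk] at h2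
  change F.τ (K.point w₀ z) ((z.2 : ModelEnd p q) v₀) = _
  rw [← F.apply_c _ (K.source_subset h1), ← map_smul, ha]
  have h3 : k = ((k.re / (F.c (K.point w₀ z)).re : ℝ) : ℂ) * F.c (K.point w₀ z) := by
    refine Complex.ext ?_ ?_
    · rw [Complex.re_ofReal_mul, div_mul_cancel₀ _ hre]
    · rw [Complex.im_ofReal_mul]
      field_simp
      linarith
  conv_lhs => rw [h3, mul_smul]
  rfl

theorem mul_mem_dom (hz : z ∈ K.dom w₀) (h : 𝓥.H w₀ v₀ = 1) {k : ℂ} {r : ℝ} (hr : r ≠ 0)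
    {b : (ModelEnd p q)ˣ} (ha : (z.2 : ModelEnd p q) v₀ = k • v₀)
    (hb : b.1 v₀ = (r : ℂ) • v₀) : (z.1, z.2 * b) ∈ K.dom w₀ := by
  refine ⟨hz.1, ?_, ?_⟩
  · have h1 := hz.2.1
    rw [𝓥.H_apply h ha] at h1
    change (𝓥.H w₀ (((z.2 * b : (ModelEnd p q)ˣ) : ModelEnd p q) v₀)).re ≠ 0
    rw [𝓥.H_mul_apply h ha hb, Complex.re_ofReal_mul]
    exact mul_ne_zero hr h1
  · change 𝓥.ratio v₀ w₀ (z.2 * b) ∈ _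
    rw [𝓥.ratio_mul h hr ha hb]
    exact hz.2.2

theorem point_mul (h : 𝓥.H w₀ v₀ = 1) {k : ℂ} {r : ℝ} (hr : r ≠ 0)
    {b : (ModelEnd p q)ˣ} (ha : (z.2 : ModelEnd p q) v₀ = k • v₀)
    (hb : b.1 v₀ = (r : ℂ) • v₀) : K.point w₀ (z.1, z.2 * b) = K.point w₀ z := by
  rw [point, point]
  simp only [𝓥.ratio_mul h hr ha hb]

variable [FiniteDimensional ℝ T]


theorem param_frame (hz : z ∈ K.dom w₀) : F.param (K.point w₀ z) (K.frame w₀ z) = z.2 :=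
  complexPart_of_complex fun v => ContinuousLinearMap.IsInvertible.inverse_apply_self
    (AdaptedFrame.isInvertible (K.source_subset (point_mem hz))) _

theorem exists_params (h : 𝓥.H w₀ v₀ = 1) {x : E} (hx : x ∈ K.Θ.source) {u : ModelV p q →L[ℝ] T}
    (hu : C.IsFrame x u) {r : ℝ} (hr : r ≠ 0) (huv : u v₀ = r • C.e) : ∃ a ∈ 𝓥.SU,
    (∃ k : ℂ, k ≠ 0 ∧ a.1 v₀ = k • v₀) ∧ (ψ x, a) ∈ K.dom w₀ ∧ K.point w₀ (ψ x, a) = x ∧ K.frame w₀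
    (ψ x, a) = u := by
  have hO := K.source_subset hx
  have hc : F.c x ≠ 0 := fun h0 => K.re_ne x hx (by rw [h0, Complex.zero_re])
  obtain ⟨a, ha, hau⟩ := (F.isFrame x hO).exists_unit hu
  have hav : a.1 v₀ = ((r : ℂ) * F.c x) • v₀ := by
    refine (F.isFrame x hO).isInvertible.injective ?_
    have h1 : (((r : ℂ) * F.c x) • v₀ : ModelV p q) = r • F.c x • v₀ :=
      (mul_smul _ _ _).trans (Complex.coe_smul r _)
    rw [hau, huv, ← F.apply_c x hO, h1]
    exact (ContinuousLinearMap.map_smul (F.τ x) r _).symm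
  have hrat : 𝓥.ratio v₀ w₀ a = F.angle x := by
    rw [HermitianModel.ratio, 𝓥.H_apply h hav, Complex.re_ofReal_mul, Complex.im_ofReal_mul,
      mul_div_mul_left _ _ hr, AdaptedFrame.angle]
  have ht : (ψ x, F.angle x) ∈ K.Θ.target := by
    rw [← K.apply]
    exact K.Θ.map_source hx
  have hp : K.point w₀ (ψ x, a) = x := by
    change K.Θ.symm (ψ x, 𝓥.ratio v₀ w₀ a) = x
    rw [hrat, ← K.apply]
    exact K.Θ.left_inv hx
  refine ⟨a, ha, ⟨_, mul_ne_zero (Complex.ofReal_ne_zero.2 hr) hc, hav⟩,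
    ⟨(K.mem_target.1 ht).1, ?_, ?_⟩, hp, ?_⟩
  · change (𝓥.H w₀ (a.1 v₀)).re ≠ 0
    rw [𝓥.H_apply h hav, Complex.re_ofReal_mul]
    exact mul_ne_zero hr (K.re_ne x hx)
  · change 𝓥.ratio v₀ w₀ a ∈ _
    rw [hrat]
    exact (K.mem_target.1 ht).2
  · ext1 v
    change F.τ (K.point w₀ (ψ x, a)) (a.1 v) = u v
    rw [hp, hau]

theorem alpha_eq_zero {y : E'} (hy : y ∈ Metric.ball K.base K.δ) (ξ : E') (k : ℂ)
    (h : (K.alpha y ξ : ModelEnd p q) v₀ = k • v₀) : ξ = 0 := by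
  have ht : (y, (0 : ℝ)) ∈ K.Θ.target := K.mem_target.2 ⟨hy, Metric.mem_ball_self K.δ_pos⟩
  have h1 := K.fderiv_ψ_symm ht (ξ, 0)
  have h2 := K.alpha_injective (K.Θ.map_target ht) (X := fderiv ℝ K.Θ.symm (y, 0) (ξ, 0)) (z := k)
    (by rwa [h1, K.ψ_symm ht])
  exact h1.symm.trans h2

theorem exists_alpha_eq {y : E'} (hy : y ∈ Metric.ball K.base K.δ) (B : ModelEnd p q)
    (hB : B ∈ 𝓥.su) : ∃ ξ, ∃ k : ℂ, (K.alpha y ξ : ModelEnd p q) v₀ = B v₀ + k • v₀ := by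
  have ht : (y, (0 : ℝ)) ∈ K.Θ.target := K.mem_target.2 ⟨hy, Metric.mem_ball_self K.δ_pos⟩
  obtain ⟨X, k, h⟩ := K.alpha_surjective (K.Θ.map_target ht) hB
  rw [K.ψ_symm ht] at h
  exact ⟨_, k, h⟩

end LeafChart

section framesInCharts

variable {n : ℕ} {M : Type*} [TopologicalSpace M]
  [ChartedSpace (𝔼 n) M] [IsManifold (𝓡 n) ∞ M] {r s : ℕ}
  {V : Type*} [NormedAddCommGroup V] [NormedSpace ℝ V]

/-- The bundle of linear maps from a fixed vector space to the tractor bundle. -/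
abbrev FrameTotal (V : Type*) [NormedAddCommGroup V] [NormedSpace ℝ V] (n : ℕ) (M : Type*)
    [TopologicalSpace M] [ChartedSpace (𝔼 n) M] [IsManifold (𝓡 n) ∞ M] : Type _ :=
  TotalSpace (V →L[ℝ] 𝕋 n) (fun x : M => Bundle.Trivial M V x →L[ℝ] Tractor n M x)

/-- The fibre component of a frame, as a map between fixed vector spaces. -/
def FrameTotal.toMap (u : FrameTotal V n M) : V →L[ℝ] 𝕋 n := u.2

/-- The frame with given components in the chart at `x₀`. -/
def frameOfChart (x₀ : M) (z : (𝔼 n) × (V →L[ℝ] 𝕋 n)) : FrameTotal V n M :=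
  ⟨(chart n x₀).symm z.1, (diagL (symmDeriv x₀ z.1) ∘L z.2 : V →L[ℝ] 𝕋 n)⟩

/-- The components of a frame in the chart at `x₀`. -/
def frameInChart (x₀ : M) (u : FrameTotal V n M) : (𝔼 n) × (V →L[ℝ] 𝕋 n) :=
  (chart n x₀ u.proj, diagL (chartDeriv x₀ u.proj) ∘L u.toMap)

theorem FrameTotal.ext {u w : FrameTotal V n M} (h : u.proj = w.proj) (h' : u.toMap = w.toMap) :
    u = w := by
  obtain ⟨x, u⟩ := u
  obtain ⟨x', w⟩ := w
  obtain rfl : x = x' := h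
  exact congrArg _ h'

theorem frameInChart_frameOfChart {x₀ : M} {z : (𝔼 n) × (V →L[ℝ] 𝕋 n)}
    (hz : z.1 ∈ (chart n x₀).target) : frameInChart x₀ (frameOfChart x₀ z) = z :=
  Prod.ext ((chart n x₀).right_inv hz)
    (ContinuousLinearMap.ext fun v => diagL_chartDeriv_symmDeriv hz (z.2 v))

theorem frameOfChart_frameInChart {x₀ : M} {u : FrameTotal V n M}
    (hu : u.proj ∈ (chart n x₀).source) : frameOfChart x₀ (frameInChart x₀ u) = u :=
  FrameTotal.ext ((chart n x₀).left_inv hu)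
    (ContinuousLinearMap.ext fun v => diagL_symmDeriv_chartDeriv hu (u.toMap v))

theorem trivializationAt_frameInChart {x₀ : M} {u : FrameTotal V n M}
    (hu : u.proj ∈ (chart n x₀).source) :
    (trivializationAt (V →L[ℝ] 𝕋 n) (fun x : M => Bundle.Trivial M V x →L[ℝ] Tractor n M x) x₀ u).2
    = (frameInChart x₀ u).2 :=
  ContinuousLinearMap.ext fun v => trivializationAt_frame hu u.2 v

theorem baseSet_frame (x₀ : M) : (trivializationAt (V →L[ℝ] 𝕋 n)
    (fun x : M => Bundle.Trivial M V x →L[ℝ] Tractor n M x) x₀).baseSet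
      = (chart n x₀).source := by
  rw [hom_trivializationAt_baseSet, baseSet_tractor]
  exact univ_inter _

theorem contMDiffOn_frameInChart (x₀ : M) : ContMDiffOn ((𝓡 n).prod 𝓘(ℝ, V →L[ℝ] 𝕋 n))
    𝓘(ℝ, 𝔼 n × (V →L[ℝ] 𝕋 n)) ∞ (frameInChart (V := V) (n := n) x₀) {u : FrameTotal V n M | u.proj ∈ (chart n x₀).source} := by
  have h1 : ContMDiffOn ((𝓡 n).prod 𝓘(ℝ, V →L[ℝ] 𝕋 n)) 𝓘(ℝ, 𝔼 n) ∞
      (fun u : FrameTotal V n M => chart n x₀ u.proj)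
      {u | u.proj ∈ (chart n x₀).source} :=
    (contMDiffOn_extChartAt (I := 𝓡 n) (n := ∞) (x := x₀)).comp
      (Bundle.contMDiff_proj (IB := 𝓡 n) (F := V →L[ℝ] 𝕋 n)
        (fun x : M => Bundle.Trivial M V x →L[ℝ] Tractor n M x)).contMDiffOn fun u hu => by
        rw [mem_preimage, ← extChartAt_source (𝓡 n)]
        exact hu
  have h2 := contMDiff_snd.comp_contMDiffOn ((trivializationAt (V →L[ℝ] 𝕋 n)
    (fun x : M => Bundle.Trivial M V x →L[ℝ] Tractor n M x) x₀).contMDiffOn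
      (IB := 𝓡 n) (n := ∞))
  refine h1.prodMk_space ((h2.mono fun u hu => ?_).congr fun u hu =>
    (trivializationAt_frameInChart hu).symm)
  rw [Trivialization.mem_source, baseSet_frame]
  exact hu

variable {EX : Type*} [NormedAddCommGroup EX] [NormedSpace ℝ EX] {HX : Type*} [TopologicalSpace HX]
  {I : ModelWithCorners ℝ EX HX} {X : Type*} [TopologicalSpace X] [ChartedSpace HX X]

theorem contMDiffOn_frameOfChart {x₀ : M} {f : X → 𝔼 n × (V →L[ℝ] 𝕋 n)} {S : Set X}
    (hf : ContMDiffOn I 𝓘(ℝ, 𝔼 n × (V →L[ℝ] 𝕋 n)) ∞ f S)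
    (hS : ∀ z ∈ S, (f z).1 ∈ (chart n x₀).target) :
    ContMDiffOn I ((𝓡 n).prod 𝓘(ℝ, V →L[ℝ] 𝕋 n)) ∞ (fun z => frameOfChart x₀ (f z)) S := by
  have hsrc : ∀ z ∈ S, (frameOfChart x₀ (f z)).proj ∈ (chart n x₀).source :=
    fun z hz => (chart n x₀).map_target (hS z hz)
  have hf1 : ContMDiffOn I 𝓘(ℝ, 𝔼 n) ∞ (fun z => (f z).1) S :=
    contDiff_fst.contMDiff.comp_contMDiffOn hf
  have hf2 : ContMDiffOn I 𝓘(ℝ, V →L[ℝ] 𝕋 n) ∞ (fun z => (f z).2) S :=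
    contDiff_snd.contMDiff.comp_contMDiffOn hf
  refine ((trivializationAt (V →L[ℝ] 𝕋 n)
    (fun x : M => Bundle.Trivial M V x →L[ℝ] Tractor n M x) x₀).contMDiffOn_iff
      (IB := 𝓡 n) fun z hz => ?_).2 ⟨?_, hf2.congr fun z hz => ?_⟩
  · rw [Trivialization.mem_source, baseSet_frame]
    exact hsrc z hz
  · exact (contMDiffOn_extChartAt_symm (I := 𝓡 n) (n := ∞) x₀).comp hf1 hS
  · rw [trivializationAt_frameInChart (hsrc z hz), frameInChart_frameOfChart (hS z hz)]

theorem PseudoRiemannianMetric.connector_frameOfChart (g : PseudoRiemannianMetric n M r s)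
    {x₀ : M} {f : X → 𝔼 n × (V →L[ℝ] 𝕋 n)} {z : X}
    (hz : (f z).1 ∈ (chart n x₀).target)
    {D : EX →L[ℝ] 𝔼 n × (V →L[ℝ] 𝕋 n)}
    (hD : HasMFDerivAt I 𝓘(ℝ, 𝔼 n × (V →L[ℝ] 𝕋 n)) f z D)
    {f' : EX →L[ℝ] 𝔼 n × (V →L[ℝ] 𝕋 n)}
    (hf : HasMFDerivAt I ((𝓡 n).prod 𝓘(ℝ, V →L[ℝ] 𝕋 n))
      (fun z => frameOfChart x₀ (f z)) z f') (ζ : EX) (v : V) :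
    diagL (chartDeriv x₀ (frameOfChart x₀ (f z)).proj) (g.connector (frameOfChart x₀ (f z)).proj
        ((frameOfChart x₀ (f z)).toMap v) (f' ζ).1 ((f' ζ).2 v))
      = (D ζ).2 v + CoordMetric.tractorConn (g.inChart x₀) (f z).1 (D ζ).1 ((f z).2 v) := by
  have hev : ∀ᶠ z' in 𝓝 z, (f z').1 ∈ (chart n x₀).target :=
    (continuous_fst.continuousAt.comp hD.1).eventually
      ((isOpen_extChartAt_target x₀).mem_nhds hz)
  have hP : HasMFDerivAt I 𝓘(ℝ, 𝔼 n)
      (fun z' => chart n x₀ (frameOfChart x₀ (f z')).proj) z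
      ((ContinuousLinearMap.fst ℝ (𝔼 n) (V →L[ℝ] 𝕋 n)) ∘L D) := by
    refine (((ContinuousLinearMap.fst ℝ (𝔼 n) (V →L[ℝ] 𝕋 n)).hasMFDerivAt
      (x := f z)).comp z hD).congr_of_eventuallyEq ?_
    filter_upwards [hev] with z' hz'
    exact (chart n x₀).right_inv hz'
  have hW : HasMFDerivAt I 𝓘(ℝ, 𝕋 n)
      (fun z' => diagL (chartDeriv x₀ (frameOfChart x₀ (f z')).proj)
        ((frameOfChart x₀ (f z')).toMap v)) z
      ((ContinuousLinearMap.apply ℝ 𝕋 n v ∘L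
        ContinuousLinearMap.snd ℝ (𝔼 n) (V →L[ℝ] 𝕋 n)) ∘L D) := by
    refine (((ContinuousLinearMap.apply ℝ 𝕋 n v ∘L
        ContinuousLinearMap.snd ℝ (𝔼 n) (V →L[ℝ] 𝕋 n)).hasMFDerivAt
      (x := f z)).comp z hD).congr_of_eventuallyEq ?_
    filter_upwards [hev] with z' hz'
    exact diagL_chartDeriv_symmDeriv hz' ((f z').2 v)
  have hc : ContinuousAt (fun z' => (frameOfChart x₀ (f z')).proj) z :=
    (FiberBundle.continuous_proj (V →L[ℝ] 𝕋 n)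
      (fun x : M => Bundle.Trivial M V x →L[ℝ] Tractor n M x)).continuousAt.comp hf.1
  have h := g.connector_natural (p := fun z' => (frameOfChart x₀ (f z')).proj)
    (w := fun z' => (frameOfChart x₀ (f z')).toMap v)
    ((chart n x₀).map_target hz) hc (HasMFDerivAt.frame_components hf v) hP hW ζ
  refine h.trans ?_
  have e1 : chart n x₀ (frameOfChart x₀ (f z)).proj = (f z).1 :=
    (chart n x₀).right_inv hz
  have e2 : diagL (chartDeriv x₀ (frameOfChart x₀ (f z)).proj)
    ((frameOfChart x₀ (f z)).toMap v) = (f z).2 v := diagL_chartDeriv_symmDeriv hz ((f z).2 v)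
  rw [e1, e2]
  rfl

end framesInCharts

local instance {n : ℕ} {M V : Type*} [TopologicalSpace M] [ChartedSpace (𝔼 n) M]
    [IsManifold (𝓡 n) ∞ M] [NormedAddCommGroup V] [NormedSpace ℝ V] :
    TopologicalSpace (FrameTotal V n M) := inferInstance

local instance {n : ℕ} {M V : Type*} [TopologicalSpace M] [ChartedSpace (𝔼 n) M]
    [IsManifold (𝓡 n) ∞ M] [NormedAddCommGroup V] [NormedSpace ℝ V] :
    ChartedSpace (ModelProd (𝔼 n) (V →L[ℝ] 𝕋 n))
      (FrameTotal V n M) := inferInstance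

theorem exists_splitting {E E' : Type*} [NormedAddCommGroup E] [NormedSpace ℝ E]
    [FiniteDimensional ℝ E] [NormedAddCommGroup E'] [NormedSpace ℝ E'] [FiniteDimensional ℝ E']
    {v : E} (hv : v ≠ 0) (hdim : Module.finrank ℝ E = Module.finrank ℝ E' + 1) :
    ∃ Λ : (ℝ × E') ≃L[ℝ] E, Λ (1, 0) = v := by
  obtain ⟨S, hS⟩ := (Submodule.span ℝ {v}).exists_isCompl
  have h1 := Submodule.finrank_add_eq_of_isCompl hS
  rw [finrank_span_singleton hv, hdim] at h1
  have e1 : E' ≃ₗ[ℝ] S := LinearEquiv.ofFinrankEq E' S (by omega)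
  refine ⟨(((LinearEquiv.toSpanNonzeroSingleton ℝ E v hv).prodCongr e1).trans
    (Submodule.prodEquivOfIsCompl _ _ hS)).toContinuousLinearEquiv, ?_⟩
  simp

theorem exists_isLocalLeafSpace {n d : ℕ} (hnd : n = d + 1) {M : Type*} [TopologicalSpace M]
    [ChartedSpace (𝔼 n) M] [IsManifold (𝓡 n) ∞ M] {κ : ∀ x : M, TangentSpace (𝓡 n) x} {x₀ : M}
    {k : 𝔼 n → 𝔼 n} (hk : ContDiffOn ℝ ∞ k (chart n x₀).target)
    (hkκ : ∀ x ∈ (chart n x₀).source, k (chart n x₀ x) = chartDeriv x₀ x (κ x))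
    (h0 : k (chart n x₀ x₀) ≠ 0) : ∃ (W : Set M) (U : TopologicalSpace.Opens (𝔼 d)) (ψ : M → U), x₀
    ∈ W ∧ IsLocalLeafSpace (d := d) κ W ψ := by
  obtain ⟨Λ, hΛ⟩ := exists_splitting (E' := 𝔼 d) h0 (by simp [hnd])
  obtain ⟨ε, Θ, η, hε, hsrc, htgt, hΘ0, hΘ, hΘs, -, hdΘ, -, -⟩ :=
    exists_flow_box (P := ℝ) (Z := fun _ => 0) (σ := fun _ => 0) (isOpen_extChartAt_target x₀) hk
      contDiffOn_const contDiffOn_const (mem_extChartAt_target x₀) Λ hΛ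
  let φ := chart n x₀
  let W : Set M := φ.source ∩ φ ⁻¹' Θ.target
  have hW : IsOpen W := (continuousOn_extChartAt x₀).isOpen_inter_preimage
    (isOpen_extChartAt_source x₀) Θ.open_target
  let U : TopologicalSpace.Opens (𝔼 d) := ⟨Metric.ball 0 ε, Metric.isOpen_ball⟩
  classical
  let ψ : M → U := fun x => if h : (Θ.symm (φ x)).2 ∈ Metric.ball (0 : 𝔼 d) ε
    then ⟨_, h⟩ else ⟨0, Metric.mem_ball_self hε⟩
  have hmem : ∀ x ∈ W, Θ.symm (φ x) ∈ Θ.source := fun x hx => Θ.map_target hx.2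
  have hψ : ∀ x ∈ W, (ψ x : 𝔼 d) = (Θ.symm (φ x)).2 := fun x hx => by
    have h := hmem x hx
    rw [hsrc] at h
    simp only [ψ]
    rw [dif_pos h.2]
  have hsm : ContMDiffOn (𝓡 n) (𝓡 d) ∞ ψ W := fun x hx => by
    refine (ContMDiffWithinAt.subtypeVal_comp_iff U ψ W x).1 ?_
    have h1 : ContMDiffOn (𝓡 n) (𝓡 d) ∞ (fun x => (Θ.symm (φ x)).2) W :=
      (contDiff_snd.comp_contDiffOn hΘs).contMDiffOn.comp
        ((contMDiffOn_extChartAt (I := 𝓡 n) (n := ∞) (x := x₀)).mono fun x hx => by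
          rw [← extChartAt_source (𝓡 n)]
          exact hx.1) fun x hx => hx.2
    exact (h1 x hx).congr (fun z hz => hψ z hz) (hψ x hx)
  have hΘd : ∀ z ∈ Θ.source, HasFDerivAt Θ (fderiv ℝ Θ z) z := fun z hz =>
    hΘ.hasFDerivAt_of_isOpen Θ.open_source hz
  have hΘsd : ∀ y ∈ Θ.target, HasFDerivAt Θ.symm (fderiv ℝ Θ.symm y) y := fun y hy =>
    hΘs.hasFDerivAt_of_isOpen Θ.open_target hy
  have hl : ∀ y ∈ Θ.target, ∀ X, fderiv ℝ Θ (Θ.symm y) (fderiv ℝ Θ.symm y X) = X := by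
    intro y hy X
    have h1 := (hΘd _ (Θ.map_target hy)).comp y (hΘsd y hy)
    have h2 : Θ ∘ Θ.symm =ᶠ[𝓝 y] id := by
      filter_upwards [Θ.open_target.mem_nhds hy] with z hz
      exact Θ.right_inv hz
    exact congrArg (fun f : 𝔼 n →L[ℝ] 𝔼 n => f X)
      ((h1.congr_of_eventuallyEq h2.symm).unique (hasFDerivAt_id y))
  have hr : ∀ y ∈ Θ.target, ∀ ζ, fderiv ℝ Θ.symm y (fderiv ℝ Θ (Θ.symm y) ζ) = ζ := by
    intro y hy ζ
    have hs := Θ.map_target hy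
    have h1 := (Θ.right_inv hy).symm ▸ hΘsd y hy
    have h2 := h1.comp (Θ.symm y) (hΘd _ hs)
    have h3 : Θ.symm ∘ Θ =ᶠ[𝓝 (Θ.symm y)] id := by
      filter_upwards [Θ.open_source.mem_nhds hs] with z hz
      exact Θ.left_inv hz
    have h4 := congrArg (fun f : _ →L[ℝ] _ => f ζ)
      ((h2.congr_of_eventuallyEq h3.symm).unique (hasFDerivAt_id _))
    rw [Θ.right_inv hy] at h4
    exact h4
  have hκ : ∀ y ∈ Θ.target, fderiv ℝ Θ (Θ.symm y) (1, 0) = k y := by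
    intro y hy
    have hs := Θ.map_target hy
    have h1 : HasDerivAt (fun t : ℝ => ((t, (Θ.symm y).2) : ℝ × 𝔼 d)) (1, 0)
      (Θ.symm y).1 := (hasDerivAt_id _).prodMk (hasDerivAt_const _ _)
    have h2 := ((hΘd _ hs).comp_hasDerivAt (Θ.symm y).1 h1).unique (hdΘ _ hs)
    rw [h2, Θ.right_inv hy]
  have hd : ∀ x ∈ W, HasMFDerivAt (𝓡 n) (𝓡 d) ψ x (ContinuousLinearMap.snd ℝ ℝ _ ∘L
      (fderiv ℝ Θ.symm (φ x) ∘L chartDeriv x₀ x)) := by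
    intro x hx
    have h1 : HasMFDerivAt (𝓡 n) (𝓡 d) (fun x => (ψ x : 𝔼 d)) x
        (ContinuousLinearMap.snd ℝ ℝ _ ∘L (fderiv ℝ Θ.symm (φ x) ∘L chartDeriv x₀ x)) := by
      refine (((ContinuousLinearMap.snd ℝ ℝ (𝔼 d)).hasMFDerivAt
        (x := Θ.symm (φ x))).comp x ((hΘsd _ hx.2).hasMFDerivAt.comp x
          (hasMFDerivAt_chartDeriv hx.1))).congr_of_eventuallyEq ?_
      filter_upwards [hW.mem_nhds hx] with z hz
      exact hψ z hz
    exact ⟨(hsm.continuousOn.continuousAt (hW.mem_nhds hx)), h1.2⟩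
  have hx₀ : x₀ ∈ W := ⟨mem_extChartAt_source x₀, by
    change φ x₀ ∈ Θ.target
    rw [← hΘ0]
    refine Θ.map_source ?_
    rw [hsrc]
    exact ⟨Metric.mem_ball_self hε, Metric.mem_ball_self hε⟩⟩
  refine ⟨W, U, ψ, hx₀, hW, hsm, eq_univ_of_forall fun u => ?_, fun x hx => ?_, fun x hx => ?_⟩
  · have hz : ((0 : ℝ), (u : 𝔼 d)) ∈ Θ.source := by
      rw [hsrc]
      exact ⟨Metric.mem_ball_self hε, u.2⟩
    have ht := Θ.map_source hz
    have hφ : φ (φ.symm (Θ (0, u))) = Θ (0, u) := φ.right_inv (htgt ht)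
    have hxW : φ.symm (Θ (0, u)) ∈ W := ⟨φ.map_target (htgt ht), by rwa [mem_preimage, hφ]⟩
    refine ⟨_, hxW, Subtype.ext ?_⟩
    rw [hψ _ hxW, hφ, Θ.left_inv hz]
  · rw [(hd x hx).mfderiv]
    intro ξ
    refine ⟨symmDeriv x₀ (φ x) (fderiv ℝ Θ (Θ.symm (φ x)) (0, ξ)), ?_⟩
    change (fderiv ℝ Θ.symm (φ x) (chartDeriv x₀ x (symmDeriv x₀ (φ x)
      (fderiv ℝ Θ (Θ.symm (φ x)) (0, ξ))))).2 = ξ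
    have h1 := chartDeriv_symmDeriv (φ.map_source hx.1) (fderiv ℝ Θ (Θ.symm (φ x)) (0, ξ))
    rw [φ.left_inv hx.1] at h1
    rw [h1, hr _ hx.2]
  · rw [(hd x hx).mfderiv]
    refine le_antisymm (fun X hX => ?_) ?_
    · have hX' : (fderiv ℝ Θ.symm (φ x) (chartDeriv x₀ x X)).2 = 0 := hX
      obtain ⟨t, ht⟩ : ∃ t : ℝ, fderiv ℝ Θ.symm (φ x) (chartDeriv x₀ x X) = t • (1, 0) :=
        ⟨_, Prod.ext (mul_one _).symm (hX'.trans (smul_zero _).symm)⟩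
      have h1 := hl _ hx.2 (chartDeriv x₀ x X)
      rw [ht, map_smul, hκ _ hx.2, hkκ x hx.1] at h1
      have h2 := congrArg (symmDeriv x₀ (φ x)) h1
      rw [map_smul] at h2
      exact Submodule.mem_span_singleton.2 ⟨t, ((congrArg (t • ·)
        (symmDeriv_chartDeriv hx.1 (κ x))).symm.trans h2).trans (symmDeriv_chartDeriv hx.1 X)⟩
    · rw [Submodule.span_singleton_le_iff_mem]
      change (fderiv ℝ Θ.symm (φ x) (chartDeriv x₀ x (κ x))).2 = 0
      rw [← hkκ x hx.1, ← hκ _ hx.2, hr _ hx.2]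

namespace LeafChart

variable {p q : ℕ} {𝓥 : HermitianModel p q} {E T E' : Type*} [NormedAddCommGroup E]
    [NormedSpace ℝ E] [NormedAddCommGroup T] [NormedSpace ℝ T] [NormedAddCommGroup E']
    [NormedSpace ℝ E'] {C : TractorChart 𝓥 E T} {v₀ : ModelV p q} {F : AdaptedFrame C v₀}
    {ψ : E → E'} (K : LeafChart F ψ) (w₀ : ModelV p q)

/-- The parameters `(y, B)` where `B` is not required to be invertible. -/
def extDom : Set (E' × ModelEnd p q) :=
  {z | z.1 ∈ Metric.ball K.base K.δ ∧ (𝓥.H w₀ (z.2 v₀)).re ≠ 0 ∧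
    (𝓥.H w₀ (z.2 v₀)).im / (𝓥.H w₀ (z.2 v₀)).re ∈ Metric.ball (0 : ℝ) K.δ}

/-- The base point and the frame with given parameters. -/
def extMap (z : E' × ModelEnd p q) : E × (ModelV p q →L[ℝ] T) :=
  (K.Θ.symm (z.1, (𝓥.H w₀ (z.2 v₀)).im / (𝓥.H w₀ (z.2 v₀)).re),
    F.τ (K.Θ.symm (z.1, (𝓥.H w₀ (z.2 v₀)).im / (𝓥.H w₀ (z.2 v₀)).re)) ∘L
      ContinuousLinearMap.restrictScalarsL ℂ (ModelV p q) (ModelV p q) ℝ ℝ z.2)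

theorem contDiff_pairing : ContDiff ℝ ∞ fun z : E' × ModelEnd p q => 𝓥.H w₀ (z.2 v₀) := by
  have h1 : ContDiff ℝ ∞ fun B : ModelEnd p q => B v₀ :=
    ((ContinuousLinearMap.apply ℂ (ModelV p q) v₀).restrictScalars ℝ).contDiff
  have h2 : ContDiff ℝ ∞ fun v : ModelV p q => 𝓥.H w₀ v :=
    ((LinearMap.toContinuousLinearMap (𝓥.H w₀)).restrictScalars ℝ).contDiff
  exact h2.comp (h1.comp contDiff_snd)

theorem contDiffOn_ratio : ContDiffOn ℝ ∞
    (fun z : E' × ModelEnd p q => (𝓥.H w₀ (z.2 v₀)).im / (𝓥.H w₀ (z.2 v₀)).re)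
    {z | (𝓥.H w₀ (z.2 v₀)).re ≠ 0} :=
  (Complex.imCLM.contDiff.comp (contDiff_pairing w₀)).contDiffOn.div
    (Complex.reCLM.contDiff.comp (contDiff_pairing w₀)).contDiffOn fun _ hz => hz

theorem isOpen_extDom : IsOpen (K.extDom w₀) := by
  have h1 : IsOpen {z : E' × ModelEnd p q | (𝓥.H w₀ (z.2 v₀)).re ≠ 0} :=
    isOpen_ne_fun (Complex.continuous_re.comp (contDiff_pairing w₀).continuous) continuous_const
  exact (Metric.isOpen_ball.preimage continuous_fst).inter
    ((contDiffOn_ratio w₀).continuousOn.isOpen_inter_preimage h1 Metric.isOpen_ball)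

variable {w₀}

theorem mapsTo_extDom {z : E' × ModelEnd p q} (hz : z ∈ K.extDom w₀) :
    (z.1, (𝓥.H w₀ (z.2 v₀)).im / (𝓥.H w₀ (z.2 v₀)).re) ∈ K.Θ.target :=
  K.mem_target.2 ⟨hz.1, hz.2.2⟩

theorem contDiffOn_extMap_fst : ContDiffOn ℝ ∞ (fun z => (K.extMap w₀ z).1) (K.extDom w₀) :=
  K.smooth_symm.comp (contDiffOn_fst.prodMk ((contDiffOn_ratio w₀).mono fun _ hz => hz.2.1))
    fun _ hz => K.mapsTo_extDom hz

theorem extMap_fst_mem {z : E' × ModelEnd p q} (hz : z ∈ K.extDom w₀) :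
    (K.extMap w₀ z).1 ∈ K.Θ.source := K.Θ.map_target (K.mapsTo_extDom hz)

theorem contDiffOn_extMap : ContDiffOn ℝ ∞ (K.extMap w₀) (K.extDom w₀) :=
  K.contDiffOn_extMap_fst.prodMk ((F.smooth_τ.comp K.contDiffOn_extMap_fst fun _ hz =>
      K.source_subset (K.extMap_fst_mem hz)).clm_comp
    ((ContinuousLinearMap.restrictScalarsL ℂ (ModelV p q) (ModelV p q) ℝ ℝ).contDiff.comp
      contDiff_snd).contDiffOn)

variable [FiniteDimensional ℝ T]

theorem hasFDerivAt_extMap {z : E' × ModelEnd p q} (hz : z ∈ K.extDom w₀) : ∃ L : E' × ModelEnd p q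
    →L[ℝ] E × (ModelV p q →L[ℝ] T), HasFDerivAt (K.extMap w₀) L z ∧ ∀ ζ, fderiv ℝ ψ
    (K.extMap w₀ z).1 (L ζ).1 = ζ.1 ∧ ∀ v, (L ζ).2 v = fderiv ℝ F.τ (K.extMap w₀ z).1 (L ζ).1
    (z.2 v) + F.τ (K.extMap w₀ z).1 (ζ.2 v) := by
  have hs := K.extMap_fst_mem hz
  have h1 := K.contDiffOn_extMap_fst.hasFDerivAt_of_isOpen (K.isOpen_extDom w₀) hz
  have h2 := (AdaptedFrame.hasFDerivAt_τ (K.source_subset hs)).comp z h1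
  have h3 : HasFDerivAt (fun z : E' × ModelEnd p q =>
      ContinuousLinearMap.restrictScalarsL ℂ (ModelV p q) (ModelV p q) ℝ ℝ z.2) _ z :=
    ((ContinuousLinearMap.restrictScalarsL ℂ (ModelV p q) (ModelV p q) ℝ ℝ).hasFDerivAt).comp z
      hasFDerivAt_snd
  refine ⟨_, h1.prodMk (h2.clm_comp h3), fun ζ => ⟨?_, fun v => ?_⟩⟩
  · have h4 := (K.hasFDerivAt_ψ hs).comp z h1
    have h5 : ψ ∘ (fun z => (K.extMap w₀ z).1) =ᶠ[𝓝 z] Prod.fst := by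
      filter_upwards [(K.isOpen_extDom w₀).mem_nhds hz] with z' hz'
      exact K.ψ_symm (K.mapsTo_extDom hz')
    exact congrArg (fun f : E' × ModelEnd p q →L[ℝ] E' => f ζ)
      ((h4.congr_of_eventuallyEq h5.symm).unique hasFDerivAt_fst)
  · exact add_comm _ _

theorem covariant_extMap {y : E'} {a : (ModelEnd p q)ˣ} (hz : (y, a) ∈ K.dom w₀) (ha : a ∈ 𝓥.SU) : ∃
    L : E' × ModelEnd p q →L[ℝ] E × (ModelV p q →L[ℝ] T), HasFDerivAt (K.extMap w₀) L (y, a.1) ∧ ∀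
    (ξ : E') (A : 𝓥.qLie) (v : ModelV p q), (L (ξ, a * A.1)).2 v + C.A (K.point w₀ (y, a))
    (L (ξ, a * A.1)).1 (K.frame w₀ (y, a) v) = K.frame w₀ (y, a)
    ((𝓥.cartanOf (K.alpha y) a (ξ, A) : ModelEnd p q) v) := by
  obtain ⟨L, hL, hL'⟩ := K.hasFDerivAt_extMap (z := (y, a.1)) hz
  refine ⟨L, hL, fun ξ A v => ?_⟩
  obtain ⟨h1, h2⟩ := hL' (ξ, a * A.1)
  have hx := point_mem hz
  have h3 := K.alpha_apply hx (L (ξ, a * A.1)).1 (a.1 v)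
  have h4 : fderiv ℝ ψ (K.point w₀ (y, a)) (L (ξ, a * A.1)).1 = ξ := h1
  rw [h4, ψ_point hz] at h3
  have h5 := AdaptedFrame.τ_beta (K.source_subset hx) (L (ξ, a * A.1)).1
    (a.1 v)
  rw [h2, 𝓥.cartanOf_apply ha]
  change fderiv ℝ F.τ (K.point w₀ (y, a)) _ (a.1 v) + F.τ (K.point w₀ (y, a))
      (a.1 (A.1 v)) + C.A (K.point w₀ (y, a)) _
        (F.τ (K.point w₀ (y, a)) (a.1 v))
    = F.τ (K.point w₀ (y, a)) ((a : ModelEnd p q)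
      ((a⁻¹).1 ((K.alpha y ξ : ModelEnd p q) (a.1 v))
        + A.1 v))
  rw [map_add (a : ModelEnd p q), ModelEnd.mul_inv_apply, map_add, h3, h5]
  abel

end LeafChart

theorem AdaptedFrame.contDiffOn_param {p q : ℕ} {𝓥 : HermitianModel p q} {E T : Type*}
    [NormedAddCommGroup E] [NormedSpace ℝ E] [NormedAddCommGroup T] [NormedSpace ℝ T]
    [FiniteDimensional ℝ T] {C : TractorChart 𝓥 E T} {v₀ : ModelV p q} (F : AdaptedFrame C v₀) :
    ContDiffOn ℝ ∞ (fun z : E × (ModelV p q →L[ℝ] T) => F.param z.1 z.2) (F.O ×ˢ univ) :=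
  complexPart.contDiff.comp_contDiffOn ((F.contDiffOn_inverse.comp contDiffOn_fst
    fun _ hz => hz.1).clm_comp contDiffOn_snd)

section units

variable {p q : ℕ}

theorem ModelEnd.contMDiff_val :
    ContMDiff 𝓘(ℝ, ModelEnd p q) 𝓘(ℝ, ModelEnd p q) ∞ (Units.val : (ModelEnd p q)ˣ → ModelEnd p q) :=
  contMDiff_isOpenEmbedding Units.isOpenEmbedding_val

theorem ModelEnd.contMDiff_val_inv : ContMDiff 𝓘(ℝ, ModelEnd p q) 𝓘(ℝ, ModelEnd p q) ∞
    (fun a : (ModelEnd p q)ˣ => (a⁻¹).1) := by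
  have : (fun a : (ModelEnd p q)ˣ => (a⁻¹).1)
    = Ring.inverse ∘ Units.val := by ext; simp
  rw [this]
  intro a
  refine ContMDiffAt.comp a ?_ (ModelEnd.contMDiff_val a)
  rw [contMDiffAt_iff_contDiffAt]
  exact (contDiffAt_ringInverse ℂ a).restrict_scalars ℝ

/-- The inverse of the inclusion of the units into the ring. -/
def ModelEnd.toUnits : ModelEnd p q → (ModelEnd p q)ˣ :=
  (Units.isOpenEmbedding_val.toOpenPartialHomeomorph
    (Units.val : (ModelEnd p q)ˣ → ModelEnd p q)).symm

theorem ModelEnd.toUnits_val (a : (ModelEnd p q)ˣ) : ModelEnd.toUnits (a : ModelEnd p q) = a :=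
  (Units.isOpenEmbedding_val.toOpenPartialHomeomorph
    (Units.val : (ModelEnd p q)ˣ → ModelEnd p q)).left_inv (mem_univ a)

theorem ModelEnd.contMDiffOn_toUnits : ContMDiffOn 𝓘(ℝ, ModelEnd p q) 𝓘(ℝ, ModelEnd p q) ∞
    (ModelEnd.toUnits : ModelEnd p q → (ModelEnd p q)ˣ) (range Units.val) :=
  contMDiffOn_isOpenEmbedding_symm Units.isOpenEmbedding_val

end units

section cartanOnLeafSpace

variable {p q n : ℕ} {N : Type*} [TopologicalSpace N]
  [ChartedSpace (𝔼 n) N] [IsManifold (𝓡 n) ∞ N] {𝓥 : HermitianModel p q}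

theorem ModelEnd.contDiff_mul_mul : ContDiff ℝ ∞
    fun z : ModelEnd p q × ModelEnd p q × ModelEnd p q => z.1 * z.2.1 * z.2.2 :=
  ContDiff.restrict_scalars ℝ (𝕜' := ℂ)
    ((contDiff_fst.mul (contDiff_fst.comp contDiff_snd)).mul (contDiff_snd.comp contDiff_snd))

theorem HermitianModel.contMDiffOn_conj {EX : Type*} [NormedAddCommGroup EX] [NormedSpace ℝ EX]
    {HX : Type*} [TopologicalSpace HX] {I : ModelWithCorners ℝ EX HX} {X : Type*}
    [TopologicalSpace X] [ChartedSpace HX X] {a : X → (ModelEnd p q)ˣ} {B : X → 𝓥.su} {S : Set X}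
    (ha : ContMDiffOn I 𝓘(ℝ, ModelEnd p q) ∞ a S) (hB : ContMDiffOn I 𝓘(ℝ, 𝓥.su) ∞ B S) :
    ContMDiffOn I 𝓘(ℝ, 𝓥.su) ∞ (fun z => 𝓥.conj (a z) (B z)) S := by
  have h1 := (ModelEnd.contMDiff_val_inv (p := p) (q := q)).comp_contMDiffOn ha
  have h2 := (ModelEnd.contMDiff_val (p := p) (q := q)).comp_contMDiffOn ha
  have h3 := 𝓥.su.subtypeL.contDiff.contMDiff.comp_contMDiffOn hB
  have h4 := ModelEnd.contDiff_mul_mul.contMDiff.comp_contMDiffOn (h1.prodMk_space (h3.prodMk_space h2))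
  exact (𝓥.suRetraction ∘L ContinuousLinearMap.restrictScalarsL ℂ (ModelV p q) (ModelV p q) ℝ
    ℝ).contDiff.contMDiff.comp_contMDiffOn h4

theorem contMDiffOn_chartDeriv (y₀ : N) : ContMDiffOn (𝓡 n).tangent 𝓘(ℝ, 𝔼 n) ∞
    (fun z : TangentBundle (𝓡 n) N => chartDeriv y₀ z.proj z.2) {z | z.proj ∈ (chart n y₀).source} := by
  have h := contMDiff_snd.comp_contMDiffOn ((trivializationAt (𝔼 n)
    (TangentSpace (𝓡 n) : N → Type) y₀).contMDiffOn (IB := 𝓡 n) (n := ∞))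
  refine (h.mono fun z hz => ?_).congr fun z hz => (trivializationAt_tangent hz z.2).symm
  rw [Trivialization.mem_source, TangentBundle.trivializationAt_baseSet, ← extChartAt_source (𝓡 n)]
  exact hz

variable (𝓥) in
/-- The one-form on `N × Q` determined by an `𝔰𝔲(V)`-valued one-form in the chart at `y₀`. -/
def leafForm (y₀ : N) (α : 𝔼 n → 𝔼 n →L[ℝ] 𝓥.su) : FormOnProduct (d := n) 𝓥 N := fun y a =>
  𝓥.cartanOf (α (chart n y₀ y) ∘L chartDeriv y₀ y) a

theorem isCartanConnection_leafForm {y₀ : N} {α : 𝔼 n → 𝔼 n →L[ℝ] 𝓥.su} {S : Set (𝔼 n)}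
    (hα : ContDiffOn ℝ ∞ α S) {N' : Set N} (hN : N' ⊆ (chart n y₀).source)
    (hS : ∀ y ∈ N', chart n y₀ y ∈ S) {v₀ : ModelV p q} (h : 𝓥.LR = Submodule.span ℝ {v₀})
    (h0 : v₀ ≠ 0) (hinj : ∀ y ∈ S, ∀ ξ (z : ℂ), (α y ξ : ModelEnd p q) v₀ = z • v₀ → ξ = 0)
    (hsurj : ∀ y ∈ S, ∀ B ∈ 𝓥.su, ∃ ξ, ∃ z : ℂ, (α y ξ : ModelEnd p q) v₀ = B v₀ + z • v₀) :
    IsCartanConnection 𝓥 (leafForm 𝓥 y₀ α) N' where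
  smooth := by
    have hp : ContMDiffOn ((𝓡 n).tangent.prod (𝓘(ℝ, ModelEnd p q).prod 𝓘(ℝ, 𝓥.qLie))) (𝓡 n) ∞
        (fun z : TangentBundle (𝓡 n) N × ((ModelEnd p q)ˣ × 𝓥.qLie) => z.1.proj)
        {z | z.1.proj ∈ N' ∧ z.2.1 ∈ 𝓥.Q} :=
      ((Bundle.contMDiff_proj (IB := 𝓡 n) (TangentSpace (𝓡 n) : N → Type)).comp
        contMDiff_fst).contMDiffOn
    have h1 := (hα.contMDiffOn.comp ((contMDiffOn_extChartAt (I := 𝓡 n) (n := ∞) (x := y₀)).comp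
      hp fun z hz => by
        rw [mem_preimage, ← extChartAt_source (𝓡 n)]
        exact hN hz.1) fun z hz => hS _ hz.1).clm_apply
      ((contMDiffOn_chartDeriv y₀).comp (contMDiffOn_fst (I := (𝓡 n).tangent)
        (J := 𝓘(ℝ, ModelEnd p q).prod 𝓘(ℝ, 𝓥.qLie)) (N := (ModelEnd p q)ˣ × 𝓥.qLie))
          fun z hz => hN hz.1)
    exact (𝓥.contMDiffOn_conj (contMDiff_fst.comp contMDiff_snd).contMDiffOn h1).add
      ((𝓥.qIncl.contDiff.contMDiff.comp (contMDiff_snd.comp contMDiff_snd)).contMDiffOn)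
  bijective := fun y hy a ha => by
    have hD := chartDeriv_symmDeriv ((chart n y₀).map_source (hN hy))
    rw [(chart n y₀).left_inv (hN hy)] at hD
    refine 𝓥.cartanOf_bijective (E' := (𝔼 n)) h h0 ha (fun ξ z hz => ?_) fun B hB => ?_
    · have h1 := hinj _ (hS y hy) _ z hz
      exact (symmDeriv_chartDeriv (hN hy) ξ).symm.trans ((congrArg _ h1).trans (map_zero _))
    · obtain ⟨ξ, z, hz⟩ := hsurj _ (hS y hy) B hB
      refine ⟨symmDeriv y₀ (chart n y₀ y) ξ, z, ?_⟩
      rw [ContinuousLinearMap.comp_apply, hD, hz]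
  fundamental := fun y _ a _ A => 𝓥.cartanOf_zero a A
  equivariant := fun y _ a ha b hb ξ A A' hA => 𝓥.cartanOf_mul (E' := (𝔼 n))
    ha.1 hb.1 ξ hA

end cartanOnLeafSpace

theorem expGL_zero_smul {p q : ℕ} (A : ModelEnd p q) : expGL ((0 : ℝ) • A) = 1 :=
  Units.ext (by
    change NormedSpace.exp ((0 : ℝ) • A) = 1
    rw [zero_smul, NormedSpace.exp_zero])

theorem hasDerivAt_mul_expGL {p q : ℕ} (a : (ModelEnd p q)ˣ) (A : ModelEnd p q) : HasDerivAt
    (fun t : ℝ => ((a * expGL (t • A) : (ModelEnd p q)ˣ) : ModelEnd p q)) (a.1 * A) 0 := by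
  have h := (hasDerivAt_exp_smul_const (𝕂 := ℝ) A 0).const_mul (a : ModelEnd p q)
  rw [zero_smul, NormedSpace.exp_zero, one_mul] at h
  exact h

theorem contDiff_mul_expGL {p q : ℕ} (a : (ModelEnd p q)ˣ) (A : ModelEnd p q) : ContDiff ℝ ∞
    fun t : ℝ => ((a * expGL (t • A) : (ModelEnd p q)ˣ) : ModelEnd p q) := by
  have h1 : ContDiff ℝ ∞ (NormedSpace.exp : ModelEnd p q → ModelEnd p q) :=
    ContDiff.restrict_scalars ℝ (𝕜' := ℂ)
      (contDiff_iff_contDiffAt.2 fun B => (NormedSpace.exp_analytic B).contDiffAt)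
  have h2 : ContDiff ℝ ∞ fun B : ModelEnd p q => a.1 * B :=
    ContDiff.restrict_scalars ℝ (𝕜' := ℂ) (contDiff_const.mul contDiff_id)
  exact h2.comp (h1.comp (contDiff_id.smul contDiff_const))

theorem PseudoRiemannianMetric.connector_frameOfChart_eq {V : Type*} [NormedAddCommGroup V]
    [NormedSpace ℝ V] {n r s : ℕ} {M : Type*} [TopologicalSpace M] [ChartedSpace (𝔼 n) M]
    [IsManifold (𝓡 n) ∞ M] {EX HX X : Type*} [NormedAddCommGroup EX] [NormedSpace ℝ EX]
    [TopologicalSpace HX] {I : ModelWithCorners ℝ EX HX} [TopologicalSpace X] [ChartedSpace HX X]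
    (g : PseudoRiemannianMetric n M r s) {x₀ : M} {f : X → 𝔼 n × (V →L[ℝ] 𝕋 n)} {z : X}
    (hz : (f z).1 ∈ (chart n x₀).target) {D : EX →L[ℝ] 𝔼 n × (V →L[ℝ] 𝕋 n)}
    (hD : HasMFDerivAt I 𝓘(ℝ, 𝔼 n × (V →L[ℝ] 𝕋 n)) f z D) {f' : EX →L[ℝ] 𝔼 n × (V →L[ℝ] 𝕋 n)}
    (hf : HasMFDerivAt I ((𝓡 n).prod 𝓘(ℝ, V →L[ℝ] 𝕋 n)) (fun z => frameOfChart x₀ (f z)) z f')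
    (ζ : EX) {v w : V}
    (h : (D ζ).2 v + CoordMetric.tractorConn (g.inChart x₀) (f z).1 (D ζ).1 ((f z).2 v) = (f z).2 w)
    : g.connector (frameOfChart x₀ (f z)).proj ((frameOfChart x₀ (f z)).toMap v) (f' ζ).1
    ((f' ζ).2 v) = (frameOfChart x₀ (f z)).toMap w := by
  have key := (g.connector_frameOfChart hz hD hf ζ v).trans h
  have h4 := congrArg (diagL (symmDeriv x₀ (f z).1)) key
  refine Eq.trans (Eq.symm ?_) h4
  have h5 := diagL_symmDeriv_chartDeriv ((chart n x₀).map_target hz)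
    (g.connector (frameOfChart x₀ (f z)).proj
      ((frameOfChart x₀ (f z)).toMap v) (f' ζ).1 ((f' ζ).2 v))
  rw [(chart n x₀).right_inv hz] at h5
  exact h5

section leafFrame

variable {p q n d : ℕ} {M : Type*} [TopologicalSpace M] [ChartedSpace (𝔼 n) M] [IsManifold (𝓡 n) ∞ M]
  {N : Type*} [TopologicalSpace N] [ChartedSpace (𝔼 d) N]
  [IsManifold (𝓡 d) ∞ N] {𝓥 : HermitianModel p q} {v₀ : ModelV p q}
  {C : TractorChart 𝓥 (𝔼 n) 𝕋 n} {F : AdaptedFrame C v₀}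
  {ψ' : 𝔼 n → 𝔼 d} (K : LeafChart F ψ') (w₀ : ModelV p q) (x₀ : M) (y₀ : N)

/-- The frames parametrised by a leaf chart. -/
def leafFrame (z : N × (ModelEnd p q)ˣ) : FrameTotal (ModelV p q) n M :=
  frameOfChart x₀ (K.extMap w₀ (chart d y₀ z.1, (z.2 : ModelEnd p q)))

/-- The pairs that parametrise frames over `N'`. -/
def leafDom (N' : Set N) : Set (N × (ModelEnd p q)ˣ) :=
  {z | z.1 ∈ N' ∧ (chart d y₀ z.1, z.2) ∈ K.dom w₀}

/-- The parameters of a frame. -/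
def leafParam (F : AdaptedFrame C v₀) (ψ : M → N) (u : FrameTotal (ModelV p q) n M) :
    N × (ModelEnd p q)ˣ :=
  (ψ u.proj, ModelEnd.toUnits (F.param (frameInChart x₀ u).1 (frameInChart x₀ u).2))

variable {K w₀ x₀ y₀} {N' : Set N} {z : N × (ModelEnd p q)ˣ}

theorem contMDiffOn_paramChart (hN : N' ⊆ (chart d y₀).source) : ContMDiffOn
    ((𝓡 d).prod 𝓘(ℝ, ModelEnd p q)) 𝓘(ℝ, 𝔼 d × ModelEnd p q) ∞
    (fun z : N × (ModelEnd p q)ˣ => (chart d y₀ z.1, (z.2 : ModelEnd p q))) {z | z.1 ∈ N'} :=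
  ((contMDiffOn_extChartAt (I := 𝓡 d) (n := ∞) (x := y₀)).comp contMDiffOn_fst fun z hz => by
    rw [mem_preimage, ← extChartAt_source (𝓡 d)]
    exact hN hz).prodMk_space
  (ModelEnd.contMDiff_val.comp contMDiff_snd).contMDiffOn

theorem isOpen_leafDom (hN' : IsOpen N') (hN : N' ⊆ (chart d y₀).source) :
    IsOpen (leafDom K w₀ y₀ N') :=
  (contMDiffOn_paramChart hN).continuousOn.isOpen_inter_preimage (hN'.preimage continuous_fst)
    (K.isOpen_extDom w₀)

theorem mem_target_of_leafDom (hΩ : C.Ω ⊆ (chart n x₀).target) (hz : z ∈ leafDom K w₀ y₀ N') :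
    K.point w₀ (chart d y₀ z.1, z.2) ∈ (chart n x₀).target :=
  hΩ (F.subset (K.source_subset (LeafChart.point_mem hz.2)))

theorem contMDiffOn_leafFrame (hΩ : C.Ω ⊆ (chart n x₀).target) (hN : N' ⊆ (chart d y₀).source) :
    ContMDiffOn ((𝓡 d).prod 𝓘(ℝ, ModelEnd p q)) ((𝓡 n).prod 𝓘(ℝ, ModelV p q →L[ℝ] 𝕋 n)) ∞
    (leafFrame K w₀ x₀ y₀) (leafDom K w₀ y₀ N') :=
  contMDiffOn_frameOfChart (K.contDiffOn_extMap.contMDiffOn.comp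
    ((contMDiffOn_paramChart hN).mono fun _ hz => hz.1) fun _ hz => hz.2)
    fun _ hz => mem_target_of_leafDom hΩ hz

theorem frameInChart_leafFrame (hΩ : C.Ω ⊆ (chart n x₀).target) (hz : z ∈ leafDom K w₀ y₀ N') :
    frameInChart x₀ (leafFrame K w₀ x₀ y₀ z) =
    (K.point w₀ (chart d y₀ z.1, z.2), K.frame w₀ (chart d y₀ z.1, z.2)) :=
  frameInChart_frameOfChart (mem_target_of_leafDom hΩ hz)

theorem leafParam_leafFrame {ψ : M → N} (hΩ : C.Ω ⊆ (chart n x₀).target)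
    (hz : z ∈ leafDom K w₀ y₀ N') (hψ : ψ (leafFrame K w₀ x₀ y₀ z).proj = z.1) :
    leafParam x₀ F ψ (leafFrame K w₀ x₀ y₀ z) = z := by
  refine Prod.ext hψ ?_
  rw [leafParam, frameInChart_leafFrame hΩ hz, LeafChart.param_frame hz.2, ModelEnd.toUnits_val]

theorem contMDiffOn_leafParam {ψ : M → N} {W : Set M} (hψ : ContMDiffOn (𝓡 n) (𝓡 d) ∞ ψ W)
    {S : Set (FrameTotal (ModelV p q) n M)} (hW : ∀ u ∈ S, u.proj ∈ W)
    (hs : ∀ u ∈ S, u.proj ∈ (chart n x₀).source) (hO : ∀ u ∈ S, chart n x₀ u.proj ∈ F.O)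
    (hu : ∀ u ∈ S, F.param (frameInChart x₀ u).1 (frameInChart x₀ u).2 ∈ range Units.val) :
    ContMDiffOn ((𝓡 n).prod 𝓘(ℝ, ModelV p q →L[ℝ] 𝕋 n)) ((𝓡 d).prod 𝓘(ℝ, ModelEnd p q)) ∞
    (leafParam x₀ F ψ) S := by
  have h1 : ContMDiffOn ((𝓡 n).prod 𝓘(ℝ, ModelV p q →L[ℝ] 𝕋 n)) 𝓘(ℝ, ModelEnd p q) ∞
      (fun u : FrameTotal (ModelV p q) n M =>
        F.param (frameInChart x₀ u).1 (frameInChart x₀ u).2) S :=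
    F.contDiffOn_param.contMDiffOn.comp ((contMDiffOn_frameInChart x₀).mono hs)
      fun u h => ⟨hO u h, trivial⟩
  exact (hψ.comp (Bundle.contMDiff_proj (IB := 𝓡 n) (F := ModelV p q →L[ℝ] 𝕋 n)
    (fun x : M => Bundle.Trivial M (ModelV p q) x →L[ℝ] Tractor n M x)).contMDiffOn hW).prodMk
    (ModelEnd.contMDiffOn_toUnits.comp h1 hu)

theorem leafFrame_mul (h : 𝓥.H w₀ v₀ = 1) {y : N} {a b : (ModelEnd p q)ˣ} {k : ℂ} {r : ℝ}
    (hr : r ≠ 0) (ha : a.1 v₀ = k • v₀) (hb : b.1 v₀ = (r : ℂ) • v₀) :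
    leafFrame K w₀ x₀ y₀ (y, a * b) = ⟨(leafFrame K w₀ x₀ y₀ (y, a)).proj,
      (leafFrame K w₀ x₀ y₀ (y, a)).toMap.comp ((b : ModelEnd p q).restrictScalars ℝ)⟩ := by
  have h1 := LeafChart.point_mul (K := K) (z := (chart d y₀ y, a)) h hr ha hb
  refine FrameTotal.ext (congrArg (chart n x₀).symm h1) (ContinuousLinearMap.ext fun v => ?_)
  change diagL (symmDeriv x₀ (K.point w₀ (chart d y₀ y, a * b)))
      (F.τ (K.point w₀ (chart d y₀ y, a * b)) (a.1 (b.1 v)))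
    = diagL (symmDeriv x₀ (K.point w₀ (chart d y₀ y, a)))
      (F.τ (K.point w₀ (chart d y₀ y, a)) (a.1 (b.1 v)))
  rw [h1]

theorem mdifferentiableAt_leafFrame (hΩ : C.Ω ⊆ (chart n x₀).target) (hN' : IsOpen N')
    (hN : N' ⊆ (chart d y₀).source) {y : N} {γ : ℝ → (ModelEnd p q)ˣ}
    (hz : (y, γ 0) ∈ leafDom K w₀ y₀ N') (hγ : ContDiff ℝ ∞ fun t => (γ t : ModelEnd p q)) :
    MDifferentiableAt ((𝓡 d).prod 𝓘(ℝ, ℝ)) ((𝓡 n).prod 𝓘(ℝ, ModelV p q →L[ℝ] 𝕋 n))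
    (fun w : N × ℝ => leafFrame K w₀ x₀ y₀ (w.1, γ w.2)) (y, 0) := by
  let S : Set (N × ℝ) := {w | w.1 ∈ N'}
  have hP : ContMDiffOn ((𝓡 d).prod 𝓘(ℝ, ℝ)) 𝓘(ℝ, 𝔼 d × ModelEnd p q) ∞
      (fun w : N × ℝ => (chart d y₀ w.1, (γ w.2 : ModelEnd p q))) S :=
    ((contMDiffOn_extChartAt (I := 𝓡 d) (n := ∞) (x := y₀)).comp contMDiffOn_fst fun w hw => by
      rw [mem_preimage, ← extChartAt_source (𝓡 d)]
      exact hN hw).prodMk_space (hγ.contMDiff.comp contMDiff_snd).contMDiffOn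
  have hS : IsOpen S := hN'.preimage continuous_fst
  have hO := hP.continuousOn.isOpen_inter_preimage hS (K.isOpen_extDom w₀)
  have hsm := contMDiffOn_frameOfChart (x₀ := x₀)
    ((K.contDiffOn_extMap (w₀ := w₀)).contMDiffOn.comp (hP.mono inter_subset_left) fun w hw => hw.2)
    fun w hw => hΩ (F.subset (K.source_subset (K.extMap_fst_mem (w₀ := w₀) hw.2)))
  have hmem : (y, (0 : ℝ)) ∈ S ∩ (fun w : N × ℝ =>
      (chart d y₀ w.1, (γ w.2 : ModelEnd p q))) ⁻¹' K.extDom w₀ := ⟨hz.1, hz.2⟩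
  have h := (hsm.contMDiffAt (hO.mem_nhds hmem)).mdifferentiableAt (by simp)
  exact h

theorem connector_leafFrame {r s : ℕ} (g : PseudoRiemannianMetric n M r s)
    (hA : C.A = CoordMetric.tractorConn (g.inChart x₀))
    (hΩ : C.Ω ⊆ (chart n x₀).target)
    (hN : N' ⊆ (chart d y₀).source) {y : N} {γ : ℝ → (ModelEnd p q)ˣ}
    (hz : (y, γ 0) ∈ leafDom K w₀ y₀ N') (ha : γ 0 ∈ 𝓥.SU) (ξ : 𝔼 d) (A : 𝓥.qLie)
    (hγ' : HasDerivAt (fun t => (γ t : ModelEnd p q)) ((γ 0 : ModelEnd p q) * A) 0)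
    {f' : 𝔼 d × ℝ →L[ℝ] 𝔼 n × (ModelV p q →L[ℝ] 𝕋 n)}
    (hf : HasMFDerivAt ((𝓡 d).prod 𝓘(ℝ, ℝ)) ((𝓡 n).prod 𝓘(ℝ, ModelV p q →L[ℝ] 𝕋 n))
      (fun w : N × ℝ => leafFrame K w₀ x₀ y₀ (w.1, γ w.2)) (y, 0) f')
    (v : ModelV p q) :
    g.connector (leafFrame K w₀ x₀ y₀ (y, γ 0)).proj
      ((leafFrame K w₀ x₀ y₀ (y, γ 0)).toMap v)
      (f' (ξ, 1)).1 ((f' (ξ, 1)).2 v)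
    = (leafFrame K w₀ x₀ y₀ (y, γ 0)).toMap
      ((𝓥.cartanOf (K.alpha (chart d y₀ y)) (γ 0) (chartDeriv y₀ y ξ, A) : ModelEnd p q) v) := by
  obtain ⟨L, hL, hL'⟩ := K.covariant_extMap hz.2 ha
  have h1 : HasMFDerivAt ((𝓡 d).prod 𝓘(ℝ, ℝ)) 𝓘(ℝ, 𝔼 d)
      (fun w : N × ℝ => chart d y₀ w.1) (y, 0)
      (chartDeriv y₀ y ∘L ContinuousLinearMap.fst ℝ (𝔼 d) ℝ) :=
    (hasMFDerivAt_chartDeriv (hN hz.1)).comp (y, (0 : ℝ)) (hasMFDerivAt_fst (y, (0 : ℝ)))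
  have h2 : HasMFDerivAt ((𝓡 d).prod 𝓘(ℝ, ℝ)) 𝓘(ℝ, ModelEnd p q)
      (fun w : N × ℝ => (γ w.2 : ModelEnd p q))
      (y, 0) ((ContinuousLinearMap.toSpanSingleton ℝ ((γ 0 : ModelEnd p q) * A.1)) ∘L
        ContinuousLinearMap.snd ℝ (𝔼 d) ℝ) :=
    HasMFDerivAt.comp (y, (0 : ℝ))
      (g := fun t : ℝ => (γ t : ModelEnd p q))
      (hγ'.hasFDerivAt.hasMFDerivAt)
      (hasMFDerivAt_snd (y, (0 : ℝ)))
  obtain ⟨P, hP, h3⟩ : ∃ P : 𝔼 d × ℝ →L[ℝ] 𝔼 d × ModelEnd p q,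
      P (ξ, 1) = (chartDeriv y₀ y ξ, (γ 0 : ModelEnd p q) * A.1) ∧
      HasMFDerivAt ((𝓡 d).prod 𝓘(ℝ, ℝ)) 𝓘(ℝ, 𝔼 d × ModelEnd p q)
      (fun w : N × ℝ => (chart d y₀ w.1,
        (γ w.2 : ModelEnd p q))) (y, 0) P :=
    ⟨(chartDeriv y₀ y ∘L ContinuousLinearMap.fst ℝ (𝔼 d) ℝ).prod
        ((ContinuousLinearMap.toSpanSingleton ℝ ((γ 0 : ModelEnd p q) * A.1)) ∘L
          ContinuousLinearMap.snd ℝ (𝔼 d) ℝ),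
      Prod.ext rfl (one_smul ℝ ((γ 0 : ModelEnd p q) * A.1)),
      h1.1.prodMk h2.1, h1.2.prodMk h2.2⟩
  have hD : HasMFDerivAt ((𝓡 d).prod 𝓘(ℝ, ℝ)) 𝓘(ℝ, 𝔼 n × (ModelV p q →L[ℝ] 𝕋 n))
      (fun w : N × ℝ => K.extMap w₀ (chart d y₀ w.1,
        (γ w.2 : ModelEnd p q))) (y, 0)
      (L ∘L P) := by
    refine HasMFDerivAt.comp (y, (0 : ℝ)) (g := K.extMap w₀) ?_ h3
    exact hL.hasMFDerivAt
  have hv : ((L ∘L P) (ξ, 1)).2 v + CoordMetric.tractorConn (g.inChart x₀)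
      (K.extMap w₀ (chart d y₀ y, (γ 0 : ModelEnd p q))).1 ((L ∘L P) (ξ, 1)).1
      ((K.extMap w₀ (chart d y₀ y, (γ 0 : ModelEnd p q))).2 v)
      = (K.extMap w₀ (chart d y₀ y, (γ 0 : ModelEnd p q))).2
        ((𝓥.cartanOf (K.alpha (chart d y₀ y)) (γ 0) (chartDeriv y₀ y ξ, A) :
          ModelEnd p q) v) := by
    rw [ContinuousLinearMap.comp_apply, hP, ← hA]
    exact hL' (chartDeriv y₀ y ξ) A v
  exact g.connector_frameOfChart_eq (x₀ := x₀) (z := (y, (0 : ℝ)))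
    (f := fun w : N × ℝ => K.extMap w₀ (chart d y₀ w.1, (γ w.2 : ModelEnd p q)))
    (mem_target_of_leafDom (z := (y, γ 0)) hΩ hz) hD hf (ξ, 1) hv

end leafFrame

section leafFrameImage

variable {p q n d : ℕ} {M : Type*} [TopologicalSpace M] [ChartedSpace (𝔼 n) M] [IsManifold (𝓡 n) ∞ M]
  {N : Type*} [TopologicalSpace N] [ChartedSpace (𝔼 d) N]
  [IsManifold (𝓡 d) ∞ N] {𝓥 : HermitianModel p q} {v₀ w₀ : ModelV p q}
  {C : TractorChart 𝓥 (𝔼 n) 𝕋 n} {F : AdaptedFrame C v₀}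
  {ψ' : 𝔼 n → 𝔼 d} {K : LeafChart F ψ'} {x₀ : M} {y₀ : N} {N' : Set N}
  {z : N × (ModelEnd p q)ˣ} {ψ : M → N} {W : Set M} {G : Set (FrameTotal (ModelV p q) n M)}

theorem leafFrame_proj_mem (hΩ : C.Ω ⊆ (chart n x₀).target) (hz : z ∈ leafDom K w₀ y₀ N') :
    (leafFrame K w₀ x₀ y₀ z).proj ∈ (chart n x₀).source ∧ chart n x₀ (leafFrame K w₀ x₀ y₀ z).proj ∈
    K.Θ.source := by
  have h := mem_target_of_leafDom hΩ hz
  refine ⟨(chart n x₀).map_target h, ?_⟩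
  have h1 := LeafChart.point_mem hz.2
  rw [← (chart n x₀).right_inv h] at h1
  exact h1

theorem ψ_leafFrame (hΩ : C.Ω ⊆ (chart n x₀).target)
    (hN : N' ⊆ (chart d y₀).source)
    (hK : ∀ x ∈ (chart n x₀).source, chart n x₀ x ∈ K.Θ.source →
      x ∈ W ∧ ψ x ∈ (chart d y₀).source ∧
        ψ' (chart n x₀ x) = chart d y₀ (ψ x))
    (hz : z ∈ leafDom K w₀ y₀ N') :
    (leafFrame K w₀ x₀ y₀ z).proj ∈ W ∧ ψ (leafFrame K w₀ x₀ y₀ z).proj = z.1 := by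
  obtain ⟨h1, h2⟩ := leafFrame_proj_mem hΩ hz
  obtain ⟨h3, h4, h5⟩ := hK _ h1 h2
  refine ⟨h3, (chart d y₀).injOn h4 (hN hz.1) (h5.symm.trans ?_)⟩
  exact (congrArg ψ' ((chart n x₀).right_inv (mem_target_of_leafDom hΩ hz))).trans
    (LeafChart.ψ_point hz.2)

theorem mem_leafDom_mul (h : 𝓥.LR = Submodule.span ℝ {v₀}) (h0 : v₀ ≠ 0) (hH : 𝓥.H w₀ v₀ = 1)
    {y : N} {a b : (ModelEnd p q)ˣ} (hz : (y, a) ∈ leafDom K w₀ y₀ N' ∩ N' ×ˢ 𝓥.Q) (hb : b ∈ 𝓥.PSU) :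
    (y, a * b) ∈ leafDom K w₀ y₀ N' ∩ N' ×ˢ 𝓥.Q := by
  obtain ⟨k, hk, hak⟩ := 𝓥.apply_mem_Q h h0 hz.2.2
  obtain ⟨r, hr, hbr⟩ := 𝓥.apply_mem_PSU h h0 hb
  exact ⟨⟨hz.1.1, LeafChart.mul_mem_dom (z := (chart d y₀ y, a)) hz.1.2 hH hr hak hbr⟩,
    hz.2.1, 𝓥.mul_mem_Q hz.2.2 (𝓥.PSU_subset_Q hb)⟩

theorem one_mem_leafDom (h : 𝓥.LR = Submodule.span ℝ {v₀}) (hH : 𝓥.H w₀ v₀ = 1) {y : N}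
    (hy : y ∈ N') (hb : chart d y₀ y ∈ Metric.ball K.base K.δ) :
    (y, 1) ∈ leafDom K w₀ y₀ N' ∩ N' ×ˢ 𝓥.Q := by
  have h1 : ((1 : (ModelEnd p q)ˣ) : ModelEnd p q) v₀ = (1 : ℂ) • v₀ := (one_smul ℂ v₀).symm
  have h2 := 𝓥.H_apply hH h1
  refine ⟨⟨hy, hb, ?_, ?_⟩, hy, 𝓥.mem_Q_of_apply h (one_mem _) one_ne_zero h1⟩
  · change (𝓥.H w₀ (((1 : (ModelEnd p q)ˣ) : ModelEnd p q) v₀)).re ≠ 0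
    rw [h2]
    exact one_ne_zero
  · change 𝓥.ratio v₀ w₀ 1 ∈ _
    rw [HermitianModel.ratio, h2, Complex.one_im, zero_div]
    exact Metric.mem_ball_self K.δ_pos

theorem leafFrame_act (h : 𝓥.LR = Submodule.span ℝ {v₀}) (h0 : v₀ ≠ 0) (hH : 𝓥.H w₀ v₀ = 1)
    {y : N} {a b : (ModelEnd p q)ˣ} (ha : a ∈ 𝓥.Q) (hb : b ∈ 𝓥.PSU) :
    leafFrame K w₀ x₀ y₀ (y, a * b) = ⟨(leafFrame K w₀ x₀ y₀ (y, a)).proj,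
      (leafFrame K w₀ x₀ y₀ (y, a)).toMap.comp ((b : ModelEnd p q).restrictScalars ℝ)⟩ := by
  obtain ⟨k, hk, hak⟩ := 𝓥.apply_mem_Q h h0 ha
  obtain ⟨r, hr, hbr⟩ := 𝓥.apply_mem_PSU h h0 hb
  exact leafFrame_mul hH hr hak hbr

theorem image_leafFrame (hΩ : C.Ω ⊆ (chart n x₀).target)
    (hN : N' ⊆ (chart d y₀).source)
    (hK : ∀ x ∈ (chart n x₀).source, chart n x₀ x ∈ K.Θ.source →
      x ∈ W ∧ ψ x ∈ (chart d y₀).source ∧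
        ψ' (chart n x₀ x) = chart d y₀ (ψ x))
    (h : 𝓥.LR = Submodule.span ℝ {v₀}) (h0 : v₀ ≠ 0) (hH : 𝓥.H w₀ v₀ = 1)
    (hG : ∀ u : FrameTotal (ModelV p q) n M, u.proj ∈ (chart n x₀).source →
      (frameInChart x₀ u).1 ∈ C.Ω → (u ∈ G ↔ C.IsFrame (frameInChart x₀ u).1 (frameInChart x₀ u).2 ∧
        ∃ r : ℝ, r ≠ 0 ∧ (frameInChart x₀ u).2 v₀ = r • C.e)) :
    leafFrame K w₀ x₀ y₀ '' (leafDom K w₀ y₀ N' ∩ N' ×ˢ 𝓥.Q)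
      = TotalSpace.proj ⁻¹' (((chart n x₀).source ∩ chart n x₀ ⁻¹' K.Θ.source) ∩
        (W ∩ ψ ⁻¹' N')) ∩ G := by
  refine Subset.antisymm ?_ fun u hu => ?_
  · rintro _ ⟨z, hz, rfl⟩
    have h1 := leafFrame_proj_mem hΩ hz.1
    have h2 := ψ_leafFrame hΩ hN hK hz.1
    obtain ⟨k, hk, hak⟩ := 𝓥.apply_mem_Q h h0 hz.2.2
    refine ⟨⟨h1, h2.1, ?_⟩, (hG _ h1.1 (F.subset (K.source_subset h1.2))).2 ?_⟩
    · rw [mem_preimage, h2.2]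
      exact hz.1.1
    · rw [frameInChart_leafFrame hΩ hz.1]
      exact ⟨LeafChart.isFrame_frame hz.1.2 hz.2.2.1, LeafChart.frame_apply hz.1.2 hH hak⟩
  · obtain ⟨⟨⟨h1, h2⟩, h3, h4⟩, h5⟩ := hu
    obtain ⟨hfr, r, hr, hv⟩ := (hG u h1 (F.subset (K.source_subset h2))).1 h5
    obtain ⟨a, ha, ⟨k, hk, hak⟩, hd, hp, hf⟩ := LeafChart.exists_params hH h2 hfr hr hv
    rw [(hK _ h1 h2).2.2] at hd hp hf
    refine ⟨(ψ u.proj, a), ⟨⟨h4, hd⟩, h4, 𝓥.mem_Q_of_apply h ha hk hak⟩, ?_⟩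
    refine Eq.trans ?_ (frameOfChart_frameInChart h1)
    exact congrArg (frameOfChart x₀) (Prod.ext hp hf)

theorem isInvertible_leafFrame (hΩ : C.Ω ⊆ (chart n x₀).target) (hz : z ∈ leafDom K w₀ y₀ N')
    (ha : z.2 ∈ 𝓥.SU) : (leafFrame K w₀ x₀ y₀ z).toMap.IsInvertible := by
  have h := mem_target_of_leafDom hΩ hz
  have h1 : (diagL (symmDeriv x₀ (K.point w₀ (chart d y₀ z.1, z.2)))).IsInvertible :=
    ⟨ContinuousLinearEquiv.equivOfInverse _
      (diagL (chartDeriv x₀ ((chart n x₀).symm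
        (K.point w₀ (chart d y₀ z.1, z.2)))))
      (fun v => diagL_chartDeriv_symmDeriv h v) (fun v => by
        have h2 := diagL_symmDeriv_chartDeriv ((chart n x₀).map_target h) v
        rwa [(chart n x₀).right_inv h] at h2), rfl⟩
  exact h1.comp (LeafChart.isFrame_frame hz.2 ha).isInvertible

theorem cartan_leafFrame {r s : ℕ} (g : PseudoRiemannianMetric n M r s)
    (hA : C.A = CoordMetric.tractorConn (g.inChart x₀))
    (hΩ : C.Ω ⊆ (chart n x₀).target) (hN' : IsOpen N')
    (hN : N' ⊆ (chart d y₀).source) {y : N} {a : (ModelEnd p q)ˣ}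
    (hz : (y, a) ∈ leafDom K w₀ y₀ N') (ha : a ∈ 𝓥.SU) (ξ : 𝔼 d) (A : 𝓥.qLie)
    (v : ModelV p q) {f' : 𝔼 d × ℝ →L[ℝ] 𝔼 n × (ModelV p q →L[ℝ] 𝕋 n)}
    (hf : f' = mfderiv ((𝓡 d).prod 𝓘(ℝ, ℝ)) ((𝓡 n).prod 𝓘(ℝ, ModelV p q →L[ℝ] 𝕋 n))
      (fun w : N × ℝ => leafFrame K w₀ x₀ y₀ (w.1, a * expGL (w.2 • A.1))) (y, 0))
    {u : FrameTotal (ModelV p q) n M}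
    (hu : u = leafFrame K w₀ x₀ y₀ (y, a * expGL ((0 : ℝ) • A.1))) :
    u.toMap.inverse (g.connector u.proj (u.toMap v) (f' (ξ, 1)).1 ((f' (ξ, 1)).2 v))
      = (leafForm 𝓥 y₀ K.alpha y a (ξ, A) : ModelEnd p q) v := by
  have e : a * expGL ((0 : ℝ) • A.1) = a := by rw [expGL_zero_smul, mul_one]
  have hz' := hz
  have ha' := ha
  rw [← e] at hz' ha'
  have hmd := mdifferentiableAt_leafFrame (K := K) (w₀ := w₀) (γ := fun t => a * expGL (t • A.1))
    hΩ hN' hN hz' (contDiff_mul_expGL a A)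
  have hγ : HasDerivAt (fun t : ℝ => ((a * expGL (t • A.1) : (ModelEnd p q)ˣ) : ModelEnd p q))
      (((a * expGL ((0 : ℝ) • A.1) : (ModelEnd p q)ˣ) : ModelEnd p q) * A) 0 := by
    rw [e]
    exact hasDerivAt_mul_expGL a (A : ModelEnd p q)
  have hf' := hmd.hasMFDerivAt
  have h := connector_leafFrame (K := K) (w₀ := w₀) (γ := fun t => a * expGL (t • A.1))
    g hA hΩ hN hz' ha' ξ A hγ (f' := f') (by rw [hf]; exact hf') v
  have hi := isInvertible_leafFrame (x₀ := x₀) hΩ hz' ha'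
  rw [← hu] at hi h
  rw [h, hi.inverse_apply_self]
  simp only [e]
  rfl

theorem exists_leafFrame_diffeomorphism (hΩ : C.Ω ⊆ (chart n x₀).target)
    (hN' : IsOpen N') (hN : N' ⊆ (chart d y₀).source)
    (hball : ∀ y ∈ N', chart d y₀ y ∈ Metric.ball K.base K.δ)
    (hψ : ContMDiffOn (𝓡 n) (𝓡 d) ∞ ψ W) (hW : IsOpen W)
    (hK : ∀ x ∈ (chart n x₀).source, chart n x₀ x ∈ K.Θ.source →
      x ∈ W ∧ ψ x ∈ (chart d y₀).source ∧
        ψ' (chart n x₀ x) = chart d y₀ (ψ x))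
    (h : 𝓥.LR = Submodule.span ℝ {v₀}) (h0 : v₀ ≠ 0) (hH : 𝓥.H w₀ v₀ = 1)
    (hG : ∀ u : FrameTotal (ModelV p q) n M, u.proj ∈ (chart n x₀).source →
      (frameInChart x₀ u).1 ∈ C.Ω → (u ∈ G ↔ C.IsFrame (frameInChart x₀ u).1 (frameInChart x₀ u).2 ∧
        ∃ r : ℝ, r ≠ 0 ∧ (frameInChart x₀ u).2 v₀ = r • C.e))
    {r s : ℕ} (g : PseudoRiemannianMetric n M r s)
    (hA : C.A = CoordMetric.tractorConn (g.inChart x₀)) :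
    ∃ (D : Set (N × (ModelEnd p q)ˣ)) (Φ : N × (ModelEnd p q)ˣ → FrameTotal (ModelV p q) n M),
      (∃ O : Set (N × (ModelEnd p q)ˣ), IsOpen O ∧ D = O ∩ N' ×ˢ 𝓥.Q) ∧
      (∀ y a, (y, a) ∈ D → ∀ b ∈ 𝓥.PSU, (y, a * b) ∈ D) ∧
      (∀ y ∈ N', (y, 1) ∈ D) ∧
      ContMDiffOn ((𝓡 d).prod 𝓘(ℝ, ModelEnd p q))
        ((𝓡 n).prod 𝓘(ℝ, ModelV p q →L[ℝ] 𝕋 n)) ∞ Φ D ∧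
      (∃ Ψ : FrameTotal (ModelV p q) n M → N × (ModelEnd p q)ˣ,
        ContMDiffOn ((𝓡 n).prod 𝓘(ℝ, ModelV p q →L[ℝ] 𝕋 n))
          ((𝓡 d).prod 𝓘(ℝ, ModelEnd p q)) ∞ Ψ (Φ '' D) ∧ ∀ z ∈ D, Ψ (Φ z) = z) ∧
      (∃ O : Set (FrameTotal (ModelV p q) n M), IsOpen O ∧ Φ '' D = O ∩ G) ∧
      (∀ u ∈ Φ '' D, ∀ b ∈ 𝓥.PSU,
        (⟨u.proj, u.toMap.comp ((b : ModelEnd p q).restrictScalars ℝ)⟩ :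
          FrameTotal (ModelV p q) n M) ∈ Φ '' D) ∧
      (∀ y a, (y, a) ∈ D → ∀ b ∈ 𝓥.PSU, Φ (y, a * b) = ⟨(Φ (y, a)).proj,
        (Φ (y, a)).toMap.comp ((b : ModelEnd p q).restrictScalars ℝ)⟩) ∧
      (∀ z ∈ D, (Φ z).proj ∈ W ∧ ψ (Φ z).proj = z.1) ∧
      ∀ y a, (y, a) ∈ D → ∀ (ξ : 𝔼 d) (A : 𝓥.qLie) (v : ModelV p q)
        (f' : 𝔼 d × ℝ →L[ℝ] 𝔼 n × (ModelV p q →L[ℝ] 𝕋 n))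
        (_ : f' = mfderiv ((𝓡 d).prod 𝓘(ℝ, ℝ)) ((𝓡 n).prod 𝓘(ℝ, ModelV p q →L[ℝ] 𝕋 n))
          (fun w : N × ℝ => Φ (w.1, a * expGL (w.2 • A.1))) (y, 0))
        (u : FrameTotal (ModelV p q) n M)
        (_ : u = Φ (y, a * expGL ((0 : ℝ) • A.1))),
        u.toMap.inverse (g.connector u.proj (u.toMap v) (f' (ξ, 1)).1 ((f' (ξ, 1)).2 v))
          = (leafForm 𝓥 y₀ K.alpha y a (ξ, A) : ModelEnd p q) v := by
  have hact : ∀ y a, (y, a) ∈ leafDom K w₀ y₀ N' ∩ N' ×ˢ 𝓥.Q → ∀ b ∈ 𝓥.PSU,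
      leafFrame K w₀ x₀ y₀ (y, a * b) = ⟨(leafFrame K w₀ x₀ y₀ (y, a)).proj,
      (leafFrame K w₀ x₀ y₀ (y, a)).toMap.comp ((b : ModelEnd p q).restrictScalars ℝ)⟩ :=
    fun y a hz b hb => leafFrame_act h h0 hH hz.2.2 hb
  refine ⟨leafDom K w₀ y₀ N' ∩ N' ×ˢ 𝓥.Q, leafFrame K w₀ x₀ y₀,
    ⟨_, isOpen_leafDom hN' hN, rfl⟩, fun y a hz b hb => mem_leafDom_mul h h0 hH hz hb,
    fun y hy => one_mem_leafDom h hH hy (hball y hy),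
    (contMDiffOn_leafFrame hΩ hN).mono inter_subset_left,
    ⟨leafParam x₀ F ψ, contMDiffOn_leafParam hψ ?_ ?_ ?_ ?_, fun z hz =>
      leafParam_leafFrame hΩ hz.1 (ψ_leafFrame hΩ hN hK hz.1).2⟩,
    ⟨_, ?_, image_leafFrame hΩ hN hK h h0 hH hG⟩, ?_, hact,
    fun z hz => ψ_leafFrame hΩ hN hK hz.1, fun y a hz ξ A v f' hf u hu =>
      cartan_leafFrame g hA hΩ hN' hN hz.1 hz.2.2.1 ξ A v hf hu⟩
  · rintro _ ⟨z, hz, rfl⟩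
    exact (ψ_leafFrame hΩ hN hK hz.1).1
  · rintro _ ⟨z, hz, rfl⟩
    exact (leafFrame_proj_mem hΩ hz.1).1
  · rintro _ ⟨z, hz, rfl⟩
    exact K.source_subset (leafFrame_proj_mem hΩ hz.1).2
  · rintro _ ⟨z, hz, rfl⟩
    rw [frameInChart_leafFrame hΩ hz.1]
    exact ⟨z.2, (LeafChart.param_frame hz.1.2).symm⟩
  · exact (((continuousOn_extChartAt x₀).isOpen_inter_preimage (isOpen_extChartAt_source x₀)
      K.Θ.open_source).inter (hψ.continuousOn.isOpen_inter_preimage hW hN')).preimage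
      (FiberBundle.continuous_proj (ModelV p q →L[ℝ] 𝕋 n)
        (fun x : M => Bundle.Trivial M (ModelV p q) x →L[ℝ] Tractor n M x))
  · rintro _ ⟨⟨y, a⟩, hz, rfl⟩ b hb
    exact ⟨(y, a * b), mem_leafDom_mul h h0 hH hz hb, hact y a hz b hb⟩

end leafFrameImage

theorem TractorChart.exists_adaptedFrame {p q : ℕ} {𝓥 : HermitianModel p q} {E T : Type*}
    (E' : Type*) [NormedAddCommGroup E] [NormedSpace ℝ E] [FiniteDimensional ℝ E]
    [NormedAddCommGroup T] [NormedSpace ℝ T] [FiniteDimensional ℝ T] [NormedAddCommGroup E']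
    [NormedSpace ℝ E'] [FiniteDimensional ℝ E'] {C : TractorChart 𝓥 E T} {y₀ : E} (hy₀ : y₀ ∈ C.Ω)
    {u₀ : ModelV p q →L[ℝ] T} (hu₀ : C.IsFrame y₀ u₀) {v₀ w₀ : ModelV p q} (h00 : 𝓥.H v₀ v₀ = 0)
    (h01 : 𝓥.H v₀ w₀ = 1) (h10 : 𝓥.H w₀ v₀ = 1) (h11 : 𝓥.H w₀ w₀ = 0) (hv₀ : u₀ v₀ = C.e)
    (he : C.e ≠ 0) (hdim : Module.finrank ℝ E = Module.finrank ℝ E' + 1) : ∃ F : AdaptedFrame C v₀,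
    y₀ ∈ F.O ∧ F.c y₀ = 1 := by
  obtain ⟨Λ, hΛ⟩ := exists_splitting (E' := E') (TractorChart.kappa_ne_zero hy₀ he) hdim
  obtain ⟨O, τ, c, h1, h2, h3, h4, h5, h6, h7, h8, h9⟩ :=
    TractorChart.exists_parallel_frame_field hy₀ hu₀ h00 h01 h10 h11 hv₀ Λ hΛ
  exact ⟨⟨O, τ, c, h1, h3, h4, h5, h7, h8, h9⟩, h2, h6⟩

section leafSpaces

variable {p q n d : ℕ} {M : Type*} [TopologicalSpace M] [ChartedSpace (𝔼 n) M] [IsManifold (𝓡 n) ∞ M]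
  {N : Type*} [TopologicalSpace N] [ChartedSpace (𝔼 d) N]
  [IsManifold (𝓡 d) ∞ N] {𝓥 : HermitianModel p q} {v₀ : ModelV p q}
  {C : TractorChart 𝓥 (𝔼 n) 𝕋 n} {x₀ : M} {ψ : M → N} {W : Set M}
  {κ : ∀ x : M, TangentSpace (𝓡 n) x}

theorem fderiv_inCharts {y₀ : N} {x : M} (hx : x ∈ (chart n x₀).source)
    (hy : ψ x ∈ (chart d y₀).source) {B : 𝔼 n →L[ℝ] 𝔼 d} (hB : HasMFDerivAt (𝓡 n) (𝓡 d) ψ x B)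
    (X : 𝔼 n) : fderiv ℝ ((chart d y₀ ∘ ψ) ∘ (chart n x₀).symm) (chart n x₀ x) X = chartDeriv y₀
    (ψ x) (B (symmDeriv x₀ (chart n x₀ x) X)) := by
  obtain ⟨L, hL⟩ : ∃ L : 𝔼 n →L[ℝ] 𝔼 d, L = chartDeriv y₀ (ψ x) ∘L B := ⟨_, rfl⟩
  have h1 : HasMFDerivAt (𝓡 n) 𝓘(ℝ, 𝔼 d) (chart d y₀ ∘ ψ) x L :=
    hL ▸ (hasMFDerivAt_chartDeriv hy).comp x hB
  have h2 : MDifferentiableAt 𝓘(ℝ, 𝔼 n) (𝓡 n) (chart n x₀).symm (chart n x₀ x) :=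
    mdifferentiableAt_extChartAt_symm ((chart n x₀).map_source hx)
  rw [← (chart n x₀).left_inv hx] at h1
  have h3 : HasFDerivAt ((chart d y₀ ∘ ψ) ∘ (chart n x₀).symm)
      (L ∘L symmDeriv x₀ (chart n x₀ x)) (chart n x₀ x) :=
    (HasMFDerivAt.comp (chart n x₀ x) h1 h2.hasMFDerivAt).hasFDerivAt
  rw [h3.fderiv, hL]
  rfl

theorem IsLocalLeafSpace.exists_hasMFDerivAt (h : IsLocalLeafSpace (d := d) κ W ψ) {x : M}
    (hx : x ∈ W) : ∃ B : 𝔼 n →L[ℝ] 𝔼 d, HasMFDerivAt (𝓡 n) (𝓡 d) ψ x B ∧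
      ∀ X : (𝔼 n), B X = 0 ↔ ∃ t : ℝ, t • (κ x : 𝔼 n) = X := by
  refine ⟨mfderiv (𝓡 n) (𝓡 d) ψ x, ((h.smooth.contMDiffAt
    (h.isOpen.mem_nhds hx)).mdifferentiableAt (by simp)).hasMFDerivAt, fun X => ?_⟩
  have h2 := Submodule.mem_span_singleton (R := ℝ) (x := (X : TangentSpace (𝓡 n) x)) (y := κ x)
  exact (SetLike.ext_iff.1 (h.ker x hx) X).trans h2

theorem IsLocalLeafSpace.exists_leafChart (h : IsLocalLeafSpace (d := d) κ W ψ) (hx₀ : x₀ ∈ W)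
    (hnd : n = d + 1)
    (hκ : ∀ x ∈ (chart n x₀).source, C.kappa (chart n x₀ x) = chartDeriv x₀ x (κ x))
    (hv₀ : v₀ ≠ 0) (F : AdaptedFrame C v₀) (hy₀ : chart n x₀ x₀ ∈ F.O)
    (hc : F.c (chart n x₀ x₀) = 1) :
    ∃ K : LeafChart F ((chart d (ψ x₀) ∘ ψ) ∘ (chart n x₀).symm),
      K.base = chart d (ψ x₀) (ψ x₀) ∧
      ∀ x ∈ (chart n x₀).source, chart n x₀ x ∈ K.Θ.source →
      x ∈ W ∧ ψ x ∈ (chart d (ψ x₀)).source ∧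
        ((chart d (ψ x₀) ∘ ψ) ∘ (chart n x₀).symm) (chart n x₀ x)
          = chart d (ψ x₀) (ψ x) := by
  have hS : IsOpen (W ∩ ψ ⁻¹' (chart d (ψ x₀)).source) :=
    h.smooth.continuousOn.isOpen_inter_preimage h.isOpen (isOpen_extChartAt_source _)
  have hsm := contDiffOn_comp_extChartAt_symm (U := W ∩ ψ ⁻¹' (chart d (ψ x₀)).source) x₀
    (((contMDiffOn_extChartAt (I := 𝓡 d) (n := ∞) (x := ψ x₀)).comp
      (h.smooth.mono inter_subset_left) fun z hz => by
        rw [mem_preimage, ← extChartAt_source (𝓡 d)]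
        exact hz.2).mono inter_subset_left)
  have hker : ∀ y ∈ chartImage x₀ (W ∩ ψ ⁻¹' (chart d (ψ x₀)).source), ∀ X : (𝔼 n),
      fderiv ℝ ((chart d (ψ x₀) ∘ ψ) ∘ (chart n x₀).symm) y X = 0 ↔
      ∃ t : ℝ, X = t • C.kappa y := by
    intro y hy X
    obtain ⟨x, hx, rfl⟩ : ∃ x ∈ (chart n x₀).source, chart n x₀ x = y :=
      ⟨_, (chart n x₀).map_target hy.1, (chart n x₀).right_inv hy.1⟩
    have hy2 := hy.2
    rw [mem_preimage, (chart n x₀).left_inv hx] at hy2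
    obtain ⟨B, hB, hBk⟩ := h.exists_hasMFDerivAt hy2.1
    rw [fderiv_inCharts hx hy2.2 hB, hκ x hx]
    have h1 : ∀ X : 𝔼 d, chartDeriv (ψ x₀) (ψ x) X = 0 ↔ X = 0 := fun X =>
      ⟨fun h0 => by
        rw [← symmDeriv_chartDeriv hy2.2 X, h0, map_zero], fun h0 => by rw [h0, map_zero]⟩
    refine ((h1 _).trans (hBk _)).trans (exists_congr fun t => ?_)
    have h3 : chartDeriv x₀ x (symmDeriv x₀ (chart n x₀ x) X) = X := by
      have := chartDeriv_symmDeriv ((chart n x₀).map_source hx) X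
      rwa [(chart n x₀).left_inv hx] at this
    constructor
    · intro h4
      rw [← h3, ← h4]
      exact map_smul (chartDeriv x₀ x) t _
    · intro h4
      rw [h4]
      refine Eq.trans ?_ (map_smul (symmDeriv x₀ (chart n x₀ x)) t _).symm
      exact congrArg (t • ·) (symmDeriv_chartDeriv hx (κ x)).symm
  obtain ⟨K, -, hKU, hb⟩ := _root_.exists_leafChart hv₀ F hy₀ hc (isOpen_chartImage x₀ hS)
    (extChartAt_mem_chartImage (mem_extChartAt_source x₀) ⟨hx₀, mem_extChartAt_source (ψ x₀)⟩) hsm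
    (by simp [hnd]) (fun y hy X => (hker y hy X).1)
    (fun y hy => (hker y hy _).2 ⟨1, (one_smul _ _).symm⟩)
  refine ⟨K, hb.trans ?_, fun x hx hxK => ?_⟩
  · change chart d (ψ x₀) (ψ ((chart n x₀).symm _)) = _
    rw [(chart n x₀).left_inv (mem_extChartAt_source x₀)]
  · have h1 := (hKU hxK).2
    rw [mem_preimage, (chart n x₀).left_inv hx] at h1
    refine ⟨h1.1, h1.2, ?_⟩
    change chart d (ψ x₀) (ψ ((chart n x₀).symm _)) = _
    rw [(chart n x₀).left_inv hx]

end leafSpaces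

theorem image_span_eq_iff {V : Type*} [AddCommGroup V] [Module ℝ V] [TopologicalSpace V] {n : ℕ}
    (f : V →L[ℝ] 𝕋 n) (v : V) : f '' (Submodule.span ℝ {v} : Submodule ℝ V) =
    {t | ∃ ρ : ℝ, t = (0, 0, ρ)} ↔ ∃ r : ℝ, r ≠ 0 ∧ f v = (0, 0, r) := by
  have hs : ∀ t r : ℝ, ((0, 0, t * r) : 𝕋 n) = t • (0, 0, r) := fun t r => by simp
  constructor
  · intro h
    have h1 : f v ∈ f '' (Submodule.span ℝ {v} : Submodule ℝ V) :=
      mem_image_of_mem _ (Submodule.mem_span_singleton_self v)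
    rw [h] at h1
    obtain ⟨r, hr⟩ := h1
    refine ⟨r, ?_, hr⟩
    rintro rfl
    have h2 : ((0, 0, 1) : 𝕋 n) ∈ f '' (Submodule.span ℝ {v} : Submodule ℝ V) := by
      rw [h]
      exact ⟨1, rfl⟩
    obtain ⟨w, hw, hw'⟩ := h2
    obtain ⟨t, rfl⟩ := Submodule.mem_span_singleton.1 hw
    rw [map_smul, hr, ← hs, mul_zero] at hw'
    exact zero_ne_one (congrArg (fun t : 𝕋 n => t.2.2) hw')
  · rintro ⟨r, hr, h⟩
    ext t
    constructor
    · rintro ⟨w, hw, rfl⟩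
      obtain ⟨t, rfl⟩ := Submodule.mem_span_singleton.1 hw
      exact ⟨t * r, by rw [map_smul, h, hs]⟩
    · rintro ⟨ρ, rfl⟩
      refine ⟨(ρ / r) • v, Submodule.smul_mem _ _ (Submodule.mem_span_singleton_self v), ?_⟩
      rw [map_smul, h, ← hs, div_mul_cancel₀ _ hr]

theorem diagL_chartDeriv_eq_iff {n : ℕ} {M : Type*} [TopologicalSpace M] [ChartedSpace (𝔼 n) M]
    [IsManifold (𝓡 n) ∞ M] {x₀ x : M} (hx : x ∈ (chart n x₀).source) (t : 𝕋 n) (r : ℝ) : diagL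
    (chartDeriv x₀ x) t = r • ((0, 0, 1) : 𝕋 n) ↔ t = (0, 0, r) := by
  have h1 : diagL (chartDeriv x₀ x) (0, 0, r) = r • ((0, 0, 1) : 𝕋 n) := by
    simp [diagL_apply]
  rw [← h1]
  exact (Function.LeftInverse.injective (diagL_symmDeriv_chartDeriv hx)).eq_iff

theorem TractorChart.kappa_extChartAt {p q n r s : ℕ} {M : Type*} [TopologicalSpace M]
    [ChartedSpace (𝔼 n) M] [IsManifold (𝓡 n) ∞ M] {g : PseudoRiemannianMetric n M r s}
    {𝕁 : ParallelComplexStructure g} {𝓥 : HermitianModel p q} {x₀ x : M}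
    {C : TractorChart 𝓥 (𝔼 n) 𝕋 n} (hJ : C.J = 𝕁.inChart x₀) (he : C.e = (0, 0, 1))
    (hpr : C.pr = tractorPr) (hx : x ∈ (chart n x₀).source) :
    C.kappa (chart n x₀ x) = chartDeriv x₀ x (𝕁.kappa x) := by
  have h1 := (diagL_chartDeriv_eq_iff hx (0, 0, 1) 1).2 rfl
  rw [one_smul] at h1
  have h := 𝕁.inChart_extChartAt hx (0, 0, 1)
  rw [h1] at h
  rw [TractorChart.kappa, hpr, hJ, he, h]
  rfl

section reducedBundle

variable {p q : ℕ} {M : Type*} [TopologicalSpace M]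
  [ChartedSpace (𝔼 (2 * p + 2 * q + 2)) M]
  [IsManifold (𝓡 (2 * p + 2 * q + 2)) ∞ M]
  {g : PseudoRiemannianMetric (2 * p + 2 * q + 2) M (2 * p + 1) (2 * q + 1)}
  {𝕁 : ParallelComplexStructure g} {ν : ParallelVolume 𝕁} {𝓥 : HermitianModel p q}

theorem mem_GSU_iff_isReducedFrame (u : FrameSpace p q M) : u ∈ GSU 𝓥 ν ↔ ν.IsReducedFrame 𝓥 u.proj
    (FrameSpace.map u) ∧ (FrameSpace.map u) '' (𝓥.LR : Set (ModelV p q)) =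
    {t | ∃ ρ : ℝ, t = ((0 : ℝ), ((0 : TangentSpace (𝓡 (2 * p + 2 * q + 2)) u.proj), ρ))} := by
  rw [ParallelVolume.IsReducedFrame, and_assoc]
  exact and_congr_right fun _ => and_comm

theorem mem_GSU_iff {v₀ : ModelV p q} (h : 𝓥.LR = Submodule.span ℝ {v₀}) (u : FrameSpace p q M) : u
    ∈ GSU 𝓥 ν ↔ ν.IsReducedFrame 𝓥 u.proj (FrameSpace.map u) ∧ ∃ r : ℝ, r ≠ 0 ∧ FrameTotal.toMap u
    v₀ = (0, 0, r) := by
  have h1 := image_span_eq_iff (FrameTotal.toMap u) v₀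
  rw [← h] at h1
  rw [← h1]
  exact mem_GSU_iff_isReducedFrame u

end reducedBundle

theorem HermitianModel.exists_hyperbolic_pair {p q : ℕ} (𝓥 : HermitianModel p q) : ∃ v₀ w₀ : ModelV
    p q, v₀ ≠ 0 ∧ 𝓥.LR = Submodule.span ℝ {v₀} ∧ 𝓥.H v₀ v₀ = 0 ∧ 𝓥.H v₀ w₀ = 1 ∧ 𝓥.H w₀ v₀ = 1 ∧ 𝓥.H
    w₀ w₀ = 0 := by
  obtain ⟨v₀, h0, h⟩ := 𝓥.exists_spanning
  have h00 : 𝓥.H v₀ v₀ = 0 := 𝓥.isotropic v₀ (by rw [h]; exact Submodule.mem_span_singleton_self v₀)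
  obtain ⟨w₀, h01, h10, h11⟩ :=
    HermitianForm.exists_hyperbolic_partner 𝓥.H 𝓥.hermitian 𝓥.nondegenerate h0 h00
  exact ⟨v₀, w₀, h0, h, h00, h01, h10, h11⟩

section reducedBundle

variable {p q : ℕ} {M : Type*} [TopologicalSpace M]
  [ChartedSpace (𝔼 (2 * p + 2 * q + 2)) M]
  [IsManifold (𝓡 (2 * p + 2 * q + 2)) ∞ M]
  {g : PseudoRiemannianMetric (2 * p + 2 * q + 2) M (2 * p + 1) (2 * q + 1)}
  {𝕁 : ParallelComplexStructure g}

theorem ParallelVolume.exists_adaptedFrame (hpq : 1 ≤ p + q) (ν : ParallelVolume 𝕁)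
    {𝓥 : HermitianModel p q} (hν : ν.IsNormalized 𝓥) (x₀ : M) {v₀ w₀ : ModelV p q} (h0 : v₀ ≠ 0)
    (h : 𝓥.LR = Submodule.span ℝ {v₀}) (h00 : 𝓥.H v₀ v₀ = 0) (h01 : 𝓥.H v₀ w₀ = 1)
    (h10 : 𝓥.H w₀ v₀ = 1) (h11 : 𝓥.H w₀ w₀ = 0) :
    ∃ (C : TractorChart 𝓥 (𝔼 (2 * p + 2 * q + 2))
        (𝕋 (2 * p + 2 * q + 2))) (F : AdaptedFrame C v₀),
      C.Ω ⊆ (extChartAt (𝓡 (2 * p + 2 * q + 2)) x₀).target ∧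
      C.A = CoordMetric.tractorConn (g.inChart x₀) ∧
      (∀ x ∈ (extChartAt (𝓡 (2 * p + 2 * q + 2)) x₀).source,
        C.kappa (extChartAt (𝓡 (2 * p + 2 * q + 2)) x₀ x) = chartDeriv x₀ x (𝕁.kappa x)) ∧
      extChartAt (𝓡 (2 * p + 2 * q + 2)) x₀ x₀ ∈ F.O ∧
      F.c (extChartAt (𝓡 (2 * p + 2 * q + 2)) x₀ x₀) = 1 ∧
      ∀ u : FrameTotal (ModelV p q) (2 * p + 2 * q + 2) M,
        u.proj ∈ (extChartAt (𝓡 (2 * p + 2 * q + 2)) x₀).source → (frameInChart x₀ u).1 ∈ C.Ω →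
        (u ∈ GSU 𝓥 ν ↔ C.IsFrame (frameInChart x₀ u).1 (frameInChart x₀ u).2 ∧
          ∃ r : ℝ, r ≠ 0 ∧ (frameInChart x₀ u).2 v₀ = r • C.e) := by
  obtain ⟨C, U, hU, hxU, hΩ, hA, -, hJ, he, hpr, hfr⟩ := ν.exists_tractorChart hpq 𝓥 x₀
  have hκ := fun x hx => TractorChart.kappa_extChartAt (𝕁 := 𝕁) (x₀ := x₀) (x := x) hJ he hpr hx
  have hx₀ := mem_extChartAt_source (I := 𝓡 (2 * p + 2 * q + 2)) x₀
  have hy₀ : extChartAt (𝓡 (2 * p + 2 * q + 2)) x₀ x₀ ∈ C.Ω := by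
    rw [hΩ]
    exact extChartAt_mem_chartImage hx₀ hxU
  obtain ⟨u₀, hu1, hu2, hu3⟩ := ν.exists_frame hpq hν x₀ h0 h00
  have hu₀ := (hfr x₀ hxU hx₀ u₀).1 ⟨hu1, hu3⟩
  have hv₀ : (diagL (chartDeriv x₀ x₀) ∘L frameMap u₀) v₀ = C.e := by
    rw [he]
    exact ((diagL_chartDeriv_eq_iff hx₀ (frameMap u₀ v₀) 1).2 hu2).trans (one_smul _ _)
  have he0 : C.e ≠ 0 := by
    rw [he]
    exact fun h => one_ne_zero (congrArg (fun t : 𝕋 (2 * p + 2 * q + 2) => t.2.2) h)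
  obtain ⟨F, hF1, hF2⟩ := TractorChart.exists_adaptedFrame
    (𝔼 (2 * p + 2 * q + 1)) hy₀ hu₀ h00 h01 h10 h11 hv₀ he0 (by simp)
  refine ⟨C, F, hΩ ▸ inter_subset_left, hA, hκ, hF1, hF2, fun u hu huΩ => ?_⟩
  have huU : u.proj ∈ U := by
    rw [hΩ] at huΩ
    have h1 : (extChartAt (𝓡 (2 * p + 2 * q + 2)) x₀).symm
      (extChartAt (𝓡 (2 * p + 2 * q + 2)) x₀ u.proj) ∈ U := huΩ.2
    rwa [(extChartAt (𝓡 (2 * p + 2 * q + 2)) x₀).left_inv hu] at h1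
  refine (mem_GSU_iff h u).trans (and_congr (hfr _ huU hu _) (exists_congr fun r =>
    and_congr_right fun _ => ?_))
  rw [he]
  exact (diagL_chartDeriv_eq_iff hu (FrameTotal.toMap u v₀) r).symm

theorem ParallelComplexStructure.exists_isLocalLeafSpace (hpq : 1 ≤ p + q) (ν : ParallelVolume 𝕁)
    (𝓥 : HermitianModel p q) (x₀ : M) : ∃ (W : Set M)
    (U : TopologicalSpace.Opens (𝔼 (2 * p + 2 * q + 1))) (ψ : M → U), x₀ ∈ W ∧ IsLocalLeafSpace (d := 2 * p + 2 * q + 1) 𝕁.kappa W ψ := by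
  obtain ⟨C, U, hU, hxU, hΩ, hA, -, hJ, he, hpr, -⟩ := ν.exists_tractorChart hpq 𝓥 x₀
  have hκ := fun x hx => TractorChart.kappa_extChartAt (𝕁 := 𝕁) (x₀ := x₀) (x := x) hJ he hpr hx
  have hy₀ : extChartAt (𝓡 (2 * p + 2 * q + 2)) x₀ x₀ ∈ C.Ω := by
    rw [hΩ]
    exact extChartAt_mem_chartImage (mem_extChartAt_source x₀) hxU
  have he0 : C.e ≠ 0 := by
    rw [he]
    exact fun h => one_ne_zero (congrArg (fun t : 𝕋 (2 * p + 2 * q + 2) => t.2.2) h)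
  refine _root_.exists_isLocalLeafSpace rfl (k := C.kappa) ?_ hκ (TractorChart.kappa_ne_zero hy₀ he0)
  have h1 : C.kappa = fun y => tractorPr (𝕁.inChart x₀ y C.e) := funext fun y => by
    rw [TractorChart.kappa, hpr, hJ]
  rw [h1]
  exact tractorPr.contDiff.comp_contDiffOn ((𝕁.contDiffOn_inChart x₀).clm_apply contDiffOn_const)

end reducedBundle

end

set_option maxHeartbeats 1600000 in
theorem theorem2p4 (p q : ℕ) (hpq : 1 ≤ p + q)
    {M : Type*} [TopologicalSpace M] [ChartedSpace (EuclideanSpace ℝ (Fin (2 * p + 2 * q + 2))) M]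
    [IsManifold (𝓡 (2 * p + 2 * q + 2)) ∞ M]
    (g : PseudoRiemannianMetric (2 * p + 2 * q + 2) M (2 * p + 1) (2 * q + 1))
    (𝕁 : ParallelComplexStructure g) (ν : ParallelVolume 𝕁)
    (𝓥 : HermitianModel p q) (hν : ν.IsNormalized 𝓥)
    {N : Type*} [TopologicalSpace N] [ChartedSpace (EuclideanSpace ℝ (Fin (2 * p + 2 * q + 1))) N]
    [IsManifold (𝓡 (2 * p + 2 * q + 1)) ∞ N] :
    (∀ x : M, ∃ (W : Set M)
      (U : TopologicalSpace.Opens (EuclideanSpace ℝ (Fin (2 * p + 2 * q + 1)))) (ψ : M → U),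
        x ∈ W ∧ IsLocalLeafSpace (d := 2 * p + 2 * q + 1) 𝕁.kappa W ψ) ∧
    ∀ (W : Set M) (ψ : M → N), IsLocalLeafSpace (d := 2 * p + 2 * q + 1) 𝕁.kappa W ψ → ∀ x ∈ W,
      ∃ N₀ : Set N, IsOpen N₀ ∧ ψ x ∈ N₀ ∧ ∀ N' : Set N, N' ⊆ N₀ → IsOpen N' →
        ∃ θ : FormOnProduct (d := 2 * p + 2 * q + 1) 𝓥 N, IsCartanConnection 𝓥 θ N' ∧
        ∃ (D : Set (N × (ModelEnd p q)ˣ)) (Φ : N × (ModelEnd p q)ˣ → FrameSpace p q M),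
          (∃ O : Set (N × (ModelEnd p q)ˣ), IsOpen O ∧ D = O ∩ N' ×ˢ 𝓥.Q) ∧
          (∀ y a, (y, a) ∈ D → ∀ b ∈ 𝓥.PSU, (y, a * b) ∈ D) ∧
          (∀ y ∈ N', (y, 1) ∈ D) ∧
          ContMDiffOn ((𝓡 (2 * p + 2 * q + 1)).prod 𝓘(ℝ, ModelEnd p q)) (frameModel p q) ∞ Φ D ∧
          (∃ Ψ : FrameSpace p q M → N × (ModelEnd p q)ˣ,
            ContMDiffOn (frameModel p q) ((𝓡 (2 * p + 2 * q + 1)).prod 𝓘(ℝ, ModelEnd p q)) ∞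
              Ψ (Φ '' D) ∧ ∀ z ∈ D, Ψ (Φ z) = z) ∧
          (∃ O : Set (FrameSpace p q M), IsOpen O ∧ Φ '' D = O ∩ GSU 𝓥 ν) ∧
          (∀ u ∈ Φ '' D, ∀ b ∈ 𝓥.PSU, FrameSpace.act u b ∈ Φ '' D) ∧
          (∀ y a, (y, a) ∈ D → ∀ b ∈ 𝓥.PSU, Φ (y, a * b) = FrameSpace.act (Φ (y, a)) b) ∧
          (∀ z ∈ D, (Φ z).proj ∈ W ∧ ψ (Φ z).proj = z.1) ∧
          ∀ y a, (y, a) ∈ D → ∀ (ξ : TangentSpace (𝓡 (2 * p + 2 * q + 1)) y) (A : 𝓥.qLie)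
            (v : ModelV p q),
            cartanForm g (Φ (y, a * expGL ((0 : ℝ) • (A : ModelEnd p q))))
              (mfderiv ((𝓡 (2 * p + 2 * q + 1)).prod 𝓘(ℝ, ℝ)) (frameModel p q)
                (fun w : N × ℝ => Φ (w.1, a * expGL (w.2 • (A : ModelEnd p q)))) (y, 0)
                (show TangentSpace (𝓡 (2 * p + 2 * q + 1)) y × ℝ from (ξ, 1))) v
              = (θ y a (ξ, A) : ModelEnd p q) v := by
  refine ⟨fun x => 𝕁.exists_isLocalLeafSpace hpq ν 𝓥 x, fun W ψ hψ x hx => ?_⟩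
  obtain ⟨v₀, w₀, h0, h, h00, h01, h10, h11⟩ := 𝓥.exists_hyperbolic_pair
  obtain ⟨C, F, hΩ, hA, hκ, hF, hc, hG⟩ := ν.exists_adaptedFrame hpq hν x h0 h h00 h01 h10 h11
  obtain ⟨K, hb, hK⟩ := hψ.exists_leafChart hx rfl hκ h0 F hF hc
  refine ⟨(extChartAt (𝓡 (2 * p + 2 * q + 1)) (ψ x)).source ∩
    extChartAt (𝓡 (2 * p + 2 * q + 1)) (ψ x) ⁻¹' Metric.ball K.base K.δ,
    (continuousOn_extChartAt (ψ x)).isOpen_inter_preimage (isOpen_extChartAt_source (ψ x))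
      Metric.isOpen_ball, ⟨mem_extChartAt_source (ψ x), ?_⟩, fun N' hN hN' => ?_⟩
  · rw [mem_preimage, hb]
    exact Metric.mem_ball_self K.δ_pos
  refine ⟨leafForm 𝓥 (ψ x) K.alpha, isCartanConnection_leafForm K.contDiffOn_alpha
    (hN.trans inter_subset_left) (fun y hy => (hN hy).2) h h0 (fun y hy => K.alpha_eq_zero hy)
    (fun y hy => K.exists_alpha_eq hy), ?_⟩
  obtain ⟨D, Φ, h1, h2, h3, h4, h5, h6, h7, h8, h9, hform⟩ := exists_leafFrame_diffeomorphism
    (W := W) (ψ := ψ) (G := GSU 𝓥 ν) hΩ hN' (hN.trans inter_subset_left) (fun y hy => (hN hy).2)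
    hψ.smooth hψ.isOpen hK h h0 h10 hG g hA
  refine ⟨D, Φ, h1, h2, h3, h4, h5, h6, h7, h8, h9, fun y a hya ξ A v => ?_⟩
  exact hform y a hya ξ A v _ rfl _ rfl
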